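/- **Setting.** Let $F:\mathbb R\to\mathbb R$ be of class $C^2$, let $\varepsilon>0$, and let $F_\varepsilon$ be the piecewise affine interpolation of $F$ with nodes in $\mathbb Z\varepsilon$. Let $\bar u:\mathbb R\to\mathbb R$ have bounded variation and let $\bar u^\varepsilon$ be right continuous and compactly supported, with values in $\mathbb Z\varepsilon$ and $\mathrm{Tot.Var.}(\bar u^\varepsilon)\le \mathrm{Tot.Var.}(\bar u)$. Let $u^\varepsilon(t,x)$, $t\ge 0$, be the wavefront tracking solution of $u_t+F_\varepsilon(u)_x=0$, $u(0,\cdot)=\bar u^\varepsilon$: the jumps of $\bar u^\varepsilon$ are resolved by the entropic solutions of the Riemann problems with flux $F_\varepsilon$, whenever wavefronts meet (an *interaction*) the new Riemann problem is solved, and so on; $u^\varepsilon(t,\cdot)$ is right continuous. Assume that the interactions occur at distinct times $t_1<t_2<\dots$, each at one point $(t_j,x_j)$ at which exactly two wavefronts meet; set $t_0=0$. If the left wavefront carries the jump $(a,b)$ and the right one the jump $(b,c)$, the interaction is *same-sign* if $a<b<c$ or $a>b>c$. In the first case its change of speed is $$\Delta\sigma(t_j,x_j)=\int_a^b\Big|\tfrac{d}{d\tau}\operatorname{conv}_{[a,b]}F_\varepsilon-\tfrac{d}{d\tau}\operatorname{conv}_{[a,c]}F_\varepsilon\Big|d\tau+\int_b^c\Big|\tfrac{d}{d\tau}\operatorname{conv}_{[b,c]}F_\varepsilon-\tfrac{d}{d\tau}\operatorname{conv}_{[a,c]}F_\varepsilon\Big|d\tau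 ,$$ where $\operatorname{conv}_I$ is the convex envelope on $I$; in the second case use the concave envelopes $\operatorname{conc}$ on $[b,a]$, $[c,b]$, $[c,a]$. **Waves.** The set of waves is $\mathcal W=(0,\mathrm{Tot.Var.}(\bar u^\varepsilon)]$. The initial position $X(0,w)$ of $w\in\mathcal W$ is the point where the right continuous function $x\mapsto\mathrm{Tot.Var.}(\bar u^\varepsilon;(-\infty,x])$ jumps across $w$ (from a value $<w$ to a value $\ge w$). The sign $\mathcal S(w)=\pm1$ is the sign of the jump of $\bar u^\varepsilon$ there, and the state is $\mathtt u(w)=\int_0^w\mathcal S$. For a set $\mathcal I$ of waves of the same sign whose states fill an interval, and $w\in\mathcal I$, let $\sigma^{\rm ent}(\mathcal I,w)$ be the derivative at $\mathtt u(w)$ of $\operatorname{conv}_{\mathtt u(\mathcal I)}F_\varepsilon$ if the sign is $+1$, of $\operatorname{conc}_{\mathtt u(\mathcal I)}F_\varepsilon$ if it is $-1$ (left derivative for positive, right derivative for negative waves). Let $\mathcal W(t)$ be the set of waves not canceled up to time $t$, $X(t,w)$ the position of $w\in\mathcal W(t)$, and $\mathcal W(t,x)=\{w\in\mathcal W(t):X(t,w)=x\}$;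 they are defined recursively. First, $\mathcal W(0)=\mathcal W$. Between $t_j$ and $t_{j+1}$ (or after the last interaction) no wave is canceled and $w$ moves with speed $\sigma^{\rm ent}(\mathcal W(t_j,X(t_j,w)),w)$. A wave that reaches $x_{j+1}$ at time $t_{j+1}$ survives if and only if it has the sign of the jump of $u^\varepsilon(t_{j+1},\cdot)$ at $x_{j+1}$ and its state lies in that jump (in $(\alpha,\beta]$ if the jump is from $\alpha$ to $\beta>\alpha$, in $[\beta,\alpha)$ if $\beta<\alpha$). Every other wave survives. **The functional.** For $\bar t\ge0$ set $$\mathfrak Q(\bar t)=\iint_{w,w'\in\mathcal W(\bar t),\ w<w'}\mathfrak q(\bar t,w,w')\,dw\,dw'\in[0,\infty],$$ where * $\mathfrak q(\bar t,w,w')=\|F''\|_{L^\infty(\mathbb R)}\in[0,\infty]$ if $\mathcal S$ is not constant on $[w,w']\cap\mathcal W(\bar t)$; * otherwise, $\mathfrak q(\bar t,w,w')=0$ if $X(\bar t,w)=X(\bar t,w')$, or if $w,w'$ have the same position at no time $t>\bar t$ (at which both are present); * otherwise, let $T$ be the first time after $\bar t$ at which $w,w'$ have the same position, let $\mathcal W(\bar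 t,w,w')=\mathcal W(T,X(T,w))$, $\mathcal J^{\rm left}=\mathcal W(\bar t,X(\bar t,w))\cap\mathcal W(\bar t,w,w')$, $\mathcal J^{\rm right}=\mathcal W(\bar t,X(\bar t,w'))\cap\mathcal W(\bar t,w,w')$, and $$\mathfrak q(\bar t,w,w')=\frac{\pi}{d},\qquad \pi=\big[\sigma^{\rm ent}(\mathcal J^{\rm left},w)-\sigma^{\rm ent}(\mathcal J^{\rm right},w')\big]^+,\qquad d=\mathcal L^1\big(\mathcal W(\bar t,w,w')\big).$$ **Proposition 2.2.** The functional $\mathfrak Q$ has the following properties. 1. $\mathfrak Q(\bar t)$ depends only on the present and future profiles $u^\varepsilon(t,\cdot)$, $t\ge\bar t$: if $v^\varepsilon$ is another wavefront tracking solution as above, with the same $F$ and $\varepsilon$, and $u^\varepsilon(\bar t+s,\cdot)=v^\varepsilon(\bar t'+s,\cdot)$ for all $s\ge0$, where $\bar t,\bar t'\ge0$, then $\mathfrak Q$ of $u^\varepsilon$ at $\bar t$ equals $\mathfrak Q$ of $v^\varepsilon$ at $\bar t'$. 2. $\mathfrak Q(0)\le\frac12\|F''\|_{L^\infty}\,\mathrm{Tot.Var.}(\bar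 u)^2$. 3. $\mathfrak Q$ is non-increasing on $[0,\infty)$, and at each same-sign interaction $(t_j,x_j)$ the one-sided limits $\mathfrak Q(t_j\pm)$ exist in $[0,\infty]$ and $$\tfrac12\,\Delta\sigma(t_j,x_j)+\mathfrak Q(t_j+)\le\mathfrak Q(t_j-).$$ Equivalently for items 2 and 3, the functional $2\mathfrak Q$ satisfies $2\mathfrak Q(0)\le\|F''\|_{L^\infty}\mathrm{Tot.Var.}(\bar u)^2$, is non-increasing and, when $\|F''\|_{L^\infty}<\infty$, bounds $\Delta\sigma(t_j,x_j)\le 2\mathfrak Q(t_j-)-2\mathfrak Q(t_j+)$. -/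

import Mathlib

open scoped ENNReal

noncomputable section

namespace WaveTracking

/-! ### Flux and envelopes -/

/-- The piecewise affine interpolation of `F` with nodes in `ℤ ε`. -/
def gridFlux (F : ℝ → ℝ) (ε : ℝ) (v : ℝ) : ℝ :=
  F (⌊v / ε⌋ * ε) +
    (F ((⌊v / ε⌋ + 1) * ε) - F (⌊v / ε⌋ * ε)) / ε * (v - ⌊v / ε⌋ * ε)

/-- The convex envelope of `g` on the interval `I`: the largest convex function below `g` on `I`. -/
def convEnv (I : Set ℝ) (g : ℝ → ℝ) (v : ℝ) : ℝ :=
  sSup {y | ∃ h : ℝ → ℝ, ConvexOn ℝ I h ∧ (∀ z ∈ I, h z ≤ g z) ∧ y = h v}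

/-- The concave envelope of `g` on the interval `I`: the least concave function above `g` on `I`. -/
def concEnv (I : Set ℝ) (g : ℝ → ℝ) (v : ℝ) : ℝ :=
  sInf {y | ∃ h : ℝ → ℝ, ConcaveOn ℝ I h ∧ (∀ z ∈ I, g z ≤ h z) ∧ y = h v}

/-- Derivative from the left. -/
def leftDeriv (g : ℝ → ℝ) (v : ℝ) : ℝ := derivWithin g (Set.Iic v) v

/-- Derivative from the right. -/
def rightDeriv (g : ℝ → ℝ) (v : ℝ) : ℝ := derivWithin g (Set.Ici v) v

/-- The `L^∞` norm of the second derivative (possibly infinite). -/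
def normF2 (F : ℝ → ℝ) : ℝ≥0∞ := MeasureTheory.eLpNorm (iteratedDeriv 2 F) ⊤ MeasureTheory.volume

/-- Total variation on the real line. -/
def totalVar (v : ℝ → ℝ) : ℝ≥0∞ := eVariationOn v Set.univ

/-! ### The wavefront tracking solution

Throughout, `f` is the piecewise affine flux and `u₀` is the discretized initial datum. -/

open Classical in
/-- The entropic solution, as a right continuous function of `ξ = x / t`, of the Riemann problem
with flux `f`, left state `a` and right state `b`. It is the inverse of the derivative of the convex
envelope of `f` on `[a, b]` if `a < b`, of the concave envelope on `[b, a]` if `b < a`. -/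
def riemann (f : ℝ → ℝ) (a b ξ : ℝ) : ℝ :=
  if a ≤ b then
    sSup (insert a {v | v ∈ Set.Ioc a b ∧ leftDeriv (convEnv (Set.Icc a b) f) v ≤ ξ})
  else
    sInf (insert a {v | v ∈ Set.Ico b a ∧ rightDeriv (concEnv (Set.Icc b a) f) v ≤ ξ})

/-- The Riemann solution centered at the jump (if any) of the profile `v` at `x`. -/
def riemannAt (f v : ℝ → ℝ) (x : ℝ) : ℝ → ℝ := riemann f (Function.leftLim v x) (v x)

/-- The wavefronts emerging from the profile `v`: pairs (initial position, speed). -/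
def fronts (f v : ℝ → ℝ) : Set (ℝ × ℝ) := {p | ¬ ContinuousAt (riemannAt f v p.1) p.2}

/-- State on the left of a wavefront. -/
def frontLeft (f v : ℝ → ℝ) (p : ℝ × ℝ) : ℝ := Function.leftLim (riemannAt f v p.1) p.2

/-- State on the right of a wavefront. -/
def frontRight (f v : ℝ → ℝ) (p : ℝ × ℝ) : ℝ := riemannAt f v p.1 p.2

/-- Position of a wavefront after the time `s`. -/
def frontPos (p : ℝ × ℝ) (s : ℝ) : ℝ := p.1 + p.2 * s

open Classical in
/-- The superposition of the Riemann solutions emerging from the jumps of the profile `v`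
(a compactly supported step function), after the time `s`; it is used only as long as wavefronts
emerging from different jumps have not crossed each other. -/
def evolve (f v : ℝ → ℝ) (s x : ℝ) : ℝ :=
  if s = 0 then v x
  else ∑ᶠ y : ℝ, (riemannAt f v y ((x - y) / s) - Function.leftLim v y)

/-- The times after which two of the wavefronts emerging from the profile `v` meet. -/
def meetingTimes (f v : ℝ → ℝ) : Set ℝ :=
  {s | 0 < s ∧ ∃ p ∈ fronts f v, ∃ q ∈ fronts f v, p ≠ q ∧ frontPos p s = frontPos q s}

open Classical in
/-- Time to the next interaction. If there is none, the solution is prolonged by one unit of time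
(and the construction restarted there, with no effect on the solution). -/
def delay (f v : ℝ → ℝ) : ℝ :=
  if (meetingTimes f v).Nonempty then sInf (meetingTimes f v) else 1

/-- A time at which the construction is restarted, with the profile of the solution there. -/
structure Stage where
  time : ℝ
  profile : ℝ → ℝ

/-- The stages of the wavefront tracking algorithm: stage `0` is the initial datum, the next ones
are the successive interaction times (and, after the last one, the dummy restarting times). -/
def stage (f u₀ : ℝ → ℝ) : ℕ → Stage
  | 0 => ⟨0, u₀⟩
  | n + 1 =>
    ⟨(stage f u₀ n).time + delay f (stage f u₀ n).profile,
      evolve f (stage f u₀ n).profile (delay f (stage f u₀ n).profile)⟩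

/-- The number of the last stage not after the time `t`. -/
def stageIndex (f u₀ : ℝ → ℝ) (t : ℝ) : ℕ := sSup {n | (stage f u₀ n).time ≤ t}

/-- The wavefront tracking solution `u(t, x)`, for `t ≥ 0`. -/
def solution (f u₀ : ℝ → ℝ) (t x : ℝ) : ℝ :=
  evolve f (stage f u₀ (stageIndex f u₀ t)).profile
    (t - (stage f u₀ (stageIndex f u₀ t)).time) x

/-- The wavefronts of stage `n` which meet another wavefront at the time of stage `n + 1`. -/
def interactingFronts (f u₀ : ℝ → ℝ) (n : ℕ) : Set (ℝ × ℝ) :=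
  {p | p ∈ fronts f (stage f u₀ n).profile ∧
    ∃ q ∈ fronts f (stage f u₀ n).profile, p ≠ q ∧
      frontPos p (delay f (stage f u₀ n).profile) = frontPos q (delay f (stage f u₀ n).profile)}

/-- At each interaction time there is only one interaction, and exactly two wavefronts meet. -/
def BinaryInteractions (f u₀ : ℝ → ℝ) : Prop :=
  ∀ n, (interactingFronts f u₀ n).Nonempty → (interactingFronts f u₀ n).ncard = 2

/-- At the time of stage `n + 1` a left wavefront with jump `(a, b)` interacts with a right
wavefront with jump `(b, c)`; of the two, the left one is the faster. -/
def Interaction (f u₀ : ℝ → ℝ) (n : ℕ) (a b c : ℝ) : Prop :=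
  ∃ p ∈ interactingFronts f u₀ n, ∃ q ∈ interactingFronts f u₀ n,
    q.2 < p.2 ∧
    frontPos p (delay f (stage f u₀ n).profile) = frontPos q (delay f (stage f u₀ n).profile) ∧
    frontLeft f (stage f u₀ n).profile p = a ∧ frontRight f (stage f u₀ n).profile p = b ∧
    frontLeft f (stage f u₀ n).profile q = b ∧ frontRight f (stage f u₀ n).profile q = c

open Classical in
/-- Change of speed in a same-sign interaction between the jumps `(a, b)` and `(b, c)`,
where `a < b < c` or `c < b < a`. -/
def speedChange (f : ℝ → ℝ) (a b c : ℝ) : ℝ :=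
  if a < b then
    (∫ τ in a..b, |deriv (convEnv (Set.Icc a b) f) τ - deriv (convEnv (Set.Icc a c) f) τ|) +
      ∫ τ in b..c, |deriv (convEnv (Set.Icc b c) f) τ - deriv (convEnv (Set.Icc a c) f) τ|
  else
    (∫ τ in b..a, |deriv (concEnv (Set.Icc b a) f) τ - deriv (concEnv (Set.Icc c a) f) τ|) +
      ∫ τ in c..b, |deriv (concEnv (Set.Icc c b) f) τ - deriv (concEnv (Set.Icc c a) f) τ|

/-! ### The wave tracing -/

/-- The set of all waves. -/
def allWaves (u₀ : ℝ → ℝ) : Set ℝ := Set.Ioc 0 (totalVar u₀).toReal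

/-- Position of the wave `w` at time `0`: with `U x` the total variation of `u₀` on `(-∞, x]`, the
only point `x` such that `U (x-) < w ≤ U x`. -/
def initialPos (u₀ : ℝ → ℝ) (w : ℝ) : ℝ :=
  sInf {x | w ≤ (eVariationOn u₀ (Set.Iic x)).toReal}

open Classical in
/-- Sign of a wave. -/
def waveSign (u₀ : ℝ → ℝ) (w : ℝ) : ℝ :=
  if Function.leftLim u₀ (initialPos u₀ w) < u₀ (initialPos u₀ w) then 1 else -1

/-- State of a wave. -/
def waveState (u₀ : ℝ → ℝ) (w : ℝ) : ℝ := ∫ z in (0 : ℝ)..w, waveSign u₀ z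

open Classical in
/-- The entropic speed given to the wave `w` by the interval of waves `I`. At the finitely many
states where the envelope has a corner, the derivative is taken from the side of the preceding waves
(smaller states for positive waves, larger states for negative ones), so that the sets of waves
with a given speed are unions of intervals `(·, ·]`. -/
def entSpeed (f u₀ : ℝ → ℝ) (I : Set ℝ) (w : ℝ) : ℝ :=
  if waveSign u₀ w = 1 then leftDeriv (convEnv (waveState u₀ '' I) f) (waveState u₀ w)
  else rightDeriv (concEnv (waveState u₀ '' I) f) (waveState u₀ w)

/-- The waves not yet canceled, and their positions (irrelevant for canceled waves). -/
structure Tracing where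
  alive : Set ℝ
  pos : ℝ → ℝ

/-- The speed of the wave `w`: the entropic speed given by the waves at the same position. -/
def Tracing.speed (f u₀ : ℝ → ℝ) (T : Tracing) (w : ℝ) : ℝ :=
  entSpeed f u₀ {z | z ∈ T.alive ∧ T.pos z = T.pos w} w

/-- The wave `w`, of the same sign as the jump `(a, b)`, has its state in that jump. Sets of waves
are unions of intervals `(·, ·]` and the state decreases along negative waves, so that the states in
a negative jump form the interval `[b, a)`. -/
def InJump (u₀ : ℝ → ℝ) (a b w : ℝ) : Prop :=
  (a < b ∧ waveSign u₀ w = 1 ∧ waveState u₀ w ∈ Set.Ioc a b) ∨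
    (b < a ∧ waveSign u₀ w = -1 ∧ waveState u₀ w ∈ Set.Ico b a)

/-- The points where wavefronts of stage `n` meet at the time of stage `n + 1`. -/
def interactionPoints (f u₀ : ℝ → ℝ) (n : ℕ) : Set ℝ :=
  (fun p => frontPos p (delay f (stage f u₀ n).profile)) '' interactingFronts f u₀ n

/-- The wave tracing at the time of stage `n`. Waves move with their speed between two stages; a wave
arriving at an interaction point survives if and only if it belongs to the jump of the solution
there. -/
def tracing (f u₀ : ℝ → ℝ) : ℕ → Tracing
  | 0 => ⟨allWaves u₀, initialPos u₀⟩
  | n + 1 =>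
    let T := tracing f u₀ n
    let y : ℝ → ℝ := fun w => T.pos w + T.speed f u₀ w * delay f (stage f u₀ n).profile
    let v := (stage f u₀ (n + 1)).profile
    ⟨{w | w ∈ T.alive ∧
        (y w ∈ interactionPoints f u₀ n → InJump u₀ (Function.leftLim v (y w)) (v (y w)) w)}, y⟩

/-- The set of waves at time `t`. -/
def waves (f u₀ : ℝ → ℝ) (t : ℝ) : Set ℝ := (tracing f u₀ (stageIndex f u₀ t)).alive

/-- Position of the wave `w` at time `t`. -/
def pos (f u₀ : ℝ → ℝ) (t w : ℝ) : ℝ :=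
  (tracing f u₀ (stageIndex f u₀ t)).pos w +
    (tracing f u₀ (stageIndex f u₀ t)).speed f u₀ w *
      (t - (stage f u₀ (stageIndex f u₀ t)).time)

/-- The waves which at time `t` are at the point `x`. -/
def wavesAt (f u₀ : ℝ → ℝ) (t x : ℝ) : Set ℝ := {w | w ∈ waves f u₀ t ∧ pos f u₀ t w = x}

/-! ### The interaction potential -/

/-- The times after `t` at which the waves `w` and `w'` interact. -/
def interactionTimes (f u₀ : ℝ → ℝ) (t w w' : ℝ) : Set ℝ :=
  {s | t < s ∧ w ∈ waves f u₀ s ∧ w' ∈ waves f u₀ s ∧ pos f u₀ s w = pos f u₀ s w'}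

/-- The first time after `t` at which `w` and `w'` interact. -/
def interactionTime (f u₀ : ℝ → ℝ) (t w w' : ℝ) : ℝ := sInf (interactionTimes f u₀ t w w')

/-- The waves which are with `w` and `w'` at the first time after `t` at which these interact. -/
def futureWaves (f u₀ : ℝ → ℝ) (t w w' : ℝ) : Set ℝ :=
  wavesAt f u₀ (interactionTime f u₀ t w w') (pos f u₀ (interactionTime f u₀ t w w') w)

/-- The waves which are with `w` at time `t` and with `w` and `w'` when these interact. -/
def leftWaves (f u₀ : ℝ → ℝ) (t w w' : ℝ) : Set ℝ :=
  wavesAt f u₀ t (pos f u₀ t w) ∩ futureWaves f u₀ t w w'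

/-- The waves which are with `w'` at time `t` and with `w` and `w'` when these interact. -/
def rightWaves (f u₀ : ℝ → ℝ) (t w w' : ℝ) : Set ℝ :=
  wavesAt f u₀ t (pos f u₀ t w') ∩ futureWaves f u₀ t w w'

/-- The numerator of the weight. -/
def numerator (f u₀ : ℝ → ℝ) (t w w' : ℝ) : ℝ :=
  max (entSpeed f u₀ (leftWaves f u₀ t w w') w - entSpeed f u₀ (rightWaves f u₀ t w w') w') 0

/-- The denominator of the weight. -/
def denominator (f u₀ : ℝ → ℝ) (t w w' : ℝ) : ℝ≥0∞ :=
  MeasureTheory.volume (futureWaves f u₀ t w w')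

open Classical in
/-- The weight of the pair of waves `(w, w')`, `w < w'`, at time `t`. -/
def weight (F : ℝ → ℝ) (ε : ℝ) (u₀ : ℝ → ℝ) (t w w' : ℝ) : ℝ≥0∞ :=
  if ∃ z ∈ waves (gridFlux F ε) u₀ t ∩ Set.Icc w w', waveSign u₀ z ≠ waveSign u₀ w then
    normF2 F
  else if pos (gridFlux F ε) u₀ t w = pos (gridFlux F ε) u₀ t w' ∨
      interactionTimes (gridFlux F ε) u₀ t w w' = ∅ then
    0
  else
    ENNReal.ofReal (numerator (gridFlux F ε) u₀ t w w') / denominator (gridFlux F ε) u₀ t w w'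

/-- The interaction potential: the integral of the weights over all pairs of waves `w < w'`. -/
def potential (F : ℝ → ℝ) (ε : ℝ) (u₀ : ℝ → ℝ) (t : ℝ) : ℝ≥0∞ :=
  ∫⁻ w in waves (gridFlux F ε) u₀ t,
    ∫⁻ w' in waves (gridFlux F ε) u₀ t ∩ Set.Ioi w, weight F ε u₀ t w w'

/-- Admissible discretizations `u₀` of the datum `ubar`: right continuous, compactly supported,
with values in `ℤ ε`, with total variation not larger than that of `ubar`, and such that the
interactions of the resulting wavefront tracking solution are binary. -/
structure IsDiscretization (F : ℝ → ℝ) (ε : ℝ) (ubar u₀ : ℝ → ℝ) : Prop where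
  rightCont : ∀ x, ContinuousWithinAt u₀ (Set.Ici x) x
  compactSupport : HasCompactSupport u₀
  grid : ∀ x, ∃ k : ℤ, u₀ x = k * ε
  totalVar_le : totalVar u₀ ≤ totalVar ubar
  binary : BinaryInteractions (gridFlux F ε) u₀

end WaveTracking

end

open scoped ENNReal

noncomputable section

namespace WaveTracking

section

/-! ### Slopes of discrete convex envelopes -/

/-! All data live on the grid, so the waves are cut into cells of length `ε`. A cell has a sign, a
position and a level (the state on its left, times the sign, in units of `ε`). Its waves move
together (`Cells.entSpeed_eq`) and are canceled together (`Cells.inJump_iff`). Weights are constant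
on products of cells, so the potential is `ε²` times a finite double sum (`Track.potential_eq`), and
what remains is a statement about slopes of convex envelopes of functions on `ℤ`. Negative waves
reduce to positive ones by the reflection `v ↦ -v`, `f ↦ -f (-·)`, built into `flux`.

Bound at time zero. The two speeds in a weight are values of `F'` on a common interval whose length
is the denominator, so a weight is at most `normF2 F` (`Traj.stageWt_le`); ordered pairs are at most
half of all pairs.

Monotonicity. The potential is constant between two stages. Just after a stage the cells at one
point separate into fronts of different speeds. This does not increase any weight, because fronts
end at contact points of the envelope and slopes are monotone in the interval
(`Traj.stageWt_front_le`). At a cancellation, a surviving pair either had the maximal weight already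
or sees the same left and right sets as before (`Traj.stageWt_succ_le`). At a same-sign merging a
single weight can increase, but the sum over the merged cells against one fixed cell does not
(`MergeAt.sum_left_le`, `MergeAt.sum_right_le`). The reason is `sum_posPart_merge_le`: the terms of
`∑ (slope - c)⁺` over an initial segment vanish up to a contact point and telescope after it, and
joining two intervals lowers the envelope.

Gain at a merging. Let fronts of lengths `ℓ₁`, `ℓ₂` and speeds `v₁ > v₂` merge. Each pair with one
wave on either front has weight `(v₁ - v₂) / (ℓ₁ + ℓ₂)` before and `0` after, so the potential loses
`ℓ₁ ℓ₂ (v₁ - v₂) / (ℓ₁ + ℓ₂)` (`MergeAt.potSum_succ_add_le`). The merged front has the mean speed,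
so this is half the change of speed (`abs_sub_average`, `speedChange_eq`).

Dependence on the future. Position, sign and level of the cells can be read off the profile, hence
so can speeds and cancellations. Two solutions with the same future therefore have order isomorphic
cells at all later times (`Traj.corrAt`) and equal sums of weights. -/

/-- The line `c + σ k` lies below `φ` on `[α, β]` and touches `φ` on both sides of the cell
`[m, m + 1]`. -/
structure IsSupport (φ : ℤ → ℝ) (α β m : ℤ) (c σ : ℝ) : Prop where
  below : ∀ k, α ≤ k → k ≤ β → c + σ * k ≤ φ k
  left : ∃ i, α ≤ i ∧ i ≤ m ∧ φ i = c + σ * i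
  right : ∃ j, m < j ∧ j ≤ β ∧ φ j = c + σ * j

/-- Some line below `φ` on `[α, β]` touches `φ` at `r`. -/
def Contact (φ : ℤ → ℝ) (α β r : ℤ) : Prop :=
  ∃ c σ : ℝ, (∀ k, α ≤ k → k ≤ β → c + σ * k ≤ φ k) ∧ φ r = c + σ * r

/-- Among the chords joining a node `i ≤ m` to a node `j > m`, the one that is lowest at `m + 1/2`
works: a node `k` under its line could replace the endpoint on its own side and lower the chord at
`m + 1/2`. -/
theorem exists_isSupport (φ : ℤ → ℝ) {α β m : ℤ} (h₁ : α ≤ m) (h₂ : m < β) :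
    ∃ c σ, IsSupport φ α β m c σ := by
  -- minimize the value at `m + 1/2` of the chords over the cell
  let v : ℤ × ℤ → ℝ := fun p =>
    φ p.1 + (φ p.2 - φ p.1) / (p.2 - p.1) * (m + 1 / 2 - p.1)
  obtain ⟨⟨i, j⟩, hp, hmin⟩ := (Finset.Icc α m ×ˢ Finset.Ioc m β).exists_min_image v
    ⟨(m, m + 1), by simp [h₁]; omega⟩
  simp only [Finset.mem_product, Finset.mem_Icc, Finset.mem_Ioc, Prod.forall] at hp hmin
  obtain ⟨⟨hi₁, hi₂⟩, hj₁, hj₂⟩ := hp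
  have hiR : (i : ℝ) ≤ m := by exact_mod_cast hi₂
  have hjR : (m : ℝ) + 1 ≤ j := by exact_mod_cast hj₁
  set σ := (φ j - φ i) / (j - i) with hσ
  have hσ' : σ * (j - i) = φ j - φ i := by
    rw [hσ]; field_simp [show (j : ℝ) - i ≠ 0 by linarith]
  refine ⟨φ i - σ * i, σ, ?_, ⟨i, hi₁, hi₂, by ring⟩, ⟨j, hj₁, hj₂, by linarith⟩⟩
  intro k hk₁ hk₂
  rcases le_or_gt k m with hkm | hkm
  · have h := hmin k j ⟨⟨hk₁, hkm⟩, hj₁, hj₂⟩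
    simp only [v] at h
    rw [← hσ] at h
    have hkR : (k : ℝ) ≤ m := by exact_mod_cast hkm
    set τ := (φ j - φ k) / (j - k) with hτ
    have hτ' : τ * (j - k) = φ j - φ k := by
      rw [hτ]; field_simp [show (j : ℝ) - k ≠ 0 by linarith]
    -- Both chords pass through `j`, so their order at `m + 1/2` is the order of their slopes.
    have h1 : 0 ≤ (σ - τ) * ((j : ℝ) - (m + 1 / 2)) := by nlinarith
    have h2 : 0 ≤ σ - τ := nonneg_of_mul_nonneg_left h1 (by linarith)
    nlinarith [mul_nonneg h2 (show (0 : ℝ) ≤ j - k by linarith)]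
  · have h := hmin i k ⟨⟨hi₁, hi₂⟩, hkm, hk₂⟩
    simp only [v] at h
    rw [← hσ] at h
    have hkR : (m : ℝ) + 1 ≤ k := by exact_mod_cast hkm
    set τ := (φ k - φ i) / (k - i) with hτ
    have hτ' : τ * (k - i) = φ k - φ i := by
      rw [hτ]; field_simp [show (k : ℝ) - i ≠ 0 by linarith]
    have h1 : 0 ≤ (τ - σ) * ((m : ℝ) + 1 / 2 - i) := by nlinarith
    have h2 : 0 ≤ τ - σ := nonneg_of_mul_nonneg_left h1 (by linarith)
    nlinarith [mul_nonneg h2 (show (0 : ℝ) ≤ k - i by linarith)]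

open Classical in
/-- The slope on the cell `[m, m + 1]` of the convex envelope of `φ` on `[α, β]`. -/
def slope (φ : ℤ → ℝ) (α β m : ℤ) : ℝ :=
  if h : ∃ σ c, IsSupport φ α β m c σ then h.choose else 0

/-- A line below `φ` at the two contact points lies below the supporting line in between. -/
theorem IsSupport.line_le {φ : ℤ → ℝ} {α β m : ℤ} {c σ c' σ' : ℝ} (h : IsSupport φ α β m c σ)
    (h' : ∀ k, α ≤ k → k ≤ β → c' + σ' * k ≤ φ k) {x : ℝ} (hx : m ≤ x) (hx' : x ≤ m + 1) :
    c' + σ' * x ≤ c + σ * x := by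
  obtain ⟨i, hi₁, hi₂, hi⟩ := h.left
  obtain ⟨j, hj₁, hj₂, hj⟩ := h.right
  have h1 := h' i hi₁ (by omega)
  have h2 := h' j (by omega) hj₂
  have hiR : (i : ℝ) ≤ m := by exact_mod_cast hi₂
  have hjR : (m : ℝ) + 1 ≤ j := by exact_mod_cast hj₁
  rw [hi] at h1; rw [hj] at h2
  have h3 : ((c' - c) + (σ' - σ) * x) * (j - i) ≤ 0 := by
    have e : ((c' - c) + (σ' - σ) * x) * (j - i) =
      ((c' - c) + (σ' - σ) * i) * (j - x) + ((c' - c) + (σ' - σ) * j) * (x - i) := by ring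
    rw [e]
    nlinarith [mul_nonneg (show (0 : ℝ) ≤ -((c' - c) + (σ' - σ) * i) by linarith)
      (show (0 : ℝ) ≤ j - x by linarith),
      mul_nonneg (show (0 : ℝ) ≤ -((c' - c) + (σ' - σ) * j) by linarith)
      (show (0 : ℝ) ≤ x - i by linarith)]
  have := nonpos_of_mul_nonpos_left h3 (by linarith)
  linarith

/-- Each of the two lines lies below the other on the whole cell, so they agree at both its ends. -/
theorem IsSupport.unique {φ : ℤ → ℝ} {α β m : ℤ} {c σ c' σ' : ℝ} (h : IsSupport φ α β m c σ)
    (h' : IsSupport φ α β m c' σ') : σ = σ' ∧ c = c' := by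
  have a1 := h.line_le h'.below (x := m) le_rfl (by linarith)
  have a2 := h.line_le h'.below (x := m + 1) (by linarith) le_rfl
  have a3 := h'.line_le h.below (x := m) le_rfl (by linarith)
  have a4 := h'.line_le h.below (x := m + 1) (by linarith) le_rfl
  have : σ = σ' := by nlinarith
  subst this
  exact ⟨rfl, by linarith⟩

theorem IsSupport.slope_eq {φ : ℤ → ℝ} {α β m : ℤ} {c σ : ℝ} (h : IsSupport φ α β m c σ) :
    slope φ α β m = σ := by
  have hex : ∃ σ c, IsSupport φ α β m c σ := ⟨σ, c, h⟩
  obtain ⟨c', h'⟩ := hex.choose_spec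
  rw [slope, dif_pos hex]
  exact (h'.unique h).1

theorem exists_isSupport_slope (φ : ℤ → ℝ) {α β m : ℤ} (h₁ : α ≤ m) (h₂ : m < β) :
    ∃ c, IsSupport φ α β m c (slope φ α β m) := by
  obtain ⟨c, σ, h⟩ := exists_isSupport φ h₁ h₂
  exact ⟨c, h.slope_eq.symm ▸ h⟩

/-- At `m` the supporting line of the larger interval is the lower one. At its contact point `j > m`
it has the value `φ j`, so there it is the upper one. Hence its slope is at least as large. -/
theorem slope_anti_left (φ : ℤ → ℝ) {α α' β m : ℤ} (h : α ≤ α') (h₁ : α' ≤ m) (h₂ : m < β) :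
    slope φ α' β m ≤ slope φ α β m := by
  obtain ⟨c, hs⟩ := exists_isSupport_slope φ (h.trans h₁) h₂
  obtain ⟨c', hs'⟩ := exists_isSupport_slope φ h₁ h₂
  have a1 := hs'.line_le (fun k hk => hs.below k (h.trans hk)) (x := m) le_rfl (by linarith)
  obtain ⟨j, hj₁, hj₂, hj⟩ := hs.right
  have a2 := hs'.below j (by omega) hj₂
  have hjR : (m : ℝ) + 1 ≤ j := by exact_mod_cast hj₁
  rw [hj] at a2
  by_contra! hlt
  nlinarith

theorem slope_mono_right (φ : ℤ → ℝ) {α β β' m : ℤ} (h : β' ≤ β) (h₁ : α ≤ m) (h₂ : m < β') :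
    slope φ α β m ≤ slope φ α β' m := by
  obtain ⟨c, hs⟩ := exists_isSupport_slope φ h₁ (h₂.trans_le h)
  obtain ⟨c', hs'⟩ := exists_isSupport_slope φ h₁ h₂
  have a1 := hs'.line_le (fun k hk hk' => hs.below k hk (hk'.trans h)) (x := m + 1) (by linarith)
    le_rfl
  obtain ⟨i, hi₁, hi₂, hi⟩ := hs.left
  have a2 := hs'.below i hi₁ (by omega)
  have hiR : (i : ℝ) ≤ m := by exact_mod_cast hi₂
  rw [hi] at a2
  by_contra! hlt
  nlinarith

/-- Convexity of the envelope: the supporting line of a cell dominates, over that cell, every line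
below `φ`. Comparing the lines of two adjacent cells at `m + 1` and at `m + 2` orders their slopes.
-/
theorem slope_le_succ (φ : ℤ → ℝ) {α β m : ℤ} (h₁ : α ≤ m) (h₂ : m + 1 < β) :
    slope φ α β m ≤ slope φ α β (m + 1) := by
  obtain ⟨c, hs⟩ := exists_isSupport_slope φ h₁ ((lt_add_one m).trans h₂)
  obtain ⟨c', hs'⟩ := exists_isSupport_slope φ (show α ≤ m + 1 by omega) h₂
  have a1 := hs.line_le hs'.below (x := m + 1) (by linarith) le_rfl
  have a2 := hs'.line_le hs.below (x := m + 2) (by push_cast; linarith) (by push_cast; linarith)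
  linarith

theorem slope_mono (φ : ℤ → ℝ) {α β m m' : ℤ} (h₁ : α ≤ m) (h : m ≤ m') (h₂ : m' < β) :
    slope φ α β m ≤ slope φ α β m' := by
  revert h₂
  induction m', h using Int.leInduction with
  | base => exact fun _ => le_rfl
  | succ k hk ih => exact fun h => (ih (by omega)).trans (slope_le_succ φ (by omega) h)

/-- The slope is the slope of a chord. -/
theorem exists_slope_eq_chord (φ : ℤ → ℝ) {α β m : ℤ} (h₁ : α ≤ m) (h₂ : m < β) :
    ∃ i j, α ≤ i ∧ i ≤ m ∧ m < j ∧ j ≤ β ∧ slope φ α β m = (φ j - φ i) / (j - i) := by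
  obtain ⟨c, hs⟩ := exists_isSupport_slope φ h₁ h₂
  obtain ⟨i, hi₁, hi₂, hi⟩ := hs.left
  obtain ⟨j, hj₁, hj₂, hj⟩ := hs.right
  refine ⟨i, j, hi₁, hi₂, hj₁, hj₂, ?_⟩
  have : (i : ℝ) < j := by exact_mod_cast hi₂.trans_lt hj₁
  rw [eq_div_iff (by linarith), hi, hj]
  ring

/-! ### The discrete convex envelope -/

open Classical in
/-- The intercept of the supporting line of a cell. -/
def intercept (φ : ℤ → ℝ) (α β m : ℤ) : ℝ :=
  if h : ∃ c, IsSupport φ α β m c (slope φ α β m) then h.choose else 0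

theorem isSupport_slope (φ : ℤ → ℝ) {α β m : ℤ} (h₁ : α ≤ m) (h₂ : m < β) :
    IsSupport φ α β m (intercept φ α β m) (slope φ α β m) := by
  have h := exists_isSupport_slope φ h₁ h₂
  rw [intercept, dif_pos h]
  exact h.choose_spec

/-- The convex envelope of `φ` on `[α, β]`, at the nodes. -/
def env (φ : ℤ → ℝ) (α β m : ℤ) : ℝ :=
  if m < β then intercept φ α β m + slope φ α β m * m else φ β

theorem env_right (φ : ℤ → ℝ) (α β : ℤ) : env φ α β β = φ β := by simp [env]

theorem env_le (φ : ℤ → ℝ) {α β m : ℤ} (h₁ : α ≤ m) (h₂ : m ≤ β) : env φ α β m ≤ φ m := by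
  rcases h₂.lt_or_eq with h | rfl
  · rw [env, if_pos h]; exact (isSupport_slope φ h₁ h).below m h₁ h₂
  · rw [env_right]

theorem line_le_env {φ : ℤ → ℝ} {α β m : ℤ} {c σ : ℝ}
    (h : ∀ k, α ≤ k → k ≤ β → c + σ * k ≤ φ k) (h₁ : α ≤ m) (h₂ : m ≤ β) :
    c + σ * m ≤ env φ α β m := by
  rcases h₂.lt_or_eq with h' | rfl
  · rw [env, if_pos h']; exact (isSupport_slope φ h₁ h').line_le h le_rfl (by linarith)
  · rw [env_right]; exact h m h₁ h₂

/-- The supporting line of a cell carries the envelope at both ends of the cell: at `m + 1` it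
dominates the line of the next cell and is itself a line below `φ`; if `m + 1 = β`, its right
contact point can only be `β`. Sums of slopes therefore telescope. -/
theorem env_succ (φ : ℤ → ℝ) {α β m : ℤ} (h₁ : α ≤ m) (h₂ : m < β) :
    env φ α β (m + 1) = env φ α β m + slope φ α β m := by
  have hs := isSupport_slope φ h₁ h₂
  have e : env φ α β (m + 1) = intercept φ α β m + slope φ α β m * (m + 1) := by
    apply le_antisymm
    · rcases (show m + 1 ≤ β by omega).lt_or_eq with h | h
      · rw [env, if_pos h]
        have := hs.line_le (isSupport_slope φ (show α ≤ m + 1 by omega) h).below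
          (x := m + 1) (by linarith) le_rfl
        push_cast; linarith
      · obtain ⟨j, hj₁, hj₂, hj⟩ := hs.right
        have : j = m + 1 := by omega
        subst this
        rw [env, if_neg (by omega)]
        subst h
        rw [hj]; push_cast; linarith
    · have := line_le_env hs.below (m := m + 1) (by omega) (by omega)
      push_cast at this; linarith
  rw [e, env, if_pos h₂]; ring

theorem env_left (φ : ℤ → ℝ) {α β : ℤ} (h : α ≤ β) : env φ α β α = φ α := by
  rcases h.lt_or_eq with h | rfl
  · obtain ⟨i, hi₁, hi₂, hi⟩ := (isSupport_slope φ le_rfl h).left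
    obtain rfl : i = α := by omega
    rw [env, if_pos h, hi]
  · rw [env_right]

theorem exists_line_env (φ : ℤ → ℝ) {α β m : ℤ} (h₁ : α ≤ m) (h₂ : m < β) :
    ∃ c σ : ℝ, (∀ k, α ≤ k → k ≤ β → c + σ * k ≤ φ k) ∧ env φ α β m = c + σ * m :=
  ⟨_, _, (isSupport_slope φ h₁ h₂).below, by rw [env, if_pos h₂]⟩

theorem env_anti (φ : ℤ → ℝ) {α α' β β' m : ℤ} (h : α ≤ α') (h' : β' ≤ β) (h₁ : α' ≤ m)
    (h₂ : m ≤ β') : env φ α β m ≤ env φ α' β' m := by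
  rcases (h₂.trans h').lt_or_eq with h₃ | rfl
  · obtain ⟨c, σ, hl, he⟩ := exists_line_env φ (h.trans h₁) h₃
    rw [he]
    exact line_le_env (fun k hk hk' => hl k (h.trans hk) (hk'.trans h')) h₁ h₂
  · obtain rfl : m = β' := le_antisymm h₂ h'
    rw [env_right, env_right]

theorem sum_slope (φ : ℤ → ℝ) {α β r e : ℤ} (h₁ : α ≤ r) (h : r ≤ e) (h₂ : e ≤ β) :
    ∑ m ∈ Finset.Ico r e, slope φ α β m = env φ α β e - env φ α β r := by
  revert h₂
  induction e, h using Int.leInduction with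
  | base => simp
  | succ k hk ih =>
    intro h
    rw [← Finset.insert_Ico_right_eq_Ico_add_one hk, Finset.sum_insert (by simp), ih (by omega),
      env_succ φ (h₁.trans hk) (by omega)]
    ring

/-! ### Contact points -/

theorem Contact.mono {φ : ℤ → ℝ} {α α' β β' r : ℤ} (h : Contact φ α β r) (h₁ : α ≤ α')
    (h₂ : β' ≤ β) : Contact φ α' β' r := by
  obtain ⟨c, σ, h, e⟩ := h
  exact ⟨c, σ, fun k hk hk' => h k (h₁.trans hk) (hk'.trans h₂), e⟩

theorem contact_iff_env {φ : ℤ → ℝ} {α β r : ℤ} (h₁ : α ≤ r) (h₂ : r < β) :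
    Contact φ α β r ↔ env φ α β r = φ r := by
  constructor
  · rintro ⟨c, σ, h, e⟩
    exact le_antisymm (env_le φ h₁ h₂.le) (e ▸ line_le_env h h₁ h₂.le)
  · intro h
    obtain ⟨c, σ, hl, he⟩ := exists_line_env φ h₁ h₂
    exact ⟨c, σ, hl, by rw [← h, he]⟩

theorem contact_left (φ : ℤ → ℝ) {α β : ℤ} (h : α < β) : Contact φ α β α :=
  (contact_iff_env le_rfl h).2 (env_left φ h.le)

theorem contact_right (φ : ℤ → ℝ) {α β : ℤ} (h : α < β) : Contact φ α β β := by
  have hs := isSupport_slope φ (show α ≤ β - 1 by omega) (sub_one_lt β)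
  obtain ⟨j, hj₁, hj₂, hj⟩ := hs.right
  obtain rfl : j = β := by omega
  exact ⟨_, _, hs.below, hj⟩

/-- At a corner, the supporting line of the cell on the right touches `φ` at `m` itself. If its left
contact point were some `i < m`, the flatter line of the preceding cell would pass above `φ` at `i`.
-/
theorem contact_of_slope_lt {φ : ℤ → ℝ} {α β m : ℤ} (h₁ : α < m) (h₂ : m < β)
    (h : slope φ α β (m - 1) < slope φ α β m) : Contact φ α β m := by
  have hs := isSupport_slope φ h₁.le h₂
  have hs' := isSupport_slope φ (show α ≤ m - 1 by omega) (by omega : m - 1 < β)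
  obtain ⟨i, hi₁, hi₂, hi⟩ := hs.left
  rcases hi₂.lt_or_eq with hi₂ | rfl
  · exfalso
    have a1 := hs'.line_le hs.below (x := m) (by push_cast; linarith) (by push_cast; linarith)
    have a2 := hs'.below i hi₁ (by omega)
    have hiR : (i : ℝ) < m := by exact_mod_cast hi₂
    rw [hi] at a2
    nlinarith
  · exact ⟨_, _, hs.below, hi⟩

/-- Cutting the interval at a contact point does not change the envelope. If the left contact point
of the supporting line precedes `r`, that line also supports the cell `r`. It then dominates the
line touching `φ` at `r`, so it touches `φ` there too. -/
theorem slope_eq_of_contact_left {φ : ℤ → ℝ} {α β r m : ℤ} (hc : Contact φ α β r) (h₀ : α ≤ r)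
    (h₁ : r ≤ m) (h₂ : m < β) : slope φ r β m = slope φ α β m := by
  have hs := isSupport_slope φ (h₀.trans h₁) h₂
  refine IsSupport.slope_eq (c := intercept φ α β m)
    ⟨fun k hk hk' => hs.below k (h₀.trans hk) hk', ?_, hs.right⟩
  obtain ⟨i, hi₁, hi₂, hi⟩ := hs.left
  rcases le_or_gt r i with h | h
  · exact ⟨i, h, hi₂, hi⟩
  · refine ⟨r, le_rfl, h₁, ?_⟩
    obtain ⟨c, σ, hl, he⟩ := hc
    obtain ⟨j, hj₁, hj₂, hj⟩ := hs.right
    have hs' : IsSupport φ α β r (intercept φ α β m) (slope φ α β m) :=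
      ⟨hs.below, ⟨i, hi₁, h.le, hi⟩, ⟨j, by omega, hj₂, hj⟩⟩
    exact le_antisymm (he ▸ hs'.line_le hl le_rfl (by linarith)) (hs.below r h₀ (by omega))

theorem slope_eq_of_contact_right {φ : ℤ → ℝ} {α β r m : ℤ} (hc : Contact φ α β r) (h₀ : r ≤ β)
    (h₁ : α ≤ m) (h₂ : m < r) : slope φ α r m = slope φ α β m := by
  have hs := isSupport_slope φ h₁ (h₂.trans_le h₀)
  refine IsSupport.slope_eq (c := intercept φ α β m)
    ⟨fun k hk hk' => hs.below k hk (hk'.trans h₀), hs.left, ?_⟩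
  obtain ⟨j, hj₁, hj₂, hj⟩ := hs.right
  rcases le_or_gt j r with h | h
  · exact ⟨j, hj₁, h, hj⟩
  · refine ⟨r, h₂, le_rfl, ?_⟩
    obtain ⟨c, σ, hl, he⟩ := hc
    obtain ⟨i, hi₁, hi₂, hi⟩ := hs.left
    have hs' : IsSupport φ α β r (intercept φ α β m) (slope φ α β m) :=
      ⟨hs.below, ⟨i, hi₁, by omega, hi⟩, ⟨j, h, hj₂, hj⟩⟩
    exact le_antisymm (he ▸ hs'.line_le hl le_rfl (by linarith)) (hs.below r (by omega) h₀)

/-! ### Merging two intervals -/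

/-- Slopes of the envelopes on `[α, β]` and `[β, γ]`. -/
def splitSlope (φ : ℤ → ℝ) (α β γ m : ℤ) : ℝ :=
  if m < β then slope φ α β m else slope φ β γ m

/-- The envelopes on `[α, β]` and `[β, γ]`. -/
def splitEnv (φ : ℤ → ℝ) (α β γ m : ℤ) : ℝ :=
  if m < β then env φ α β m else env φ β γ m

theorem splitEnv_succ (φ : ℤ → ℝ) {α β γ m : ℤ} (h₁ : α ≤ m) (h₂ : m < γ) (hβ : β ≤ γ) :
    splitEnv φ α β γ (m + 1) = splitEnv φ α β γ m + splitSlope φ α β γ m := by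
  simp only [splitEnv, splitSlope]
  rcases lt_or_ge m β with h | h
  · rw [if_pos h, if_pos h, ← env_succ φ h₁ h]
    split_ifs with h'
    · rfl
    · obtain rfl : m + 1 = β := by omega
      rw [env_left φ hβ, env_right]
  · rw [if_neg (by omega), if_neg (by omega), if_neg (by omega), env_succ φ h h₂]

theorem sum_splitSlope (φ : ℤ → ℝ) {α β γ r e : ℤ} (h₁ : α ≤ r) (h : r ≤ e) (h₂ : e ≤ γ)
    (hβ : β ≤ γ) :
    ∑ m ∈ Finset.Ico r e, splitSlope φ α β γ m = splitEnv φ α β γ e - splitEnv φ α β γ r := by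
  revert h₂
  induction e, h using Int.leInduction with
  | base => simp
  | succ k hk ih =>
    intro h
    rw [← Finset.insert_Ico_right_eq_Ico_add_one hk, Finset.sum_insert (by simp), ih (by omega),
      splitEnv_succ φ (h₁.trans hk) (by omega) hβ]
    ring

theorem env_le_splitEnv (φ : ℤ → ℝ) {α β γ m : ℤ} (h₁ : α ≤ m) (h₂ : m ≤ γ) (hα : α ≤ β)
    (hβ : β ≤ γ) : env φ α γ m ≤ splitEnv φ α β γ m := by
  rw [splitEnv]
  split_ifs with h
  · exact env_anti φ le_rfl hβ h₁ h.le
  · exact env_anti φ hα le_rfl (by omega) h₂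

theorem splitEnv_le (φ : ℤ → ℝ) {α β γ m : ℤ} (h₁ : α ≤ m) (h₂ : m ≤ γ) :
    splitEnv φ α β γ m ≤ φ m := by
  rw [splitEnv]
  split_ifs with h
  · exact env_le φ h₁ h.le
  · exact env_le φ (by omega) h₂

/-- A strict increase of the slope is needed only in the interior, since the envelope meets `φ` at
both ends of the interval anyway. -/
theorem env_eq_of_slope_lt {φ : ℤ → ℝ} {α β r : ℤ} (h₁ : α ≤ r) (h₂ : r ≤ β)
    (h : α < r → r < β → slope φ α β (r - 1) < slope φ α β r) : env φ α β r = φ r := by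
  rcases h₁.lt_or_eq with h₁ | rfl
  · rcases h₂.lt_or_eq with h₂ | rfl
    · exact (contact_iff_env h₁.le h₂).1 (contact_of_slope_lt h₁ h₂ (h h₁ h₂))
    · exact env_right φ α r
  · exact env_left φ h₂

/-- Merging decreases the sum of the positive parts of the slopes over an initial segment. -/
theorem sum_posPart_merge_le (φ : ℤ → ℝ) {p β γ e : ℤ} (hp : p ≤ β) (hβ : β ≤ γ) (hpe : p ≤ e)
    (he : e ≤ γ) (c : ℝ) :
    ∑ m ∈ Finset.Ico p e, max (slope φ p γ m - c) 0 ≤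
      ∑ m ∈ Finset.Ico p e, max (splitSlope φ p β γ m - c) 0 := by
  by_cases hex : ∃ m ∈ Finset.Ico p e, c < slope φ p γ m
  -- `r` is the first cell with slope above `c`. Slopes increase, so the terms vanish before `r` and
  -- are positive from `r` on. Moreover `r` is an end or a corner, so the envelope touches `φ`
  -- there.
  · obtain ⟨r, hr, hmin⟩ : ∃ r ∈ (Finset.Ico p e).filter (fun m => c < slope φ p γ m),
        ∀ m ∈ (Finset.Ico p e).filter (fun m => c < slope φ p γ m), r ≤ m := by
      refine Finset.exists_min_image _ id ?_
      obtain ⟨m, hm, hm'⟩ := hex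
      exact ⟨m, by simp only [Finset.mem_filter]; exact ⟨hm, hm'⟩⟩
    simp only [Finset.mem_filter, Finset.mem_Ico] at hr hmin
    obtain ⟨⟨hr₁, hr₂⟩, hr₃⟩ := hr
    have hcont : env φ p γ r = φ r := by
      refine env_eq_of_slope_lt hr₁ (by omega) fun h₁ h₂ => lt_of_le_of_lt ?_ hr₃
      by_contra! hlt
      have := hmin (r - 1) ⟨⟨by omega, by omega⟩, hlt⟩
      omega
    have hL : ∑ m ∈ Finset.Ico p e, max (slope φ p γ m - c) 0 =
        ∑ m ∈ Finset.Ico r e, (slope φ p γ m - c) := by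
      rw [← Finset.sum_subset (Finset.Ico_subset_Ico_left hr₁)]
      · refine Finset.sum_congr rfl fun m hm => max_eq_left ?_
        rw [Finset.mem_Ico] at hm
        have := slope_mono φ hr₁ hm.1 (show m < γ by omega)
        linarith
      · intro m hm hm'
        rw [Finset.mem_Ico] at hm hm'
        refine max_eq_right ?_
        by_contra! hlt
        exact hm' ⟨hmin m ⟨hm, by linarith⟩, hm.2⟩
    calc _ = ∑ m ∈ Finset.Ico r e, (slope φ p γ m - c) := hL
      -- Both sums telescope. At `e` the envelope on the union is the lower one; at `r` it equals
      -- `φ`, which dominates `splitEnv`.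
      _ ≤ ∑ m ∈ Finset.Ico r e, (splitSlope φ p β γ m - c) := by
        rw [Finset.sum_sub_distrib, Finset.sum_sub_distrib, sum_slope φ hr₁ hr₂.le he,
          sum_splitSlope φ hr₁ hr₂.le he hβ, hcont]
        linarith [env_le_splitEnv φ hpe he hp hβ,
          splitEnv_le φ (β := β) hr₁ (show r ≤ γ by omega)]
      _ ≤ ∑ m ∈ Finset.Ico r e, max (splitSlope φ p β γ m - c) 0 :=
        Finset.sum_le_sum fun m _ => le_max_left _ _
      _ ≤ _ := Finset.sum_le_sum_of_subset_of_nonneg (Finset.Ico_subset_Ico_left hr₁)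
        fun m _ _ => le_max_right _ _
  · push Not at hex
    rw [Finset.sum_eq_zero fun m hm => max_eq_right (by linarith [hex m hm])]
    exact Finset.sum_nonneg fun m _ => le_max_right _ _

/-- Merging decreases the sum of the negative parts of the slopes over a final segment. -/
theorem sum_negPart_merge_le (φ : ℤ → ℝ) {α β p e : ℤ} (hα : α ≤ β) (hp : β ≤ p) (hαe : α ≤ e)
    (he : e ≤ p) (c : ℝ) :
    ∑ m ∈ Finset.Ico e p, max (c - slope φ α p m) 0 ≤
      ∑ m ∈ Finset.Ico e p, max (c - splitSlope φ α β p m) 0 := by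
  by_cases hex : ∃ m ∈ Finset.Ico e p, slope φ α p m < c
  · obtain ⟨r, hr, hmax⟩ : ∃ r ∈ (Finset.Ico e p).filter (fun m => slope φ α p m < c),
        ∀ m ∈ (Finset.Ico e p).filter (fun m => slope φ α p m < c), m ≤ r := by
      refine Finset.exists_max_image _ id ?_
      obtain ⟨m, hm, hm'⟩ := hex
      exact ⟨m, by simp only [Finset.mem_filter]; exact ⟨hm, hm'⟩⟩
    simp only [Finset.mem_filter, Finset.mem_Ico] at hr hmax
    obtain ⟨⟨hr₁, hr₂⟩, hr₃⟩ := hr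
    -- Here `r` is the last cell with slope below `c`, so the contact point is its right end `r +
    -- 1`.
    have hcont : env φ α p (r + 1) = φ (r + 1) := by
      refine env_eq_of_slope_lt (by omega) (by omega) fun h₁ h₂ => ?_
      rw [add_sub_cancel_right]
      refine hr₃.trans_le ?_
      by_contra! hlt
      have := hmax (r + 1) ⟨⟨by omega, by omega⟩, hlt⟩
      omega
    have hL : ∑ m ∈ Finset.Ico e p, max (c - slope φ α p m) 0 =
        ∑ m ∈ Finset.Ico e (r + 1), (c - slope φ α p m) := by
      rw [← Finset.sum_subset (Finset.Ico_subset_Ico_right (show r + 1 ≤ p by omega))]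
      · refine Finset.sum_congr rfl fun m hm => max_eq_left ?_
        rw [Finset.mem_Ico] at hm
        have := slope_mono φ (hαe.trans hm.1) (show m ≤ r by omega) hr₂
        linarith
      · intro m hm hm'
        rw [Finset.mem_Ico] at hm hm'
        refine max_eq_right ?_
        by_contra! hlt
        have := hmax m ⟨hm, by linarith⟩
        exact hm' ⟨hm.1, by omega⟩
    calc _ = ∑ m ∈ Finset.Ico e (r + 1), (c - slope φ α p m) := hL
      _ ≤ ∑ m ∈ Finset.Ico e (r + 1), (c - splitSlope φ α β p m) := by
        rw [Finset.sum_sub_distrib, Finset.sum_sub_distrib, sum_slope φ hαe (by omega) (by omega),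
          sum_splitSlope φ hαe (by omega) (by omega) hp, hcont]
        linarith [env_le_splitEnv φ hαe he hα hp,
          splitEnv_le φ (β := β) (show α ≤ r + 1 by omega) (show r + 1 ≤ p by omega)]
      _ ≤ ∑ m ∈ Finset.Ico e (r + 1), max (c - splitSlope φ α β p m) 0 :=
        Finset.sum_le_sum fun m _ => le_max_left _ _
      _ ≤ _ := Finset.sum_le_sum_of_subset_of_nonneg
        (Finset.Ico_subset_Ico_right (show r + 1 ≤ p by omega)) fun m _ _ => le_max_right _ _
  · push Not at hex
    rw [Finset.sum_eq_zero fun m hm => max_eq_right (by linarith [hex m hm])]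
    exact Finset.sum_nonneg fun m _ => le_max_right _ _

theorem env_of_slope_const {φ : ℤ → ℝ} {α β : ℤ} {lam : ℝ}
    (h : ∀ m, α ≤ m → m < β → slope φ α β m = lam) {k : ℤ} (h₁ : α ≤ k) (h₂ : k ≤ β) :
    env φ α β k = φ α + lam * (k - α) := by
  have := sum_slope φ (le_refl α) h₁ h₂
  rw [Finset.sum_congr rfl fun m hm =>
    h m (Finset.mem_Ico.1 hm).1 ((Finset.mem_Ico.1 hm).2.trans_le h₂), Finset.sum_const,
    Int.card_Ico, nsmul_eq_mul, env_left φ (h₁.trans h₂)] at this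
  have e : (((k - α).toNat : ℕ) : ℝ) = k - α := by
    have : (((k - α).toNat : ℕ) : ℤ) = k - α := Int.toNat_of_nonneg (by omega)
    exact_mod_cast this
  rw [e] at this
  linarith

/-- Two affine pieces with decreasing slopes merge into one affine piece. -/
theorem slope_merge_const {φ : ℤ → ℝ} {α β γ : ℤ} {lam₁ lam₂ : ℝ} (hαβ : α < β) (hβγ : β < γ)
    (h₁ : ∀ m, α ≤ m → m < β → slope φ α β m = lam₁)
    (h₂ : ∀ m, β ≤ m → m < γ → slope φ β γ m = lam₂) (h : lam₂ ≤ lam₁) {m : ℤ} (hm : α ≤ m)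
    (hm' : m < γ) :
    slope φ α γ m = (lam₁ * (β - α) + lam₂ * (γ - β)) / (γ - α) := by
  have r1 : (α : ℝ) < β := by exact_mod_cast hαβ
  have r2 : (β : ℝ) < γ := by exact_mod_cast hβγ
  set lam := (lam₁ * (β - α) + lam₂ * (γ - β)) / (γ - α) with hlam
  have hlam' : lam * (γ - α) = lam₁ * (β - α) + lam₂ * (γ - β) := by
    rw [hlam, div_mul_cancel₀]; linarith
  have eβ := env_of_slope_const h₁ hαβ.le le_rfl
  have eγ := env_of_slope_const h₂ hβγ.le le_rfl
  rw [env_right] at eβ eγ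
  have l1 : lam ≤ lam₁ := by
    by_contra! hlt; nlinarith
  have l2 : lam₂ ≤ lam := by
    by_contra! hlt; nlinarith
  -- The supporting line is the chord over `[α, γ]`: since `lam₂ ≤ lam ≤ lam₁`, the broken line made
  -- of the two affine pieces stays above it, and `φ` lies above that broken line.
  refine IsSupport.slope_eq (c := φ α - lam * α) ⟨fun k hk hk' => ?_, ⟨α, le_rfl, hm, by ring⟩,
    ⟨γ, hm', le_rfl, by linarith⟩⟩
  rcases le_or_gt k β with hkβ | hkβ
  · have a := env_le φ hk hkβ
    rw [env_of_slope_const h₁ hk hkβ] at a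
    have : (α : ℝ) ≤ k := by exact_mod_cast hk
    nlinarith
  · have a := env_le φ hkβ.le hk'
    rw [env_of_slope_const h₂ hkβ.le hk'] at a
    have : (k : ℝ) ≤ γ := by exact_mod_cast hk'
    nlinarith

end

section

/-! ### Envelopes of piecewise affine functions -/

/-- `f` is the piecewise affine interpolation of the values `φ k` at the nodes `k ε`. -/
def GridAffine (ε : ℝ) (φ : ℤ → ℝ) (f : ℝ → ℝ) : Prop :=
  ∀ (k : ℤ) (v : ℝ), k * ε ≤ v → v ≤ (k + 1) * ε → f v = φ k + (φ (k + 1) - φ k) * (v / ε - k)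

theorem gridAffine_gridFlux (F : ℝ → ℝ) {ε : ℝ} (hε : 0 < ε) :
    GridAffine ε (fun k => F (k * ε)) (gridFlux F ε) := by
  intro k v h₁ h₂
  rcases h₂.lt_or_eq with h | rfl
  · have : ⌊v / ε⌋ = k := by
      rw [Int.floor_eq_iff, le_div_iff₀ hε, div_lt_iff₀ hε]; exact ⟨h₁, h⟩
    rw [gridFlux, this]; push_cast; field_simp
  · have : ⌊((k : ℝ) + 1) * ε / ε⌋ = k + 1 := by
      rw [mul_div_cancel_right₀ _ hε.ne']; exact_mod_cast Int.floor_intCast (R := ℝ) (k + 1)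
    rw [gridFlux, this]; push_cast; field_simp; ring_nf

theorem GridAffine.reflect {ε : ℝ} {φ : ℤ → ℝ} {f : ℝ → ℝ} (hf : GridAffine ε φ f) :
    GridAffine ε (fun k => -φ (-k)) (fun v => -f (-v)) := by
  intro k v h₁ h₂
  have := hf (-(k + 1)) (-v) (by push_cast; linarith) (by push_cast; linarith)
  simp only [this, neg_add_rev, neg_add_cancel_comm]
  rw [neg_div]
  push_cast; ring

theorem GridAffine.node {ε : ℝ} (hε : 0 < ε) {φ : ℤ → ℝ} {f : ℝ → ℝ} (hf : GridAffine ε φ f)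
    (k : ℤ) : f (k * ε) = φ k := by
  rw [hf k _ le_rfl (by nlinarith), mul_div_cancel_right₀ _ hε.ne']; ring

theorem exists_cell {ε : ℝ} (hε : 0 < ε) (v : ℝ) : ∃ k : ℤ, k * ε ≤ v ∧ v < (k + 1) * ε :=
  ⟨⌊v / ε⌋, (le_div_iff₀ hε).1 (Int.floor_le _), (div_lt_iff₀ hε).1 (Int.lt_floor_add_one _)⟩

theorem line_le_of_gridAffine {ε : ℝ} (hε : 0 < ε) {φ : ℤ → ℝ} {f : ℝ → ℝ}
    (hf : GridAffine ε φ f) {α β : ℤ} {c σ : ℝ} (h : ∀ k, α ≤ k → k ≤ β → c + σ * k ≤ φ k) {z : ℝ}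
    (hz₁ : α * ε ≤ z) (hz₂ : z ≤ β * ε) : c + σ * (z / ε) ≤ f z := by
  obtain ⟨k, hk₁, hk₂⟩ := exists_cell hε z
  have hαk : α ≤ k := by
    have : (α : ℝ) * ε < (k + 1 : ℤ) * ε := by push_cast; linarith
    have : (α : ℝ) < (k + 1 : ℤ) := lt_of_mul_lt_mul_right this hε.le
    have : α < k + 1 := by exact_mod_cast this
    omega
  have hkβ : k ≤ β := by
    have : (k : ℝ) * ε ≤ β * ε := by linarith
    exact_mod_cast le_of_mul_le_mul_right this hε
  rcases hkβ.lt_or_eq with h' | rfl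
  · rw [hf k z hk₁ hk₂.le]
    have a1 := h k hαk hkβ
    have a2 := h (k + 1) (by omega) (by omega)
    have b1 : 0 ≤ z / ε - k := by rw [sub_nonneg, le_div_iff₀ hε]; exact hk₁
    have b2 : 0 ≤ (k : ℝ) + 1 - z / ε := by rw [sub_nonneg, div_le_iff₀ hε]; exact hk₂.le
    push_cast at a2
    nlinarith [mul_nonneg b1 (sub_nonneg.2 a2), mul_nonneg b2 (sub_nonneg.2 a1)]
  · obtain rfl : z = k * ε := le_antisymm hz₂ hk₁
    rw [hf.node hε, mul_div_cancel_right₀ _ hε.ne']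
    exact h k hαk le_rfl

/-- The supporting line is itself an admissible minorant. Conversely, a convex minorant minus the
line is smaller than any `η > 0` at suitable points near the two contact points, hence also between
them. The contact points are approached from inside, since an endpoint of the interval need not
belong to `I`. -/
theorem convEnv_eq_of_isSupport {ε : ℝ} (hε : 0 < ε) {φ : ℤ → ℝ} {f : ℝ → ℝ}
    (hf : GridAffine ε φ f) {α β m : ℤ} {c σ : ℝ} (hs : IsSupport φ α β m c σ) {I : Set ℝ}
    (hI : Convex ℝ I) (hI₁ : Set.Ioo (α * ε) (β * ε) ⊆ I) (hI₂ : I ⊆ Set.Icc (α * ε) (β * ε))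
    {v : ℝ} (hv : v ∈ I) (hv₁ : m * ε ≤ v) (hv₂ : v ≤ (m + 1) * ε) :
    convEnv I f v = c + σ * (v / ε) := by
  refine IsGreatest.csSup_eq ⟨⟨fun z => c + σ * (z / ε), ⟨hI, ?_⟩, ?_, rfl⟩, ?_⟩
  · intro x _ y _ a b _ _ hab
    simp only [smul_eq_mul]
    have : c = (a + b) * c := by rw [hab, one_mul]
    apply le_of_eq
    linear_combination this
  · intro z hz
    exact line_le_of_gridAffine hε hf hs.below (hI₂ hz).1 (hI₂ hz).2
  · rintro _ ⟨h, hconv, hle, rfl⟩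
    obtain ⟨i, hi₁, hi₂, hi⟩ := hs.left
    obtain ⟨j, hj₁, hj₂, hj⟩ := hs.right
    have hiR : (i : ℝ) * ε ≤ m * ε := by
      have : (i : ℝ) ≤ m := by exact_mod_cast hi₂
      gcongr
    have hjR : ((m : ℝ) + 1) * ε ≤ j * ε := by
      have : (m : ℝ) + 1 ≤ j := by exact_mod_cast hj₁
      gcongr
    have hαi : (α : ℝ) * ε ≤ i * ε := by
      have : (α : ℝ) ≤ i := by exact_mod_cast hi₁
      gcongr
    have hjβ : (j : ℝ) * ε ≤ β * ε := by
      have : (j : ℝ) ≤ β := by exact_mod_cast hj₂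
      gcongr
    rcases (hiR.trans hv₁).eq_or_lt with e | hiv
    · have := hle v hv
      rwa [← e, hf.node hε, hi, e, show (i : ℝ) = v / ε by rw [← e]; field_simp] at this
    rcases (hv₂.trans hjR).eq_or_lt with e | hvj
    · have := hle v hv
      rwa [e, hf.node hε, hj, ← e, show (j : ℝ) = v / ε by rw [e]; field_simp] at this
    refine le_of_forall_pos_le_add fun η hη => ?_
    obtain ⟨x, hx₁, hx₂, hx₃⟩ : ∃ x, i * ε < x ∧ x < v ∧ f x - (c + σ * (x / ε)) < η := by
      have ht : Filter.Tendsto (fun x => φ i + (φ (i + 1) - φ i) * (x / ε - i) - (c + σ * (x / ε)))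
          (nhdsWithin (i * ε) (Set.Ioi (i * ε))) (nhds 0) := by
        have : Continuous (fun x : ℝ => φ i + (φ (i + 1) - φ i) * (x / ε - i) -
          (c + σ * (x / ε))) := by fun_prop
        have h0 := this.tendsto (i * ε)
        rw [show φ i + (φ (i + 1) - φ i) * (i * ε / ε - i) - (c + σ * (i * ε / ε)) = 0 by
          rw [mul_div_cancel_right₀ _ hε.ne', hi]; ring] at h0
        exact h0.mono_left nhdsWithin_le_nhds
      have e1 := ht.eventually_lt_const hη
      have e2 : ∀ᶠ x in nhdsWithin (i * ε) (Set.Ioi (i * ε)), x ∈ Set.Ioo (i * ε) v :=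
        Ioo_mem_nhdsGT hiv
      have e3 : ∀ᶠ x in nhdsWithin (i * ε) (Set.Ioi (i * ε)), x ∈ Set.Ioo (i * ε) ((i + 1) * ε) :=
        Ioo_mem_nhdsGT (by nlinarith)
      obtain ⟨x, h1, h2, h3⟩ := (e1.and (e2.and e3)).exists
      exact ⟨x, h2.1, h2.2, by rw [hf i x h3.1.le h3.2.le]; exact h1⟩
    obtain ⟨y, hy₁, hy₂, hy₃⟩ : ∃ y, v < y ∧ y < j * ε ∧ f y - (c + σ * (y / ε)) < η := by
      have ht : Filter.Tendsto (fun x => φ (j - 1) + (φ (j - 1 + 1) - φ (j - 1)) *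
          (x / ε - (j - 1 : ℤ)) - (c + σ * (x / ε)))
          (nhdsWithin (j * ε) (Set.Iio (j * ε))) (nhds 0) := by
        have : Continuous (fun x : ℝ => φ (j - 1) + (φ (j - 1 + 1) - φ (j - 1)) *
          (x / ε - (j - 1 : ℤ)) - (c + σ * (x / ε))) := by fun_prop
        have h0 := this.tendsto (j * ε)
        rw [show φ (j - 1) + (φ (j - 1 + 1) - φ (j - 1)) * (j * ε / ε - (j - 1 : ℤ)) -
          (c + σ * (j * ε / ε)) = 0 by
          rw [mul_div_cancel_right₀ _ hε.ne', sub_add_cancel, hj]; push_cast; ring] at h0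
        exact h0.mono_left nhdsWithin_le_nhds
      have e1 := ht.eventually_lt_const hη
      have e2 : ∀ᶠ x in nhdsWithin (j * ε) (Set.Iio (j * ε)), x ∈ Set.Ioo v (j * ε) :=
        Ioo_mem_nhdsLT hvj
      have e3 : ∀ᶠ x in nhdsWithin (j * ε) (Set.Iio (j * ε)),
          x ∈ Set.Ioo ((j - 1) * ε) (j * ε) := Ioo_mem_nhdsLT (by nlinarith)
      obtain ⟨x, h1, h2, h3⟩ := (e1.and (e2.and e3)).exists
      refine ⟨x, h2.1, h2.2, ?_⟩
      rw [hf (j - 1) x (by push_cast; exact h3.1.le) (by push_cast; linarith [h3.2])]; exact h1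
    have hxI : x ∈ I := hI₁ ⟨by linarith, by linarith⟩
    have hyI : y ∈ I := hI₁ ⟨by linarith, by linarith⟩
    have hc' : ConvexOn ℝ I (fun z => h z + (-c + -σ * (z / ε))) := by
      refine hconv.add ⟨hI, ?_⟩
      intro x _ y _ a b _ _ hab
      simp only [smul_eq_mul]
      have : c = (a + b) * c := by rw [hab, one_mul]
      apply le_of_eq
      linear_combination -this
    have key := hc'.le_max_of_mem_Icc hxI hyI ⟨hx₂.le, hy₁.le⟩
    have k1 := hle x hxI
    have k2 := hle y hyI
    rcases le_max_iff.1 key with h' | h' <;> linarith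

/-- The reflection `v ↦ -v`, `f ↦ -f (-·)` exchanges the two envelopes and preserves slopes; through
it negative waves are handled as positive ones. -/
theorem concEnv_eq_neg_convEnv (I : Set ℝ) (f : ℝ → ℝ) (v : ℝ) :
    concEnv I f v = -convEnv (-I) (fun z => -f (-z)) (-v) := by
  rw [concEnv, convEnv, ← Real.sInf_neg]
  congr 1
  ext y
  simp only [Set.mem_neg, Set.mem_ofPred_eq]
  constructor
  · rintro ⟨h, hc, hle, rfl⟩
    refine ⟨fun z => -h (-z), ⟨hc.1.neg, ?_⟩, fun z hz => neg_le_neg (hle _ hz), by simp⟩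
    intro x hx y hy a b ha hb hab
    have := hc.2 hx hy ha hb hab
    simp only [smul_eq_mul] at this ⊢
    rw [show -(a * x + b * y) = a * -x + b * -y by ring]
    linarith
  · rintro ⟨h, hc, hle, he⟩
    refine ⟨fun z => -h (-z), ⟨by simpa using hc.1.neg, ?_⟩, fun z hz => ?_, by
      simp only; rw [← he, neg_neg]⟩
    · intro x hx y hy a b ha hb hab
      have := hc.2 (show -x ∈ -I by simpa using hx) (show -y ∈ -I by simpa using hy) ha hb hab
      simp only [smul_eq_mul] at this ⊢
      rw [show -(a * x + b * y) = a * -x + b * -y by ring]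
      linarith
    · have := hle (-z) (by simpa using hz)
      rw [neg_neg] at this
      linarith

/-- Values, at oriented grid points, of the flux seen by waves of sign `s`. -/
def flux (F : ℝ → ℝ) (ε : ℝ) (s k : ℤ) : ℝ := s * F ((s * k : ℤ) * ε)

theorem gridAffine_flux_one (F : ℝ → ℝ) {ε : ℝ} (hε : 0 < ε) :
    GridAffine ε (flux F ε 1) (gridFlux F ε) := by
  convert gridAffine_gridFlux F hε using 1
  ext k; simp [flux]

theorem gridAffine_flux_neg (F : ℝ → ℝ) {ε : ℝ} (hε : 0 < ε) :
    GridAffine ε (flux F ε (-1)) (fun v => -gridFlux F ε (-v)) := by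
  convert (gridAffine_gridFlux F hε).reflect using 1
  ext k; simp [flux]

theorem hasDerivAt_line (c σ ε v : ℝ) : HasDerivAt (fun z => c + σ * (z / ε)) (σ / ε) v := by
  have := (((hasDerivAt_id v).div_const ε).const_mul σ).const_add c
  rwa [mul_one_div] at this

section

variable {F : ℝ → ℝ} {ε : ℝ} (hε : 0 < ε) {α β m : ℤ} (h₁ : α ≤ m) (h₂ : m < β) {I : Set ℝ}
  (hI : Convex ℝ I) {v : ℝ}

include hε h₁ h₂ hI

theorem convEnv_eq (hI₁ : Set.Ioo (α * ε) (β * ε) ⊆ I) (hI₂ : I ⊆ Set.Icc (α * ε) (β * ε))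
    (hv : v ∈ I) (hv₁ : m * ε ≤ v) (hv₂ : v ≤ (m + 1) * ε) :
    convEnv I (gridFlux F ε) v =
      intercept (flux F ε 1) α β m + slope (flux F ε 1) α β m * (v / ε) :=
  convEnv_eq_of_isSupport hε (gridAffine_flux_one F hε) (isSupport_slope _ h₁ h₂) hI hI₁ hI₂ hv
    hv₁ hv₂

theorem concEnv_eq (hI₁ : Set.Ioo (-β * ε) (-α * ε) ⊆ I) (hI₂ : I ⊆ Set.Icc (-β * ε) (-α * ε))
    (hv : v ∈ I) (hv₁ : -(m + 1) * ε ≤ v) (hv₂ : v ≤ -m * ε) :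
    concEnv I (gridFlux F ε) v =
      -intercept (flux F ε (-1)) α β m + slope (flux F ε (-1)) α β m * (v / ε) := by
  rw [concEnv_eq_neg_convEnv, convEnv_eq_of_isSupport hε (gridAffine_flux_neg F hε)
    (isSupport_slope _ h₁ h₂) hI.neg]
  · ring
  · intro z hz
    exact hI₁ ⟨by linarith [hz.2], by linarith [hz.1]⟩
  · intro z hz
    have := hI₂ hz
    exact ⟨by linarith [this.2], by linarith [this.1]⟩
  · simpa using hv
  · linarith
  · linarith

omit h₁ hI in
theorem cell_mem_Ioo (h₁ : α ≤ m) {z : ℝ} (hz₁ : m * ε < z) (hz₂ : z < (m + 1) * ε) :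
    z ∈ Set.Ioo (α * ε) (β * ε) := by
  have a1 : (α : ℝ) ≤ m := by exact_mod_cast h₁
  have a2 : (m : ℝ) + 1 ≤ β := by exact_mod_cast h₂
  constructor <;> nlinarith

omit h₁ hI in
theorem cell_mem_Ioo_neg (h₁ : α ≤ m) {z : ℝ} (hz₁ : -(m + 1) * ε < z) (hz₂ : z < -m * ε) :
    z ∈ Set.Ioo (-β * ε) (-α * ε) := by
  have := cell_mem_Ioo hε h₂ h₁ (z := -z) (by linarith) (by linarith)
  exact ⟨by linarith [this.2], by linarith [this.1]⟩

/-- The cell is open on the left and closed on the right: at the node `(m + 1) ε` the left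
derivative still sees the cell `m`, in agreement with cells of waves of the form `(·, ·]`. -/
theorem leftDeriv_convEnv (hI₁ : Set.Ioo (α * ε) (β * ε) ⊆ I)
    (hI₂ : I ⊆ Set.Icc (α * ε) (β * ε)) (hv : v ∈ I) (hv₁ : m * ε < v) (hv₂ : v ≤ (m + 1) * ε) :
    leftDeriv (convEnv I (gridFlux F ε)) v = slope (flux F ε 1) α β m / ε := by
  have hd : HasDerivAt (fun z => intercept (flux F ε 1) α β m + slope (flux F ε 1) α β m * (z / ε))
      (slope (flux F ε 1) α β m / ε) v := hasDerivAt_line _ _ _ _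
  have he : convEnv I (gridFlux F ε) =ᶠ[nhdsWithin v (Set.Iic v)]
      fun z => intercept (flux F ε 1) α β m + slope (flux F ε 1) α β m * (z / ε) := by
    filter_upwards [Ioc_mem_nhdsLE hv₁] with z hz
    rcases hz.2.lt_or_eq with h | rfl
    · exact convEnv_eq hε h₁ h₂ hI hI₁ hI₂ (hI₁ (cell_mem_Ioo hε h₂ h₁ hz.1 (by linarith)))
        hz.1.le (by linarith)
    · exact convEnv_eq hε h₁ h₂ hI hI₁ hI₂ hv hv₁.le hv₂
  rw [leftDeriv, he.derivWithin_eq (he.eq_of_nhdsWithin Set.self_mem_Iic)]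
  exact hd.hasDerivWithinAt.derivWithin (uniqueDiffOn_Iic v v Set.self_mem_Iic)

theorem rightDeriv_concEnv (hI₁ : Set.Ioo (-β * ε) (-α * ε) ⊆ I)
    (hI₂ : I ⊆ Set.Icc (-β * ε) (-α * ε)) (hv : v ∈ I) (hv₁ : -(m + 1) * ε ≤ v)
    (hv₂ : v < -m * ε) :
    rightDeriv (concEnv I (gridFlux F ε)) v = slope (flux F ε (-1)) α β m / ε := by
  have hd : HasDerivAt (fun z => -intercept (flux F ε (-1)) α β m +
      slope (flux F ε (-1)) α β m * (z / ε)) (slope (flux F ε (-1)) α β m / ε) v := hasDerivAt_line _ _ _ _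
  have he : concEnv I (gridFlux F ε) =ᶠ[nhdsWithin v (Set.Ici v)]
      fun z => -intercept (flux F ε (-1)) α β m + slope (flux F ε (-1)) α β m * (z / ε) := by
    filter_upwards [Ico_mem_nhdsGE hv₂] with z hz
    rcases hz.1.lt_or_eq with h | rfl
    · exact concEnv_eq hε h₁ h₂ hI hI₁ hI₂ (hI₁ (cell_mem_Ioo_neg hε h₂ h₁ (by linarith) hz.2))
        (by linarith) hz.2.le
    · exact concEnv_eq hε h₁ h₂ hI hI₁ hI₂ hv hv₁ hv₂.le
  rw [rightDeriv, he.derivWithin_eq (he.eq_of_nhdsWithin Set.self_mem_Ici)]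
  exact hd.hasDerivWithinAt.derivWithin (uniqueDiffOn_Ici v v Set.self_mem_Ici)

theorem deriv_convEnv (hI₁ : Set.Ioo (α * ε) (β * ε) ⊆ I)
    (hI₂ : I ⊆ Set.Icc (α * ε) (β * ε)) (hv₁ : m * ε < v) (hv₂ : v < (m + 1) * ε) :
    deriv (convEnv I (gridFlux F ε)) v = slope (flux F ε 1) α β m / ε := by
  have hd : HasDerivAt (fun z => intercept (flux F ε 1) α β m + slope (flux F ε 1) α β m * (z / ε))
      (slope (flux F ε 1) α β m / ε) v := hasDerivAt_line _ _ _ _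
  have he : convEnv I (gridFlux F ε) =ᶠ[nhds v]
      fun z => intercept (flux F ε 1) α β m + slope (flux F ε 1) α β m * (z / ε) := by
    filter_upwards [Ioo_mem_nhds hv₁ hv₂] with z hz
    exact convEnv_eq hε h₁ h₂ hI hI₁ hI₂ (hI₁ (cell_mem_Ioo hε h₂ h₁ hz.1 hz.2)) hz.1.le hz.2.le
  rw [he.deriv_eq, hd.deriv]

theorem deriv_concEnv (hI₁ : Set.Ioo (-β * ε) (-α * ε) ⊆ I)
    (hI₂ : I ⊆ Set.Icc (-β * ε) (-α * ε)) (hv₁ : -(m + 1) * ε < v) (hv₂ : v < -m * ε) :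
    deriv (concEnv I (gridFlux F ε)) v = slope (flux F ε (-1)) α β m / ε := by
  have hd : HasDerivAt (fun z => -intercept (flux F ε (-1)) α β m +
      slope (flux F ε (-1)) α β m * (z / ε)) (slope (flux F ε (-1)) α β m / ε) v := hasDerivAt_line _ _ _ _
  have he : concEnv I (gridFlux F ε) =ᶠ[nhds v]
      fun z => -intercept (flux F ε (-1)) α β m + slope (flux F ε (-1)) α β m * (z / ε) := by
    filter_upwards [Ioo_mem_nhds hv₁ hv₂] with z hz
    exact concEnv_eq hε h₁ h₂ hI hI₁ hI₂ (hI₁ (cell_mem_Ioo_neg hε h₂ h₁ hz.1 hz.2)) hz.1.le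
      hz.2.le
  rw [he.deriv_eq, hd.deriv]

end

/-! ### Riemann problems -/

/-- A monotone predicate on an integer interval holds on an initial segment. -/
theorem exists_prefix (P : ℤ → Prop) [DecidablePred P] {α β : ℤ} (h : α ≤ β)
    (hP : ∀ m m', α ≤ m → m ≤ m' → m' < β → P m' → P m) :
    α + ((Finset.Ico α β).filter P).card ≤ β ∧
      ∀ m, α ≤ m → m < β → (P m ↔ m < α + ((Finset.Ico α β).filter P).card) := by
  induction β, h using Int.leInduction with
  | base => simp; omega
  | succ k hk ih =>
    obtain ⟨ih₁, ih₂⟩ := ih fun m m' h1 h2 h3 => hP m m' h1 h2 (by omega)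
    rw [← Finset.insert_Ico_right_eq_Ico_add_one hk, Finset.filter_insert]
    split_ifs with hPk
    · have hall : (Finset.Ico α k).filter P = Finset.Ico α k :=
        Finset.filter_true_of_mem fun m hm => by
          rw [Finset.mem_Ico] at hm
          exact hP m k hm.1 hm.2.le (by omega) hPk
      rw [Finset.card_insert_of_notMem (by simp), hall, Int.card_Ico]
      refine ⟨by omega, fun m h1 h2 => ⟨fun _ => by omega, fun _ => hP m k h1 (by omega)
        (by omega) hPk⟩⟩
    · refine ⟨by omega, fun m h1 h2 => ?_⟩
      rcases (show m ≤ k by omega).lt_or_eq with h | rfl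
      · exact ih₂ m h1 h
      · exact ⟨fun h => absurd h hPk, fun h => by omega⟩

-- Slopes of the envelope increase, so the cells of speed at most `ξ` form an initial segment of
-- `[α, β)`, and the supremum in `riemann` is the right end of that segment.
open Classical in
theorem riemann_of_le {F : ℝ → ℝ} {ε : ℝ} (hε : 0 < ε) {α β : ℤ} (h : α ≤ β) (ξ : ℝ) :
    riemann (gridFlux F ε) (α * ε) (β * ε) ξ =
      (α + ((Finset.Ico α β).filter fun m => slope (flux F ε 1) α β m / ε ≤ ξ).card) * ε := by
  have hR : (α : ℝ) * ε ≤ β * ε := by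
    have : (α : ℝ) ≤ β := by exact_mod_cast h
    gcongr
  rw [riemann, if_pos hR]
  obtain ⟨hc, hpre⟩ := exists_prefix (fun m => slope (flux F ε 1) α β m / ε ≤ ξ) h
    fun m m' h1 h2 h3 h4 => (div_le_div_of_nonneg_right (slope_mono _ h1 h2 h3) hε.le).trans h4
  set c := ((Finset.Ico α β).filter fun m => slope (flux F ε 1) α β m / ε ≤ ξ).card with hcdef
  clear_value c
  have hld : ∀ m, α ≤ m → m < β → ∀ v : ℝ, m * ε < v → v ≤ (m + 1) * ε →
      leftDeriv (convEnv (Set.Icc (α * ε) (β * ε)) (gridFlux F ε)) v =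
        slope (flux F ε 1) α β m / ε := by
    intro m h1 h2 v hv1 hv2
    have a1 : (α : ℝ) ≤ m := by exact_mod_cast h1
    have a2 : (m : ℝ) + 1 ≤ β := by exact_mod_cast h2
    exact leftDeriv_convEnv hε h1 h2 (convex_Icc _ _) Set.Ioo_subset_Icc_self subset_rfl
      ⟨by nlinarith, by nlinarith⟩ hv1 hv2
  refine IsGreatest.csSup_eq ⟨?_, ?_⟩
  -- For `c = 0` the supremum is the left state, the point added by `insert`.
  · rcases Nat.eq_zero_or_pos c with h0 | h0
    · left; rw [h0]; simp
    · right
      have e : ((α : ℝ) + c) * ε = ((α + c - 1 : ℤ) + 1) * ε := by push_cast; ring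
      have a1 : (1 : ℝ) ≤ c := by exact_mod_cast h0
      have a2 : (α : ℝ) + c ≤ β := by exact_mod_cast hc
      refine ⟨⟨by nlinarith, by nlinarith⟩, ?_⟩
      rw [hld (α + c - 1) (by omega) (by omega) _ (by push_cast; nlinarith) e.le]
      exact (hpre (α + c - 1) (by omega) (by omega)).2 (by omega)
  · rintro v (rfl | ⟨⟨hv1, hv2⟩, hv3⟩)
    · have : (0 : ℝ) ≤ c := by positivity
      nlinarith
    -- The cell of `-v` yields `m = -k - 1` with `m ε < v ≤ (m + 1) ε`, half-open on the side that
    -- suits the left derivative.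
    · obtain ⟨k, hk1, hk2⟩ := exists_cell hε (-v)
      have b1 : α ≤ -k - 1 := by
        have : (α : ℝ) * ε < (-k : ℤ) * ε := by push_cast; linarith
        have : (α : ℝ) < (-k : ℤ) := lt_of_mul_lt_mul_right this hε.le
        have : α < -k := by exact_mod_cast this
        omega
      have b2 : -k - 1 < β := by
        have : ((-k - 1 : ℤ) : ℝ) * ε < β * ε := by push_cast; linarith
        have : ((-k - 1 : ℤ) : ℝ) < β := lt_of_mul_lt_mul_right this hε.le
        exact_mod_cast this
      rw [hld (-k - 1) b1 b2 v (by push_cast; linarith) (by push_cast; linarith)] at hv3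
      have := (hpre _ b1 b2).1 hv3
      have : (-k : ℝ) ≤ α + c := by exact_mod_cast (by omega : -k ≤ α + c)
      nlinarith

open Classical in
theorem riemann_of_gt {F : ℝ → ℝ} {ε : ℝ} (hε : 0 < ε) {α β : ℤ} (h : α < β) (ξ : ℝ) :
    riemann (gridFlux F ε) (-α * ε) (-β * ε) ξ =
      (-α - ((Finset.Ico α β).filter fun m => slope (flux F ε (-1)) α β m / ε ≤ ξ).card) * ε := by
  have hR : ¬ (-α : ℝ) * ε ≤ -β * ε := by
    have : (α : ℝ) < β := by exact_mod_cast h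
    intro h'; nlinarith
  rw [riemann, if_neg hR]
  obtain ⟨hc, hpre⟩ := exists_prefix (fun m => slope (flux F ε (-1)) α β m / ε ≤ ξ) h.le
    fun m m' h1 h2 h3 h4 => (div_le_div_of_nonneg_right (slope_mono _ h1 h2 h3) hε.le).trans h4
  set c := ((Finset.Ico α β).filter fun m => slope (flux F ε (-1)) α β m / ε ≤ ξ).card with hcdef
  clear_value c
  have hld : ∀ m, α ≤ m → m < β → ∀ v : ℝ, -(m + 1) * ε ≤ v → v < -m * ε →
      rightDeriv (concEnv (Set.Icc (-β * ε) (-α * ε)) (gridFlux F ε)) v =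
        slope (flux F ε (-1)) α β m / ε := by
    intro m h1 h2 v hv1 hv2
    have a1 : (α : ℝ) ≤ m := by exact_mod_cast h1
    have a2 : (m : ℝ) + 1 ≤ β := by exact_mod_cast h2
    exact rightDeriv_concEnv hε h1 h2 (convex_Icc _ _) Set.Ioo_subset_Icc_self subset_rfl
      ⟨by nlinarith, by nlinarith⟩ hv1 hv2
  refine IsLeast.csInf_eq ⟨?_, ?_⟩
  · rcases Nat.eq_zero_or_pos c with h0 | h0
    · left; rw [h0]; simp
    · right
      have e : (-(α : ℝ) - c) * ε = -((α + c - 1 : ℤ) + 1) * ε := by push_cast; ring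
      have a1 : (1 : ℝ) ≤ c := by exact_mod_cast h0
      have a2 : (α : ℝ) + c ≤ β := by exact_mod_cast hc
      refine ⟨⟨by nlinarith, by nlinarith⟩, ?_⟩
      rw [hld (α + c - 1) (by omega) (by omega) _ e.ge (by push_cast; nlinarith)]
      exact (hpre (α + c - 1) (by omega) (by omega)).2 (by omega)
  · rintro v (rfl | ⟨⟨hv1, hv2⟩, hv3⟩)
    · have : (0 : ℝ) ≤ c := by positivity
      nlinarith
    · obtain ⟨k, hk1, hk2⟩ := exists_cell hε v
      have b1 : α ≤ -k - 1 := by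
        have : (k : ℝ) * ε < (-α : ℤ) * ε := by push_cast; linarith
        have : (k : ℝ) < (-α : ℤ) := lt_of_mul_lt_mul_right this hε.le
        have : k < -α := by exact_mod_cast this
        omega
      have b2 : -k - 1 < β := by
        have : ((-β : ℤ) : ℝ) * ε < (k + 1 : ℤ) * ε := by push_cast; linarith
        have : ((-β : ℤ) : ℝ) < (k + 1 : ℤ) := lt_of_mul_lt_mul_right this hε.le
        have : -β < k + 1 := by exact_mod_cast this
        omega
      rw [hld (-k - 1) b1 b2 v (by push_cast; linarith) (by push_cast; linarith)] at hv3
      have := (hpre _ b1 b2).1 hv3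
      have : (-k : ℝ) ≤ α + c := by exact_mod_cast (by omega : -k ≤ α + c)
      nlinarith

end

section

open scoped Classical

/-! ### Configurations of wave cells -/

/-- `K` is the set of cells present, `X` their position, `sgn` their sign and `lev` their state to
the left, times the sign and in units of the mesh size. -/
structure PreConfig (sgn lev : ℕ → ℤ) (K : Finset ℕ) (X : ℕ → ℝ) : Prop where
  sgn_eq : ∀ k, sgn k = 1 ∨ sgn k = -1
  mono : ∀ k ∈ K, ∀ l ∈ K, k ≤ l → X k ≤ X l
  lev_eq : ∀ k ∈ K, lev k = sgn k * ∑ j ∈ K.filter (· < k), sgn j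

/-- A configuration where cells at the same position have the same sign. -/
structure Config (sgn lev : ℕ → ℤ) (K : Finset ℕ) (X : ℕ → ℝ) : Prop
    extends PreConfig sgn lev K X where
  same : ∀ k ∈ K, ∀ l ∈ K, X k = X l → sgn k = sgn l

/-- `G` is a set of consecutive elements of `K` of the same sign. -/
structure Run (sgn : ℕ → ℤ) (K G : Finset ℕ) : Prop where
  subset : G ⊆ K
  convex : ∀ k ∈ G, ∀ l ∈ G, ∀ z ∈ K, k ≤ z → z ≤ l → z ∈ G
  const : ∀ k ∈ G, ∀ l ∈ G, sgn k = sgn l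

variable {F : ℝ → ℝ} {ε : ℝ} {sgn lev : ℕ → ℤ} {K G : Finset ℕ} {X : ℕ → ℝ}

theorem PreConfig.sgn_mul_self (h : PreConfig sgn lev K X) (k : ℕ) : sgn k * sgn k = 1 := by
  rcases h.sgn_eq k with e | e <;> rw [e] <;> norm_num

/-- What precedes the run contributes a common constant to the oriented state, and each member of
the run contributes one unit. The levels of a run are therefore consecutive integers. -/
theorem Run.lev_eq (hc : PreConfig sgn lev K X) (h : Run sgn K G) {k : ℕ} (hk : k ∈ G) :
    lev k = sgn k * ∑ j ∈ K.filter (fun j => ∀ g ∈ G, j < g), sgn j +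
      (G.filter (· < k)).card := by
  rw [hc.lev_eq k (h.subset hk)]
  have : K.filter (· < k) = K.filter (fun j => ∀ g ∈ G, j < g) ∪ G.filter (· < k) := by
    ext j
    simp only [Finset.mem_filter, Finset.mem_union]
    constructor
    · rintro ⟨hj, hjk⟩
      by_cases hex : ∀ g ∈ G, j < g
      · exact Or.inl ⟨hj, hex⟩
      · push Not at hex
        obtain ⟨g, hg, hgj⟩ := hex
        exact Or.inr ⟨h.convex g hg k hk j hj hgj hjk.le, hjk⟩
    · rintro (⟨hj, hj'⟩ | ⟨hj, hj'⟩)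
      · exact ⟨hj, hj' k hk⟩
      · exact ⟨h.subset hj, hj'⟩
  rw [this, Finset.sum_union, mul_add]
  · congr 1
    rw [Finset.sum_congr rfl fun j hj => h.const j (Finset.mem_filter.1 hj).1 k hk,
      Finset.sum_const, nsmul_eq_mul, mul_left_comm, hc.sgn_mul_self, mul_one]
  · rw [Finset.disjoint_left]
    intro j hj hj'
    simp only [Finset.mem_filter] at hj hj'
    exact lt_irrefl _ (hj.2 j hj'.1)

theorem Run.strictMonoOn (hc : PreConfig sgn lev K X) (h : Run sgn K G) :
    StrictMonoOn lev (G : Set ℕ) := by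
  intro k hk l hl hkl
  rw [h.lev_eq hc hk, h.lev_eq hc hl, h.const k hk l hl]
  have : (G.filter (· < k)).card < (G.filter (· < l)).card := by
    apply Finset.card_lt_card
    rw [Finset.ssubset_iff_of_subset]
    · exact ⟨k, by simpa [hkl] using hk, by simp⟩
    · intro j hj
      simp only [Finset.mem_filter] at hj ⊢
      exact ⟨hj.1, hj.2.trans hkl⟩
  omega

theorem Run.image_lev (hc : PreConfig sgn lev K X) (h : Run sgn K G) {p : ℕ} (hp : p ∈ G) :
    G.image lev = Finset.Ico (sgn p * ∑ j ∈ K.filter (fun j => ∀ g ∈ G, j < g), sgn j)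
      (sgn p * ∑ j ∈ K.filter (fun j => ∀ g ∈ G, j < g), sgn j + G.card) := by
  apply Finset.eq_of_subset_of_card_le
  · intro m hm
    obtain ⟨k, hk, rfl⟩ := Finset.mem_image.1 hm
    rw [h.lev_eq hc hk, h.const k hk p hp, Finset.mem_Ico]
    have : (G.filter (· < k)).card < G.card := by
      apply Finset.card_lt_card
      rw [Finset.ssubset_iff_of_subset (Finset.filter_subset _ _)]
      exact ⟨k, hk, by simp⟩
    omega
  · rw [Int.card_Ico, Finset.card_image_of_injOn (h.strictMonoOn hc).injOn]
    omega

theorem Run.exists_image (hc : PreConfig sgn lev K X) (h : Run sgn K G) (hG : G.Nonempty) :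
    ∃ a b, a < b ∧ G.image lev = Finset.Ico a b := by
  obtain ⟨p, hp⟩ := hG
  have := Finset.card_pos.2 ⟨p, hp⟩
  exact ⟨_, _, by omega, h.image_lev hc hp⟩

theorem suffix_image {a b : ℤ} (hG : G.image lev = Finset.Ico a b)
    (hm : StrictMonoOn lev (G : Set ℕ)) {J : Finset ℕ} (hJ : J ⊆ G) (hne : J.Nonempty)
    (hup : ∀ k ∈ J, ∀ z ∈ G, k ≤ z → z ∈ J) :
    ∃ a', a ≤ a' ∧ a' < b ∧ J.image lev = Finset.Ico a' b := by
  have hp := J.min'_mem hne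
  have hpI : lev (J.min' hne) ∈ Finset.Ico a b := hG ▸ Finset.mem_image_of_mem _ (hJ hp)
  rw [Finset.mem_Ico] at hpI
  refine ⟨lev (J.min' hne), hpI.1, hpI.2, ?_⟩
  ext m
  simp only [Finset.mem_image, Finset.mem_Ico]
  constructor
  · rintro ⟨k, hk, rfl⟩
    have hkI : lev k ∈ Finset.Ico a b := hG ▸ Finset.mem_image_of_mem _ (hJ hk)
    exact ⟨hm.monotoneOn (hJ hp) (hJ hk) (J.min'_le k hk), (Finset.mem_Ico.1 hkI).2⟩
  · rintro ⟨h1, h2⟩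
    have : m ∈ G.image lev := by rw [hG, Finset.mem_Ico]; omega
    obtain ⟨z, hz, rfl⟩ := Finset.mem_image.1 this
    exact ⟨z, hup _ hp z hz ((hm.le_iff_le (hJ hp) hz).1 h1), rfl⟩

theorem prefix_image {a b : ℤ} (hG : G.image lev = Finset.Ico a b)
    (hm : StrictMonoOn lev (G : Set ℕ)) {J : Finset ℕ} (hJ : J ⊆ G) (hne : J.Nonempty)
    (hdown : ∀ k ∈ J, ∀ z ∈ G, z ≤ k → z ∈ J) :
    ∃ b', a < b' ∧ b' ≤ b ∧ J.image lev = Finset.Ico a b' := by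
  have hp := J.max'_mem hne
  have hpI : lev (J.max' hne) ∈ Finset.Ico a b := hG ▸ Finset.mem_image_of_mem _ (hJ hp)
  rw [Finset.mem_Ico] at hpI
  refine ⟨lev (J.max' hne) + 1, by omega, by omega, ?_⟩
  ext m
  simp only [Finset.mem_image, Finset.mem_Ico]
  constructor
  · rintro ⟨k, hk, rfl⟩
    have hkI : lev k ∈ Finset.Ico a b := hG ▸ Finset.mem_image_of_mem _ (hJ hk)
    exact ⟨(Finset.mem_Ico.1 hkI).1,
      Int.lt_add_one_iff.2 (hm.monotoneOn (hJ hk) (hJ hp) (J.le_max' k hk))⟩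
  · rintro ⟨h1, h2⟩
    have : m ∈ G.image lev := by rw [hG, Finset.mem_Ico]; omega
    obtain ⟨z, hz, rfl⟩ := Finset.mem_image.1 this
    exact ⟨z, hdown _ hp z hz ((hm.le_iff_le hz (hJ hp)).1 (by omega)), rfl⟩

/-- The cells at the same position as `k`. -/
def grp (K : Finset ℕ) (X : ℕ → ℝ) (k : ℕ) : Finset ℕ := K.filter fun l => X l = X k

/-- The state, in units of the mesh size, on the left of `x`. -/
def below (sgn : ℕ → ℤ) (K : Finset ℕ) (X : ℕ → ℝ) (x : ℝ) : ℤ := ∑ j ∈ K.filter (X · < x), sgn j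

/-- The state, in units of the mesh size, at `x`. -/
def upto (sgn : ℕ → ℤ) (K : Finset ℕ) (X : ℕ → ℝ) (x : ℝ) : ℤ := ∑ j ∈ K.filter (X · ≤ x), sgn j

theorem upto_eq (sgn : ℕ → ℤ) (K : Finset ℕ) (X : ℕ → ℝ) (x : ℝ) :
    upto sgn K X x = below sgn K X x + ∑ j ∈ K.filter (X · = x), sgn j := by
  rw [upto, below, ← Finset.sum_union]
  · congr 1
    ext j
    simp only [Finset.mem_filter, Finset.mem_union, le_iff_lt_or_eq]
    tauto
  · rw [Finset.disjoint_left]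
    intro j hj hj'
    simp only [Finset.mem_filter] at hj hj'
    exact absurd hj'.2 hj.2.ne

theorem mem_grp {k l : ℕ} : l ∈ grp K X k ↔ l ∈ K ∧ X l = X k := by simp [grp]

theorem mem_grp_self {k : ℕ} (hk : k ∈ K) : k ∈ grp K X k := mem_grp.2 ⟨hk, rfl⟩

theorem grp_eq {k l : ℕ} (h : X l = X k) : grp K X l = grp K X k := by simp [grp, h]

theorem run_grp (hc : PreConfig sgn lev K X) {k : ℕ}
    (hs : ∀ l ∈ K, X l = X k → sgn l = sgn k) : Run sgn K (grp K X k) where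
  subset := Finset.filter_subset _ _
  convex := fun a ha b hb z hz h1 h2 => by
    rw [mem_grp] at ha hb ⊢
    exact ⟨hz, le_antisymm (hb.2 ▸ hc.mono z hz b hb.1 h2) (ha.2 ▸ hc.mono a ha.1 z hz h1)⟩
  const := fun a ha b hb => by
    rw [mem_grp] at ha hb
    rw [hs a ha.1 ha.2, hs b hb.1 hb.2]

theorem Config.run_grp (hc : Config sgn lev K X) {k : ℕ} (hk : k ∈ K) :
    Run sgn K (grp K X k) :=
  WaveTracking.run_grp hc.toPreConfig fun l hl h => hc.same l hl k hk h

theorem below_eq (hc : PreConfig sgn lev K X) {k : ℕ} (hk : k ∈ K) :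
    below sgn K X (X k) = ∑ j ∈ K.filter (fun j => ∀ g ∈ grp K X k, j < g), sgn j := by
  rw [below]
  congr 1
  ext j
  simp only [Finset.mem_filter, mem_grp, and_congr_right_iff]
  intro hj
  constructor
  · rintro h g ⟨hg, hg'⟩
    by_contra! hlt
    exact absurd (hc.mono g hg j hj hlt) (by rw [hg']; exact not_le.2 h)
  · intro h
    refine lt_of_le_of_ne (hc.mono j hj k hk (h k ⟨hk, rfl⟩).le) fun he => ?_
    exact lt_irrefl _ (h j ⟨hj, he⟩)

/-- The cells at one position form a run whose levels start at the oriented left state and whose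
number is the size of the jump. These levels depend on the profile only, which is what makes two
solutions comparable. -/
theorem Config.image_grp (hc : Config sgn lev K X) {k : ℕ} (hk : k ∈ K) :
    (grp K X k).image lev =
      Finset.Ico (sgn k * below sgn K X (X k)) (sgn k * upto sgn K X (X k)) := by
  rw [(hc.run_grp hk).image_lev hc.toPreConfig (mem_grp_self hk),
    ← below_eq hc.toPreConfig hk, upto_eq, mul_add, ← grp,
    Finset.sum_congr rfl fun j hj => hc.same j (mem_grp.1 hj).1 k hk (mem_grp.1 hj).2,
    Finset.sum_const, nsmul_eq_mul, mul_left_comm, hc.sgn_mul_self, mul_one]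

theorem Config.lev_mem (hc : Config sgn lev K X) {k : ℕ} (hk : k ∈ K) :
    sgn k * below sgn K X (X k) ≤ lev k ∧ lev k < sgn k * upto sgn K X (X k) := by
  rw [← Finset.mem_Ico, ← hc.image_grp hk]
  exact Finset.mem_image_of_mem _ (mem_grp_self hk)

/-- The speed of the cell `k` in the envelope determined by the cells in `J`. -/
def grpSlope (F : ℝ → ℝ) (ε : ℝ) (sgn lev : ℕ → ℤ) (J : Finset ℕ) (k : ℕ) : ℝ :=
  slope (flux F ε (sgn k)) (sInf (lev '' J)) (sSup (lev '' J) + 1) (lev k) / ε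

theorem grpSlope_eq {J : Finset ℕ} {a b : ℤ} (hJ : J.image lev = Finset.Ico a b) (hab : a < b)
    (k : ℕ) : grpSlope F ε sgn lev J k = slope (flux F ε (sgn k)) a b (lev k) / ε := by
  have e : lev '' J = Set.Icc a (b - 1) := by
    rw [← Finset.coe_image, hJ, Finset.coe_Ico]
    ext x; simp only [Set.mem_Ico, Set.mem_Icc]; omega
  rw [grpSlope, e, csInf_Icc (by omega), csSup_Icc (by omega), sub_add_cancel]

/-- The speed of the cell `k`. -/
def vel (F : ℝ → ℝ) (ε : ℝ) (sgn lev : ℕ → ℤ) (K : Finset ℕ) (X : ℕ → ℝ) (k : ℕ) : ℝ :=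
  grpSlope F ε sgn lev (grp K X k) k

/-- The cells `k` and `l` have the same position and the same speed. -/
def Fr (F : ℝ → ℝ) (ε : ℝ) (sgn lev : ℕ → ℤ) (K : Finset ℕ) (X : ℕ → ℝ) (k l : ℕ) : Prop :=
  X k = X l ∧ vel F ε sgn lev K X k = vel F ε sgn lev K X l

/-- The cells of the wavefront of the cell `k`. -/
def front (F : ℝ → ℝ) (ε : ℝ) (sgn lev : ℕ → ℤ) (K : Finset ℕ) (X : ℕ → ℝ) (k : ℕ) : Finset ℕ :=
  K.filter fun l => Fr F ε sgn lev K X l k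

theorem Fr.rfl {k : ℕ} : Fr F ε sgn lev K X k k := ⟨by rfl, by rfl⟩

theorem Fr.symm {k l : ℕ} (h : Fr F ε sgn lev K X k l) : Fr F ε sgn lev K X l k :=
  ⟨h.1.symm, h.2.symm⟩

theorem Fr.trans {k l m : ℕ} (h : Fr F ε sgn lev K X k l) (h' : Fr F ε sgn lev K X l m) :
    Fr F ε sgn lev K X k m :=
  ⟨h.1.trans h'.1, h.2.trans h'.2⟩

theorem mem_front {k l : ℕ} :
    l ∈ front F ε sgn lev K X k ↔ l ∈ K ∧ Fr F ε sgn lev K X l k := by simp [front]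

theorem mem_front_self {k : ℕ} (hk : k ∈ K) : k ∈ front F ε sgn lev K X k :=
  mem_front.2 ⟨hk, Fr.rfl⟩

theorem front_eq {k l : ℕ} (h : Fr F ε sgn lev K X k l) :
    front F ε sgn lev K X k = front F ε sgn lev K X l := by
  ext j
  rw [mem_front, mem_front]
  exact and_congr_right fun _ => ⟨fun h' => h'.trans h, fun h' => h'.trans h.symm⟩

theorem front_subset_grp {k : ℕ} : front F ε sgn lev K X k ⊆ grp K X k := fun l hl => by
  rw [mem_front] at hl
  exact mem_grp.2 ⟨hl.1, hl.2.1⟩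

theorem vel_eq {k l : ℕ} {a b : ℤ} (h : (grp K X k).image lev = Finset.Ico a b) (hab : a < b)
    (hl : X l = X k) :
    vel F ε sgn lev K X l = slope (flux F ε (sgn l)) a b (lev l) / ε := by
  rw [vel, grp_eq hl, grpSlope_eq h hab]

/-- At one position the order of the cells is the order of their levels, and the slopes of a convex
envelope increase with the level: fronts leaving the same point fan out and do not meet. -/
theorem Config.vel_mono (hε : 0 < ε) (hc : Config sgn lev K X) {k l : ℕ} (hk : k ∈ K)
    (hl : l ∈ K) (h : X k = X l) (hkl : k ≤ l) :
    vel F ε sgn lev K X k ≤ vel F ε sgn lev K X l := by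
  have hi := hc.image_grp hk
  have hlt := (hc.lev_mem hk).1.trans_lt (hc.lev_mem hk).2
  rw [vel_eq hi hlt rfl, vel_eq hi hlt h.symm, hc.same k hk l hl h]
  refine div_le_div_of_nonneg_right (slope_mono _ ?_ ?_ ?_) hε.le
  · rw [← hc.same k hk l hl h]; exact (hc.lev_mem hk).1
  · exact ((hc.run_grp hk).strictMonoOn hc.toPreConfig).monotoneOn (mem_grp_self hk)
      (mem_grp.2 ⟨hl, h.symm⟩) hkl
  · rw [h]; exact (hc.lev_mem hl).2

theorem Config.run_front (hε : 0 < ε) (hc : Config sgn lev K X) {k : ℕ} (hk : k ∈ K) :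
    Run sgn K (front F ε sgn lev K X k) where
  subset := Finset.filter_subset _ _
  convex := fun a ha b hb z hz h1 h2 => by
    have hzg := (hc.run_grp hk).convex a (front_subset_grp ha) b (front_subset_grp hb) z hz h1 h2
    rw [mem_grp] at hzg
    rw [mem_front] at ha hb ⊢
    refine ⟨hz, hzg.2, le_antisymm ?_ ?_⟩
    · rw [← hb.2.2]; exact hc.vel_mono hε hz hb.1 (hzg.2.trans hb.2.1.symm) h2
    · rw [← ha.2.2]; exact hc.vel_mono hε ha.1 hz (ha.2.1.trans hzg.2.symm) h1
  const := fun a ha b hb =>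
    (hc.run_grp hk).const a (front_subset_grp ha) b (front_subset_grp hb)

theorem mem_Ico_of_image {J : Finset ℕ} {a b : ℤ} (hJ : J.image lev = Finset.Ico a b) {k : ℕ}
    (hk : k ∈ J) : a ≤ lev k ∧ lev k < b := by
  rw [← Finset.mem_Ico, ← hJ]; exact Finset.mem_image_of_mem _ hk

/-- A wavefront occupies an interval of levels between two contact points of the envelope. -/
theorem Config.exists_front_image (hε : 0 < ε) (hc : Config sgn lev K X) {k : ℕ} (hk : k ∈ K)
    {a b : ℤ} (hab : (grp K X k).image lev = Finset.Ico a b) :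
    ∃ a₁ b₁, a ≤ a₁ ∧ a₁ < b₁ ∧ b₁ ≤ b ∧
      (front F ε sgn lev K X k).image lev = Finset.Ico a₁ b₁ ∧
      Contact (flux F ε (sgn k)) a b a₁ ∧ Contact (flux F ε (sgn k)) a b b₁ := by
  have hkab := mem_Ico_of_image hab (mem_grp_self hk)
  have hlt : a < b := hkab.1.trans_lt hkab.2
  obtain ⟨a₁, b₁, h₁, hi⟩ := (hc.run_front (F := F) hε hk).exists_image hc.toPreConfig
    ⟨k, mem_front_self hk⟩
  have hsub : Finset.Ico a₁ b₁ ⊆ Finset.Ico a b := by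
    rw [← hi, ← hab]; exact Finset.image_subset_image front_subset_grp
  rw [Finset.Ico_subset_Ico_iff h₁] at hsub
  -- The front occupies exactly the levels whose slope is that of `k`. At each of its ends the slope
  -- jumps strictly, which gives a corner, unless it is an end of the whole group.
  have hin : ∀ m, a ≤ m → m < b → ((a₁ ≤ m ∧ m < b₁) ↔
      slope (flux F ε (sgn k)) a b m = slope (flux F ε (sgn k)) a b (lev k)) := by
    intro m hm hm'
    have : m ∈ (grp K X k).image lev := by rw [hab, Finset.mem_Ico]; exact ⟨hm, hm'⟩
    obtain ⟨z, hz, rfl⟩ := Finset.mem_image.1 this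
    have hz' := mem_grp.1 hz
    have hs := hc.same z hz'.1 k hk hz'.2
    rw [← Finset.mem_Ico, ← hi]
    constructor
    · intro h
      obtain ⟨y, hy, hyz⟩ := Finset.mem_image.1 h
      obtain rfl := ((hc.run_grp hk).strictMonoOn hc.toPreConfig).injOn (front_subset_grp hy) hz hyz
      have := (mem_front.1 hy).2.2
      rw [vel_eq hab hlt hz'.2, vel_eq hab hlt rfl, hs] at this
      exact (div_left_inj' hε.ne').1 this
    · intro h
      refine Finset.mem_image_of_mem _ (mem_front.2 ⟨hz'.1, hz'.2, ?_⟩)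
      rw [vel_eq hab hlt hz'.2, vel_eq hab hlt rfl, hs, h]
  have hk₁ := mem_Ico_of_image hi (mem_front_self hk)
  refine ⟨a₁, b₁, hsub.1, h₁, hsub.2, hi, ?_, ?_⟩
  · rcases hsub.1.eq_or_lt with e | h
    · rw [← e]; exact contact_left _ hlt
    · refine contact_of_slope_lt h (by omega) (lt_of_le_of_ne (slope_mono _ (by omega) (by omega)
        (by omega)) fun he => ?_)
      rw [(hin a₁ (by omega) (by omega)).1 ⟨le_rfl, h₁⟩] at he
      have := (hin (a₁ - 1) (by omega) (by omega)).2 he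
      omega
  · rcases hsub.2.eq_or_lt with e | h
    · rw [e]; exact contact_right _ hlt
    · refine contact_of_slope_lt (by omega) h (lt_of_le_of_ne (slope_mono _ (by omega) (by omega)
        (by omega)) fun he => ?_)
      rw [(hin (b₁ - 1) (by omega) (by omega)).1 ⟨by omega, by omega⟩] at he
      have := (hin b₁ (by omega) (by omega)).2 he.symm
      omega

/-- The envelope on the interval of levels of a wavefront is affine, with the same slope. -/
theorem Config.grpSlope_front (hε : 0 < ε) (hc : Config sgn lev K X) {k l : ℕ} (hk : k ∈ K)
    (hl : l ∈ front F ε sgn lev K X k) :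
    grpSlope F ε sgn lev (front F ε sgn lev K X k) l = vel F ε sgn lev K X l := by
  have hi := hc.image_grp hk
  obtain ⟨a₁, b₁, h1, h2, h3, hi₁, c1, c2⟩ := hc.exists_front_image (F := F) hε hk hi
  have hl' := mem_Ico_of_image hi₁ hl
  have hs := (hc.run_front (F := F) hε hk).const l hl k (mem_front_self hk)
  rw [grpSlope_eq hi₁ h2, vel_eq hi (by omega) (mem_front.1 hl).2.1, hs,
    slope_eq_of_contact_right (c2.mono h1 le_rfl) h3 hl'.1 hl'.2,
    slope_eq_of_contact_left c1 h1 hl'.1 (by omega)]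

/-! ### Profiles -/

/-- Right continuous step function with jumps `c k` at the points `Y k`. -/
def stepFn (G : Finset ℕ) (Y c : ℕ → ℝ) (x : ℝ) : ℝ := ∑ k ∈ G.filter (Y · ≤ x), c k

theorem stepFn_eventually_lt (G : Finset ℕ) (Y c : ℕ → ℝ) (x : ℝ) :
    ∀ᶠ y in nhdsWithin x (Set.Iio x), stepFn G Y c y = ∑ k ∈ G.filter (Y · < x), c k := by
  have : ∀ k ∈ G, ∀ᶠ y in nhdsWithin x (Set.Iio x), (Y k ≤ y ↔ Y k < x) := by
    intro k _
    rcases lt_or_ge (Y k) x with h | h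
    · filter_upwards [Ioo_mem_nhdsLT h] with y hy
      exact ⟨fun _ => h, fun _ => hy.1.le⟩
    · filter_upwards [self_mem_nhdsWithin] with y hy
      exact ⟨fun h' => absurd (h'.trans_lt hy) (not_lt.2 h), fun h' => absurd h' (not_lt.2 h)⟩
  filter_upwards [(Filter.eventually_all_finset G).2 this] with y hy
  rw [stepFn]
  congr 1
  exact Finset.filter_congr hy

theorem stepFn_eventually_gt (G : Finset ℕ) (Y c : ℕ → ℝ) (x : ℝ) :
    ∀ᶠ y in nhdsWithin x (Set.Ici x), stepFn G Y c y = stepFn G Y c x := by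
  have : ∀ k ∈ G, ∀ᶠ y in nhdsWithin x (Set.Ici x), (Y k ≤ y ↔ Y k ≤ x) := by
    intro k _
    rcases le_or_gt (Y k) x with h | h
    · filter_upwards [self_mem_nhdsWithin] with y hy
      exact ⟨fun _ => h, fun _ => h.trans hy⟩
    · filter_upwards [Ico_mem_nhdsGE h] with y hy
      exact ⟨fun h' => absurd h' (not_le.2 hy.2), fun h' => absurd h' (not_le.2 h)⟩
  filter_upwards [(Filter.eventually_all_finset G).2 this] with y hy
  rw [stepFn, stepFn]
  congr 1
  exact Finset.filter_congr hy

theorem leftLim_stepFn (G : Finset ℕ) (Y c : ℕ → ℝ) (x : ℝ) :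
    Function.leftLim (stepFn G Y c) x = ∑ k ∈ G.filter (Y · < x), c k :=
  leftLim_eq_of_tendsto (tendsto_const_nhds.congr' ((stepFn_eventually_lt G Y c x).mono fun _ h => h.symm))

theorem continuousAt_stepFn_iff (G : Finset ℕ) (Y c : ℕ → ℝ) (x : ℝ) :
    ContinuousAt (stepFn G Y c) x ↔ ∑ k ∈ G.filter (Y · = x), c k = 0 := by
  have e : stepFn G Y c x = ∑ k ∈ G.filter (Y · < x), c k + ∑ k ∈ G.filter (Y · = x), c k := by
    rw [stepFn, ← Finset.sum_union]
    · congr 1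
      ext j
      simp only [Finset.mem_filter, Finset.mem_union, le_iff_lt_or_eq]
      tauto
    · rw [Finset.disjoint_left]
      intro j hj hj'
      simp only [Finset.mem_filter] at hj hj'
      exact absurd hj'.2 hj.2.ne
  constructor
  · intro h
    have h1 : Filter.Tendsto (stepFn G Y c) (nhdsWithin x (Set.Iio x))
        (nhds (∑ k ∈ G.filter (Y · < x), c k)) :=
      tendsto_const_nhds.congr' ((stepFn_eventually_lt G Y c x).mono fun _ h => h.symm)
    have h2 := tendsto_nhds_unique (h.tendsto.mono_left nhdsWithin_le_nhds) h1
    linarith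
  · intro h
    rw [h, add_zero] at e
    rw [continuousAt_iff_continuous_left'_right']
    refine ⟨?_, ?_⟩
    · rw [ContinuousWithinAt, e]
      exact tendsto_const_nhds.congr' ((stepFn_eventually_lt G Y c x).mono fun _ h => h.symm)
    · refine ContinuousWithinAt.mono (t := Set.Ici x) ?_ Set.Ioi_subset_Ici_self
      exact tendsto_const_nhds.congr' ((stepFn_eventually_gt G Y c x).mono fun _ h => h.symm)

/-- The profile of a configuration. -/
def prof (ε : ℝ) (sgn : ℕ → ℤ) (K : Finset ℕ) (X : ℕ → ℝ) (x : ℝ) : ℝ := upto sgn K X x * ε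

theorem prof_eq_stepFn (ε : ℝ) (sgn : ℕ → ℤ) (K : Finset ℕ) (X : ℕ → ℝ) :
    prof ε sgn K X = stepFn K X fun k => sgn k * ε := by
  ext x
  rw [prof, upto, stepFn, Int.cast_sum, Finset.sum_mul]

theorem leftLim_prof (ε : ℝ) (sgn : ℕ → ℤ) (K : Finset ℕ) (X : ℕ → ℝ) (x : ℝ) :
    Function.leftLim (prof ε sgn K X) x = below sgn K X x * ε := by
  rw [prof_eq_stepFn, leftLim_stepFn, below, Int.cast_sum, Finset.sum_mul]

end

section

open scoped Classical

variable {F : ℝ → ℝ} {ε : ℝ} {sgn lev : ℕ → ℤ} {K G : Finset ℕ} {X : ℕ → ℝ}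

/-! ### Riemann problems of a configuration -/

theorem card_filter_image {a b : ℤ} (hG : G.image lev = Finset.Ico a b)
    (hm : StrictMonoOn lev (G : Set ℕ)) (P : ℤ → Prop) [DecidablePred P] :
    ((Finset.Ico a b).filter P).card = (G.filter fun k => P (lev k)).card := by
  rw [← hG, Finset.filter_image, Finset.card_image_of_injOn]
  exact hm.injOn.mono (by exact_mod_cast Finset.filter_subset _ _)

/-- The Riemann solution advances by one grid step for each cell of speed at most `ξ`: the levels
carry the counts of `riemann_of_le` and `riemann_of_gt` over to the cells. -/
theorem Config.riemannAt_prof (hε : 0 < ε) (hc : Config sgn lev K X) (y ξ : ℝ) :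
    riemannAt (gridFlux F ε) (prof ε sgn K X) y ξ = (below sgn K X y +
      ∑ k ∈ (K.filter (X · = y)).filter (vel F ε sgn lev K X · ≤ ξ), sgn k : ℤ) * ε := by
  rw [riemannAt, leftLim_prof, prof]
  rcases (K.filter (X · = y)).eq_empty_or_nonempty with he | ⟨k, hk⟩
  · have : upto sgn K X y = below sgn K X y := by rw [upto_eq, he]; simp
    rw [this, riemann_of_le hε le_rfl, he]
    simp
  · obtain ⟨hkK, rfl⟩ := Finset.mem_filter.1 hk
    have hi := hc.image_grp hkK
    have hm := (hc.run_grp hkK).strictMonoOn hc.toPreConfig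
    have hlt := (hc.lev_mem hkK).1.trans_lt (hc.lev_mem hkK).2
    have hcard : ((Finset.Ico (sgn k * below sgn K X (X k)) (sgn k * upto sgn K X (X k))).filter
        fun m => slope (flux F ε (sgn k)) (sgn k * below sgn K X (X k))
          (sgn k * upto sgn K X (X k)) m / ε ≤ ξ).card =
        ((K.filter (X · = X k)).filter (vel F ε sgn lev K X · ≤ ξ)).card := by
      rw [card_filter_image hi hm]
      congr 1
      refine Finset.filter_congr fun l hl => ?_
      have hl' := mem_grp.1 hl
      rw [vel_eq hi hlt hl'.2, hc.same l hl'.1 k hkK hl'.2]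
    have hsum : ∑ l ∈ (K.filter (X · = X k)).filter (vel F ε sgn lev K X · ≤ ξ), sgn l =
        sgn k * ((K.filter (X · = X k)).filter (vel F ε sgn lev K X · ≤ ξ)).card := by
      rw [Finset.sum_congr rfl (g := fun _ => sgn k), Finset.sum_const, nsmul_eq_mul, mul_comm]
      intro l hl
      simp only [Finset.mem_filter] at hl
      exact hc.same l hl.1.1 k hkK hl.1.2
    rw [hsum, ← hcard]
    rcases hc.sgn_eq k with e | e
    · rw [e, one_mul, one_mul] at hlt
      simp only [e, one_mul]
      rw [riemann_of_le hε hlt.le]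
      push_cast; ring
    · rw [e] at hlt
      have := riemann_of_gt (F := F) hε hlt ξ
      simp only [e] at this ⊢
      push_cast at this ⊢
      rw [show (below sgn K X (X k) : ℝ) = - (-1 * below sgn K X (X k)) by ring,
        show (upto sgn K X (X k) : ℝ) = - (-1 * upto sgn K X (X k)) by ring, this]
      ring

theorem Config.riemannAt_eq_stepFn (hε : 0 < ε) (hc : Config sgn lev K X) (y : ℝ) :
    riemannAt (gridFlux F ε) (prof ε sgn K X) y = fun ξ => below sgn K X y * ε +
      stepFn (K.filter (X · = y)) (vel F ε sgn lev K X) (fun k => sgn k * ε) ξ := by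
  ext ξ
  rw [hc.riemannAt_prof hε, stepFn, ← Finset.sum_mul]
  push_cast; ring

/-- The cells at one position have the same sign, so the jumps of those with equal speed add up
without cancellation, and the Riemann solution is discontinuous exactly at the speeds of the cells.
-/
theorem Config.mem_fronts (hε : 0 < ε) (hc : Config sgn lev K X) (p : ℝ × ℝ) :
    p ∈ fronts (gridFlux F ε) (prof ε sgn K X) ↔
      ∃ k ∈ K, (X k, vel F ε sgn lev K X k) = p := by
  rw [fronts, Set.mem_ofPred_eq, hc.riemannAt_eq_stepFn hε]
  have : ContinuousAt (fun ξ => below sgn K X p.1 * ε + stepFn (K.filter (X · = p.1))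
      (vel F ε sgn lev K X) (fun k => sgn k * ε) ξ) p.2 ↔
      ContinuousAt (stepFn (K.filter (X · = p.1)) (vel F ε sgn lev K X)
        (fun k => sgn k * ε)) p.2 := by
    constructor
    · intro h
      have := (continuousAt_const (y := -(below sgn K X p.1 * ε))).add h
      exact this.congr (.of_forall fun x => by simp)
    · exact fun h => continuousAt_const.add h
  rw [this, continuousAt_stepFn_iff]
  constructor
  · intro h
    obtain ⟨k, hk, -⟩ := Finset.exists_ne_zero_of_sum_ne_zero h
    simp only [Finset.mem_filter] at hk
    exact ⟨k, hk.1.1, Prod.ext hk.1.2 hk.2⟩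
  · rintro ⟨k, hk, rfl⟩ h
    rw [Finset.sum_congr rfl (g := fun _ => sgn k * ε), Finset.sum_const, nsmul_eq_mul] at h
    · have h1 : (0 : ℝ) < (((K.filter (X · = X k)).filter
          (vel F ε sgn lev K X · = vel F ε sgn lev K X k)).card : ℝ) := by
        have : 0 < ((K.filter (X · = X k)).filter
          (vel F ε sgn lev K X · = vel F ε sgn lev K X k)).card :=
          Finset.card_pos.2 ⟨k, by simp [hk]⟩
        exact_mod_cast this
      have h2 : (sgn k : ℝ) ≠ 0 := by
        rcases hc.sgn_eq k with e | e <;> rw [e] <;> norm_num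
      rcases mul_eq_zero.1 h with h | h
      · exact h1.ne' h
      · rcases mul_eq_zero.1 h with h | h
        · exact h2 h
        · exact hε.ne' h
    · intro l hl
      simp only [Finset.mem_filter] at hl
      rw [hc.same l hl.1.1 k hk hl.1.2]

theorem Config.frontRight_eq (hε : 0 < ε) (hc : Config sgn lev K X) (p : ℝ × ℝ) :
    frontRight (gridFlux F ε) (prof ε sgn K X) p = (below sgn K X p.1 +
      ∑ k ∈ (K.filter (X · = p.1)).filter (vel F ε sgn lev K X · ≤ p.2), sgn k : ℤ) * ε := by
  rw [frontRight, hc.riemannAt_prof hε]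

theorem Config.frontLeft_eq (hε : 0 < ε) (hc : Config sgn lev K X) (p : ℝ × ℝ) :
    frontLeft (gridFlux F ε) (prof ε sgn K X) p = (below sgn K X p.1 +
      ∑ k ∈ (K.filter (X · = p.1)).filter (vel F ε sgn lev K X · < p.2), sgn k : ℤ) * ε := by
  rw [frontLeft, hc.riemannAt_eq_stepFn hε]
  refine leftLim_eq_of_tendsto (tendsto_const_nhds.congr' ?_)
  filter_upwards [stepFn_eventually_lt (K.filter (X · = p.1)) (vel F ε sgn lev K X)
    (fun k => sgn k * ε) p.2] with ξ hξ
  rw [hξ, ← Finset.sum_mul]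
  push_cast; ring

/-- Free motion of the cells. -/
def adv (F : ℝ → ℝ) (ε : ℝ) (sgn lev : ℕ → ℤ) (K : Finset ℕ) (X : ℕ → ℝ) (s : ℝ) (k : ℕ) : ℝ :=
  X k + vel F ε sgn lev K X k * s

/-- The condition `vel ≤ (x - y) / s` says that a cell issued from `y` is not beyond `x` after the
time `s`. Superposing Riemann solutions thus amounts to letting the cells move freely, whether or
not they have crossed. -/
theorem Config.evolve_prof (hε : 0 < ε) (hc : Config sgn lev K X) {s : ℝ} (hs : 0 ≤ s) :
    evolve (gridFlux F ε) (prof ε sgn K X) s = prof ε sgn K (adv F ε sgn lev K X s) := by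
  ext x
  rw [evolve]
  rcases hs.eq_or_lt with rfl | hs
  · rw [if_pos rfl]
    have : adv F ε sgn lev K X 0 = X := by ext k; simp [adv]
    rw [this]
  · rw [if_neg hs.ne']
    have h0 : ∀ y, riemannAt (gridFlux F ε) (prof ε sgn K X) y ((x - y) / s) -
        Function.leftLim (prof ε sgn K X) y = ∑ k ∈ (K.filter (X · = y)).filter
          (vel F ε sgn lev K X · ≤ (x - y) / s), (sgn k : ℝ) * ε := by
      intro y
      rw [hc.riemannAt_prof hε, leftLim_prof, ← Finset.sum_mul]
      push_cast; ring
    simp only [h0]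
    rw [finsum_eq_sum_of_support_subset (s := K.image X), prof, upto, Int.cast_sum, Finset.sum_mul]
    · rw [← Finset.sum_fiberwise_of_maps_to (g := X) (t := K.image X)
          (s := K.filter (adv F ε sgn lev K X s · ≤ x))]
      · refine Finset.sum_congr rfl fun y _ => Finset.sum_congr ?_ fun _ _ => rfl
        ext k
        simp only [Finset.mem_filter]
        simp only [adv]
        constructor
        · rintro ⟨⟨h1, h2⟩, h3⟩
          rw [le_div_iff₀ hs] at h3
          exact ⟨⟨h1, by rw [h2]; linarith⟩, h2⟩
        · rintro ⟨⟨h1, h2⟩, h3⟩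
          refine ⟨⟨h1, h3⟩, ?_⟩
          rw [le_div_iff₀ hs]; rw [h3] at h2; linarith
      · intro k hk
        exact Finset.mem_image_of_mem _ (Finset.mem_filter.1 hk).1
    · intro y hy
      rw [Function.mem_support] at hy
      obtain ⟨k, hk, -⟩ := Finset.exists_ne_zero_of_sum_ne_zero hy
      simp only [Finset.mem_filter] at hk
      rw [Finset.coe_image]
      exact ⟨k, hk.1.1, hk.1.2⟩

/-! ### Meetings of wavefronts -/

theorem Config.mem_meetingTimes (hε : 0 < ε) (hc : Config sgn lev K X) (s : ℝ) :
    s ∈ meetingTimes (gridFlux F ε) (prof ε sgn K X) ↔ 0 < s ∧ ∃ k ∈ K, ∃ l ∈ K,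
      ¬ Fr F ε sgn lev K X k l ∧ adv F ε sgn lev K X s k = adv F ε sgn lev K X s l := by
  rw [meetingTimes, Set.mem_ofPred_eq, and_congr_right_iff]
  intro hs
  constructor
  · rintro ⟨p, hp, q, hq, hne, he⟩
    obtain ⟨k, hk, rfl⟩ := (hc.mem_fronts hε p).1 hp
    obtain ⟨l, hl, rfl⟩ := (hc.mem_fronts hε q).1 hq
    exact ⟨k, hk, l, hl, fun h => hne (Prod.ext h.1 h.2), he⟩
  · rintro ⟨k, hk, l, hl, hne, he⟩
    exact ⟨_, (hc.mem_fronts hε _).2 ⟨k, hk, rfl⟩, _, (hc.mem_fronts hε _).2 ⟨l, hl, rfl⟩,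
      fun h => hne ⟨congrArg Prod.fst h, congrArg Prod.snd h⟩, he⟩

/-- Two cells on different fronts can meet at one time only, the quotient of distance and relative
speed. Finiteness makes the infimum in `delay` a minimum. -/
theorem Config.finite_meetingTimes (hε : 0 < ε) (hc : Config sgn lev K X) :
    (meetingTimes (gridFlux F ε) (prof ε sgn K X)).Finite := by
  refine ((K ×ˢ K).image fun p => (X p.2 - X p.1) /
    (vel F ε sgn lev K X p.1 - vel F ε sgn lev K X p.2)).finite_toSet.subset fun s hs => ?_
  obtain ⟨_, k, hk, l, hl, hne, he⟩ := (hc.mem_meetingTimes hε s).1 hs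
  rw [Finset.coe_image]
  refine ⟨(k, l), by simp [hk, hl], ?_⟩
  simp only [adv] at he
  have : vel F ε sgn lev K X k - vel F ε sgn lev K X l ≠ 0 := fun h => by
    have h' := sub_eq_zero.1 h
    rw [h'] at he
    exact hne ⟨add_right_cancel he, h'⟩
  rw [div_eq_iff this]; linarith

theorem Config.delay_mem (hε : 0 < ε) (hc : Config sgn lev K X)
    (h : (meetingTimes (gridFlux F ε) (prof ε sgn K X)).Nonempty) :
    delay (gridFlux F ε) (prof ε sgn K X) ∈ meetingTimes (gridFlux F ε) (prof ε sgn K X) := by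
  rw [delay, if_pos h]
  exact h.csInf_mem (hc.finite_meetingTimes hε)

theorem Config.delay_pos (hε : 0 < ε) (hc : Config sgn lev K X) :
    0 < delay (gridFlux F ε) (prof ε sgn K X) := by
  by_cases h : (meetingTimes (gridFlux F ε) (prof ε sgn K X)).Nonempty
  · exact (hc.delay_mem hε h).1
  · rw [delay, if_neg h]; exact one_pos

theorem delay_le {f v : ℝ → ℝ} {s : ℝ} (h : s ∈ meetingTimes f v) : delay f v ≤ s := by
  rw [delay, if_pos ⟨s, h⟩]
  exact csInf_le ⟨0, fun _ h => h.1.le⟩ h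

/-- Cells that start together fan out, so a coincidence or an inversion requires `X k < X l` and a
faster left cell. The two then meet at the quotient of distance and relative speed, which is at most
`s`, and less than `s` if the order is already reversed. -/
theorem Config.exists_meeting (hε : 0 < ε) (hc : Config sgn lev K X) {k l : ℕ} (hk : k ∈ K)
    (hl : l ∈ K) (hkl : k < l) (hne : ¬ Fr F ε sgn lev K X k l) {s : ℝ} (hs : 0 < s)
    (h : adv F ε sgn lev K X s l ≤ adv F ε sgn lev K X s k) :
    X k < X l ∧ vel F ε sgn lev K X l < vel F ε sgn lev K X k ∧
    ∃ s' ∈ meetingTimes (gridFlux F ε) (prof ε sgn K X), s' ≤ s ∧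
      (adv F ε sgn lev K X s l < adv F ε sgn lev K X s k → s' < s) := by
  simp only [adv] at h ⊢
  rcases (hc.mono k hk l hl hkl.le).eq_or_lt with e | hX
  · exfalso
    have h1 : vel F ε sgn lev K X k < vel F ε sgn lev K X l :=
      lt_of_le_of_ne (hc.vel_mono hε hk hl e hkl.le) fun h => hne ⟨e, h⟩
    rw [e] at h
    nlinarith
  · have hV : vel F ε sgn lev K X l < vel F ε sgn lev K X k := by
      by_contra! h'
      nlinarith
    have hV' := sub_pos.2 hV
    refine ⟨hX, hV, (X l - X k) / (vel F ε sgn lev K X k - vel F ε sgn lev K X l),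
      (hc.mem_meetingTimes hε _).2 ⟨div_pos (sub_pos.2 hX) hV', k, hk, l, hl, hne, ?_⟩, ?_, ?_⟩
    · simp only [adv]
      field_simp
      ring
    · rw [div_le_iff₀ hV']; nlinarith
    · intro h'
      rw [div_lt_iff₀ hV']; nlinarith

theorem Config.adv_lt (hε : 0 < ε) (hc : Config sgn lev K X) {k l : ℕ} (hk : k ∈ K)
    (hl : l ∈ K) (hkl : k < l) (hne : ¬ Fr F ε sgn lev K X k l) {s : ℝ} (hs : 0 < s)
    (hs' : s < delay (gridFlux F ε) (prof ε sgn K X)) :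
    adv F ε sgn lev K X s k < adv F ε sgn lev K X s l := by
  by_contra! h
  obtain ⟨-, -, s', hs₁, hs₂, -⟩ := hc.exists_meeting hε hk hl hkl hne hs h
  linarith [delay_le hs₁]

theorem Fr.adv_eq {k l : ℕ} (h : Fr F ε sgn lev K X k l) (s : ℝ) :
    adv F ε sgn lev K X s k = adv F ε sgn lev K X s l := by
  rw [adv, adv, h.1, h.2]

theorem Config.adv_le (hε : 0 < ε) (hc : Config sgn lev K X) {k l : ℕ} (hk : k ∈ K)
    (hl : l ∈ K) (hkl : k ≤ l) {s : ℝ} (hs : 0 ≤ s)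
    (hs' : s ≤ delay (gridFlux F ε) (prof ε sgn K X)) :
    adv F ε sgn lev K X s k ≤ adv F ε sgn lev K X s l := by
  rcases hs.eq_or_lt with rfl | hs
  · simpa [adv] using hc.mono k hk l hl hkl
  by_cases hF : Fr F ε sgn lev K X k l
  · exact (hF.adv_eq s).le
  · by_contra! h
    have hkl' : k < l := lt_of_le_of_ne hkl fun e => hF (e ▸ Fr.rfl)
    obtain ⟨-, -, s', hs₁, -, hs₂⟩ := hc.exists_meeting hε hk hl hkl' hF hs h.le
    linarith [delay_le hs₁, hs₂ h]

theorem Config.preConfig_adv (hε : 0 < ε) (hc : Config sgn lev K X) {s : ℝ} (hs : 0 ≤ s)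
    (hs' : s ≤ delay (gridFlux F ε) (prof ε sgn K X)) :
    PreConfig sgn lev K (adv F ε sgn lev K X s) :=
  ⟨hc.sgn_eq, fun _ hk _ hl hkl => hc.adv_le hε hk hl hkl hs hs', hc.lev_eq⟩

/-- Strictly between two stages the groups of cells sharing a position are the fronts. -/
theorem Config.adv_eq_iff (hε : 0 < ε) (hc : Config sgn lev K X) {k l : ℕ} (hk : k ∈ K)
    (hl : l ∈ K) {s : ℝ} (hs : 0 < s) (hs' : s < delay (gridFlux F ε) (prof ε sgn K X)) :
    adv F ε sgn lev K X s k = adv F ε sgn lev K X s l ↔ Fr F ε sgn lev K X k l := by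
  refine ⟨fun h => ?_, fun h => h.adv_eq s⟩
  by_contra hne
  rcases lt_trichotomy k l with hkl | rfl | hkl
  · exact (hc.adv_lt hε hk hl hkl hne hs hs').ne h
  · exact hne Fr.rfl
  · exact (hc.adv_lt hε hl hk hkl (fun h' => hne h'.symm) hs hs').ne h.symm

/-- The wavefronts of the cells `p < q` meet after the time `s`, and no other ones do. -/
structure Meet (F : ℝ → ℝ) (ε : ℝ) (sgn lev : ℕ → ℤ) (K : Finset ℕ) (X : ℕ → ℝ) (s : ℝ)
    (p q : ℕ) : Prop where
  memL : p ∈ K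
  memR : q ∈ K
  lt : p < q
  pos_lt : X p < X q
  vel_lt : vel F ε sgn lev K X q < vel F ε sgn lev K X p
  adv_eq : adv F ε sgn lev K X s p = adv F ε sgn lev K X s q
  only : ∀ k ∈ K, ∀ l ∈ K, ¬ Fr F ε sgn lev K X k l →
    adv F ε sgn lev K X s k = adv F ε sgn lev K X s l →
    (Fr F ε sgn lev K X k p ∧ Fr F ε sgn lev K X l q) ∨
      (Fr F ε sgn lev K X k q ∧ Fr F ε sgn lev K X l p)

/-- The wavefronts of the profile `v` that meet another one after the time `s`. -/
def meetingFronts (f v : ℝ → ℝ) (s : ℝ) : Set (ℝ × ℝ) :=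
  {p | p ∈ fronts f v ∧ ∃ q ∈ fronts f v, p ≠ q ∧ frontPos p s = frontPos q s}

theorem Config.exists_meet (hε : 0 < ε) (hc : Config sgn lev K X)
    (hb : (meetingFronts (gridFlux F ε) (prof ε sgn K X)
      (delay (gridFlux F ε) (prof ε sgn K X))).ncard = 2)
    (hne : (meetingTimes (gridFlux F ε) (prof ε sgn K X)).Nonempty) :
    ∃ p q, Meet F ε sgn lev K X (delay (gridFlux F ε) (prof ε sgn K X)) p q ∧
      meetingFronts (gridFlux F ε) (prof ε sgn K X) (delay (gridFlux F ε) (prof ε sgn K X)) =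
        {(X p, vel F ε sgn lev K X p), (X q, vel F ε sgn lev K X q)} := by
  set s := delay (gridFlux F ε) (prof ε sgn K X) with hs
  obtain ⟨hs0, k, hk, l, hl, hkl, he⟩ := (hc.mem_meetingTimes hε s).1 (hc.delay_mem hε hne)
  obtain ⟨p, hp, q, hq, hpq, hF, he⟩ : ∃ p ∈ K, ∃ q ∈ K, p < q ∧ ¬ Fr F ε sgn lev K X p q ∧
      adv F ε sgn lev K X s p = adv F ε sgn lev K X s q := by
    rcases lt_trichotomy k l with h | rfl | h
    · exact ⟨k, hk, l, hl, h, hkl, he⟩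
    · exact absurd Fr.rfl hkl
    · exact ⟨l, hl, k, hk, h, fun h' => hkl h'.symm, he.symm⟩
  have hmem : ∀ k ∈ K, ∀ l ∈ K, ¬ Fr F ε sgn lev K X k l →
      adv F ε sgn lev K X s k = adv F ε sgn lev K X s l →
      (X k, vel F ε sgn lev K X k) ∈ meetingFronts (gridFlux F ε) (prof ε sgn K X) s :=
    fun k hk l hl hkl he => ⟨(hc.mem_fronts hε _).2 ⟨k, hk, rfl⟩, _,
      (hc.mem_fronts hε _).2 ⟨l, hl, rfl⟩, fun h => hkl ⟨congrArg Prod.fst h, congrArg Prod.snd h⟩,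
      he⟩
  have hset : meetingFronts (gridFlux F ε) (prof ε sgn K X) s =
      {(X p, vel F ε sgn lev K X p), (X q, vel F ε sgn lev K X q)} := by
    symm
    -- Two meeting fronts have been found and there are exactly two, so there are no others.
    refine Set.eq_of_subset_of_ncard_le ?_ ?_ (Set.finite_of_ncard_ne_zero (by rw [hb]; norm_num))
    · rintro _ (rfl | rfl)
      · exact hmem p hp q hq hF he
      · exact hmem q hq p hp (fun h => hF h.symm) he.symm
    · rw [hb, Set.ncard_pair fun h => hF ⟨congrArg Prod.fst h, congrArg Prod.snd h⟩]
  obtain ⟨hX, hV, -⟩ := hc.exists_meeting hε hp hq hpq hF hs0 he.ge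
  refine ⟨p, q, ⟨hp, hq, hpq, hX, hV, he, fun k hk l hl hkl he => ?_⟩, hset⟩
  have h1 := hmem k hk l hl hkl he
  have h2 := hmem l hl k hk (fun h => hkl h.symm) he.symm
  have conv : ∀ a b, (X a, vel F ε sgn lev K X a) = (X b, vel F ε sgn lev K X b) →
      Fr F ε sgn lev K X a b := fun a b h => ⟨congrArg Prod.fst h, congrArg Prod.snd h⟩
  rw [hset] at h1 h2
  rcases h1 with h1 | h1 <;> rcases h2 with h2 | h2
  · exact absurd ((conv _ _ h1).trans (conv _ _ h2).symm) hkl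
  · exact Or.inl ⟨conv _ _ h1, conv _ _ h2⟩
  · exact Or.inr ⟨conv _ _ h1, conv _ _ h2⟩
  · exact absurd ((conv _ _ h1).trans (conv _ _ h2).symm) hkl

end

section

open scoped Classical

variable {F : ℝ → ℝ} {ε : ℝ} {sgn lev : ℕ → ℤ} {K K' G : Finset ℕ} {X X' : ℕ → ℝ}

/-! ### Interactions -/

/-- The cell `k` has the sign of the jump from `a` to `b` and its state lies in that jump. -/
def InCellJump (sgn lev : ℕ → ℤ) (a b : ℤ) (k : ℕ) : Prop :=
  sgn k * a ≤ lev k ∧ lev k < sgn k * b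

theorem Config.inCellJump (hc : Config sgn lev K X) {k : ℕ} (hk : k ∈ K) :
    InCellJump sgn lev (below sgn K X (X k)) (upto sgn K X (X k)) k := hc.lev_mem hk

/-- A consecutive block at a single point, with signs adding up to zero, enters each relevant
partial sum entirely or not at all. Removing it changes neither the levels of the other cells nor
the profile. -/
theorem PreConfig.sdiff (hc : PreConfig sgn lev K X) {R : Finset ℕ} (hR : R ⊆ K) {y : ℝ}
    (hpos : ∀ k ∈ R, X k = y) (hconv : ∀ a ∈ R, ∀ b ∈ R, ∀ z ∈ K, a ≤ z → z ≤ b → z ∈ R)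
    (hsum : ∑ k ∈ R, sgn k = 0) :
    PreConfig sgn lev (K \ R) X ∧ ∀ x, upto sgn (K \ R) X x = upto sgn K X x := by
  have key : ∀ (P : ℕ → Prop) [DecidablePred P], ((∀ k ∈ R, P k) ∨ ∀ k ∈ R, ¬ P k) →
      ∑ j ∈ (K \ R).filter P, sgn j = ∑ j ∈ K.filter P, sgn j := by
    intro P _ hP
    have h1 : ∑ j ∈ R.filter P, sgn j = 0 := by
      rcases hP with hP | hP
      · rw [Finset.filter_true_of_mem hP, hsum]
      · rw [Finset.filter_false_of_mem hP, Finset.sum_empty]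
    have h2 : K.filter P = (K \ R).filter P ∪ R.filter P := by
      rw [← Finset.filter_union, Finset.sdiff_union_of_subset hR]
    rw [h2, Finset.sum_union, h1, add_zero]
    exact Finset.disjoint_filter_filter Finset.sdiff_disjoint
  refine ⟨⟨hc.sgn_eq, fun k hk l hl => hc.mono k (Finset.mem_sdiff.1 hk).1 l
    (Finset.mem_sdiff.1 hl).1, fun k hk => ?_⟩, fun x => key _ ?_⟩
  · rw [Finset.mem_sdiff] at hk
    rw [hc.lev_eq k hk.1, key]
    by_contra! h
    obtain ⟨⟨b, hb, hb'⟩, a, ha, ha'⟩ := h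
    exact hk.2 (hconv a ha b hb k hk.1 ha'.le hb')
  · by_cases h : y ≤ x
    · exact Or.inl fun k hk => (hpos k hk).trans_le h
    · exact Or.inr fun k hk => by rw [hpos k hk]; exact h

theorem below_eq_of_upto_eq (h : ∀ x, upto sgn K' X x = upto sgn K X x) (x : ℝ) :
    below sgn K' X x * ε = below sgn K X x * ε := by
  rw [← leftLim_prof, ← leftLim_prof]
  congr 1
  ext x
  rw [prof, prof, h]

theorem Meet.grp_eq {s : ℝ} {p q : ℕ} (hm : Meet F ε sgn lev K X s p q) {k : ℕ}
    (hk : k ∈ K) :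
    adv F ε sgn lev K X s k = adv F ε sgn lev K X s p ↔
      k ∈ front F ε sgn lev K X p ∨ k ∈ front F ε sgn lev K X q := by
  rw [mem_front, mem_front]
  constructor
  · intro h
    by_cases hF : Fr F ε sgn lev K X k p
    · exact Or.inl ⟨hk, hF⟩
    · rcases hm.only k hk p hm.memL hF h with h' | h'
      · exact absurd h'.1 hF
      · exact Or.inr ⟨hk, h'.1⟩
  · rintro (h | h)
    · exact h.2.adv_eq s
    · rw [h.2.adv_eq s, hm.adv_eq]

theorem Meet.lt_of_mem {s : ℝ} {p q : ℕ} (hc : Config sgn lev K X)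
    (hm : Meet F ε sgn lev K X s p q) {k l : ℕ} (hk : k ∈ front F ε sgn lev K X p)
    (hl : l ∈ front F ε sgn lev K X q) : k < l := by
  rw [mem_front] at hk hl
  by_contra! h
  have := hc.mono l hl.1 k hk.1 h
  rw [hk.2.1, hl.2.1] at this
  exact absurd hm.pos_lt (not_lt.2 this)

/-- The transition from one stage to the next one. -/
structure Step (F : ℝ → ℝ) (ε : ℝ) (sgn lev : ℕ → ℤ) (K : Finset ℕ) (X : ℕ → ℝ) (s : ℝ)
    (K' : Finset ℕ) : Prop where
  cfg : Config sgn lev K' (adv F ε sgn lev K X s)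
  sub : K' ⊆ K
  mem_iff : ∀ k ∈ K, k ∈ K' ↔ InCellJump sgn lev
    (below sgn K (adv F ε sgn lev K X s) (adv F ε sgn lev K X s k))
    (upto sgn K (adv F ε sgn lev K X s) (adv F ε sgn lev K X s k)) k
  sandwich : ∀ i ∈ K', ∀ j ∈ K', (∀ z ∈ K, i ≤ z → z ≤ j → sgn z = sgn i) →
    ∀ z ∈ K, i ≤ z → z ≤ j → z ∈ K'
  upto_eq : ∀ x, upto sgn K' (adv F ε sgn lev K X s) x = upto sgn K (adv F ε sgn lev K X s) x
  simple_or_merge : (∀ k ∈ K', ∀ l ∈ K', adv F ε sgn lev K X s k = adv F ε sgn lev K X s l →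
    Fr F ε sgn lev K X k l) ∨
    (K' = K ∧ ∃ p q, Meet F ε sgn lev K X s p q ∧ sgn p = sgn q)

theorem step_self {s : ℝ} (hcfg : Config sgn lev K (adv F ε sgn lev K X s))
    (h : (∀ k ∈ K, ∀ l ∈ K, adv F ε sgn lev K X s k = adv F ε sgn lev K X s l →
      Fr F ε sgn lev K X k l) ∨ ∃ p q, Meet F ε sgn lev K X s p q ∧ sgn p = sgn q) :
    Step F ε sgn lev K X s K where
  cfg := hcfg
  sub := subset_rfl
  mem_iff := fun _ hk => ⟨fun _ => hcfg.inCellJump hk, fun _ => hk⟩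
  sandwich := fun _ _ _ _ _ _ hz _ _ => hz
  upto_eq := fun _ => rfl
  simple_or_merge := h.imp_right fun h => ⟨rfl, h⟩

theorem Config.step_quiet (hε : 0 < ε) (hc : Config sgn lev K X) {s : ℝ} (hs : 0 ≤ s)
    (hs' : s ≤ delay (gridFlux F ε) (prof ε sgn K X))
    (h : ∀ k ∈ K, ∀ l ∈ K, adv F ε sgn lev K X s k = adv F ε sgn lev K X s l →
      Fr F ε sgn lev K X k l) : Step F ε sgn lev K X s K :=
  step_self ⟨hc.preConfig_adv hε hs hs', fun k hk l hl he => hc.same k hk l hl (h k hk l hl he).1⟩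
    (Or.inl h)

theorem Config.step_merge (hε : 0 < ε) (hc : Config sgn lev K X) {s : ℝ} (hs : 0 ≤ s)
    (hs' : s ≤ delay (gridFlux F ε) (prof ε sgn K X)) {p q : ℕ}
    (hm : Meet F ε sgn lev K X s p q) (hpq : sgn p = sgn q) : Step F ε sgn lev K X s K := by
  refine step_self ⟨hc.preConfig_adv hε hs hs', fun k hk l hl he => ?_⟩ (Or.inr ⟨p, q, hm, hpq⟩)
  by_cases hF : Fr F ε sgn lev K X k l
  · exact hc.same k hk l hl hF.1
  · rcases hm.only k hk l hl hF he with ⟨h1, h2⟩ | ⟨h1, h2⟩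
    · rw [hc.same k hk p hm.memL h1.1, hc.same l hl q hm.memR h2.1, hpq]
    · rw [hc.same k hk q hm.memR h1.1, hc.same l hl p hm.memL h2.1, hpq]

theorem card_filter_lev {a b : ℤ} (hG : G.image lev = Finset.Ico a b)
    (hm : StrictMonoOn lev (G : Set ℕ)) (P : ℤ → Prop) [DecidablePred P] {c d : ℤ} (hcd : c ≤ d)
    (hP : ∀ m, (a ≤ m ∧ m < b ∧ P m) ↔ (c ≤ m ∧ m < d)) :
    ((G.filter fun k => P (lev k)).card : ℤ) = d - c := by
  rw [← card_filter_image hG hm]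
  have : (Finset.Ico a b).filter P = Finset.Ico c d := by
    ext m
    rw [Finset.mem_filter, Finset.mem_Ico, Finset.mem_Ico, ← hP m, and_assoc]
  rw [this, Int.card_Ico]
  omega

/-- Let the left front have `ℓ` cells and the right one `μ` cells of the opposite sign. With `B` the
oriented left state, the left levels are `[B, B + ℓ)` and the right ones `[-B - ℓ, -B - ℓ + μ)`. The
new jump keeps the left levels below `B + ℓ - μ` and the right levels from `-B` on. So each side
loses the `min ℓ μ` cells nearest to the other front. -/
theorem Config.step_cancel (hε : 0 < ε) (hc : Config sgn lev K X) {s : ℝ} (hs : 0 ≤ s)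
    (hs' : s ≤ delay (gridFlux F ε) (prof ε sgn K X)) {p q : ℕ}
    (hm : Meet F ε sgn lev K X s p q) (hpq : sgn p ≠ sgn q) :
    Step F ε sgn lev K X s (K.filter fun k =>
      adv F ε sgn lev K X s k = adv F ε sgn lev K X s p → InCellJump sgn lev
        (below sgn K (adv F ε sgn lev K X s) (adv F ε sgn lev K X s k))
        (upto sgn K (adv F ε sgn lev K X s) (adv F ε sgn lev K X s k)) k) ∧
    (K.filter fun k =>
      adv F ε sgn lev K X s k = adv F ε sgn lev K X s p → InCellJump sgn lev
        (below sgn K (adv F ε sgn lev K X s) (adv F ε sgn lev K X s k))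
        (upto sgn K (adv F ε sgn lev K X s) (adv F ε sgn lev K X s k)) k) ⊂ K := by
  set Y := adv F ε sgn lev K X s with hY
  have hpc : PreConfig sgn lev K Y := hc.preConfig_adv hε hs hs'
  set Lf := front F ε sgn lev K X p with hL
  set Mf := front F ε sgn lev K X q with hM
  have rL : Run sgn K Lf := hc.run_front hε hm.memL
  have rM : Run sgn K Mf := hc.run_front hε hm.memR
  have hpL : p ∈ Lf := mem_front_self hm.memL
  have hqM : q ∈ Mf := mem_front_self hm.memR
  have hLM : ∀ k ∈ Lf, ∀ l ∈ Mf, k < l := fun k hk l hl => hm.lt_of_mem hc hk hl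
  have hYL : ∀ k ∈ Lf, Y k = Y p := fun k hk => (hm.grp_eq (rL.subset hk)).2 (Or.inl hk)
  have hYM : ∀ k ∈ Mf, Y k = Y p := fun k hk => (hm.grp_eq (rM.subset hk)).2 (Or.inr hk)
  have hYLM : ∀ k ∈ K, Y k = Y p → k ∈ Lf ∨ k ∈ Mf := fun k hk => (hm.grp_eq hk).1
  have hsq : sgn q = -sgn p := by
    have h1 := hc.sgn_eq p
    have h2 := hc.sgn_eq q
    omega
  have hdisj : Disjoint Lf Mf := Finset.disjoint_left.2 fun k h1 h2 => lt_irrefl _ (hLM k h1 k h2)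
  set A := below sgn K Y (Y p) with hA
  have hBL : ∑ j ∈ K.filter (fun j => ∀ g ∈ Lf, j < g), sgn j = A := by
    rw [hA, below]
    congr 1
    ext j
    simp only [Finset.mem_filter, and_congr_right_iff]
    intro hj
    constructor
    · intro h
      refine lt_of_le_of_ne (hpc.mono j hj p hm.memL (h p hpL).le) fun he => ?_
      rcases hYLM j hj he with h' | h'
      · exact lt_irrefl _ (h j h')
      · exact lt_asymm (hLM p hpL j h') (h p hpL)
    · intro h g hg
      by_contra! hlt
      exact absurd (hpc.mono g (rL.subset hg) j hj hlt) (by rw [hYL g hg]; exact not_le.2 h)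
  have hBM : ∑ j ∈ K.filter (fun j => ∀ g ∈ Mf, j < g), sgn j = A + sgn p * Lf.card := by
    rw [← hBL]
    have : K.filter (fun j => ∀ g ∈ Mf, j < g) = K.filter (fun j => ∀ g ∈ Lf, j < g) ∪ Lf := by
      ext j
      simp only [Finset.mem_filter, Finset.mem_union]
      constructor
      · rintro ⟨hj, h⟩
        by_cases hjp : Y j = Y p
        · rcases hYLM j hj hjp with h' | h'
          · exact Or.inr h'
          · exact absurd (h j h') (lt_irrefl _)
        · refine Or.inl ⟨hj, fun g hg => ?_⟩
          by_contra! hlt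
          have h1 := hpc.mono g (rL.subset hg) j hj hlt
          have h2 := hpc.mono j hj q hm.memR (h q hqM).le
          rw [hYL g hg] at h1
          rw [hYM q hqM] at h2
          exact hjp (le_antisymm h2 h1)
      · rintro (⟨hj, h⟩ | h)
        · exact ⟨hj, fun g hg => (h p hpL).trans (hLM p hpL g hg)⟩
        · exact ⟨rL.subset h, fun g hg => hLM j h g hg⟩
    rw [this, Finset.sum_union, Finset.sum_congr rfl fun j hj => rL.const j hj p hpL,
      Finset.sum_const, nsmul_eq_mul, mul_comm (Lf.card : ℤ)]
    rw [Finset.disjoint_left]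
    intro j hj hj'
    exact lt_irrefl _ ((Finset.mem_filter.1 hj).2 j hj')
  have iL := rL.image_lev hc.toPreConfig hpL
  have iM := rM.image_lev hc.toPreConfig hqM
  rw [hBL] at iL
  rw [hBM, hsq] at iM
  have hupto : upto sgn K Y (Y p) = A + sgn p * (Lf.card - Mf.card) := by
    rw [upto_eq, ← hA]
    have : K.filter (Y · = Y p) = Lf ∪ Mf := by
      ext j
      simp only [Finset.mem_filter, Finset.mem_union]
      constructor
      · rintro ⟨h1, h2⟩; exact hYLM j h1 h2
      · rintro (h | h)
        · exact ⟨rL.subset h, hYL j h⟩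
        · exact ⟨rM.subset h, hYM j h⟩
    rw [this, Finset.sum_union hdisj, Finset.sum_congr rfl fun j hj => rL.const j hj p hpL,
      Finset.sum_congr (s₁ := Mf) rfl fun j hj => rM.const j hj q hqM, Finset.sum_const,
      Finset.sum_const, hsq]
    simp only [nsmul_eq_mul]; ring
  have hs2 : sgn p * sgn p = 1 := hc.sgn_mul_self p
  set ℓ := (Lf.card : ℤ) with hℓ
  set μ := (Mf.card : ℤ) with hμ
  have hℓ0 : 0 < ℓ := by rw [hℓ]; exact_mod_cast Finset.card_pos.2 ⟨p, hpL⟩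
  have hμ0 : 0 < μ := by rw [hμ]; exact_mod_cast Finset.card_pos.2 ⟨q, hqM⟩
  set B : ℤ := sgn p * A with hB
  have eM : -sgn p * (A + sgn p * ℓ) = -B - ℓ := by
    rw [hB]; linear_combination (-ℓ) * hs2
  rw [eM] at iM
  have mL := rL.strictMonoOn hc.toPreConfig
  have mM := rM.strictMonoOn hc.toPreConfig
  have jL : ∀ k ∈ Lf, (InCellJump sgn lev (below sgn K Y (Y k)) (upto sgn K Y (Y k)) k ↔
      lev k < B + ℓ - μ) := by
    intro k hk
    have := mem_Ico_of_image iL hk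
    rw [InCellJump, hYL k hk, ← hA, hupto, rL.const k hk p hpL, ← hB,
      show sgn p * (A + sgn p * (ℓ - μ)) = B + ℓ - μ by
        rw [hB]; linear_combination (ℓ - μ) * hs2]
    omega
  have jM : ∀ k ∈ Mf, (InCellJump sgn lev (below sgn K Y (Y k)) (upto sgn K Y (Y k)) k ↔
      -B ≤ lev k) := by
    intro k hk
    have := mem_Ico_of_image iM hk
    rw [InCellJump, hYM k hk, ← hA, hupto, rM.const k hk q hqM, hsq,
      show -sgn p * A = -B by rw [hB]; ring,
      show -sgn p * (A + sgn p * (ℓ - μ)) = -B - ℓ + μ by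
        rw [hB]; linear_combination (-(ℓ - μ)) * hs2]
    omega
  set RL := Lf.filter fun k => B + ℓ - μ ≤ lev k with hRL
  set RM := Mf.filter fun k => lev k < -B with hRM
  have cL : (RL.card : ℤ) = min ℓ μ := by
    rw [hRL, card_filter_lev iL mL (fun m => B + ℓ - μ ≤ m) (c := max B (B + ℓ - μ))
      (d := B + ℓ) (by omega) (fun m => by omega)]
    omega
  have cM : (RM.card : ℤ) = min ℓ μ := by
    rw [hRM, card_filter_lev iM mM (fun m => m < -B) (c := -B - ℓ)
      (d := min (-B) (-B - ℓ + μ)) (by omega) (fun m => by omega)]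
    omega
  have hRLs : RL ⊆ Lf := Finset.filter_subset _ _
  have hRMs : RM ⊆ Mf := Finset.filter_subset _ _
  have hRsub : RL ∪ RM ⊆ K := Finset.union_subset (hRLs.trans rL.subset) (hRMs.trans rM.subset)
  have hRpos : ∀ k ∈ RL ∪ RM, Y k = Y p := by
    intro k hk
    rcases Finset.mem_union.1 hk with h | h
    · exact hYL k (hRLs h)
    · exact hYM k (hRMs h)
  -- The canceled cells are the last ones of the left front and the first ones of the right front,
  -- hence consecutive.
  have hRconv : ∀ a ∈ RL ∪ RM, ∀ b ∈ RL ∪ RM, ∀ z ∈ K, a ≤ z → z ≤ b → z ∈ RL ∪ RM := by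
    intro a ha b hb z hz h1 h2
    have hzp : Y z = Y p := le_antisymm ((hpc.mono z hz b (hRsub hb) h2).trans_eq (hRpos b hb))
      ((hRpos a ha).symm.trans_le (hpc.mono a (hRsub ha) z hz h1))
    rw [Finset.mem_union] at ha hb ⊢
    rcases hYLM z hz hzp with h | h
    · left
      rcases ha with ha | ha
      · have := (Finset.mem_filter.1 ha).2
        exact Finset.mem_filter.2 ⟨h, this.trans (mL.monotoneOn (hRLs ha) h h1)⟩
      · exact absurd (hLM z h a (hRMs ha)) (not_lt.2 h1)
    · right
      rcases hb with hb | hb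
      · exact absurd (hLM b (hRLs hb) z h) (not_lt.2 h2)
      · have := (Finset.mem_filter.1 hb).2
        exact Finset.mem_filter.2 ⟨h, (mM.monotoneOn h (hRMs hb) h2).trans_lt this⟩
  have hRsum : ∑ k ∈ RL ∪ RM, sgn k = 0 := by
    rw [Finset.sum_union (Finset.disjoint_of_subset_left hRLs
      (Finset.disjoint_of_subset_right hRMs hdisj)),
      Finset.sum_congr rfl fun j hj => rL.const j (hRLs hj) p hpL,
      Finset.sum_congr (s₁ := RM) rfl fun j hj => rM.const j (hRMs hj) q hqM, Finset.sum_const,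
      Finset.sum_const, hsq]
    simp only [nsmul_eq_mul]
    rw [cL, cM]; ring
  obtain ⟨hpc', hup⟩ := hpc.sdiff hRsub hRpos hRconv hRsum
  have hK' : (K.filter fun k => Y k = Y p → InCellJump sgn lev
      (below sgn K Y (Y k)) (upto sgn K Y (Y k)) k) = K \ (RL ∪ RM) := by
    ext k
    rw [Finset.mem_filter, Finset.mem_sdiff, Finset.mem_union, and_congr_right_iff]
    intro hk
    by_cases hkp : Y k = Y p
    · rcases hYLM k hk hkp with h | h
      · have h' : k ∉ RM := fun h' => lt_irrefl _ (hLM k h k (hRMs h'))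
        simp only [hkp, true_imp_iff, h', or_false]
        rw [← hkp, jL k h, hRL, Finset.mem_filter]
        simp only [h, true_and, not_le]
      · have h' : k ∉ RL := fun h' => lt_irrefl _ (hLM k (hRLs h') k h)
        simp only [hkp, true_imp_iff, h', false_or]
        rw [← hkp, jM k h, hRM, Finset.mem_filter]
        simp only [h, true_and, not_lt]
    · have h1 : k ∉ RL := fun h => hkp (hYL k (hRLs h))
      have h2 : k ∉ RM := fun h => hkp (hYM k (hRMs h))
      simp [hkp, h1, h2]
  -- Survivors on the left require `ℓ > μ` and survivors on the right require `μ > ℓ`, so at most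
  -- one of the two fronts survives.
  have hsimple : ∀ k ∈ K \ (RL ∪ RM), ∀ l ∈ K \ (RL ∪ RM), Y k = Y l →
      Fr F ε sgn lev K X k l := by
    intro k hk l hl he
    by_contra hF
    rw [← hK', Finset.mem_filter] at hk hl
    have aux : ∀ k l, k ∈ K → l ∈ K → (Y k = Y p → InCellJump sgn lev
        (below sgn K Y (Y k)) (upto sgn K Y (Y k)) k) → (Y l = Y p → InCellJump sgn lev
        (below sgn K Y (Y l)) (upto sgn K Y (Y l)) l) → Fr F ε sgn lev K X k p →
        Fr F ε sgn lev K X l q → False := by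
      intro k l hk hl hk' hl' h1 h2
      have kL : k ∈ Lf := mem_front.2 ⟨hk, h1⟩
      have lM : l ∈ Mf := mem_front.2 ⟨hl, h2⟩
      have b1 := (jL k kL).1 (hk' (hYL k kL))
      have b2 := (jM l lM).1 (hl' (hYM l lM))
      have b3 := mem_Ico_of_image iL kL
      have b4 := mem_Ico_of_image iM lM
      omega
    rcases hm.only k hk.1 l hl.1 hF he with ⟨h1, h2⟩ | ⟨h1, h2⟩
    · exact aux k l hk.1 hl.1 hk.2 hl.2 h1 h2
    · exact aux l k hl.1 hk.1 hl.2 hk.2 h2 h1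
  have hcfg : Config sgn lev (K \ (RL ∪ RM)) Y := ⟨hpc', fun k hk l hl he =>
    hc.same k (Finset.mem_sdiff.1 hk).1 l (Finset.mem_sdiff.1 hl).1 (hsimple k hk l hl he).1⟩
  have hRLne : RL.Nonempty := by rw [← Finset.card_pos]; omega
  have hRMne : RM.Nonempty := by rw [← Finset.card_pos]; omega
  rw [hK']
  refine ⟨⟨hcfg, Finset.sdiff_subset, fun k hk => ?_, ?_, hup, Or.inl hsimple⟩, ?_⟩
  · rw [← hK', Finset.mem_filter]
    constructor
    · rintro ⟨-, h⟩
      by_cases hkp : Y k = Y p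
      · exact h hkp
      · have hkR : k ∈ K \ (RL ∪ RM) := by
          rw [← hK', Finset.mem_filter]; exact ⟨hk, fun h' => absurd h' hkp⟩
        have := hcfg.inCellJump hkR
        rw [hup] at this
        have hb : below sgn (K \ (RL ∪ RM)) Y (Y k) = below sgn K Y (Y k) := by
          have := below_eq_of_upto_eq (ε := ε) hup (Y k)
          exact_mod_cast mul_right_cancel₀ hε.ne' this
        rwa [hb] at this
    · exact fun h => ⟨hk, fun _ => h⟩
  -- The canceled block is consecutive and contains both signs. If it met the interval between two
  -- survivors it would lie inside it, against the constancy of the sign there.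
  · intro i hi j hj hs z hz hiz hzj
    rw [Finset.mem_sdiff] at hi hj ⊢
    refine ⟨hz, fun hzR => ?_⟩
    obtain ⟨a, ha⟩ := hRLne
    obtain ⟨b, hb⟩ := hRMne
    have ha' : a ∈ RL ∪ RM := Finset.mem_union_left _ ha
    have hb' : b ∈ RL ∪ RM := Finset.mem_union_right _ hb
    have inside : ∀ c ∈ RL ∪ RM, sgn c = sgn i := by
      intro c hcR
      refine hs c (hRsub hcR) ?_ ?_
      · by_contra! h
        exact hi.2 (hRconv c hcR z hzR i hi.1 h.le hiz)
      · by_contra! h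
        exact hj.2 (hRconv z hzR c hcR j hj.1 hzj h.le)
    have e1 := inside a ha'
    have e2 := inside b hb'
    rw [rL.const a (hRLs ha) p hpL] at e1
    rw [rM.const b (hRMs hb) q hqM] at e2
    exact hpq (e1.trans e2.symm)
  · rw [Finset.ssubset_iff_of_subset Finset.sdiff_subset]
    obtain ⟨a, ha⟩ := hRLne
    exact ⟨a, rL.subset (hRLs ha), fun h => (Finset.mem_sdiff.1 h).2 (Finset.mem_union_left _ ha)⟩

/-- The velocity is preserved where no wavefronts merge. -/
theorem Config.vel_eq_of_grp_eq_front (hε : 0 < ε) (hc : Config sgn lev K X) {Y : ℕ → ℝ} {k : ℕ}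
    (hk : k ∈ K) (h : grp K' Y k = front F ε sgn lev K X k) :
    vel F ε sgn lev K' Y k = vel F ε sgn lev K X k := by
  rw [vel, h, hc.grpSlope_front hε hk (mem_front_self hk)]

theorem Config.vel_adv (hε : 0 < ε) (hc : Config sgn lev K X) {s : ℝ} (hs : 0 ≤ s)
    (hs' : s < delay (gridFlux F ε) (prof ε sgn K X)) {k : ℕ} (hk : k ∈ K) :
    vel F ε sgn lev K (adv F ε sgn lev K X s) k = vel F ε sgn lev K X k := by
  rcases hs.eq_or_lt with rfl | hs
  · have : adv F ε sgn lev K X 0 = X := by ext k; simp [adv]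
    rw [this]
  · refine hc.vel_eq_of_grp_eq_front hε hk ?_
    ext l
    rw [mem_grp, mem_front]
    exact and_congr_right fun hl => hc.adv_eq_iff hε hl hk hs hs'

theorem Config.config_adv (hε : 0 < ε) (hc : Config sgn lev K X) {s : ℝ} (hs : 0 ≤ s)
    (hs' : s < delay (gridFlux F ε) (prof ε sgn K X)) :
    Config sgn lev K (adv F ε sgn lev K X s) := by
  refine ⟨hc.preConfig_adv hε hs hs'.le, fun k hk l hl h => ?_⟩
  rcases hs.eq_or_lt with rfl | hs
  · exact hc.same k hk l hl (by simpa [adv] using h)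
  · exact hc.same k hk l hl ((hc.adv_eq_iff hε hk hl hs hs').1 h).1

/-- Levels of two wavefronts of the same sign which meet. -/
theorem Meet.exists_images (hε : 0 < ε) (hc : Config sgn lev K X) {s : ℝ} {p q : ℕ}
    (hm : Meet F ε sgn lev K X s p q)
    (hcfg : Config sgn lev K (adv F ε sgn lev K X s)) :
    ∃ a b c, a < b ∧ b < c ∧ (front F ε sgn lev K X p).image lev = Finset.Ico a b ∧
      (front F ε sgn lev K X q).image lev = Finset.Ico b c ∧
      (grp K (adv F ε sgn lev K X s) p).image lev = Finset.Ico a c := by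
  obtain ⟨a, b, hab, iL⟩ := (hc.run_front (F := F) hε hm.memL).exists_image hc.toPreConfig
    ⟨p, mem_front_self hm.memL⟩
  obtain ⟨b', c, hbc, iM⟩ := (hc.run_front (F := F) hε hm.memR).exists_image hc.toPreConfig
    ⟨q, mem_front_self hm.memR⟩
  obtain ⟨a', c', hac, iP⟩ := (hcfg.run_grp hm.memL).exists_image hcfg.toPreConfig
    ⟨p, mem_grp_self hm.memL⟩
  have hU : grp K (adv F ε sgn lev K X s) p =
      front F ε sgn lev K X p ∪ front F ε sgn lev K X q := by
    ext k
    rw [mem_grp, Finset.mem_union]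
    constructor
    · rintro ⟨h1, h2⟩; exact (hm.grp_eq h1).1 h2
    · rintro h
      have hk : k ∈ K := by
        rcases h with h | h <;> exact (mem_front.1 h).1
      exact ⟨hk, (hm.grp_eq hk).2 h⟩
  have mP := (hcfg.run_grp hm.memL).strictMonoOn hcfg.toPreConfig
  have hun : Finset.Ico a' c' = Finset.Ico a b ∪ Finset.Ico b' c := by
    rw [← iP, hU, Finset.image_union, iL, iM]
  -- The two intervals of levels are ordered and their union is an interval, so the second starts
  -- where the first ends.
  have hlt : ∀ m ∈ Finset.Ico a b, ∀ m' ∈ Finset.Ico b' c, m < m' := by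
    intro m h1 m' h2
    rw [← iL] at h1; rw [← iM] at h2
    obtain ⟨k, hk, rfl⟩ := Finset.mem_image.1 h1
    obtain ⟨l, hl, rfl⟩ := Finset.mem_image.1 h2
    exact mP (by rw [hU]; simp [hk]) (by rw [hU]; simp [hl]) (hm.lt_of_mem hc hk hl)
  have hmem : ∀ m, (a' ≤ m ∧ m < c') ↔ ((a ≤ m ∧ m < b) ∨ (b' ≤ m ∧ m < c)) := fun m => by
    rw [← Finset.mem_Ico, hun, Finset.mem_union, Finset.mem_Ico, Finset.mem_Ico]
  have h1 := hlt (b - 1) (by simp; omega) b' (by simp; omega)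
  have e1 : b = b' := by
    have h2 := (hmem a').1 ⟨le_rfl, hac⟩
    have h3 := (hmem (c - 1)).2 (Or.inr (by omega))
    have h4 := (hmem a).2 (Or.inl (by omega))
    have h5 := hmem b
    omega
  subst e1
  have h2 := (hmem a').1 ⟨le_rfl, hac⟩
  have h3 := (hmem (c - 1)).2 (Or.inr (by omega))
  have h4 := (hmem a).2 (Or.inl (by omega))
  have h5 := (hmem (c' - 1)).1 (by omega)
  have e2 : a' = a := by omega
  have e3 : c' = c := by omega
  subst e2 e3
  exact ⟨a', b, c', hab, hbc, iL, iM, iP⟩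

/-- Each front is an affine piece, with slope `ε` times its speed. Since the left front is faster,
the envelope on the union is the chord, and all cells leave on one front with the averaged speed. -/
theorem Meet.vel_adv (hε : 0 < ε) (hc : Config sgn lev K X) {s : ℝ} {p q : ℕ}
    (hm : Meet F ε sgn lev K X s p q) (hpq : sgn p = sgn q)
    (hcfg : Config sgn lev K (adv F ε sgn lev K X s)) {a b c : ℤ} (hab : a < b) (hbc : b < c)
    (iL : (front F ε sgn lev K X p).image lev = Finset.Ico a b)
    (iM : (front F ε sgn lev K X q).image lev = Finset.Ico b c)
    (iP : (grp K (adv F ε sgn lev K X s) p).image lev = Finset.Ico a c) :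
    (∀ m, a ≤ m → m < b →
      slope (flux F ε (sgn p)) a b m = vel F ε sgn lev K X p * ε) ∧
    (∀ m, b ≤ m → m < c →
      slope (flux F ε (sgn p)) b c m = vel F ε sgn lev K X q * ε) ∧
    (∀ m, a ≤ m → m < c → slope (flux F ε (sgn p)) a c m =
      (vel F ε sgn lev K X p * ε * (b - a) + vel F ε sgn lev K X q * ε * (c - b)) / (c - a)) ∧
    ∀ k ∈ grp K (adv F ε sgn lev K X s) p, vel F ε sgn lev K (adv F ε sgn lev K X s) k =
      (vel F ε sgn lev K X p * ε * (b - a) + vel F ε sgn lev K X q * ε * (c - b)) / (c - a) / ε := by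
  have h1 : ∀ m, a ≤ m → m < b →
      slope (flux F ε (sgn p)) a b m = vel F ε sgn lev K X p * ε := by
    intro m h1 h2
    have : m ∈ (front F ε sgn lev K X p).image lev := by rw [iL, Finset.mem_Ico]; exact ⟨h1, h2⟩
    obtain ⟨k, hk, rfl⟩ := Finset.mem_image.1 this
    have h := hc.grpSlope_front hε hm.memL hk
    have hk' := mem_front.1 hk
    rw [grpSlope_eq iL hab, hk'.2.2, hc.same k hk'.1 p hm.memL hk'.2.1, div_eq_iff hε.ne'] at h
    exact h
  have h2 : ∀ m, b ≤ m → m < c →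
      slope (flux F ε (sgn p)) b c m = vel F ε sgn lev K X q * ε := by
    intro m h1 h2
    have : m ∈ (front F ε sgn lev K X q).image lev := by rw [iM, Finset.mem_Ico]; exact ⟨h1, h2⟩
    obtain ⟨k, hk, rfl⟩ := Finset.mem_image.1 this
    have h := hc.grpSlope_front hε hm.memR hk
    have hk' := mem_front.1 hk
    rw [grpSlope_eq iM hbc, hk'.2.2, hc.same k hk'.1 q hm.memR hk'.2.1, div_eq_iff hε.ne',
      ← hpq] at h
    exact h
  have h3 : ∀ m, a ≤ m → m < c → slope (flux F ε (sgn p)) a c m =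
      (vel F ε sgn lev K X p * ε * (b - a) + vel F ε sgn lev K X q * ε * (c - b)) / (c - a) :=
    fun m hm1 hm2 => slope_merge_const hab hbc h1 h2
      (mul_le_mul_of_nonneg_right hm.vel_lt.le hε.le) hm1 hm2
  refine ⟨h1, h2, h3, fun k hk => ?_⟩
  have hk' := mem_grp.1 hk
  have hI := mem_Ico_of_image iP hk
  rw [vel_eq iP (hab.trans hbc) hk'.2, hcfg.same k hk'.1 p hm.memL hk'.2, h3 _ hI.1 hI.2]

end

section

open scoped Classical

/-! ### Trajectories -/

/-- Time between the stages `n` and `n + 1` of a sequence of configurations. -/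
def dl (F : ℝ → ℝ) (ε : ℝ) (sgn : ℕ → ℤ) (K : ℕ → Finset ℕ) (X : ℕ → ℕ → ℝ) (n : ℕ) : ℝ :=
  delay (gridFlux F ε) (prof ε sgn (K n) (X n))

/-- Successive stages of the evolution of a configuration. -/
structure Traj (F : ℝ → ℝ) (ε : ℝ) (sgn lev : ℕ → ℤ) (K : ℕ → Finset ℕ) (X : ℕ → ℕ → ℝ) :
    Prop where
  pos : 0 < ε
  cfg : ∀ n, Config sgn lev (K n) (X n)
  succ : ∀ n, X (n + 1) = adv F ε sgn lev (K n) (X n) (dl F ε sgn K X n)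
  step : ∀ n, Step F ε sgn lev (K n) (X n) (dl F ε sgn K X n) (K (n + 1))
  quiet : ∀ n, ¬ (meetingTimes (gridFlux F ε) (prof ε sgn (K n) (X n))).Nonempty →
    K (n + 1) = K n
  meet : ∀ n, (meetingTimes (gridFlux F ε) (prof ε sgn (K n) (X n))).Nonempty →
    ∃ p q, Meet F ε sgn lev (K n) (X n) (dl F ε sgn K X n) p q ∧
      ((sgn p ≠ sgn q ∧ K (n + 1) ⊂ K n) ∨ (sgn p = sgn q ∧ K (n + 1) = K n))

variable {F : ℝ → ℝ} {ε : ℝ} {sgn lev : ℕ → ℤ} {K : ℕ → Finset ℕ} {X : ℕ → ℕ → ℝ}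

theorem Traj.dl_pos (T : Traj F ε sgn lev K X) (n : ℕ) : 0 < dl F ε sgn K X n :=
  (T.cfg n).delay_pos T.pos

theorem Traj.anti (T : Traj F ε sgn lev K X) {n m : ℕ} (h : n ≤ m) : K m ⊆ K n := by
  induction m, h using Nat.le_induction with
  | base => exact subset_rfl
  | succ m _ ih => exact (T.step m).sub.trans ih

theorem Traj.grp_succ (T : Traj F ε sgn lev K X) (n : ℕ) (hK : K (n + 1) = K n) {k : ℕ}
    (h : ∀ l ∈ K n, X (n + 1) l = X (n + 1) k →
      Fr F ε sgn lev (K n) (X n) l k) :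
    grp (K (n + 1)) (X (n + 1)) k = front F ε sgn lev (K n) (X n) k := by
  ext l
  rw [mem_grp, mem_front, hK]
  refine and_congr_right fun hl => ⟨h l hl, fun h => ?_⟩
  rw [T.succ n, h.adv_eq]

theorem Traj.vel_succ_of_simple (T : Traj F ε sgn lev K X) (n : ℕ) (hK : K (n + 1) = K n) {k : ℕ}
    (hk : k ∈ K n) (h : ∀ l ∈ K n, X (n + 1) l = X (n + 1) k →
      Fr F ε sgn lev (K n) (X n) l k) :
    vel F ε sgn lev (K (n + 1)) (X (n + 1)) k = vel F ε sgn lev (K n) (X n) k :=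
  (T.cfg n).vel_eq_of_grp_eq_front T.pos hk (T.grp_succ n hK h)

/-- Cells on a wavefront stay together if no cell is canceled. -/
theorem Traj.fr_succ (T : Traj F ε sgn lev K X) (n : ℕ) (hK : K (n + 1) = K n) {k l : ℕ}
    (hk : k ∈ K n) (hl : l ∈ K n) (h : Fr F ε sgn lev (K n) (X n) k l) :
    Fr F ε sgn lev (K (n + 1)) (X (n + 1)) k l := by
  have hX : X (n + 1) k = X (n + 1) l := by rw [T.succ n, h.adv_eq]
  refine ⟨hX, ?_⟩
  by_cases hs : ∀ m ∈ K n, X (n + 1) m = X (n + 1) k → Fr F ε sgn lev (K n) (X n) m k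
  · rw [T.vel_succ_of_simple n hK hk hs, T.vel_succ_of_simple n hK hl, h.2]
    exact fun m hm he => (hs m hm (he.trans hX.symm)).trans h
  · rcases (T.step n).simple_or_merge with hs' | ⟨-, p, q, hm, hpq⟩
    · rw [hK, ← T.succ n] at hs'
      exact absurd (fun m hm he => hs' m hm k hk he) hs
    · push Not at hs
      obtain ⟨m, hmK, he, hF⟩ := hs
      have hcfg := T.cfg (n + 1)
      rw [hK, T.succ n] at hcfg
      obtain ⟨a, b, c, hab, hbc, iL, iM, iP⟩ := hm.exists_images T.pos (T.cfg n) hcfg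
      obtain ⟨-, -, -, hv⟩ := hm.vel_adv T.pos (T.cfg n) hpq hcfg hab hbc iL iM iP
      rw [T.succ n] at he hX
      have hkp : k ∈ grp (K n) (adv F ε sgn lev (K n) (X n) (dl F ε sgn K X n)) p := by
        refine mem_grp.2 ⟨hk, ?_⟩
        rcases hm.only m hmK k hk hF he with h' | h'
        · rw [h'.2.adv_eq, hm.adv_eq]
        · exact h'.2.adv_eq _
      have hlp := mem_grp.2 ⟨hl, hX.symm.trans (mem_grp.1 hkp).2⟩
      rw [hK, T.succ n, hv k hkp, hv l hlp]

/-- Pairs of cells on the same wavefront. -/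
def frPairs (F : ℝ → ℝ) (ε : ℝ) (sgn lev : ℕ → ℤ) (K : Finset ℕ) (X : ℕ → ℝ) : Finset (ℕ × ℕ) :=
  (K ×ˢ K).filter fun p => Fr F ε sgn lev K X p.1 p.2

theorem Traj.card_frPairs_le (T : Traj F ε sgn lev K X) (n : ℕ) :
    (frPairs F ε sgn lev (K n) (X n)).card ≤ (K 0).card * (K 0).card := by
  refine (Finset.card_filter_le _ _).trans ?_
  rw [Finset.card_product]
  have := Finset.card_le_card (T.anti (Nat.zero_le n))
  gcongr

theorem Traj.frPairs_subset (T : Traj F ε sgn lev K X) (n : ℕ) (hK : K (n + 1) = K n) :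
    frPairs F ε sgn lev (K n) (X n) ⊆ frPairs F ε sgn lev (K (n + 1)) (X (n + 1)) := by
  intro p hp
  rw [frPairs, Finset.mem_filter, Finset.mem_product] at hp ⊢
  exact ⟨by rw [hK]; exact hp.1, T.fr_succ n hK hp.1.1 hp.1.2 hp.2⟩

/-- A quantity decreasing at each interaction. -/
def rank (F : ℝ → ℝ) (ε : ℝ) (sgn lev : ℕ → ℤ) (K : ℕ → Finset ℕ) (X : ℕ → ℕ → ℝ) (n : ℕ) : ℕ :=
  (K n).card * ((K 0).card * (K 0).card + 1) +
    ((K 0).card * (K 0).card + 1 - (frPairs F ε sgn lev (K n) (X n)).card)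

theorem Traj.rank_succ_le (T : Traj F ε sgn lev K X) (n : ℕ) (hK : K (n + 1) = K n) :
    rank F ε sgn lev K X (n + 1) ≤ rank F ε sgn lev K X n := by
  have := Finset.card_le_card (T.frPairs_subset n hK)
  rw [rank, rank, hK]
  rw [hK] at this
  omega

/-- The rank is lexicographic. A cancellation lowers the number of cells, which outweighs any change
in the number of pairs. A same-sign meeting keeps the cells, separates no pair and puts the pair
`(p, q)` on a common front. -/
theorem Traj.rank_succ_lt (T : Traj F ε sgn lev K X) (n : ℕ)
    (h : (meetingTimes (gridFlux F ε) (prof ε sgn (K n) (X n))).Nonempty) :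
    rank F ε sgn lev K X (n + 1) < rank F ε sgn lev K X n := by
  rw [rank, rank]
  have hb := T.card_frPairs_le n
  obtain ⟨p, q, hm, ⟨-, h⟩ | ⟨hpq, hK⟩⟩ := T.meet n h
  · have := Finset.card_lt_card h
    have h2 : ((K (n + 1)).card + 1) * ((K 0).card * (K 0).card + 1) ≤
        (K n).card * ((K 0).card * (K 0).card + 1) := Nat.mul_le_mul_right _ this
    rw [add_one_mul] at h2
    omega
  · have hlt : (frPairs F ε sgn lev (K n) (X n)).card <
        (frPairs F ε sgn lev (K (n + 1)) (X (n + 1))).card := by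
      apply Finset.card_lt_card
      rw [Finset.ssubset_iff_of_subset (T.frPairs_subset n hK)]
      have hcfg := T.cfg (n + 1)
      rw [hK, T.succ n] at hcfg
      obtain ⟨a, b, c, hab, hbc, iL, iM, iP⟩ := hm.exists_images T.pos (T.cfg n) hcfg
      obtain ⟨-, -, -, hv⟩ := hm.vel_adv T.pos (T.cfg n) hpq hcfg hab hbc iL iM iP
      refine ⟨(p, q), ?_, ?_⟩
      · rw [frPairs, Finset.mem_filter, Finset.mem_product, hK, T.succ n]
        refine ⟨⟨hm.memL, hm.memR⟩, hm.adv_eq, ?_⟩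
        simp only
        rw [hv p (mem_grp_self hm.memL), hv q (mem_grp.2 ⟨hm.memR, hm.adv_eq.symm⟩)]
      · rw [frPairs, Finset.mem_filter]
        exact fun h => hm.pos_lt.ne h.2.1
    rw [hK] at hlt ⊢
    omega

/-- The time of the stage `n`. -/
def tm (F : ℝ → ℝ) (ε : ℝ) (sgn : ℕ → ℤ) (K : ℕ → Finset ℕ) (X : ℕ → ℕ → ℝ) (n : ℕ) : ℝ :=
  ∑ i ∈ Finset.range n, dl F ε sgn K X i

theorem tm_zero : tm F ε sgn K X 0 = 0 := by simp [tm]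

theorem tm_succ (n : ℕ) : tm F ε sgn K X (n + 1) = tm F ε sgn K X n + dl F ε sgn K X n := by
  rw [tm, Finset.sum_range_succ, ← tm]

theorem Traj.tm_strictMono (T : Traj F ε sgn lev K X) : StrictMono (tm F ε sgn K X) :=
  strictMono_nat_of_lt_succ fun n => by rw [tm_succ]; linarith [T.dl_pos n]

/-- An interaction lowers the rank by at least one, and a stage without interaction lasts one unit
of time. Since the rank is a natural number, the times of the stages are unbounded: interactions do
not accumulate. -/
theorem Traj.le_tm (T : Traj F ε sgn lev K X) (n : ℕ) :
    (n : ℝ) + rank F ε sgn lev K X n ≤ tm F ε sgn K X n + rank F ε sgn lev K X 0 := by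
  induction n with
  | zero => simp [tm_zero]
  | succ n ih =>
    rw [tm_succ]
    by_cases h : (meetingTimes (gridFlux F ε) (prof ε sgn (K n) (X n))).Nonempty
    · have h1 : (rank F ε sgn lev K X (n + 1) : ℝ) + 1 ≤ rank F ε sgn lev K X n := by
        exact_mod_cast T.rank_succ_lt n h
      have h2 := T.dl_pos n
      push_cast; linarith
    · have h1 : (rank F ε sgn lev K X (n + 1) : ℝ) ≤ rank F ε sgn lev K X n := by
        exact_mod_cast T.rank_succ_le n (T.quiet n h)
      have h2 : dl F ε sgn K X n = 1 := by rw [dl, delay, if_neg h]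
      push_cast; linarith

theorem Traj.exists_lt_tm (T : Traj F ε sgn lev K X) (t : ℝ) : ∃ n, t < tm F ε sgn K X n := by
  obtain ⟨n, hn⟩ := exists_nat_gt (t + rank F ε sgn lev K X 0)
  refine ⟨n, ?_⟩
  have := T.le_tm n
  have h0 : (0 : ℝ) ≤ rank F ε sgn lev K X n := by positivity
  linarith

theorem Traj.exists_stage (T : Traj F ε sgn lev K X) {t : ℝ} (ht : 0 ≤ t) :
    ∃ n, tm F ε sgn K X n ≤ t ∧ t < tm F ε sgn K X (n + 1) := by
  have hex := T.exists_lt_tm t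
  have h1 := Nat.find_spec hex
  have h0 : Nat.find hex ≠ 0 := fun h => by
    rw [h, tm_zero] at h1; linarith
  obtain ⟨n, hn⟩ := Nat.exists_eq_succ_of_ne_zero h0
  refine ⟨n, ?_, by rw [hn] at h1; exact h1⟩
  have := Nat.find_min hex (m := n) (by omega)
  exact not_lt.1 this

/-- Cells between two surviving cells survive, if they all have the same sign. -/
theorem Traj.sandwich (T : Traj F ε sgn lev K X) {n m : ℕ} (h : n ≤ m) {i j : ℕ} (hi : i ∈ K m)
    (hj : j ∈ K m) (hs : ∀ z ∈ K n, i ≤ z → z ≤ j → sgn z = sgn i) :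
    ∀ z ∈ K n, i ≤ z → z ≤ j → z ∈ K m := by
  induction m, h using Nat.le_induction with
  | base => exact fun z hz _ _ => hz
  | succ m hm ih =>
    intro z hz h1 h2
    have h3 := ih ((T.step m).sub hi) ((T.step m).sub hj) z hz h1 h2
    exact (T.step m).sandwich i hi j hj (fun y hy => hs y (T.anti hm hy)) z h3 h1 h2

/-! ### First meeting -/

/-- The cells `i` and `j` are at the same position at the stage `m > n`. -/
def MeetAt (K : ℕ → Finset ℕ) (X : ℕ → ℕ → ℝ) (n i j m : ℕ) : Prop :=
  n < m ∧ i ∈ K m ∧ j ∈ K m ∧ X m i = X m j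

/-- First stage after `n` at which `i` and `j` are at the same position. -/
def firstMeet (K : ℕ → Finset ℕ) (X : ℕ → ℕ → ℝ) (n i j : ℕ) : ℕ :=
  if h : ∃ m, MeetAt K X n i j m then Nat.find h else 0

theorem meetAt_firstMeet {n i j : ℕ} (h : ∃ m, MeetAt K X n i j m) :
    MeetAt K X n i j (firstMeet K X n i j) := by
  rw [firstMeet, dif_pos h]; exact Nat.find_spec h

theorem firstMeet_le {n i j m : ℕ} (h : MeetAt K X n i j m) : firstMeet K X n i j ≤ m := by
  rw [firstMeet, dif_pos ⟨m, h⟩]; exact Nat.find_le h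

theorem meetAt_succ_iff {n i j m : ℕ} (h : X (n + 1) i ≠ X (n + 1) j) :
    MeetAt K X (n + 1) i j m ↔ MeetAt K X n i j m := by
  refine ⟨fun h' => ⟨by have := h'.1; omega, h'.2⟩, fun h' => ⟨?_, h'.2⟩⟩
  have h1 := h'.1
  by_contra h2
  obtain rfl : m = n + 1 := by omega
  exact h h'.2.2.2

theorem firstMeet_succ {n i j : ℕ} (h : X (n + 1) i ≠ X (n + 1) j) :
    firstMeet K X (n + 1) i j = firstMeet K X n i j := by
  have e : MeetAt K X (n + 1) i j = MeetAt K X n i j :=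
    funext fun m => propext (meetAt_succ_iff h)
  unfold firstMeet
  rw [e]

/-- Cells which are with `i` and `j` at the first meeting. -/
def meetCells (K : ℕ → Finset ℕ) (X : ℕ → ℕ → ℝ) (n i j : ℕ) : Finset ℕ :=
  grp (K (firstMeet K X n i j)) (X (firstMeet K X n i j)) i

end

section

open scoped Classical

variable {F : ℝ → ℝ} {ε : ℝ} {sgn lev : ℕ → ℤ}

/-! ### Slopes and the second derivative of the flux -/

theorem abs_deriv_two_le (hF : ContDiff ℝ 2 F) (hM : normF2 F ≠ ⊤) (x : ℝ) :
    ‖deriv (deriv F) x‖ ≤ (normF2 F).toReal := by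
  have hc : Continuous (iteratedDeriv 2 F) := hF.continuous_iteratedDeriv 2 le_rfl
  have hae : ∀ᵐ x, ‖iteratedDeriv 2 F x‖ₑ ≤ normF2 F := by
    rw [normF2, MeasureTheory.eLpNorm_exponent_top]
    exact MeasureTheory.enorm_ae_le_eLpNormEssSup _ _
  -- A set of full measure is dense, and this one is closed because `F''` is continuous; so the
  -- essential bound holds everywhere.
  have hd : Dense {x | ‖iteratedDeriv 2 F x‖ₑ ≤ normF2 F} := MeasureTheory.Measure.dense_of_ae hae
  have hcl : IsClosed {x | ‖iteratedDeriv 2 F x‖ₑ ≤ normF2 F} :=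
    isClosed_le (continuous_enorm.comp hc) continuous_const
  have hx : x ∈ {x | ‖iteratedDeriv 2 F x‖ₑ ≤ normF2 F} := by
    rw [← hcl.closure_eq, hd.closure_eq]; trivial
  rw [iteratedDeriv_succ, iteratedDeriv_one] at hx
  have := ENNReal.toReal_mono hM hx
  rwa [toReal_enorm] at this

theorem abs_deriv_sub_le (hF : ContDiff ℝ 2 F) (hM : normF2 F ≠ ⊤) (x y : ℝ) :
    ‖deriv F y - deriv F x‖ ≤ (normF2 F).toReal * ‖y - x‖ := by
  refine Convex.norm_image_sub_le_of_norm_deriv_le (s := Set.univ) (fun z _ => ?_)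
    (fun z _ => abs_deriv_two_le hF hM z) convex_univ trivial trivial
  have h1 : ContDiff ℝ 1 (deriv F) := by
    have : ContDiff ℝ (1 + 1) F := by norm_num; exact hF
    exact (contDiff_succ_iff_deriv.1 this).2.2
  exact h1.differentiable one_ne_zero z

/-- The slope is that of a chord between grid nodes, where the interpolated flux agrees with `F`.
The mean value theorem applies to `x ↦ s F (s x)`, whose derivative is `F' (s x)` because `s² = 1`.
-/
theorem exists_slope_eq_deriv (hF : Differentiable ℝ F) (hε : 0 < ε) {s : ℤ}
    (hs : s = 1 ∨ s = -1) {a b m A B : ℤ} (h₁ : a ≤ m) (h₂ : m < b) (hA : A ≤ a) (hB : b ≤ B) :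
    ∃ x : ℝ, A * ε ≤ x ∧ x ≤ B * ε ∧ slope (flux F ε s) a b m / ε = deriv F (s * x) := by
  obtain ⟨i, j, hi, him, hj, hjb, he⟩ := exists_slope_eq_chord (flux F ε s) h₁ h₂
  have hij : (i : ℝ) * ε < j * ε := by
    have : (i : ℝ) < j := by exact_mod_cast him.trans_lt hj
    gcongr
  have hij' : (i : ℝ) < j := by exact_mod_cast him.trans_lt hj
  have hG : ∀ x, HasDerivAt (fun x => (s : ℝ) * F (s * x)) (deriv F (s * x)) x := by
    intro x
    have h1 : HasDerivAt (fun x : ℝ => (s : ℝ) * x) s x := by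
      simpa using (hasDerivAt_id x).const_mul (s : ℝ)
    have h2 := ((hF (s * x)).hasDerivAt.comp x h1).const_mul (s : ℝ)
    have e : (s : ℝ) * (deriv F (s * x) * s) = deriv F (s * x) := by
      rcases hs with rfl | rfl <;> push_cast <;> ring
    rwa [e] at h2
  obtain ⟨x, hx, hx'⟩ := exists_deriv_eq_slope (fun x => (s : ℝ) * F (s * x)) hij
    (fun z _ => (hG z).continuousAt.continuousWithinAt)
    (fun z _ => (hG z).differentiableAt.differentiableWithinAt)
  have a1 : (A : ℝ) ≤ i := by exact_mod_cast hA.trans hi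
  have a2 : (j : ℝ) ≤ B := by exact_mod_cast hjb.trans hB
  refine ⟨x, by nlinarith [hx.1], by nlinarith [hx.2], ?_⟩
  rw [← (hG x).deriv, hx', he, flux, flux]
  push_cast
  rw [mul_assoc, mul_assoc, ← sub_mul, div_div]

/-- Up to the sign `s`, both slopes are values of `F'` at points of one interval of length `ε (B -
A)`. When `[A, B)` are the levels of the meeting cells, this length is the denominator of the
weight. -/
theorem slope_sub_slope_le (hF : ContDiff ℝ 2 F) (hM : normF2 F ≠ ⊤) (hε : 0 < ε) {s : ℤ}
    (hs : s = 1 ∨ s = -1) {a b m c d m' A B : ℤ} (h₁ : a ≤ m) (h₂ : m < b) (hA : A ≤ a)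
    (hB : b ≤ B) (h₁' : c ≤ m') (h₂' : m' < d) (hA' : A ≤ c) (hB' : d ≤ B) :
    slope (flux F ε s) a b m / ε - slope (flux F ε s) c d m' / ε ≤
      (normF2 F).toReal * (ε * (B - A)) := by
  have hd : Differentiable ℝ F := hF.differentiable two_ne_zero
  obtain ⟨x, hx₁, hx₂, hx⟩ := exists_slope_eq_deriv hd hε hs h₁ h₂ hA hB
  obtain ⟨y, hy₁, hy₂, hy⟩ := exists_slope_eq_deriv hd hε hs h₁' h₂' hA' hB'
  rw [hx, hy]
  refine (Real.le_norm_self _).trans ((abs_deriv_sub_le hF hM _ _).trans ?_)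
  refine mul_le_mul_of_nonneg_left ?_ ENNReal.toReal_nonneg
  have : ‖(s : ℝ) * x - s * y‖ = |x - y| := by
    rw [← mul_sub, norm_mul, Real.norm_eq_abs, Real.norm_eq_abs]
    rcases hs with rfl | rfl <;> simp
  rw [this, abs_le]
  constructor <;> linarith

/-! ### Discrete weights -/

/-- Weight of a pair of cells: `K` is the set of cells present, `γ k` the set of those at the same
position as `k`, `E` the set of cells present at the first meeting, which takes place if `P`. -/
def wt (M : ℝ≥0∞) (F : ℝ → ℝ) (ε : ℝ) (sgn lev : ℕ → ℤ) (K : Finset ℕ) (γ : ℕ → Finset ℕ)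
    (E : Finset ℕ) (P : Prop) (i j : ℕ) : ℝ≥0∞ :=
  if ∃ z ∈ K, i ≤ z ∧ z ≤ j ∧ sgn z ≠ sgn i then M
  else if j ∈ γ i ∨ ¬ P then 0
  else ENNReal.ofReal (max (grpSlope F ε sgn lev (γ i ∩ E) i - grpSlope F ε sgn lev (γ j ∩ E) j) 0 /
    (ε * E.card))

/-- A partition of `K` into runs. -/
structure Grouping (sgn : ℕ → ℤ) (K : Finset ℕ) (γ : ℕ → Finset ℕ) : Prop where
  self : ∀ k ∈ K, k ∈ γ k
  run : ∀ k ∈ K, Run sgn K (γ k)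
  symm : ∀ k ∈ K, ∀ l ∈ K, l ∈ γ k → k ∈ γ l

theorem Config.grouping_grp {K : Finset ℕ} {X : ℕ → ℝ} (hc : Config sgn lev K X) :
    Grouping sgn K (grp K X) :=
  ⟨fun _ hk => mem_grp_self hk, fun _ hk => hc.run_grp hk,
    fun _ hk _ _ h => mem_grp.2 ⟨hk, (mem_grp.1 h).2.symm⟩⟩

theorem Config.grouping_front (hε : 0 < ε) {K : Finset ℕ} {X : ℕ → ℝ}
    (hc : Config sgn lev K X) : Grouping sgn K (front F ε sgn lev K X) :=
  ⟨fun _ hk => mem_front_self hk, fun _ hk => hc.run_front hε hk,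
    fun _ hk _ _ h => mem_front.2 ⟨hk, (mem_front.1 h).2.symm⟩⟩

variable {K : ℕ → Finset ℕ} {X : ℕ → ℕ → ℝ}

/-- Weight of a pair of cells at or after the stage `n`. -/
def stageWt (M : ℝ≥0∞) (F : ℝ → ℝ) (ε : ℝ) (sgn lev : ℕ → ℤ) (K : ℕ → Finset ℕ) (X : ℕ → ℕ → ℝ)
    (n : ℕ) (γ : ℕ → Finset ℕ) (i j : ℕ) : ℝ≥0∞ :=
  wt M F ε sgn lev (K n) γ (meetCells K X n i j) (∃ m, MeetAt K X n i j m) i j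

theorem stageWt_of_sgn {M : ℝ≥0∞} {n : ℕ} {γ : ℕ → Finset ℕ} {i j : ℕ}
    (h : ∃ z ∈ K n, i ≤ z ∧ z ≤ j ∧ sgn z ≠ sgn i) :
    stageWt M F ε sgn lev K X n γ i j = M := by
  rw [stageWt, wt, if_pos h]

theorem stageWt_of_mem {M : ℝ≥0∞} {n : ℕ} {γ : ℕ → Finset ℕ} {i j : ℕ}
    (h : ¬ ∃ z ∈ K n, i ≤ z ∧ z ≤ j ∧ sgn z ≠ sgn i) (h' : j ∈ γ i) :
    stageWt M F ε sgn lev K X n γ i j = 0 := by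
  rw [stageWt, wt, if_neg h, if_pos (Or.inl h')]

theorem stageWt_of_not_meet {M : ℝ≥0∞} {n : ℕ} {γ : ℕ → Finset ℕ} {i j : ℕ}
    (h : ¬ ∃ z ∈ K n, i ≤ z ∧ z ≤ j ∧ sgn z ≠ sgn i) (h' : ¬ ∃ m, MeetAt K X n i j m) :
    stageWt M F ε sgn lev K X n γ i j = 0 := by
  rw [stageWt, wt, if_neg h, if_pos (Or.inr h')]

theorem stageWt_of_meet {M : ℝ≥0∞} {n : ℕ} {γ : ℕ → Finset ℕ} {i j : ℕ}
    (h : ¬ ∃ z ∈ K n, i ≤ z ∧ z ≤ j ∧ sgn z ≠ sgn i) (hγ : j ∉ γ i)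
    (h' : ∃ m, MeetAt K X n i j m) :
    stageWt M F ε sgn lev K X n γ i j =
      ENNReal.ofReal (max (grpSlope F ε sgn lev (γ i ∩ meetCells K X n i j) i -
        grpSlope F ε sgn lev (γ j ∩ meetCells K X n i j) j) 0 /
          (ε * (meetCells K X n i j).card)) := by
  rw [stageWt, wt, if_neg h, if_neg (by tauto)]

/-- A cell of `Γ` after `k` lies between `k` and `j`, where the sign is constant. It survives as
long as those two do (`Traj.sandwich`) and is squeezed into their position. The left set of the
weight is therefore a final segment of `Γ`, and its levels form an interval. -/
theorem Traj.left_upward (T : Traj F ε sgn lev K X) {n m i j : ℕ} {Γ : Finset ℕ}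
    (hΓ : Run sgn (K n) Γ) (hi : i ∈ Γ) (hj : j ∉ Γ) (hjK : j ∈ K n) (hij : i < j)
    (hm : MeetAt K X n i j m) (hs : ∀ z ∈ K n, i ≤ z → z ≤ j → sgn z = sgn i) :
    ∀ k ∈ Γ ∩ grp (K m) (X m) i, ∀ z ∈ Γ, k ≤ z → z ∈ Γ ∩ grp (K m) (X m) i := by
  intro k hk z hz hkz
  obtain ⟨hnm, hiK, hjm, hX⟩ := hm
  rw [Finset.mem_inter, mem_grp] at hk ⊢
  have hlt : ∀ y ∈ Γ, y < j := by
    intro y hy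
    by_contra! h
    exact hj (hΓ.convex i hi y hy j hjK hij.le h)
  have hsk : ∀ y ∈ K n, k ≤ y → y ≤ j → sgn y = sgn k := by
    intro y hy h1 h2
    rw [hΓ.const k hk.1 i hi]
    rcases le_total i y with h | h
    · exact hs y hy h h2
    · exact hΓ.const y (hΓ.convex k hk.1 i hi y hy h1 h) i hi
  have hzm := T.sandwich hnm.le hk.2.1 hjm hsk z (hΓ.subset hz) hkz (hlt z hz).le
  refine ⟨hz, hzm, le_antisymm ?_ ?_⟩
  · rw [hX]; exact (T.cfg m).mono z hzm j hjm (hlt z hz).le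
  · rw [← hk.2.2]; exact (T.cfg m).mono k hk.2.1 z hzm hkz

theorem Traj.right_downward (T : Traj F ε sgn lev K X) {n m i j : ℕ} {Γ : Finset ℕ}
    (hΓ : Run sgn (K n) Γ) (hj : j ∈ Γ) (hi : i ∉ Γ) (hiK : i ∈ K n) (hij : i < j)
    (hm : MeetAt K X n i j m) (hs : ∀ z ∈ K n, i ≤ z → z ≤ j → sgn z = sgn i) :
    ∀ k ∈ Γ ∩ grp (K m) (X m) i, ∀ z ∈ Γ, z ≤ k → z ∈ Γ ∩ grp (K m) (X m) i := by
  intro k hk z hz hkz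
  obtain ⟨hnm, him, hjm, hX⟩ := hm
  rw [Finset.mem_inter, mem_grp] at hk ⊢
  have hlt : ∀ y ∈ Γ, i < y := by
    intro y hy
    by_contra! h
    exact hi (hΓ.convex y hy j hj i hiK h hij.le)
  have hsk : ∀ y ∈ K n, i ≤ y → y ≤ k → sgn y = sgn i := by
    intro y hy h1 h2
    rcases le_total y j with h | h
    · exact hs y hy h1 h
    · rw [hΓ.const y (hΓ.convex j hj k hk.1 y hy h h2) j hj]
      exact hs j (hΓ.subset hj) hij.le le_rfl
  have hzm := T.sandwich hnm.le him hk.2.1 hsk z (hΓ.subset hz) (hlt z hz).le hkz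
  refine ⟨hz, hzm, le_antisymm ?_ ?_⟩
  · rw [← hk.2.2]; exact (T.cfg m).mono z hzm k hk.2.1 hkz
  · exact (T.cfg m).mono i him z hzm (hlt z hz).le

/-- Levels of the cells on the left side of a future interaction. -/
theorem Traj.left_image (T : Traj F ε sgn lev K X) {n m i j : ℕ} {Γ : Finset ℕ}
    (hΓ : Run sgn (K n) Γ) (hi : i ∈ Γ) (hj : j ∉ Γ) (hjK : j ∈ K n) (hij : i < j)
    (hm : MeetAt K X n i j m) (hs : ∀ z ∈ K n, i ≤ z → z ≤ j → sgn z = sgn i) {a b : ℤ}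
    (hab : Γ.image lev = Finset.Ico a b) :
    ∃ a', a ≤ a' ∧ a' ≤ lev i ∧ lev i < b ∧
      (Γ ∩ grp (K m) (X m) i).image lev = Finset.Ico a' b := by
  have hmem : i ∈ Γ ∩ grp (K m) (X m) i := Finset.mem_inter.2 ⟨hi, mem_grp_self hm.2.1⟩
  obtain ⟨a', h1, h2, h3⟩ := suffix_image hab (hΓ.strictMonoOn (T.cfg n).toPreConfig)
    Finset.inter_subset_left ⟨i, hmem⟩ (T.left_upward hΓ hi hj hjK hij hm hs)
  have := mem_Ico_of_image h3 hmem
  exact ⟨a', h1, this.1, this.2, h3⟩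

/-- Levels of the cells on the right side of a future interaction. -/
theorem Traj.right_image (T : Traj F ε sgn lev K X) {n m i j : ℕ} {Γ : Finset ℕ}
    (hΓ : Run sgn (K n) Γ) (hj : j ∈ Γ) (hi : i ∉ Γ) (hiK : i ∈ K n) (hij : i < j)
    (hm : MeetAt K X n i j m) (hs : ∀ z ∈ K n, i ≤ z → z ≤ j → sgn z = sgn i) {a b : ℤ}
    (hab : Γ.image lev = Finset.Ico a b) :
    ∃ b', b' ≤ b ∧ a ≤ lev j ∧ lev j < b' ∧
      (Γ ∩ grp (K m) (X m) i).image lev = Finset.Ico a b' := by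
  have hmem : j ∈ Γ ∩ grp (K m) (X m) i :=
    Finset.mem_inter.2 ⟨hj, mem_grp.2 ⟨hm.2.2.1, hm.2.2.2.symm⟩⟩
  obtain ⟨b', h1, h2, h3⟩ := prefix_image hab (hΓ.strictMonoOn (T.cfg n).toPreConfig)
    Finset.inter_subset_left ⟨j, hmem⟩ (T.right_downward hΓ hj hi hiK hij hm hs)
  have := mem_Ico_of_image h3 hmem
  exact ⟨b', h2, this.1, this.2, h3⟩

theorem sgn_const_of_not {n i j : ℕ} (h : ¬ ∃ z ∈ K n, i ≤ z ∧ z ≤ j ∧ sgn z ≠ sgn i) :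
    ∀ z ∈ K n, i ≤ z → z ≤ j → sgn z = sgn i := by
  intro z hz h1 h2
  by_contra h3
  exact h ⟨z, hz, h1, h2, h3⟩

/-- The left and right sets consist of cells present at the meeting, so their levels lie in the
interval of the meeting cells; `slope_sub_slope_le` then bounds the numerator by `normF2 F` times
the denominator. -/
theorem Traj.stageWt_le (T : Traj F ε sgn lev K X) (hF : ContDiff ℝ 2 F) {n : ℕ}
    {γ : ℕ → Finset ℕ} (hγ : Grouping sgn (K n) γ) {i j : ℕ} (hi : i ∈ K n) (hj : j ∈ K n)
    (hij : i < j) : stageWt (normF2 F) F ε sgn lev K X n γ i j ≤ normF2 F := by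
  by_cases hs : ∃ z ∈ K n, i ≤ z ∧ z ≤ j ∧ sgn z ≠ sgn i
  · rw [stageWt_of_sgn hs]
  by_cases hγij : j ∈ γ i
  · rw [stageWt_of_mem hs hγij]; exact zero_le
  by_cases hm : ∃ m, MeetAt K X n i j m
  swap
  · rw [stageWt_of_not_meet hs hm]; exact zero_le
  by_cases hM : normF2 F = ⊤
  · rw [hM]; exact le_top
  rw [stageWt_of_meet hs hγij hm]
  have hs' := sgn_const_of_not hs
  have hmeet := meetAt_firstMeet hm
  rw [meetCells]
  set m := firstMeet K X n i j
  have hcm := T.cfg m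
  have hγji : i ∉ γ j := fun h => hγij (hγ.symm j hj i hi h)
  obtain ⟨a, b, hab, ia⟩ := (hγ.run i hi).exists_image (T.cfg n).toPreConfig ⟨i, hγ.self i hi⟩
  obtain ⟨c, d, hcd, ic⟩ := (hγ.run j hj).exists_image (T.cfg n).toPreConfig ⟨j, hγ.self j hj⟩
  obtain ⟨a', -, a1, a2, iL⟩ := T.left_image (hγ.run i hi) (hγ.self i hi) hγij hj hij hmeet hs' ia
  obtain ⟨d', -, a3, a4, iR⟩ := T.right_image (hγ.run j hj) (hγ.self j hj) hγji hi hij hmeet hs' ic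
  obtain ⟨A, B, hAB, iE⟩ := (hcm.run_grp hmeet.2.1).exists_image hcm.toPreConfig
    ⟨i, mem_grp_self hmeet.2.1⟩
  have hcard : ((grp (K m) (X m) i).card : ℝ) = B - A := by
    rw [← Finset.card_image_of_injOn ((hcm.run_grp hmeet.2.1).strictMonoOn hcm.toPreConfig).injOn,
      iE, Int.card_Ico]
    have : (((B - A).toNat : ℕ) : ℤ) = B - A := Int.toNat_of_nonneg (by omega)
    exact_mod_cast this
  have s1 : Finset.Ico a' b ⊆ Finset.Ico A B := by
    rw [← iL, ← iE]; exact Finset.image_subset_image Finset.inter_subset_right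
  have s2 : Finset.Ico c d' ⊆ Finset.Ico A B := by
    rw [← iR, ← iE]; exact Finset.image_subset_image Finset.inter_subset_right
  rw [Finset.Ico_subset_Ico_iff (by omega)] at s1 s2
  have hBA : (0 : ℝ) < B - A := by
    have : (A : ℝ) < B := by exact_mod_cast hAB
    linarith
  rw [grpSlope_eq iL (by omega), grpSlope_eq iR (by omega), hs' j hj hij.le le_rfl, hcard]
  rw [← ENNReal.ofReal_toReal hM]
  refine ENNReal.ofReal_le_ofReal ?_
  rw [div_le_iff₀ (mul_pos T.pos hBA)]
  exact max_le (slope_sub_slope_le hF hM T.pos (hcm.sgn_eq i) a1 a2 s1.1 s1.2 a3 a4 s2.1 s2.2)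
    (mul_nonneg ENNReal.toReal_nonneg (mul_pos T.pos hBA).le)

theorem wt_ofReal_mono {x y : ℝ} (h : x ≤ y) (hε : 0 < ε) (N : ℕ) :
    ENNReal.ofReal (max x 0 / (ε * N)) ≤ ENNReal.ofReal (max y 0 / (ε * N)) :=
  ENNReal.ofReal_le_ofReal (div_le_div_of_nonneg_right (max_le_max_right _ h) (by positivity))

/-- Splitting the positions into wavefronts decreases the weights. -/
theorem Traj.stageWt_front_le (T : Traj F ε sgn lev K X) (M : ℝ≥0∞) {n : ℕ} {i j : ℕ}
    (hi : i ∈ K n) (hj : j ∈ K n) (hij : i < j) :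
    stageWt M F ε sgn lev K X n (front F ε sgn lev (K n) (X n)) i j ≤
      stageWt M F ε sgn lev K X n (grp (K n) (X n)) i j := by
  by_cases hs : ∃ z ∈ K n, i ≤ z ∧ z ≤ j ∧ sgn z ≠ sgn i
  · rw [stageWt_of_sgn hs, stageWt_of_sgn hs]
  by_cases hγij : j ∈ front F ε sgn lev (K n) (X n) i
  · rw [stageWt_of_mem hs hγij]; exact zero_le
  by_cases hm : ∃ m, MeetAt K X n i j m
  swap
  · rw [stageWt_of_not_meet hs hm]; exact zero_le
  rw [stageWt_of_meet hs hγij hm]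
  have hs' := sgn_const_of_not hs
  have hmeet := meetAt_firstMeet hm
  simp only [meetCells]
  set m := firstMeet K X n i j
  have hc := T.cfg n
  have gF : Grouping sgn (K n) (front F ε sgn lev (K n) (X n)) := hc.grouping_front T.pos
  have hγji : i ∉ front F ε sgn lev (K n) (X n) j := fun h => hγij (gF.symm j hj i hi h)
  have ia := hc.image_grp hi
  have ic := hc.image_grp hj
  obtain ⟨a₁, b₁, ha₁, hab₁, hb₁, ia₁, ca, cb⟩ := hc.exists_front_image (F := F) T.pos hi ia
  obtain ⟨c₁, d₁, hc₁, hcd₁, hd₁, ic₁, cc, cd⟩ := hc.exists_front_image (F := F) T.pos hj ic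
  set a := sgn i * below sgn (K n) (X n) (X n i)
  set b := sgn i * upto sgn (K n) (X n) (X n i)
  set c := sgn j * below sgn (K n) (X n) (X n j)
  set d := sgn j * upto sgn (K n) (X n) (X n j)
  obtain ⟨p, hp, hpi, hib, iL⟩ := T.left_image (gF.run i hi) (gF.self i hi) hγij hj hij hmeet hs' ia₁
  obtain ⟨e, he, hcj, hje, iR⟩ :=
    T.right_image (gF.run j hj) (gF.self j hj) hγji hi hij hmeet hs' ic₁
  have hsj : sgn j = sgn i := hs' j hj hij.le le_rfl
  rw [grpSlope_eq iL (by omega), grpSlope_eq iR (by omega)]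
  -- A front ends at contact points of the envelope of its group, so prolonging the interval from
  -- the end of the front to the end of the group leaves the slope unchanged.
  have e1 : slope (flux F ε (sgn i)) p b₁ (lev i) = slope (flux F ε (sgn i)) p b (lev i) :=
    slope_eq_of_contact_right (cb.mono (by omega) le_rfl) hb₁ hpi hib
  have e2 : slope (flux F ε (sgn j)) c₁ e (lev j) = slope (flux F ε (sgn j)) c e (lev j) :=
    slope_eq_of_contact_left (cc.mono le_rfl (by omega)) hc₁ hcj hje
  -- Two fronts of one group: the pair had weight zero and has to keep it. It does, because the
  -- envelope of the group already gives `i` a speed not larger than that of `j`.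
  by_cases hgrp : j ∈ grp (K n) (X n) i
  · have hX := (mem_grp.1 hgrp).2
    have eac : c = a := by simp only [a, c, hX, hsj]
    have ebd : d = b := by simp only [b, d, hX, hsj]
    have hlev : lev i ≤ lev j := ((hc.run_grp hi).strictMonoOn hc.toPreConfig).monotoneOn
      (mem_grp_self hi) hgrp hij.le
    rw [e1, e2, hsj]
    have i1 : slope (flux F ε (sgn i)) p b (lev i) ≤ slope (flux F ε (sgn i)) a b (lev i) :=
      slope_anti_left _ (by omega) hpi (by omega)
    have i2 : slope (flux F ε (sgn i)) a b (lev i) ≤ slope (flux F ε (sgn i)) a b (lev j) :=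
      slope_mono _ (by omega) hlev (by omega)
    have i3 : slope (flux F ε (sgn i)) a b (lev j) ≤ slope (flux F ε (sgn i)) c e (lev j) := by
      rw [← eac]
      exact slope_mono_right _ (by omega) (by omega) hje
    rw [max_eq_right, zero_div, ENNReal.ofReal_zero]
    · exact zero_le
    · rw [sub_nonpos]
      exact div_le_div_of_nonneg_right (i1.trans (i2.trans i3)) T.pos.le
  · rw [stageWt_of_meet hs hgrp hm]
    have gG := hc.grouping_grp
    have hgrp' : i ∉ grp (K n) (X n) j := fun h => hgrp (gG.symm j hj i hi h)
    obtain ⟨p', hp', hpi', hib', iL'⟩ :=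
      T.left_image (gG.run i hi) (gG.self i hi) hgrp hj hij hmeet hs' ia
    obtain ⟨e', he', hcj', hje', iR'⟩ :=
      T.right_image (gG.run j hj) (gG.self j hj) hgrp' hi hij hmeet hs' ic
    simp only [meetCells]
    rw [grpSlope_eq iL' (by omega), grpSlope_eq iR' (by omega)]
    -- Taking groups instead of fronts, the left interval effectively grows to the left only and the
    -- right one to the right only. This raises the speed of `i` and lowers that of `j`.
    have s1 : Finset.Ico p b₁ ⊆ Finset.Ico p' b := by
      rw [← iL, ← iL']
      exact Finset.image_subset_image (Finset.inter_subset_inter_right front_subset_grp)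
    have s2 : Finset.Ico c₁ e ⊆ Finset.Ico c e' := by
      rw [← iR, ← iR']
      exact Finset.image_subset_image (Finset.inter_subset_inter_right front_subset_grp)
    rw [Finset.Ico_subset_Ico_iff (by omega)] at s1 s2
    refine wt_ofReal_mono (sub_le_sub ?_ ?_) T.pos _
    · rw [e1]
      exact div_le_div_of_nonneg_right (slope_anti_left _ s1.1 hpi hib') T.pos.le
    · rw [e2]
      exact div_le_div_of_nonneg_right (slope_mono_right _ s2.2 hcj' hje) T.pos.le

/-- The weight of a pair does not increase at a meeting which does not involve different wavefronts
of the same sign meeting at the positions of the pair. -/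
theorem Traj.stageWt_succ_le (T : Traj F ε sgn lev K X) (hF : ContDiff ℝ 2 F) {n : ℕ} {i j : ℕ}
    (hi : i ∈ K (n + 1)) (hj : j ∈ K (n + 1)) (hij : i < j)
    (hi' : ∀ k ∈ K (n + 1), X (n + 1) k = X (n + 1) i → Fr F ε sgn lev (K n) (X n) k i)
    (hj' : ∀ k ∈ K (n + 1), X (n + 1) k = X (n + 1) j → Fr F ε sgn lev (K n) (X n) k j) :
    stageWt (normF2 F) F ε sgn lev K X (n + 1) (grp (K (n + 1)) (X (n + 1))) i j ≤
      stageWt (normF2 F) F ε sgn lev K X n (front F ε sgn lev (K n) (X n)) i j := by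
  by_cases hs : ∃ z ∈ K n, i ≤ z ∧ z ≤ j ∧ sgn z ≠ sgn i
  -- A cancellation may remove the opposite waves between `i` and `j`, but such a pair already had
  -- the largest possible weight.
  · rw [stageWt_of_sgn (n := n) hs]
    exact T.stageWt_le hF (T.cfg (n + 1)).grouping_grp hi hj hij
  have hs₁ : ¬ ∃ z ∈ K (n + 1), i ≤ z ∧ z ≤ j ∧ sgn z ≠ sgn i := by
    rintro ⟨z, hz, h⟩
    exact hs ⟨z, (T.step n).sub hz, h⟩
  by_cases hX : j ∈ grp (K (n + 1)) (X (n + 1)) i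
  · rw [stageWt_of_mem hs₁ hX]; exact zero_le
  have hX' : X (n + 1) i ≠ X (n + 1) j := fun h => hX (mem_grp.2 ⟨hj, h.symm⟩)
  by_cases hm : ∃ m, MeetAt K X (n + 1) i j m
  swap
  · rw [stageWt_of_not_meet hs₁ hm]; exact zero_le
  have hm' : ∃ m, MeetAt K X n i j m := by
    obtain ⟨m, h⟩ := hm
    exact ⟨m, (meetAt_succ_iff hX').1 h⟩
  have hFr : j ∉ front F ε sgn lev (K n) (X n) i := fun h => by
    have := (mem_front.1 h).2.adv_eq (dl F ε sgn K X n)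
    rw [← T.succ n] at this
    exact hX' this.symm
  rw [stageWt_of_meet hs₁ hX hm, stageWt_of_meet hs hFr hm']
  have hmeet := meetAt_firstMeet hm
  have hE : meetCells K X (n + 1) i j = meetCells K X n i j := by
    rw [meetCells, meetCells, firstMeet_succ hX']
  have hEsub : meetCells K X n i j ⊆ K (n + 1) := by
    rw [← hE, meetCells]
    exact (Finset.filter_subset _ _).trans (T.anti hmeet.1.le)
  -- Cells canceled at this stage are absent from the later meeting, so after intersection with the
  -- meeting cells the old front and the new group coincide.
  have hint : ∀ k, (∀ l ∈ K (n + 1), X (n + 1) l = X (n + 1) k →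
      Fr F ε sgn lev (K n) (X n) l k) → grp (K (n + 1)) (X (n + 1)) k ∩ meetCells K X n i j =
        front F ε sgn lev (K n) (X n) k ∩ meetCells K X n i j := by
    intro k hk
    ext l
    rw [Finset.mem_inter, Finset.mem_inter, mem_grp, mem_front]
    constructor
    · rintro ⟨⟨h1, h2⟩, h3⟩
      exact ⟨⟨(T.step n).sub h1, hk l h1 h2⟩, h3⟩
    · rintro ⟨⟨h1, h2⟩, h3⟩
      exact ⟨⟨hEsub h3, by rw [T.succ n, h2.adv_eq]⟩, h3⟩
  rw [hE, hint i hi', hint j hj']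

end

/-! ### Merging of wavefronts: weights against a fixed cell -/

section

open scoped Classical

variable {F : ℝ → ℝ} {ε : ℝ} {sgn lev : ℕ → ℤ} {K : ℕ → Finset ℕ} {X : ℕ → ℕ → ℝ}

theorem sum_comp_lev {G : Finset ℕ} {a b : ℤ} (hG : G.image lev = Finset.Ico a b)
    (hm : StrictMonoOn lev (G : Set ℕ)) (h : ℤ → ℝ) :
    ∑ i ∈ G, h (lev i) = ∑ m ∈ Finset.Ico a b, h m := by
  rw [← hG, Finset.sum_image hm.injOn]

theorem max_div_div (hε : 0 < ε) (y N : ℝ) :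
    max (y / ε) 0 / (ε * N) = max y 0 / (ε * (ε * N)) := by
  have : max (y / ε) 0 = max y 0 / ε := by
    rcases le_total 0 y with h | h
    · rw [max_eq_left h, max_eq_left (div_nonneg h hε.le)]
    · rw [max_eq_right h, max_eq_right (div_nonpos_of_nonpos_of_nonneg h hε.le), zero_div]
  rw [this, div_div]

/-- Wavefronts of the same sign `p`, `q` meet between the stages `n` and `n + 1`; `a`, `b`, `c` are
their levels. -/
structure MergeAt (F : ℝ → ℝ) (ε : ℝ) (sgn lev : ℕ → ℤ) (K : ℕ → Finset ℕ) (X : ℕ → ℕ → ℝ)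
    (n p q : ℕ) (a b c : ℤ) : Prop where
  meet : Meet F ε sgn lev (K n) (X n) (dl F ε sgn K X n) p q
  same : sgn p = sgn q
  keep : K (n + 1) = K n
  hab : a < b
  hbc : b < c
  imL : (front F ε sgn lev (K n) (X n) p).image lev = Finset.Ico a b
  imR : (front F ε sgn lev (K n) (X n) q).image lev = Finset.Ico b c
  im : (grp (K (n + 1)) (X (n + 1)) p).image lev = Finset.Ico a c

theorem Traj.exists_mergeAt (T : Traj F ε sgn lev K X) {n p q : ℕ}
    (hm : Meet F ε sgn lev (K n) (X n) (dl F ε sgn K X n) p q) (hs : sgn p = sgn q)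
    (hK : K (n + 1) = K n) : ∃ a b c, MergeAt F ε sgn lev K X n p q a b c := by
  have hcfg := T.cfg (n + 1)
  rw [hK, T.succ n] at hcfg
  obtain ⟨a, b, c, h1, h2, h3, h4, h5⟩ := hm.exists_images T.pos (T.cfg n) hcfg
  exact ⟨a, b, c, hm, hs, hK, h1, h2, h3, h4, by rw [hK, T.succ n]; exact h5⟩

variable {n p q : ℕ} {a b c : ℤ}

theorem MergeAt.run (T : Traj F ε sgn lev K X) (h : MergeAt F ε sgn lev K X n p q a b c) :
    Run sgn (K n) (grp (K (n + 1)) (X (n + 1)) p) := by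
  have := (T.cfg (n + 1)).run_grp (k := p) (by rw [h.keep]; exact h.meet.memL)
  rwa [h.keep] at this ⊢

theorem MergeAt.mem_grp_iff (T : Traj F ε sgn lev K X) (h : MergeAt F ε sgn lev K X n p q a b c)
    (k : ℕ) : k ∈ grp (K (n + 1)) (X (n + 1)) p ↔
      k ∈ front F ε sgn lev (K n) (X n) p ∨ k ∈ front F ε sgn lev (K n) (X n) q := by
  rw [mem_grp, h.keep, T.succ n]
  constructor
  · rintro ⟨h1, h2⟩; exact (h.meet.grp_eq h1).1 h2
  · rintro h'
    have hk : k ∈ K n := by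
      rcases h' with h' | h' <;> exact (mem_front.1 h').1
    exact ⟨hk, (h.meet.grp_eq hk).2 h'⟩

theorem MergeAt.mem_left_iff (T : Traj F ε sgn lev K X) (h : MergeAt F ε sgn lev K X n p q a b c)
    {k : ℕ} (hk : k ∈ grp (K (n + 1)) (X (n + 1)) p) :
    k ∈ front F ε sgn lev (K n) (X n) p ↔ lev k < b := by
  rcases (h.mem_grp_iff T k).1 hk with h' | h'
  · exact ⟨fun _ => (mem_Ico_of_image h.imL h').2, fun _ => h'⟩
  · have h1 := (mem_Ico_of_image h.imR h').1
    refine ⟨fun h'' => ?_, fun h'' => absurd h1 (not_le.2 h'')⟩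
    exact (mem_Ico_of_image h.imL h'').2

theorem MergeAt.mem_right_iff (T : Traj F ε sgn lev K X) (h : MergeAt F ε sgn lev K X n p q a b c)
    {k : ℕ} (hk : k ∈ grp (K (n + 1)) (X (n + 1)) p) :
    k ∈ front F ε sgn lev (K n) (X n) q ↔ b ≤ lev k := by
  rcases (h.mem_grp_iff T k).1 hk with h' | h'
  · have h1 := (mem_Ico_of_image h.imL h').2
    exact ⟨fun h'' => (mem_Ico_of_image h.imR h'').1, fun h'' => absurd h1 (not_lt.2 h'')⟩
  · exact ⟨fun _ => (mem_Ico_of_image h.imR h').1, fun _ => h'⟩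

theorem MergeAt.fr_of_notMem (T : Traj F ε sgn lev K X)
    (h : MergeAt F ε sgn lev K X n p q a b c) {j : ℕ} (hj : j ∈ K n)
    (hjP : j ∉ grp (K (n + 1)) (X (n + 1)) p) :
    ∀ l ∈ K n, X (n + 1) l = X (n + 1) j → Fr F ε sgn lev (K n) (X n) l j := by
  intro l hl he
  by_contra hF
  rw [T.succ n] at he
  rw [h.mem_grp_iff T, mem_front, mem_front] at hjP
  rcases h.meet.only l hl j hj hF he with h' | h'
  · exact hjP (Or.inr ⟨hj, h'.2⟩)
  · exact hjP (Or.inl ⟨hj, h'.2⟩)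

theorem MergeAt.front_eq_left (T : Traj F ε sgn lev K X)
    (h : MergeAt F ε sgn lev K X n p q a b c) {k : ℕ}
    (hk : k ∈ grp (K (n + 1)) (X (n + 1)) p) (hb : lev k < b) :
    front F ε sgn lev (K n) (X n) k = front F ε sgn lev (K n) (X n) p :=
  front_eq (mem_front.1 ((h.mem_left_iff T hk).2 hb)).2

theorem MergeAt.front_eq_right (T : Traj F ε sgn lev K X)
    (h : MergeAt F ε sgn lev K X n p q a b c) {k : ℕ}
    (hk : k ∈ grp (K (n + 1)) (X (n + 1)) p) (hb : b ≤ lev k) :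
    front F ε sgn lev (K n) (X n) k = front F ε sgn lev (K n) (X n) q :=
  front_eq (mem_front.1 ((h.mem_right_iff T hk).2 hb)).2

/-- Levels of the cells of one of the merging wavefronts in a set `E`. -/
theorem MergeAt.image_left (T : Traj F ε sgn lev K X)
    (h : MergeAt F ε sgn lev K X n p q a b c) {E : Finset ℕ} {u v : ℤ}
    (hE : (grp (K (n + 1)) (X (n + 1)) p ∩ E).image lev = Finset.Ico u v) :
    (front F ε sgn lev (K n) (X n) p ∩ E).image lev = Finset.Ico u (min b v) := by
  ext m
  rw [Finset.mem_Ico, lt_min_iff]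
  constructor
  · intro hm
    obtain ⟨k, hk, rfl⟩ := Finset.mem_image.1 hm
    rw [Finset.mem_inter] at hk
    have hkP := (h.mem_grp_iff T k).2 (Or.inl hk.1)
    have := mem_Ico_of_image hE (Finset.mem_inter.2 ⟨hkP, hk.2⟩)
    exact ⟨this.1, (h.mem_left_iff T hkP).1 hk.1, this.2⟩
  · rintro ⟨h1, h2, h3⟩
    have : m ∈ (grp (K (n + 1)) (X (n + 1)) p ∩ E).image lev := by
      rw [hE, Finset.mem_Ico]; exact ⟨h1, h3⟩
    obtain ⟨k, hk, rfl⟩ := Finset.mem_image.1 this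
    rw [Finset.mem_inter] at hk
    exact Finset.mem_image_of_mem _ (Finset.mem_inter.2 ⟨(h.mem_left_iff T hk.1).2 h2, hk.2⟩)

theorem MergeAt.image_right (T : Traj F ε sgn lev K X)
    (h : MergeAt F ε sgn lev K X n p q a b c) {E : Finset ℕ} {u v : ℤ}
    (hE : (grp (K (n + 1)) (X (n + 1)) p ∩ E).image lev = Finset.Ico u v) :
    (front F ε sgn lev (K n) (X n) q ∩ E).image lev = Finset.Ico (max u b) v := by
  ext m
  rw [Finset.mem_Ico, max_le_iff]
  constructor
  · intro hm
    obtain ⟨k, hk, rfl⟩ := Finset.mem_image.1 hm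
    rw [Finset.mem_inter] at hk
    have hkP := (h.mem_grp_iff T k).2 (Or.inr hk.1)
    have := mem_Ico_of_image hE (Finset.mem_inter.2 ⟨hkP, hk.2⟩)
    exact ⟨⟨this.1, (h.mem_right_iff T hkP).1 hk.1⟩, this.2⟩
  · rintro ⟨⟨h1, h2⟩, h3⟩
    have : m ∈ (grp (K (n + 1)) (X (n + 1)) p ∩ E).image lev := by
      rw [hE, Finset.mem_Ico]; exact ⟨h1, h3⟩
    obtain ⟨k, hk, rfl⟩ := Finset.mem_image.1 this
    rw [Finset.mem_inter] at hk
    exact Finset.mem_image_of_mem _ (Finset.mem_inter.2 ⟨(h.mem_right_iff T hk.1).2 h2, hk.2⟩)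

theorem firstMeet_of_not {i j : ℕ} (h : ¬ ∃ m, MeetAt K X n i j m) :
    firstMeet K X n i j = 0 := by
  rw [firstMeet, dif_neg h]

/-- Merging decreases the sum of the weights of the pairs with a given cell on the right. -/
theorem MergeAt.sum_left_le (T : Traj F ε sgn lev K X)
    (h : MergeAt F ε sgn lev K X n p q a b c) (M : ℝ≥0∞) {j : ℕ} (hj : j ∈ K n)
    (hPj : ∀ i ∈ grp (K (n + 1)) (X (n + 1)) p, i < j) :
    ∑ i ∈ grp (K (n + 1)) (X (n + 1)) p,
      stageWt M F ε sgn lev K X (n + 1) (grp (K (n + 1)) (X (n + 1))) i j ≤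
    ∑ i ∈ grp (K (n + 1)) (X (n + 1)) p,
      stageWt M F ε sgn lev K X n (front F ε sgn lev (K n) (X n)) i j := by
  set P := grp (K (n + 1)) (X (n + 1)) p with hP
  have rP : Run sgn (K n) P := h.run T
  have hpP : p ∈ P := by
    rw [hP, h.mem_grp_iff T]; exact Or.inl (mem_front_self h.meet.memL)
  have hjP : j ∉ P := fun hj' => lt_irrefl _ (hPj j hj')
  have mP := rP.strictMonoOn (T.cfg n).toPreConfig
  by_cases hex : ∃ i ∈ P, ∃ z ∈ K n, i ≤ z ∧ z ≤ j ∧ sgn z ≠ sgn i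
  -- The merged cells are a run of one sign, so an opposite wave between one of them and `j` lies
  -- between each of them and `j`.
  · obtain ⟨i₀, hi₀, z, hz, hz1, hz2, hz3⟩ := hex
    have hall : ∀ i ∈ P, ∃ z ∈ K n, i ≤ z ∧ z ≤ j ∧ sgn z ≠ sgn i := by
      intro i hi
      refine ⟨z, hz, ?_, hz2, by rw [rP.const i hi i₀ hi₀]; exact hz3⟩
      by_contra! hlt
      exact hz3 (rP.const z (rP.convex i₀ hi₀ i hi z hz hz1 hlt.le) i₀ hi₀)
    refine Finset.sum_le_sum fun i hi => ?_
    rw [stageWt_of_sgn (n := n) (hall i hi), stageWt_of_sgn]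
    rw [h.keep]; exact hall i hi
  have hs : ∀ i ∈ P, ¬ ∃ z ∈ K n, i ≤ z ∧ z ≤ j ∧ sgn z ≠ sgn i :=
    fun i hi h' => hex ⟨i, hi, h'⟩
  have hs₁ : ∀ i ∈ P, ¬ ∃ z ∈ K (n + 1), i ≤ z ∧ z ≤ j ∧ sgn z ≠ sgn i := by
    rw [h.keep]; exact hs
  have hXne : ∀ i ∈ P, X (n + 1) i ≠ X (n + 1) j := by
    intro i hi he
    refine hjP (mem_grp.2 ⟨by rw [h.keep]; exact hj, ?_⟩)
    rw [← he]; exact (mem_grp.1 hi).2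
  have hnotP : ∀ i ∈ P, j ∉ grp (K (n + 1)) (X (n + 1)) i := fun i hi hj' =>
    hXne i hi (mem_grp.1 hj').2.symm
  have hnotF : ∀ i ∈ P, j ∉ front F ε sgn lev (K n) (X n) i := fun i hi hj' => by
    have := (mem_front.1 hj').2.adv_eq (dl F ε sgn K X n)
    rw [← T.succ n] at this
    exact hXne i hi this.symm
  -- The merged cells are sorted by the stage of their first meeting with `j`: on one class the
  -- meeting cells, the denominator and the speed of `j` are common.
  rw [← Finset.sum_fiberwise_of_maps_to (s := P) (g := fun i => firstMeet K X n i j)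
      (t := P.image fun i => firstMeet K X n i j) (fun i hi => Finset.mem_image_of_mem _ hi),
    ← Finset.sum_fiberwise_of_maps_to (s := P) (g := fun i => firstMeet K X n i j)
      (t := P.image fun i => firstMeet K X n i j) (fun i hi => Finset.mem_image_of_mem _ hi)
      (f := fun i => stageWt M F ε sgn lev K X n (front F ε sgn lev (K n) (X n)) i j)]
  refine Finset.sum_le_sum fun m _ => ?_
  set G := P.filter fun i => firstMeet K X n i j = m with hG
  have hGP : G ⊆ P := Finset.filter_subset _ _
  by_cases hmeets : ∃ i ∈ G, ∃ m, MeetAt K X n i j m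
  swap
  · rw [Finset.sum_eq_zero]
    · exact zero_le
    · intro i hi
      refine stageWt_of_not_meet (hs₁ i (hGP hi)) fun ⟨m', hm'⟩ => ?_
      exact hmeets ⟨i, hi, m', (meetAt_succ_iff (hXne i (hGP hi))).1 hm'⟩
  obtain ⟨i₀, hi₀, hmeet₀⟩ := hmeets
  have hm0 : MeetAt K X n i₀ j m := by
    have := meetAt_firstMeet hmeet₀
    rwa [(Finset.mem_filter.1 hi₀).2] at this
  have hex : ∀ i ∈ G, ∃ m, MeetAt K X n i j m := by
    intro i hi
    by_contra hno
    -- Cells that never meet `j` are given the stage `0`, which is not after `n`; they cannot belong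
    -- to the class of `m`.
    have h1 := firstMeet_of_not hno
    rw [(Finset.mem_filter.1 hi).2] at h1
    have := hm0.1
    omega
  have hall : ∀ i ∈ G, MeetAt K X n i j m := by
    intro i hi
    have := meetAt_firstMeet (hex i hi)
    rwa [(Finset.mem_filter.1 hi).2] at this
  set E := grp (K m) (X m) j with hE
  have hcells : ∀ i ∈ G, meetCells K X n i j = E := by
    intro i hi
    rw [meetCells, (Finset.mem_filter.1 hi).2, hE]
    exact grp_eq (hall i hi).2.2.2
  have hconst := fun i hi => sgn_const_of_not (hs i hi)
  obtain ⟨a', ha', -, -, iH⟩ := T.left_image rP (hGP hi₀) hjP hj (hPj _ (hGP hi₀)) hm0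
    (hconst i₀ (hGP hi₀)) h.im
  rw [grp_eq hm0.2.2.2, ← hE] at iH
  have hGH : G ⊆ P ∩ E := by
    intro i hi
    exact Finset.mem_inter.2 ⟨hGP hi, mem_grp.2 ⟨(hall i hi).2.1, (hall i hi).2.2.2⟩⟩
  have mH : StrictMonoOn lev ((P ∩ E : Finset ℕ) : Set ℕ) :=
    mP.mono (by exact_mod_cast Finset.inter_subset_left)
  -- When `z ≤ k` is with `j`, so is `k`, which lies between them. Hence `z` does not meet `j`
  -- before `k` does, and the class is an initial segment of the merged cells present at the
  -- meeting.
  have hdown : ∀ k ∈ G, ∀ z ∈ P ∩ E, z ≤ k → z ∈ G := by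
    intro k hk z hz hzk
    rw [Finset.mem_inter] at hz
    have hzE := mem_grp.1 hz.2
    have hzm : MeetAt K X n z j m := ⟨hm0.1, hzE.1, hm0.2.2.1, hzE.2⟩
    refine Finset.mem_filter.2 ⟨hz.1, le_antisymm (firstMeet_le hzm) ?_⟩
    have hz' := meetAt_firstMeet ⟨m, hzm⟩
    have hkm := T.sandwich hz'.1.le hz'.2.1 hz'.2.2.1 (hconst z hz.1) k (rP.subset (hGP hk)) hzk
      (hPj k (hGP hk)).le
    rw [← (Finset.mem_filter.1 hk).2]
    refine firstMeet_le ⟨hz'.1, hkm, hz'.2.2.1, le_antisymm ?_ ?_⟩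
    · exact (T.cfg _).mono k hkm j hz'.2.2.1 (hPj k (hGP hk)).le
    · rw [← hz'.2.2.2]; exact (T.cfg _).mono z hz'.2.1 k hkm hzk
  obtain ⟨e, hae, hec, iG⟩ := prefix_image iH mH hGH ⟨i₀, hi₀⟩ hdown
  have mG : StrictMonoOn lev (G : Set ℕ) := mP.mono (by exact_mod_cast hGP)
  have hβ : ∀ i ∈ G, a' ≤ lev i ∧ lev i < e := fun i hi => mem_Ico_of_image iG hi
  have hjF := h.fr_of_notMem T hj hjP
  set r := grpSlope F ε sgn lev (front F ε sgn lev (K n) (X n) j ∩ E) j with hr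
  have hf : ∀ i ∈ G, stageWt M F ε sgn lev K X (n + 1) (grp (K (n + 1)) (X (n + 1))) i j =
      ENNReal.ofReal (max (slope (flux F ε (sgn p)) a' c (lev i) - r * ε) 0 /
        (ε * (ε * E.card))) := by
    intro i hi
    have hm' : ∃ m, MeetAt K X (n + 1) i j m :=
      ⟨m, (meetAt_succ_iff (hXne i (hGP hi))).2 (hall i hi)⟩
    rw [stageWt_of_meet (hs₁ i (hGP hi)) (hnotP i (hGP hi)) hm', meetCells,
      firstMeet_succ (hXne i (hGP hi)), ← meetCells, hcells i hi, grp_eq (mem_grp.1 (hGP hi)).2,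
      ← hP, T.grp_succ n h.keep hjF, ← hr, grpSlope_eq iH (by omega), rP.const i (hGP hi) p hpP,
      ← max_div_div T.pos, sub_div, mul_div_cancel_right₀ _ T.pos.ne']
  -- Before the merging the two envelopes are separated at `b`, or at `a'` if no cell of the left
  -- front takes part in the meeting.
  have hg : ∀ i ∈ G, stageWt M F ε sgn lev K X n (front F ε sgn lev (K n) (X n)) i j =
      ENNReal.ofReal (max (splitSlope (flux F ε (sgn p)) a' (max a' b) c (lev i) - r * ε) 0 /
        (ε * (ε * E.card))) := by
    intro i hi
    have hi' := hβ i hi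
    rw [stageWt_of_meet (hs i (hGP hi)) (hnotF i (hGP hi)) (hex i hi), hcells i hi, ← hr,
      ← max_div_div T.pos, sub_div, mul_div_cancel_right₀ _ T.pos.ne', splitSlope]
    rcases lt_or_ge (lev i) b with hb | hb
    · have := h.hbc
      rw [h.front_eq_left T (hGP hi) hb, grpSlope_eq (h.image_left T iH) (by omega),
        rP.const i (hGP hi) p hpP, if_pos (by omega), max_eq_right (by omega : a' ≤ b),
        min_eq_left (by omega)]
    · rw [h.front_eq_right T (hGP hi) hb, grpSlope_eq (h.image_right T iH) (by omega),
        rP.const i (hGP hi) p hpP, if_neg (by omega)]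
  have hnn : ∀ y : ℝ, 0 ≤ max y 0 / (ε * (ε * E.card)) := fun y =>
    div_nonneg (le_max_right _ _) (mul_nonneg T.pos.le (mul_nonneg T.pos.le (Nat.cast_nonneg _)))
  rw [Finset.sum_congr rfl hf, Finset.sum_congr rfl hg,
    ← ENNReal.ofReal_sum_of_nonneg fun i _ => hnn _,
    ← ENNReal.ofReal_sum_of_nonneg fun i _ => hnn _]
  refine ENNReal.ofReal_le_ofReal ?_
  rw [← Finset.sum_div, ← Finset.sum_div,
    sum_comp_lev iG mG fun m => max (slope (flux F ε (sgn p)) a' c m - r * ε) 0,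
    sum_comp_lev iG mG fun m =>
      max (splitSlope (flux F ε (sgn p)) a' (max a' b) c m - r * ε) 0]
  exact div_le_div_of_nonneg_right (sum_posPart_merge_le _ (le_max_left _ _)
    (max_le (by omega) h.hbc.le) hae.le hec _)
    (mul_nonneg T.pos.le (mul_nonneg T.pos.le (Nat.cast_nonneg _)))

/-- Merging decreases the sum of the weights of the pairs with a given cell on the left. -/
theorem MergeAt.sum_right_le (T : Traj F ε sgn lev K X)
    (h : MergeAt F ε sgn lev K X n p q a b c) (M : ℝ≥0∞) {i : ℕ} (hi : i ∈ K n)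
    (hPi : ∀ j ∈ grp (K (n + 1)) (X (n + 1)) p, i < j) :
    ∑ j ∈ grp (K (n + 1)) (X (n + 1)) p,
      stageWt M F ε sgn lev K X (n + 1) (grp (K (n + 1)) (X (n + 1))) i j ≤
    ∑ j ∈ grp (K (n + 1)) (X (n + 1)) p,
      stageWt M F ε sgn lev K X n (front F ε sgn lev (K n) (X n)) i j := by
  set P := grp (K (n + 1)) (X (n + 1)) p with hP
  have rP : Run sgn (K n) P := h.run T
  have hpP : p ∈ P := by
    rw [hP, h.mem_grp_iff T]; exact Or.inl (mem_front_self h.meet.memL)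
  have hiP : i ∉ P := fun hi' => lt_irrefl _ (hPi i hi')
  have mP := rP.strictMonoOn (T.cfg n).toPreConfig
  by_cases hex : ∃ j ∈ P, ∃ z ∈ K n, i ≤ z ∧ z ≤ j ∧ sgn z ≠ sgn i
  · obtain ⟨j₀, hj₀, z, hz, hz1, hz2, hz3⟩ := hex
    have hall : ∀ j ∈ P, ∃ z ∈ K n, i ≤ z ∧ z ≤ j ∧ sgn z ≠ sgn i := by
      intro j hj
      rcases le_or_gt z j with hzj | hzj
      · exact ⟨z, hz, hz1, hzj, hz3⟩
      · refine ⟨j, rP.subset hj, (hPi j hj).le, le_rfl, ?_⟩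
        rw [← rP.const z (rP.convex j hj j₀ hj₀ z hz hzj.le hz2) j hj]
        exact hz3
    refine Finset.sum_le_sum fun j hj => ?_
    rw [stageWt_of_sgn (n := n) (hall j hj), stageWt_of_sgn]
    rw [h.keep]; exact hall j hj
  have hs : ∀ j ∈ P, ¬ ∃ z ∈ K n, i ≤ z ∧ z ≤ j ∧ sgn z ≠ sgn i :=
    fun j hj h' => hex ⟨j, hj, h'⟩
  have hs₁ : ∀ j ∈ P, ¬ ∃ z ∈ K (n + 1), i ≤ z ∧ z ≤ j ∧ sgn z ≠ sgn i := by
    rw [h.keep]; exact hs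
  have hXne : ∀ j ∈ P, X (n + 1) i ≠ X (n + 1) j := by
    intro j hj he
    refine hiP (mem_grp.2 ⟨by rw [h.keep]; exact hi, ?_⟩)
    rw [he]; exact (mem_grp.1 hj).2
  have hnotP : ∀ j ∈ P, j ∉ grp (K (n + 1)) (X (n + 1)) i := fun j hj hj' =>
    hXne j hj (mem_grp.1 hj').2.symm
  have hnotF : ∀ j ∈ P, j ∉ front F ε sgn lev (K n) (X n) i := fun j hj hj' => by
    have := (mem_front.1 hj').2.adv_eq (dl F ε sgn K X n)
    rw [← T.succ n] at this
    exact hXne j hj this.symm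
  rw [← Finset.sum_fiberwise_of_maps_to (s := P) (g := fun j => firstMeet K X n i j)
      (t := P.image fun j => firstMeet K X n i j) (fun i hi => Finset.mem_image_of_mem _ hi),
    ← Finset.sum_fiberwise_of_maps_to (s := P) (g := fun j => firstMeet K X n i j)
      (t := P.image fun j => firstMeet K X n i j) (fun i hi => Finset.mem_image_of_mem _ hi)
      (f := fun j => stageWt M F ε sgn lev K X n (front F ε sgn lev (K n) (X n)) i j)]
  refine Finset.sum_le_sum fun m _ => ?_
  set G := P.filter fun j => firstMeet K X n i j = m with hG
  have hGP : G ⊆ P := Finset.filter_subset _ _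
  by_cases hmeets : ∃ j ∈ G, ∃ m, MeetAt K X n i j m
  swap
  · rw [Finset.sum_eq_zero]
    · exact zero_le
    · intro j hj
      refine stageWt_of_not_meet (hs₁ j (hGP hj)) fun ⟨m', hm'⟩ => ?_
      exact hmeets ⟨j, hj, m', (meetAt_succ_iff (hXne j (hGP hj))).1 hm'⟩
  obtain ⟨j₀, hj₀, hmeet₀⟩ := hmeets
  have hm0 : MeetAt K X n i j₀ m := by
    have := meetAt_firstMeet hmeet₀
    rwa [(Finset.mem_filter.1 hj₀).2] at this
  have hex : ∀ j ∈ G, ∃ m, MeetAt K X n i j m := by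
    intro j hj
    by_contra hno
    have h1 := firstMeet_of_not hno
    rw [(Finset.mem_filter.1 hj).2] at h1
    have := hm0.1
    omega
  have hall : ∀ j ∈ G, MeetAt K X n i j m := by
    intro j hj
    have := meetAt_firstMeet (hex j hj)
    rwa [(Finset.mem_filter.1 hj).2] at this
  set E := grp (K m) (X m) i with hE
  have hcells : ∀ j ∈ G, meetCells K X n i j = E := by
    intro j hj
    rw [meetCells, (Finset.mem_filter.1 hj).2, hE]
  have hconst := fun j hj => sgn_const_of_not (hs j hj)
  obtain ⟨c', hc', -, -, iH⟩ := T.right_image rP (hGP hj₀) hiP hi (hPi _ (hGP hj₀)) hm0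
    (hconst j₀ (hGP hj₀)) h.im
  rw [← hE] at iH
  have hGH : G ⊆ P ∩ E := by
    intro j hj
    exact Finset.mem_inter.2 ⟨hGP hj, mem_grp.2 ⟨(hall j hj).2.2.1, (hall j hj).2.2.2.symm⟩⟩
  have mH : StrictMonoOn lev ((P ∩ E : Finset ℕ) : Set ℕ) :=
    mP.mono (by exact_mod_cast Finset.inter_subset_left)
  -- Now the class is a final segment: cells nearer to `i` meet it no later than farther ones.
  have hup : ∀ k ∈ G, ∀ z ∈ P ∩ E, k ≤ z → z ∈ G := by
    intro k hk z hz hzk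
    rw [Finset.mem_inter] at hz
    have hzE := mem_grp.1 hz.2
    have hzm : MeetAt K X n i z m := ⟨hm0.1, hm0.2.1, hzE.1, hzE.2.symm⟩
    refine Finset.mem_filter.2 ⟨hz.1, le_antisymm (firstMeet_le hzm) ?_⟩
    have hz' := meetAt_firstMeet ⟨m, hzm⟩
    have hkm := T.sandwich hz'.1.le hz'.2.1 hz'.2.2.1 (hconst z hz.1) k (rP.subset (hGP hk))
      (hPi k (hGP hk)).le hzk
    rw [← (Finset.mem_filter.1 hk).2]
    refine firstMeet_le ⟨hz'.1, hz'.2.1, hkm, le_antisymm ?_ ?_⟩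
    · exact (T.cfg _).mono i hz'.2.1 k hkm (hPi k (hGP hk)).le
    · rw [hz'.2.2.2]; exact (T.cfg _).mono k hkm z hz'.2.2.1 hzk
  obtain ⟨e, hae, hec, iG⟩ := suffix_image iH mH hGH ⟨j₀, hj₀⟩ hup
  have mG : StrictMonoOn lev (G : Set ℕ) := mP.mono (by exact_mod_cast hGP)
  have hβ : ∀ j ∈ G, e ≤ lev j ∧ lev j < c' := fun i hi => mem_Ico_of_image iG hi
  have hiF := h.fr_of_notMem T hi hiP
  set r := grpSlope F ε sgn lev (front F ε sgn lev (K n) (X n) i ∩ E) i with hr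
  have hf : ∀ j ∈ G, stageWt M F ε sgn lev K X (n + 1) (grp (K (n + 1)) (X (n + 1))) i j =
      ENNReal.ofReal (max (r * ε - slope (flux F ε (sgn p)) a c' (lev j)) 0 /
        (ε * (ε * E.card))) := by
    intro j hj
    have hm' : ∃ m, MeetAt K X (n + 1) i j m :=
      ⟨m, (meetAt_succ_iff (hXne j (hGP hj))).2 (hall j hj)⟩
    rw [stageWt_of_meet (hs₁ j (hGP hj)) (hnotP j (hGP hj)) hm', meetCells,
      firstMeet_succ (hXne j (hGP hj)), ← meetCells, hcells j hj, grp_eq (mem_grp.1 (hGP hj)).2,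
      ← hP, T.grp_succ n h.keep hiF, ← hr, grpSlope_eq iH (by omega), rP.const j (hGP hj) p hpP,
      ← max_div_div T.pos, sub_div, mul_div_cancel_right₀ _ T.pos.ne']
  have hg : ∀ j ∈ G, stageWt M F ε sgn lev K X n (front F ε sgn lev (K n) (X n)) i j =
      ENNReal.ofReal (max (r * ε - splitSlope (flux F ε (sgn p)) a (min b c') c' (lev j)) 0 /
        (ε * (ε * E.card))) := by
    intro j hj
    have hj' := hβ j hj
    rw [stageWt_of_meet (hs j (hGP hj)) (hnotF j (hGP hj)) (hex j hj), hcells j hj, ← hr,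
      ← max_div_div T.pos, sub_div, mul_div_cancel_right₀ _ T.pos.ne', splitSlope]
    rcases lt_or_ge (lev j) b with hb | hb
    · rw [h.front_eq_left T (hGP hj) hb, grpSlope_eq (h.image_left T iH) (by omega),
        rP.const j (hGP hj) p hpP, if_pos (by omega)]
    · have := h.hab
      rw [h.front_eq_right T (hGP hj) hb, grpSlope_eq (h.image_right T iH) (by omega),
        rP.const j (hGP hj) p hpP, if_neg (by omega), max_eq_right (by omega : a ≤ b),
        min_eq_left (by omega)]
  have hnn : ∀ y : ℝ, 0 ≤ max y 0 / (ε * (ε * E.card)) := fun y =>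
    div_nonneg (le_max_right _ _) (mul_nonneg T.pos.le (mul_nonneg T.pos.le (Nat.cast_nonneg _)))
  rw [Finset.sum_congr rfl hf, Finset.sum_congr rfl hg,
    ← ENNReal.ofReal_sum_of_nonneg fun i _ => hnn _,
    ← ENNReal.ofReal_sum_of_nonneg fun i _ => hnn _]
  refine ENNReal.ofReal_le_ofReal ?_
  rw [← Finset.sum_div, ← Finset.sum_div,
    sum_comp_lev iG mG fun m => max (r * ε - slope (flux F ε (sgn p)) a c' m) 0,
    sum_comp_lev iG mG fun m =>
      max (r * ε - splitSlope (flux F ε (sgn p)) a (min b c') c' m) 0]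
  exact div_le_div_of_nonneg_right (sum_negPart_merge_le _ (le_min h.hab.le (by omega))
    (min_le_right _ _) hae hec.le _)
    (mul_nonneg T.pos.le (mul_nonneg T.pos.le (Nat.cast_nonneg _)))

end

/-! ### The sum of the weights over all pairs of cells -/

section

open scoped Classical

variable {F : ℝ → ℝ} {ε : ℝ} {sgn lev : ℕ → ℤ} {K : ℕ → Finset ℕ} {X : ℕ → ℕ → ℝ}

/-- Pairs inside the block `P` provide the gain `D`, mixed pairs are comparable only after summation
over `P`, and the remaining ones are compared one by one. -/
theorem sum_sum_le_of_block {A P : Finset ℕ} (hP : P ⊆ A) {f g : ℕ → ℕ → ℝ≥0∞} {D : ℝ≥0∞}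
    (h₁ : ∑ i ∈ P, ∑ j ∈ P, f i j + D ≤ ∑ i ∈ P, ∑ j ∈ P, g i j)
    (h₂ : ∀ j ∈ A, j ∉ P → ∑ i ∈ P, f i j ≤ ∑ i ∈ P, g i j)
    (h₃ : ∀ i ∈ A, i ∉ P → ∑ j ∈ P, f i j ≤ ∑ j ∈ P, g i j)
    (h₄ : ∀ i ∈ A, i ∉ P → ∀ j ∈ A, j ∉ P → f i j ≤ g i j) :
    ∑ i ∈ A, ∑ j ∈ A, f i j + D ≤ ∑ i ∈ A, ∑ j ∈ A, g i j := by
  have key : ∀ f : ℕ → ℕ → ℝ≥0∞, ∑ i ∈ A, ∑ j ∈ A, f i j =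
      ∑ i ∈ P, ∑ j ∈ P, f i j + ∑ j ∈ A \ P, ∑ i ∈ P, f i j + ∑ i ∈ A \ P, ∑ j ∈ P, f i j +
        ∑ i ∈ A \ P, ∑ j ∈ A \ P, f i j := by
    intro f
    have h : ∀ i, ∑ j ∈ A, f i j = ∑ j ∈ A \ P, f i j + ∑ j ∈ P, f i j := fun i =>
      (Finset.sum_sdiff hP).symm
    rw [← Finset.sum_sdiff hP]
    simp only [h, Finset.sum_add_distrib]
    rw [Finset.sum_comm (s := P) (t := A \ P)]
    ring
  rw [key f, key g]
  have e2 : ∑ j ∈ A \ P, ∑ i ∈ P, f i j ≤ ∑ j ∈ A \ P, ∑ i ∈ P, g i j :=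
    Finset.sum_le_sum fun j hj => h₂ j (Finset.mem_sdiff.1 hj).1 (Finset.mem_sdiff.1 hj).2
  have e3 : ∑ i ∈ A \ P, ∑ j ∈ P, f i j ≤ ∑ i ∈ A \ P, ∑ j ∈ P, g i j :=
    Finset.sum_le_sum fun j hj => h₃ j (Finset.mem_sdiff.1 hj).1 (Finset.mem_sdiff.1 hj).2
  have e4 : ∑ i ∈ A \ P, ∑ j ∈ A \ P, f i j ≤ ∑ i ∈ A \ P, ∑ j ∈ A \ P, g i j :=
    Finset.sum_le_sum fun i hi => Finset.sum_le_sum fun j hj =>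
      h₄ i (Finset.mem_sdiff.1 hi).1 (Finset.mem_sdiff.1 hi).2 j (Finset.mem_sdiff.1 hj).1
        (Finset.mem_sdiff.1 hj).2
  calc _ = (∑ i ∈ P, ∑ j ∈ P, f i j + D) + ∑ j ∈ A \ P, ∑ i ∈ P, f i j +
        ∑ i ∈ A \ P, ∑ j ∈ P, f i j + ∑ i ∈ A \ P, ∑ j ∈ A \ P, f i j := by ring
    _ ≤ _ := add_le_add (add_le_add (add_le_add h₁ e2) e3) e4

/-- The sum of the weights of all pairs of cells, when the cells at the same position as `k` are
those in `γ k`. -/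
def potSum (F : ℝ → ℝ) (ε : ℝ) (sgn lev : ℕ → ℤ) (K : ℕ → Finset ℕ) (X : ℕ → ℕ → ℝ) (n : ℕ)
    (γ : ℕ → Finset ℕ) : ℝ≥0∞ :=
  ∑ i ∈ K n, ∑ j ∈ K n, if i < j then stageWt (normF2 F) F ε sgn lev K X n γ i j else 0

theorem potSum_eq {n : ℕ} {A : Finset ℕ} (hA : K n = A) (γ : ℕ → Finset ℕ) :
    potSum F ε sgn lev K X n γ =
      ∑ i ∈ A, ∑ j ∈ A, if i < j then stageWt (normF2 F) F ε sgn lev K X n γ i j else 0 := by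
  rw [potSum, hA]

theorem Traj.potSum_front_le (T : Traj F ε sgn lev K X) (n : ℕ) :
    potSum F ε sgn lev K X n (front F ε sgn lev (K n) (X n)) ≤
      potSum F ε sgn lev K X n (grp (K n) (X n)) := by
  refine Finset.sum_le_sum fun i hi => Finset.sum_le_sum fun j hj => ?_
  split_ifs with h
  · exact T.stageWt_front_le _ hi hj h
  · exact le_rfl

theorem Traj.potSum_succ_le_of_simple (T : Traj F ε sgn lev K X) (hF : ContDiff ℝ 2 F) {n : ℕ}
    (hs : ∀ k ∈ K (n + 1), ∀ l ∈ K (n + 1), X (n + 1) k = X (n + 1) l →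
      Fr F ε sgn lev (K n) (X n) k l) :
    potSum F ε sgn lev K X (n + 1) (grp (K (n + 1)) (X (n + 1))) ≤
      potSum F ε sgn lev K X n (front F ε sgn lev (K n) (X n)) := by
  rw [potSum, potSum]
  refine (Finset.sum_le_sum fun i hi => Finset.sum_le_sum fun j hj => ?_).trans
    ((Finset.sum_le_sum fun i _ => Finset.sum_le_sum_of_subset (T.step n).sub).trans
      (Finset.sum_le_sum_of_subset (T.step n).sub))
  split_ifs with h
  · exact T.stageWt_succ_le hF hi hj h (fun k hk => hs k hk i hi) (fun k hk => hs k hk j hj)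
  · exact le_rfl

variable {n p q : ℕ} {a b c : ℤ}

theorem MergeAt.grp_eq_of_mem (_ : MergeAt F ε sgn lev K X n p q a b c) {i : ℕ}
    (hi : i ∈ grp (K (n + 1)) (X (n + 1)) p) :
    grp (K (n + 1)) (X (n + 1)) i = grp (K (n + 1)) (X (n + 1)) p :=
  WaveTracking.grp_eq (mem_grp.1 hi).2

/-- The weight of a pair of cells on the two merging wavefronts. -/
theorem MergeAt.stageWt_eq (T : Traj F ε sgn lev K X) (h : MergeAt F ε sgn lev K X n p q a b c)
    (M : ℝ≥0∞) {i j : ℕ} (hi : i ∈ front F ε sgn lev (K n) (X n) p)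
    (hj : j ∈ front F ε sgn lev (K n) (X n) q) :
    stageWt M F ε sgn lev K X n (front F ε sgn lev (K n) (X n)) i j = ENNReal.ofReal
      ((vel F ε sgn lev (K n) (X n) p - vel F ε sgn lev (K n) (X n) q) / (ε * (c - a))) := by
  have hiP := (h.mem_grp_iff T i).2 (Or.inl hi)
  have hjP := (h.mem_grp_iff T j).2 (Or.inr hj)
  have rP := h.run T
  have hiP' := mem_grp.1 hiP
  have hjP' := mem_grp.1 hjP
  have hm : MeetAt K X n i j (n + 1) :=
    ⟨n.lt_succ_self, hiP'.1, hjP'.1, hiP'.2.trans hjP'.2.symm⟩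
  have hfm : firstMeet K X n i j = n + 1 := by
    have h1 := firstMeet_le hm
    have h2 := (meetAt_firstMeet ⟨_, hm⟩).1
    omega
  have hs : ¬ ∃ z ∈ K n, i ≤ z ∧ z ≤ j ∧ sgn z ≠ sgn i := by
    rintro ⟨z, hz, h1, h2, h3⟩
    exact h3 (rP.const z (rP.convex i hiP j hjP z hz h1 h2) i hiP)
  have hi' := mem_front.1 hi
  have hj' := mem_front.1 hj
  have hne : j ∉ front F ε sgn lev (K n) (X n) i := fun h' => by
    have h1 := (mem_front.1 h').2.1
    rw [hj'.2.1, hi'.2.1] at h1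
    exact h.meet.pos_lt.ne h1.symm
  have hcard : ((grp (K (n + 1)) (X (n + 1)) p).card : ℝ) = c - a := by
    rw [← Finset.card_image_of_injOn (rP.strictMonoOn (T.cfg n).toPreConfig).injOn, h.im,
      Int.card_Ico]
    have h1 := h.hab
    have h2 := h.hbc
    have : (((c - a).toNat : ℕ) : ℤ) = c - a := Int.toNat_of_nonneg (by omega)
    exact_mod_cast this
  have sL : front F ε sgn lev (K n) (X n) p ⊆ grp (K (n + 1)) (X (n + 1)) p := fun k hk =>
    (h.mem_grp_iff T k).2 (Or.inl hk)
  have sR : front F ε sgn lev (K n) (X n) q ⊆ grp (K (n + 1)) (X (n + 1)) p := fun k hk =>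
    (h.mem_grp_iff T k).2 (Or.inr hk)
  rw [stageWt_of_meet hs hne ⟨_, hm⟩, meetCells, hfm, h.grp_eq_of_mem hiP, front_eq hi'.2,
    front_eq hj'.2, Finset.inter_eq_left.2 sL, Finset.inter_eq_left.2 sR, hcard,
    (T.cfg n).grpSlope_front T.pos h.meet.memL hi, (T.cfg n).grpSlope_front T.pos h.meet.memR hj,
    hi'.2.2, hj'.2.2, max_eq_left (sub_nonneg.2 h.meet.vel_lt.le)]

/-- The decrease of the sum of the weights when two wavefronts merge. -/
theorem MergeAt.potSum_succ_add_le (T : Traj F ε sgn lev K X) (hF : ContDiff ℝ 2 F)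
    (h : MergeAt F ε sgn lev K X n p q a b c) :
    potSum F ε sgn lev K X (n + 1) (grp (K (n + 1)) (X (n + 1))) +
      ENNReal.ofReal ((b - a) * (c - b) *
        ((vel F ε sgn lev (K n) (X n) p - vel F ε sgn lev (K n) (X n) q) / (ε * (c - a)))) ≤
      potSum F ε sgn lev K X n (front F ε sgn lev (K n) (X n)) := by
  have rP := h.run T
  have hP : grp (K (n + 1)) (X (n + 1)) p ⊆ K n := rP.subset
  -- The merged cells form a run, so any other cell is on one side of all of them.
  have side : ∀ j ∈ K n, j ∉ grp (K (n + 1)) (X (n + 1)) p →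
      (∀ i ∈ grp (K (n + 1)) (X (n + 1)) p, i < j) ∨
      (∀ i ∈ grp (K (n + 1)) (X (n + 1)) p, j < i) := by
    intro j hj hjP
    by_contra! hcon
    obtain ⟨⟨i, hi, h1⟩, i', hi', h2⟩ := hcon
    exact hjP (rP.convex i' hi' i hi j hj h2 h1)
  rw [potSum_eq h.keep, potSum]
  refine sum_sum_le_of_block hP ?_ ?_ ?_ ?_
  -- After the merging all pairs inside the block have weight zero. Before it, the `(b - a) (c - b)`
  -- pairs with one cell on each front have a common weight, and this is the gain.
  · rw [Finset.sum_eq_zero, zero_add]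
    · have sL : front F ε sgn lev (K n) (X n) p ⊆ grp (K (n + 1)) (X (n + 1)) p := fun k hk =>
        (h.mem_grp_iff T k).2 (Or.inl hk)
      have sR : front F ε sgn lev (K n) (X n) q ⊆ grp (K (n + 1)) (X (n + 1)) p := fun k hk =>
        (h.mem_grp_iff T k).2 (Or.inr hk)
      refine le_trans (le_of_eq ?_) ((Finset.sum_le_sum fun i _ =>
        Finset.sum_le_sum_of_subset sR).trans (Finset.sum_le_sum_of_subset sL))
      rw [Finset.sum_congr rfl fun i hi => Finset.sum_congr rfl fun j hj => by
        rw [if_pos (h.meet.lt_of_mem (T.cfg n) hi hj), h.stageWt_eq T _ hi hj]]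
      rw [Finset.sum_const, Finset.sum_const, ← Finset.card_image_of_injOn
        (((T.cfg n).run_front T.pos h.meet.memL).strictMonoOn (T.cfg n).toPreConfig).injOn,
        ← Finset.card_image_of_injOn
        (((T.cfg n).run_front T.pos h.meet.memR).strictMonoOn (T.cfg n).toPreConfig).injOn,
        h.imL, h.imR, Int.card_Ico, Int.card_Ico, smul_smul, nsmul_eq_mul,
        ← ENNReal.ofReal_natCast, ← ENNReal.ofReal_mul (Nat.cast_nonneg _)]
      have e1 : (((b - a).toNat : ℕ) : ℤ) = b - a := Int.toNat_of_nonneg (by have := h.hab; omega)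
      have e2 : (((c - b).toNat : ℕ) : ℤ) = c - b := Int.toNat_of_nonneg (by have := h.hbc; omega)
      have e1' : (((b - a).toNat : ℕ) : ℝ) = b - a := by exact_mod_cast e1
      have e2' : (((c - b).toNat : ℕ) : ℝ) = c - b := by exact_mod_cast e2
      rw [Nat.cast_mul, e1', e2']
    · intro i hi
      refine Finset.sum_eq_zero fun j hj => ?_
      split_ifs with hij
      · refine stageWt_of_mem ?_ ?_
        · rintro ⟨z, hz, h1, h2, h3⟩
          rw [h.keep] at hz
          exact h3 (rP.const z (rP.convex i hi j hj z hz h1 h2) i hi)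
        · rw [h.grp_eq_of_mem hi]; exact hj
      · rfl
  · intro j hj hjP
    rcases side j hj hjP with hs | hs
    · rw [Finset.sum_congr rfl fun i hi => if_pos (hs i hi),
        Finset.sum_congr rfl fun i hi => if_pos (hs i hi)]
      exact h.sum_left_le T _ hj hs
    · rw [Finset.sum_congr rfl fun i hi => if_neg (hs i hi).not_gt,
        Finset.sum_congr rfl fun i hi => if_neg (hs i hi).not_gt]
  · intro i hi hiP
    rcases side i hi hiP with hs | hs
    · rw [Finset.sum_congr rfl fun j hj => if_neg (hs j hj).not_gt,
        Finset.sum_congr rfl fun j hj => if_neg (hs j hj).not_gt]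
    · rw [Finset.sum_congr rfl fun j hj => if_pos (hs j hj),
        Finset.sum_congr rfl fun j hj => if_pos (hs j hj)]
      exact h.sum_right_le T _ hi hs
  · intro i hi hiP j hj hjP
    split_ifs with hij
    · refine T.stageWt_succ_le hF (by rw [h.keep]; exact hi) (by rw [h.keep]; exact hj) hij ?_ ?_
      · rw [h.keep]; exact h.fr_of_notMem T hi hiP
      · rw [h.keep]; exact h.fr_of_notMem T hj hjP
    · exact le_rfl

theorem Traj.potSum_succ_le (T : Traj F ε sgn lev K X) (hF : ContDiff ℝ 2 F) (n : ℕ) :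
    potSum F ε sgn lev K X (n + 1) (grp (K (n + 1)) (X (n + 1))) ≤
      potSum F ε sgn lev K X n (front F ε sgn lev (K n) (X n)) := by
  rcases (T.step n).simple_or_merge with hs | ⟨hK, p, q, hm, hpq⟩
  · rw [← T.succ n] at hs
    exact T.potSum_succ_le_of_simple hF hs
  · obtain ⟨a, b, c, h⟩ := T.exists_mergeAt hm hpq hK
    exact le_self_add.trans (h.potSum_succ_add_le T hF)

theorem Traj.potSum_grp_antitone (T : Traj F ε sgn lev K X) (hF : ContDiff ℝ 2 F) :
    Antitone fun n => potSum F ε sgn lev K X n (grp (K n) (X n)) :=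
  antitone_nat_of_succ_le fun n => (T.potSum_succ_le hF n).trans (T.potSum_front_le n)

theorem Traj.potSum_le (T : Traj F ε sgn lev K X) (hF : ContDiff ℝ 2 F) (n : ℕ) :
    potSum F ε sgn lev K X n (grp (K n) (X n)) ≤
      ∑ i ∈ K n, ∑ j ∈ K n, if i < j then normF2 F else 0 := by
  refine Finset.sum_le_sum fun i hi => Finset.sum_le_sum fun j hj => ?_
  split_ifs with h
  · exact T.stageWt_le hF (T.cfg n).grouping_grp hi hj h
  · exact le_rfl

end

section

open scoped Classical

variable {u : ℝ → ℝ} {ε : ℝ}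

/-! ### The cells of the initial datum -/

/-- Distances between values are integer multiples of `ε`, hence so are the sums defining the
variation, and a bounded set of natural numbers attains its supremum. -/
theorem exists_eVariationOn_eq (hε : 0 < ε) (hg : ∀ x, ∃ k : ℤ, u x = k * ε) {s : Set ℝ}
    (hs : s.Nonempty) (hf : eVariationOn u s ≠ ⊤) :
    ∃ m : ℕ, eVariationOn u s = m * ENNReal.ofReal ε := by
  have hed : ∀ x y, ∃ m : ℕ, edist (u x) (u y) = m * ENNReal.ofReal ε := by
    intro x y
    obtain ⟨k, hk⟩ := hg x
    obtain ⟨l, hl⟩ := hg y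
    refine ⟨(k - l).natAbs, ?_⟩
    rw [edist_dist, Real.dist_eq, hk, hl, ← sub_mul, abs_mul, abs_of_pos hε,
      ENNReal.ofReal_mul (abs_nonneg _), ← ENNReal.ofReal_natCast]
    congr 2
    rw [Nat.cast_natAbs]
    push_cast; rfl
  choose d hd using hed
  set m : ℕ × { v : ℕ → ℝ // Monotone v ∧ ∀ i, v i ∈ s } → ℕ := fun p =>
    ∑ i ∈ Finset.range p.1, d (p.2.1 (i + 1)) (p.2.1 i) with hm
  have hsum : ∀ p : ℕ × { v : ℕ → ℝ // Monotone v ∧ ∀ i, v i ∈ s },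
      ∑ i ∈ Finset.range p.1, edist (u (p.2.1 (i + 1))) (u (p.2.1 i)) =
        m p * ENNReal.ofReal ε := by
    intro p
    rw [hm, Nat.cast_sum, Finset.sum_mul]
    exact Finset.sum_congr rfl fun i _ => hd _ _
  have hle : ∀ p, (m p : ℝ≥0∞) * ENNReal.ofReal ε ≤ eVariationOn u s := fun p => by
    rw [← hsum p]
    exact le_iSup (fun p : ℕ × { v : ℕ → ℝ // Monotone v ∧ ∀ i, v i ∈ s } =>
      ∑ i ∈ Finset.range p.1, edist (u (p.2.1 (i + 1))) (u (p.2.1 i))) p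
  have hbdd : BddAbove (Set.range m) := by
    obtain ⟨B, hB⟩ := exists_nat_gt ((eVariationOn u s).toReal / ε)
    refine ⟨B, ?_⟩
    rintro _ ⟨p, rfl⟩
    have h1 := ENNReal.toReal_mono hf (hle p)
    rw [ENNReal.toReal_mul, ENNReal.toReal_natCast, ENNReal.toReal_ofReal hε.le] at h1
    rw [div_lt_iff₀ hε] at hB
    have := h1.trans_lt hB
    have h2 : (m p : ℝ) < B := lt_of_mul_lt_mul_right this hε.le
    exact_mod_cast h2.le
  obtain ⟨x, hx⟩ := hs
  have hne : (Set.range m).Nonempty := ⟨_, (0, ⟨fun _ => x, monotone_const, fun _ => hx⟩), rfl⟩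
  obtain ⟨p, hp⟩ := Nat.sSup_mem hne hbdd
  refine ⟨m p, le_antisymm (iSup_le fun p' => ?_) (hle p)⟩
  rw [hsum p', hp]
  gcongr
  exact le_csSup hbdd ⟨p', rfl⟩

/-- Total variation of a grid valued function on the left of `x`, in units of the mesh size. -/
theorem exists_count (hε : 0 < ε) (hg : ∀ x, ∃ k : ℤ, u x = k * ε) (hf : totalVar u ≠ ⊤) :
    ∃ n : ℝ → ℕ, ∀ x, eVariationOn u (Set.Iic x) = n x * ENNReal.ofReal ε := by
  have := fun x => exists_eVariationOn_eq hε hg (s := Set.Iic x) ⟨x, Set.mem_Iic.2 le_rfl⟩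
    (ne_top_of_le_ne_top hf (eVariationOn.mono u (Set.subset_univ _)))
  exact ⟨fun x => (this x).choose, fun x => (this x).choose_spec⟩

theorem natCast_mul_inj {ε : ℝ} (hε : 0 < ε) {m n : ℕ}
    (h : (m : ℝ≥0∞) * ENNReal.ofReal ε = n * ENNReal.ofReal ε) : m = n := by
  have := congrArg ENNReal.toReal h
  rw [ENNReal.toReal_mul, ENNReal.toReal_mul, ENNReal.toReal_natCast, ENNReal.toReal_natCast,
    ENNReal.toReal_ofReal hε.le] at this
  exact_mod_cast mul_right_cancel₀ hε.ne' this

theorem natCast_mul_le {ε : ℝ} (hε : 0 < ε) {m n : ℕ}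
    (h : (m : ℝ≥0∞) * ENNReal.ofReal ε ≤ n * ENNReal.ofReal ε) : m ≤ n := by
  by_contra! hlt
  have h1 : (n : ℝ≥0∞) * ENNReal.ofReal ε ≤ m * ENNReal.ofReal ε := by
    gcongr
  exact hlt.ne' (natCast_mul_inj hε (le_antisymm h h1))

/-- Decomposition of a compactly supported, right continuous, grid valued function of bounded
variation into jumps of the size of the mesh. -/
theorem exists_cells (hε : 0 < ε) (hr : ∀ x, ContinuousWithinAt u (Set.Ici x) x)
    (hc : HasCompactSupport u) (hg : ∀ x, ∃ k : ℤ, u x = k * ε) (hf : totalVar u ≠ ⊤) :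
    ∃ (N : ℕ) (X : ℕ → ℝ) (sgn : ℕ → ℤ), (∀ k, sgn k = 1 ∨ sgn k = -1) ∧
      (totalVar u).toReal = N * ε ∧
      (∀ k < N, ∀ w, k * ε < w → w ≤ (k + 1) * ε →
        initialPos u w = X k ∧ waveSign u w = sgn k) ∧
      u = prof ε sgn (Finset.range N) X ∧ (∀ k l, k ≤ l → l < N → X k ≤ X l) ∧
      ∀ k l, k < N → l < N → X k = X l → sgn k = sgn l := by
  obtain ⟨n, hn⟩ := exists_count hε hg hf
  obtain ⟨N, hN⟩ := exists_eVariationOn_eq hε hg Set.univ_nonempty hf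
  obtain ⟨R, hR⟩ := hc.isBounded.subset_closedBall 0
  have hzero : ∀ x, R < |x| → u x = 0 := by
    intro x hx
    by_contra h
    have := hR (subset_tsupport _ (Function.mem_support.2 h))
    rw [mem_closedBall_zero_iff, Real.norm_eq_abs] at this
    linarith
  have hmono : Monotone n := fun x y hxy => natCast_mul_le hε (by
    rw [← hn, ← hn]; exact eVariationOn.mono u (Set.Iic_subset_Iic.2 hxy))
  have hadd : ∀ x y, x ≤ y → (n y : ℝ≥0∞) * ENNReal.ofReal ε =
      n x * ENNReal.ofReal ε + eVariationOn u (Set.Icc x y) := by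
    intro x y hxy
    rw [← hn, ← hn, ← Set.Iic_union_Icc_eq_Iic hxy]
    exact eVariationOn.union u isGreatest_Iic (isLeast_Icc hxy)
  have hconst : ∀ x y, x ≤ y → n x = n y → ∀ z, x ≤ z → z ≤ y → u z = u x := by
    intro x y hxy he z h1 h2
    have h := hadd x y hxy
    rw [he] at h
    have h0 : eVariationOn u (Set.Icc x y) = 0 := by
      have hfin : (n y : ℝ≥0∞) * ENNReal.ofReal ε ≠ ⊤ :=
        ENNReal.mul_ne_top (ENNReal.natCast_ne_top _) ENNReal.ofReal_ne_top
      conv_lhs at h => rw [← add_zero ((n y : ℝ≥0∞) * ENNReal.ofReal ε)]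
      exact ((ENNReal.add_right_inj hfin).1 h).symm
    exact edist_eq_zero.1 ((eVariationOn.eq_zero_iff u).1 h0 z ⟨h1, h2⟩ x ⟨le_rfl, hxy⟩)
  have hlow : ∀ x, x < -R → n x = 0 := by
    intro x hx
    refine natCast_mul_inj hε ?_
    rw [← hn, Nat.cast_zero, zero_mul]
    refine eVariationOn.constant_on ?_
    rintro _ ⟨y, hy, rfl⟩ _ ⟨z, hz, rfl⟩
    have hy' : y ≤ x := hy
    have hz' : z ≤ x := hz
    rw [hzero y, hzero z]
    · rw [lt_abs]; right; linarith
    · rw [lt_abs]; right; linarith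
  have hhigh : ∀ x, R < x → n x = N := by
    intro x hx
    refine natCast_mul_inj hε ?_
    rw [← hn, ← hN, ← Set.Iic_union_Ici (a := x), eVariationOn.union u isGreatest_Iic isLeast_Ici,
      eVariationOn.constant_on (s := Set.Ici x), add_zero]
    rintro _ ⟨y, hy, rfl⟩ _ ⟨z, hz, rfl⟩
    have hy' : x ≤ y := hy
    have hz' : x ≤ z := hz
    rw [hzero y, hzero z]
    · rw [lt_abs]; left; linarith
    · rw [lt_abs]; left; linarith
  have hnN : ∀ x, n x ≤ N := fun x => natCast_mul_le hε (by
    rw [← hn, ← hN]; exact eVariationOn.mono u (Set.subset_univ _))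
  -- A right continuous function with values in the grid is constant on a short interval to the
  -- right of each point, and so is the count.
  have hright : ∀ x, ∃ y, x < y ∧ n y = n x := by
    intro x
    have h1 : ∀ᶠ y in nhdsWithin x (Set.Ici x), |u y - u x| < ε := by
      have := (hr x).tendsto.eventually (Metric.ball_mem_nhds (u x) hε)
      simpa [Real.dist_eq] using this
    obtain ⟨y, hxy, hy⟩ := mem_nhdsGE_iff_exists_Ico_subset.1 h1
    refine ⟨(x + y) / 2, by simp only [Set.mem_Ioi] at hxy; linarith, ?_⟩
    simp only [Set.mem_Ioi] at hxy
    have h0 : eVariationOn u (Set.Icc x ((x + y) / 2)) = 0 := by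
      have huc : ∀ z ∈ Set.Icc x ((x + y) / 2), u z = u x := by
        intro z hz
        have h2 : |u z - u x| < ε := hy ⟨hz.1, by linarith [hz.2]⟩
        obtain ⟨k, hk⟩ := hg z
        obtain ⟨l, hl⟩ := hg x
        rw [hk, hl, ← sub_mul, abs_mul, abs_of_pos hε] at h2
        have h3 : |(k : ℝ) - l| < 1 := by
          by_contra! h
          nlinarith
        have h4 : |k - l| < 1 := by exact_mod_cast h3
        rw [Int.abs_lt_one_iff, sub_eq_zero] at h4
        rw [hk, hl, h4]
      refine eVariationOn.constant_on ?_
      rintro _ ⟨y, hy, rfl⟩ _ ⟨z, hz, rfl⟩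
      rw [huc y hy, huc z hz]
    have := hadd x ((x + y) / 2) (by linarith)
    rw [h0, add_zero] at this
    exact natCast_mul_inj hε this
  -- The cell `k` sits where the count first reaches `k + 1`; the infimum is attained because the
  -- count is constant to the right of each point.
  set X : ℕ → ℝ := fun k => sInf {x | k + 1 ≤ n x} with hX
  have hXiff : ∀ k < N, ∀ x, k + 1 ≤ n x ↔ X k ≤ x := by
    intro k hk x
    have hbdd : BddBelow {x | k + 1 ≤ n x} := ⟨-R, fun y hy => by
      by_contra! h
      have h1 : k + 1 ≤ n y := hy
      rw [hlow y h] at h1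
      omega⟩
    have hne : {x | k + 1 ≤ n x}.Nonempty := ⟨R + 1, by
      rw [Set.mem_ofPred_eq, hhigh (R + 1) (by linarith)]; omega⟩
    refine ⟨fun h => csInf_le hbdd h, fun h => ?_⟩
    obtain ⟨y, hxy, hy⟩ := hright x
    rw [← hy]
    obtain ⟨z, hz, hzy⟩ := exists_lt_of_csInf_lt hne (h.trans_lt hxy)
    exact (show k + 1 ≤ n z from hz).trans (hmono hzy.le)
  -- The count is monotone, integer valued and bounded, so it is constant just to the left of `y`;
  -- its increment at `y` is the size of the jump there.
  have hleft : ∀ y, ∃ z < y, Function.leftLim u y = u z ∧ (∀ z', z ≤ z' → z' < y → n z' = n z) ∧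
      |u y - u z| = (n y - n z) * ε := by
    intro y
    have hbdd : BddAbove (n '' Set.Iio y) := ⟨N, by rintro _ ⟨x, -, rfl⟩; exact hnN x⟩
    obtain ⟨z, hz, hz'⟩ := Nat.sSup_mem
      (show (n '' Set.Iio y).Nonempty from ⟨n (y - 1), y - 1, by simp, rfl⟩) hbdd
    have hzc : ∀ z', z ≤ z' → z' < y → n z' = n z := fun z' h1 h2 =>
      le_antisymm (hz' ▸ le_csSup hbdd ⟨z', h2, rfl⟩) (hmono h1)
    have huc : ∀ z', z ≤ z' → z' < y → u z' = u z := fun z' h1 h2 =>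
      hconst z z' h1 (hzc z' h1 h2).symm z' h1 le_rfl
    have hlim : Function.leftLim u y = u z := by
      refine leftLim_eq_of_tendsto (tendsto_const_nhds.congr' ?_)
      filter_upwards [Ioo_mem_nhdsLT hz] with x hx
      exact (huc x hx.1.le hx.2).symm
    refine ⟨z, hz, hlim, hzc, ?_⟩
    have h1 := BoundedVariationOn.eVariationOn_Iic_eq_Iio_add_edist (f := u) (a := y)
      (ne_top_of_le_ne_top hf (eVariationOn.mono u (Set.subset_univ _)))
    have h2 : eVariationOn u (Set.Iio y) = n z * ENNReal.ofReal ε := by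
      rw [← Set.Iic_union_Ico_eq_Iio hz, eVariationOn.union u isGreatest_Iic (isLeast_Ico hz), hn,
        eVariationOn.constant_on (s := Set.Ico z y), add_zero]
      rintro _ ⟨y, hy, rfl⟩ _ ⟨z, hz, rfl⟩
      rw [huc y hy.1 hy.2, huc z hz.1 hz.2]
    rw [hn, h2, hlim, edist_dist] at h1
    have h3 := congrArg ENNReal.toReal h1
    rw [ENNReal.toReal_add (ENNReal.mul_ne_top (ENNReal.natCast_ne_top _) ENNReal.ofReal_ne_top)
      ENNReal.ofReal_ne_top, ENNReal.toReal_mul, ENNReal.toReal_mul, ENNReal.toReal_natCast,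
      ENNReal.toReal_natCast, ENNReal.toReal_ofReal hε.le, ENNReal.toReal_ofReal dist_nonneg,
      Real.dist_eq] at h3
    linarith
  set sgn : ℕ → ℤ := fun k => if Function.leftLim u (X k) < u (X k) then 1 else -1 with hsgn
  have hpos : ∀ k < N, ∀ w, k * ε < w → w ≤ (k + 1) * ε → initialPos u w = X k := by
    intro k hk w h1 h2
    rw [initialPos, hX]
    congr 1
    ext x
    rw [Set.mem_ofPred_eq, Set.mem_ofPred_eq, hn, ENNReal.toReal_mul, ENNReal.toReal_natCast,
      ENNReal.toReal_ofReal hε.le]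
    constructor
    · intro h
      have := h1.trans_le h
      have : (k : ℝ) < n x := lt_of_mul_lt_mul_right this hε.le
      exact_mod_cast this
    · intro h
      refine h2.trans (mul_le_mul_of_nonneg_right ?_ hε.le)
      exact_mod_cast h
  -- Induction on the count: go back from `x` to the last jump point `y`, then to a point `z` just
  -- before it, where the count is smaller. The cells from `n z` to `m - 1` all sit at `y` and have
  -- the sign of that jump.
  have hprof : ∀ m x, n x = m → u x = prof ε sgn (Finset.range N) X x := by
    intro m
    induction m using Nat.strong_induction_on with
    | _ m ih =>
      intro x hx
      rcases Nat.eq_zero_or_pos m with rfl | hm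
      · rw [prof, upto, Finset.filter_false_of_mem, Finset.sum_empty, Int.cast_zero, zero_mul]
        · have := hconst (min x (-R - 1)) x (min_le_left _ _)
            (by rw [hx, hlow]; exact (min_le_right _ _).trans_lt (by linarith)) x
            (min_le_left _ _) le_rfl
          rw [this, hzero]
          rw [lt_abs]; right
          have := min_le_right x (-R - 1)
          linarith
        · intro k hk h
          have := (hXiff k (Finset.mem_range.1 hk) x).2 h
          omega
      · have hmN : m - 1 < N := by have := hnN x; omega
        have hyx : X (m - 1) ≤ x := (hXiff _ hmN x).1 (by omega)
        set y := X (m - 1) with hy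
        have hny : n y = m := by
          have h1 := (hXiff _ hmN y).2 le_rfl
          have h2 := hmono hyx
          omega
        have hux : u x = u y := hconst y x hyx (by rw [hny, hx]) x hyx le_rfl
        obtain ⟨z, hzy, hlim, hzc, hjump⟩ := hleft y
        have hnz : n z < m := by
          by_contra! h
          have := (hXiff _ hmN z).1 (by omega)
          linarith
        have hXy : ∀ k, n z ≤ k → k < m → X k = y := by
          intro k h1 h2
          have hkN : k < N := by omega
          refine le_antisymm ((hXiff k hkN y).1 (by omega)) ?_
          by_contra! h
          have := (hXiff k hkN (max z (X k))).2 (le_max_right _ _)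
          rw [hzc _ (le_max_left _ _) (max_lt hzy h)] at this
          omega
        have e1 : u y - u z = sgn (m - 1) * ((m - n z : ℕ) * ε) := by
          rw [hny] at hjump
          rw [hsgn, Nat.cast_sub hnz.le]
          simp only
          rw [← hy, hlim]
          split_ifs with hlt
          · rw [← hjump, abs_of_pos (sub_pos.2 hlt)]; simp
          · rw [← hjump, abs_of_nonpos (by linarith)]; push_cast; ring
        have ez := ih (n z) hnz z rfl
        rw [prof, upto] at ez ⊢
        have f1 : (Finset.range N).filter (X · ≤ x) = (Finset.range N).filter (X · ≤ z) ∪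
            Finset.Ico (n z) m := by
          ext k
          simp only [Finset.mem_filter, Finset.mem_union, Finset.mem_range, Finset.mem_Ico]
          constructor
          · rintro ⟨h1, h2⟩
            have h3 := (hXiff k h1 x).2 h2
            by_cases h4 : X k ≤ z
            · exact Or.inl ⟨h1, h4⟩
            · rw [← hXiff k h1 z] at h4
              right; omega
          · rintro (⟨h1, h2⟩ | ⟨h1, h2⟩)
            · exact ⟨h1, by linarith⟩
            · exact ⟨by omega, by rw [hXy k h1 h2]; exact hyx⟩
        rw [f1, Finset.sum_union, Finset.sum_congr (s₁ := Finset.Ico (n z) m)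
          (g := fun _ => sgn (m - 1)) rfl, Finset.sum_const, Nat.card_Ico, hux]
        · push_cast at ez ⊢
          rw [nsmul_eq_mul, add_mul, ← ez]
          push_cast
          linarith
        · intro k hk
          rw [Finset.mem_Ico] at hk
          simp only [hsgn]
          rw [hXy k hk.1 hk.2]
        · rw [Finset.disjoint_left]
          intro k hk hk'
          simp only [Finset.mem_filter, Finset.mem_range, Finset.mem_Ico] at hk hk'
          have := (hXiff k hk.1 z).2 hk.2
          omega
  refine ⟨N, X, sgn, fun k => ?_, ?_, ?_, ?_, ?_, ?_⟩
  · simp only [hsgn]; split_ifs <;> simp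
  · rw [totalVar, hN, ENNReal.toReal_mul, ENNReal.toReal_natCast, ENNReal.toReal_ofReal hε.le]
  · intro k hk w h1 h2
    refine ⟨hpos k hk w h1 h2, ?_⟩
    rw [waveSign, hpos k hk w h1 h2]
    simp only [hsgn]
    split_ifs <;> simp
  · ext x; exact hprof _ x rfl
  · intro k l hkl hl
    rw [← hXiff k (by omega)]
    have := (hXiff l hl (X l)).2 le_rfl
    omega
  · intro k l _ _ h
    simp only [hsgn, h]

end

/-! ### Waves grouped into cells -/

section

open scoped Classical

/-- The waves of the `k`-th cell. -/
def cell (ε : ℝ) (k : ℕ) : Set ℝ := Set.Ioc (k * ε) ((k + 1) * ε)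

/-- The waves of the cells in `J`. -/
def cells (ε : ℝ) (J : Finset ℕ) : Set ℝ := {w | ∃ k ∈ J, w ∈ cell ε k}

/-- Description of the initial datum `u₀` in terms of the cells of its waves. -/
structure Cells (ε : ℝ) (u₀ : ℝ → ℝ) (sgn lev : ℕ → ℤ) (N : ℕ) (X₀ : ℕ → ℝ) : Prop where
  pos : 0 < ε
  total : (totalVar u₀).toReal = N * ε
  initialPos_eq : ∀ k < N, ∀ w ∈ cell ε k, initialPos u₀ w = X₀ k
  waveSign_eq : ∀ k < N, ∀ w ∈ cell ε k, waveSign u₀ w = sgn k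
  prof_eq : u₀ = prof ε sgn (Finset.range N) X₀
  cfg : Config sgn lev (Finset.range N) X₀

variable {F : ℝ → ℝ} {u₀ : ℝ → ℝ} {ε : ℝ} {sgn lev : ℕ → ℤ} {N : ℕ} {X₀ : ℕ → ℝ}

theorem exists_Cells (hε : 0 < ε) (hr : ∀ x, ContinuousWithinAt u₀ (Set.Ici x) x)
    (hc : HasCompactSupport u₀) (hg : ∀ x, ∃ k : ℤ, u₀ x = k * ε) (hf : totalVar u₀ ≠ ⊤) :
    ∃ sgn lev N X₀, Cells ε u₀ sgn lev N X₀ := by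
  obtain ⟨N, X, sgn, h1, h2, h3, h4, h5, h6⟩ := exists_cells hε hr hc hg hf
  refine ⟨sgn, fun k => sgn k * ∑ j ∈ Finset.range k, sgn j, N, X, hε, h2,
    fun k hk w hw => (h3 k hk w hw.1 hw.2).1, fun k hk w hw => (h3 k hk w hw.1 hw.2).2, h4,
    ⟨h1, fun k _ l hl hkl => h5 k l hkl (Finset.mem_range.1 hl), fun k hk => ?_⟩,
    fun k hk l hl => h6 k l (Finset.mem_range.1 hk) (Finset.mem_range.1 hl)⟩
  congr 2
  ext j
  rw [Finset.mem_range] at hk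
  simp only [Finset.mem_filter, Finset.mem_range]
  omega

theorem exists_mem_cell (hε : 0 < ε) {w : ℝ} (hw : 0 < w) : ∃ k, w ∈ cell ε k := by
  obtain ⟨k, hk⟩ := Nat.exists_eq_succ_of_ne_zero (Nat.ceil_pos.2 (div_pos hw hε)).ne'
  refine ⟨k, ?_, ?_⟩
  · have : k < ⌈w / ε⌉₊ := by omega
    rw [Nat.lt_ceil, lt_div_iff₀ hε] at this
    exact this
  · have := Nat.le_ceil (w / ε)
    rw [hk, div_le_iff₀ hε] at this
    push_cast at this
    exact this

theorem lt_of_mem_cell_of_lt (hε : 0 < ε) {k l : ℕ} {w w' : ℝ} (hw : w ∈ cell ε k)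
    (hw' : w' ∈ cell ε l) (h : k < l) : w < w' := by
  have h1 : ((k : ℝ) + 1) * ε ≤ l * ε := by
    refine mul_le_mul_of_nonneg_right ?_ hε.le
    exact_mod_cast h
  exact hw.2.trans_lt (h1.trans_lt hw'.1)

theorem mem_cell_unique (hε : 0 < ε) {k l : ℕ} {w : ℝ} (hw : w ∈ cell ε k) (hw' : w ∈ cell ε l) :
    k = l := by
  rcases lt_trichotomy k l with h | h | h
  · exact absurd (lt_of_mem_cell_of_lt hε hw hw' h) (lt_irrefl _)
  · exact h
  · exact absurd (lt_of_mem_cell_of_lt hε hw' hw h) (lt_irrefl _)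

theorem mem_cells_iff (hε : 0 < ε) {J : Finset ℕ} {k : ℕ} {w : ℝ} (hw : w ∈ cell ε k) :
    w ∈ cells ε J ↔ k ∈ J := by
  constructor
  · rintro ⟨l, hl, hw'⟩
    rwa [mem_cell_unique hε hw hw']
  · exact fun h => ⟨k, h, hw⟩

theorem right_mem_cell (hε : 0 < ε) (k : ℕ) : ((k + 1 : ℝ) * ε) ∈ cell ε k :=
  ⟨by nlinarith, le_rfl⟩

theorem Cells.allWaves_eq (C : Cells ε u₀ sgn lev N X₀) :
    allWaves u₀ = cells ε (Finset.range N) := by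
  ext w
  rw [allWaves, C.total]
  constructor
  · rintro ⟨h1, h2⟩
    obtain ⟨k, hk⟩ := exists_mem_cell C.pos h1
    refine ⟨k, ?_, hk⟩
    rw [Finset.mem_range]
    have : (k : ℝ) < N := lt_of_mul_lt_mul_right (hk.1.trans_le h2) C.pos.le
    exact_mod_cast this
  · rintro ⟨k, hk, hw⟩
    rw [Finset.mem_range] at hk
    have h1 : (0 : ℝ) ≤ k * ε := mul_nonneg (Nat.cast_nonneg _) C.pos.le
    have h2 : ((k : ℝ) + 1) * ε ≤ N * ε := by
      refine mul_le_mul_of_nonneg_right ?_ C.pos.le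
      exact_mod_cast hk
    exact ⟨h1.trans_lt hw.1, hw.2.trans h2⟩

theorem Cells.integral_cell (C : Cells ε u₀ sgn lev N X₀) {k : ℕ} (hk : k < N) {x : ℝ}
    (h1 : k * ε ≤ x) (h2 : x ≤ (k + 1) * ε) :
    IntervalIntegrable (waveSign u₀) MeasureTheory.volume (k * ε) x ∧
      ∫ z in (k * ε : ℝ)..x, waveSign u₀ z = sgn k * (x - k * ε) := by
  have h : Set.EqOn (fun _ => (sgn k : ℝ)) (waveSign u₀) (Set.uIoc (k * ε) x) := by
    intro z hz
    rw [Set.uIoc_of_le h1] at hz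
    exact (C.waveSign_eq k hk z ⟨hz.1, hz.2.trans h2⟩).symm
  constructor
  · exact (intervalIntegrable_const (c := (sgn k : ℝ))).congr h
  · rw [← intervalIntegral.integral_congr_ae (Filter.Eventually.of_forall fun z hz => h hz),
      intervalIntegral.integral_const, smul_eq_mul, mul_comm]

/-- The integral of the sign over the preceding cells is the state at the left end of the cell, that
is `sgn k * lev k * ε` because the sign squares to one; inside the cell the state is affine. -/
theorem Cells.waveState_eq (C : Cells ε u₀ sgn lev N X₀) {k : ℕ} (hk : k < N) {w : ℝ}
    (hw : w ∈ cell ε k) : waveState u₀ w = sgn k * (lev k * ε + (w - k * ε)) := by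
  have key : ∀ m ≤ N, IntervalIntegrable (waveSign u₀) MeasureTheory.volume 0 (m * ε) ∧
      ∫ z in (0 : ℝ)..(m * ε), waveSign u₀ z = (∑ j ∈ Finset.range m, (sgn j : ℝ)) * ε := by
    intro m hm
    induction m with
    | zero => simp
    | succ m ih =>
      obtain ⟨i1, i2⟩ := ih (by omega)
      have hle : (m : ℝ) * ε ≤ (m + 1) * ε := by nlinarith [C.pos]
      obtain ⟨j1, j2⟩ := C.integral_cell (k := m) (by omega) hle le_rfl
      push_cast
      refine ⟨i1.trans j1, ?_⟩
      rw [← intervalIntegral.integral_add_adjacent_intervals i1 j1, i2, j2,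
        Finset.sum_range_succ]
      ring
  obtain ⟨i1, i2⟩ := key k hk.le
  obtain ⟨j1, j2⟩ := C.integral_cell hk hw.1.le hw.2
  rw [waveState, ← intervalIntegral.integral_add_adjacent_intervals i1 j1, i2, j2,
    C.cfg.lev_eq k (Finset.mem_range.2 hk)]
  have hf : (Finset.range N).filter (· < k) = Finset.range k := by
    ext j
    simp only [Finset.mem_filter, Finset.mem_range]
    omega
  have hs : (sgn k : ℝ) * sgn k = 1 := by exact_mod_cast C.cfg.sgn_mul_self k
  rw [hf]
  push_cast
  linear_combination (-(∑ j ∈ Finset.range k, (sgn j : ℝ)) * ε) * hs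

/-- A cell of level `m` covers the oriented states `(m ε, (m + 1) ε]`, so cells of one sign with
consecutive levels fill a half-open interval. -/
theorem Cells.mem_image_waveState (C : Cells ε u₀ sgn lev N X₀) {J : Finset ℕ}
    (hJ : J ⊆ Finset.range N) {a b : ℤ} (hi : J.image lev = Finset.Ico a b) {k : ℕ}
    (hs : ∀ l ∈ J, sgn l = sgn k) (v : ℝ) :
    v ∈ waveState u₀ '' cells ε J ↔ sgn k * v ∈ Set.Ioc (a * ε) (b * ε) := by
  have hs1 : (sgn k : ℝ) * sgn k = 1 := by exact_mod_cast C.cfg.sgn_mul_self k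
  have hε := C.pos
  constructor
  · rintro ⟨w, ⟨l, hl, hw⟩, rfl⟩
    have hm := mem_Ico_of_image hi hl
    rw [C.waveState_eq (Finset.mem_range.1 (hJ hl)) hw, hs l hl, ← mul_assoc, hs1, one_mul]
    have h1 : (a : ℝ) ≤ lev l := by exact_mod_cast hm.1
    have h2 : (lev l : ℝ) + 1 ≤ b := by exact_mod_cast hm.2
    have := hw.1
    have := hw.2
    constructor <;> nlinarith
  · rintro ⟨h1, h2⟩
    set y := (sgn k : ℝ) * v with hy
    -- The ceiling minus one selects the grid interval that is closed on the right.
    set m : ℤ := ⌈y / ε⌉ - 1 with hm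
    have hm1 : (m : ℝ) * ε < y := by
      rw [← lt_div_iff₀ hε, ← Int.lt_ceil]; omega
    have hm2 : y ≤ (m + 1) * ε := by
      rw [← div_le_iff₀ hε]
      have : (m : ℝ) + 1 = (⌈y / ε⌉ : ℤ) := by rw [hm]; push_cast; ring
      rw [this]; exact Int.le_ceil _
    have hma : a ≤ m := by
      have : a < ⌈y / ε⌉ := by rw [Int.lt_ceil, lt_div_iff₀ hε]; exact h1
      omega
    have hmb : m < b := by
      have : ⌈y / ε⌉ ≤ b := by rw [Int.ceil_le, div_le_iff₀ hε]; exact h2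
      omega
    have : m ∈ J.image lev := by rw [hi, Finset.mem_Ico]; exact ⟨hma, hmb⟩
    obtain ⟨l, hl, hlm⟩ := Finset.mem_image.1 this
    have hw : y - m * ε + l * ε ∈ cell ε l := ⟨by linarith, by linarith⟩
    refine ⟨_, ⟨l, hl, hw⟩, ?_⟩
    rw [C.waveState_eq (Finset.mem_range.1 (hJ hl)) hw, hs l hl, hlm, hy]
    linear_combination v * hs1

/-- The entropic speed of the waves in a cell. -/
theorem Cells.entSpeed_eq (C : Cells ε u₀ sgn lev N X₀) {J : Finset ℕ}
    (hJ : J ⊆ Finset.range N) {a b : ℤ} (hi : J.image lev = Finset.Ico a b) {k : ℕ} (hk : k ∈ J)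
    (hs : ∀ l ∈ J, sgn l = sgn k) {w : ℝ} (hw : w ∈ cell ε k) :
    entSpeed (gridFlux F ε) u₀ (cells ε J) w = grpSlope F ε sgn lev J k := by
  have hm := mem_Ico_of_image hi hk
  have hε := C.pos
  have hkN := Finset.mem_range.1 (hJ hk)
  have hI := C.mem_image_waveState hJ hi hs
  have hv : waveState u₀ w ∈ waveState u₀ '' cells ε J := ⟨w, ⟨k, hk, hw⟩, rfl⟩
  have hst := C.waveState_eq hkN hw
  rw [grpSlope_eq hi (by omega), entSpeed, C.waveSign_eq k hkN w hw]
  have := hw.1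
  have := hw.2
  rcases C.cfg.sgn_eq k with e | e
  · simp only [e, Int.cast_one, one_mul] at hI hst ⊢
    have hI' : waveState u₀ '' cells ε J = Set.Ioc (a * ε) (b * ε) := Set.ext hI
    rw [if_pos trivial]
    rw [hI'] at hv ⊢
    exact leftDeriv_convEnv hε hm.1 hm.2 (convex_Ioc _ _) Set.Ioo_subset_Ioc_self
      Set.Ioc_subset_Icc_self hv (by rw [hst]; linarith) (by rw [hst]; linarith)
  · simp only [e, Int.cast_neg, Int.cast_one, neg_mul, one_mul] at hI hst ⊢
    have hI' : waveState u₀ '' cells ε J = Set.Ico (-b * ε) (-a * ε) := by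
      ext v
      rw [hI v, Set.mem_Ioc, Set.mem_Ico]
      constructor <;> rintro ⟨h1, h2⟩ <;> constructor <;> linarith
    rw [if_neg (by norm_num)]
    rw [hI'] at hv ⊢
    exact rightDeriv_concEnv hε hm.1 hm.2 (convex_Ico _ _) Set.Ioo_subset_Ico_self
      Set.Ico_subset_Icc_self hv (by rw [hst]; linarith) (by rw [hst]; linarith)

/-- A jump ends at grid points and the states of a cell fill one grid interval, so at an interaction
a cell survives or disappears as a whole. -/
theorem Cells.inJump_iff (C : Cells ε u₀ sgn lev N X₀) {k : ℕ} (hk : k < N) {w : ℝ}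
    (hw : w ∈ cell ε k) (A B : ℤ) :
    InJump u₀ (A * ε) (B * ε) w ↔ InCellJump sgn lev A B k := by
  have hε := C.pos
  have hw1 := hw.1
  have hw2 := hw.2
  have lt_iff : ∀ m n : ℤ, (m : ℝ) * ε < n * ε ↔ m < n := fun m n => by
    rw [mul_lt_mul_iff_left₀ hε]; exact_mod_cast Iff.rfl
  have g1 : ∀ m : ℤ, m * ε < lev k * ε + (w - k * ε) ↔ m ≤ lev k := by
    intro m
    constructor
    · intro h
      have : (m : ℝ) * ε < ((lev k + 1 : ℤ) : ℝ) * ε := by push_cast; linarith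
      rw [lt_iff] at this; omega
    · intro h
      have : (m : ℝ) ≤ lev k := by exact_mod_cast h
      nlinarith
  have g2 : ∀ m : ℤ, lev k * ε + (w - k * ε) ≤ m * ε ↔ lev k < m := by
    intro m
    rw [← not_lt, g1, not_le]
  rw [InJump, InCellJump, C.waveSign_eq k hk w hw, C.waveState_eq hk hw, lt_iff, lt_iff]
  rcases C.cfg.sgn_eq k with e | e
  · rw [e]
    simp only [Int.cast_one, one_mul, Set.mem_Ioc, true_and, g1, g2]
    norm_num
    omega
  · rw [e]
    have e1 : ((-1 : ℤ) : ℝ) ≠ 1 := by norm_num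
    have h1 : B * ε ≤ ((-1 : ℤ) : ℝ) * (lev k * ε + (w - k * ε)) ↔ lev k < -B := by
      rw [← g2 (-B)]
      push_cast
      constructor <;> intro h <;> linarith
    have h2 : ((-1 : ℤ) : ℝ) * (lev k * ε + (w - k * ε)) < A * ε ↔ -A ≤ lev k := by
      rw [← g1 (-A)]
      push_cast
      constructor <;> intro h <;> linarith
    rw [Set.mem_Ico, h1, h2]
    simp only [e1, false_and, and_false, false_or]
    push_cast
    simp only [true_and]
    omega

end

/-! ### The wave tracing as a trajectory of cells -/

section

open scoped Classical

section Step

variable {F : ℝ → ℝ} {ε : ℝ} {sgn lev : ℕ → ℤ} {K : Finset ℕ} {X : ℕ → ℝ}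

/-- The cells which survive an interaction after the time `s`. -/
def survivors (F : ℝ → ℝ) (ε : ℝ) (sgn lev : ℕ → ℤ) (K : Finset ℕ) (X : ℕ → ℝ) (s : ℝ) :
    Finset ℕ :=
  K.filter fun k =>
    adv F ε sgn lev K X s k ∈
      (fun p => frontPos p s) '' meetingFronts (gridFlux F ε) (prof ε sgn K X) s →
    InCellJump sgn lev (below sgn K (adv F ε sgn lev K X s) (adv F ε sgn lev K X s k))
      (upto sgn K (adv F ε sgn lev K X s) (adv F ε sgn lev K X s k)) k

theorem Config.step_survivors_of_quiet (hε : 0 < ε) (hc : Config sgn lev K X)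
    (hne : ¬ (meetingTimes (gridFlux F ε) (prof ε sgn K X)).Nonempty) :
    Step F ε sgn lev K X (delay (gridFlux F ε) (prof ε sgn K X))
      (survivors F ε sgn lev K X (delay (gridFlux F ε) (prof ε sgn K X))) ∧
    survivors F ε sgn lev K X (delay (gridFlux F ε) (prof ε sgn K X)) = K := by
  have hpos := hc.delay_pos (F := F) hε
  have he : survivors F ε sgn lev K X (delay (gridFlux F ε) (prof ε sgn K X)) = K := by
    refine Finset.filter_true_of_mem fun k _ h => ?_
    obtain ⟨p, ⟨hp, q, hq, hpq, he⟩, -⟩ := h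
    exact absurd ⟨_, hpos, p, hp, q, hq, hpq, he⟩ hne
  refine ⟨?_, he⟩
  rw [he]
  refine hc.step_quiet hε hpos.le le_rfl fun k hk l hl h => ?_
  by_contra hF
  exact hne ⟨_, (hc.mem_meetingTimes hε _).2 ⟨hpos, k, hk, l, hl, hF, h⟩⟩

/-- Both meeting fronts arrive at the same point. With equal signs every cell passes the survival
test there; with opposite signs the test is the one of `Config.step_cancel`. -/
theorem Config.step_survivors_of_meet (hε : 0 < ε) (hc : Config sgn lev K X)
    (hb : (meetingFronts (gridFlux F ε) (prof ε sgn K X)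
        (delay (gridFlux F ε) (prof ε sgn K X))).Nonempty →
      (meetingFronts (gridFlux F ε) (prof ε sgn K X)
        (delay (gridFlux F ε) (prof ε sgn K X))).ncard = 2)
    (hne : (meetingTimes (gridFlux F ε) (prof ε sgn K X)).Nonempty) :
    Step F ε sgn lev K X (delay (gridFlux F ε) (prof ε sgn K X))
      (survivors F ε sgn lev K X (delay (gridFlux F ε) (prof ε sgn K X))) ∧
    ∃ p q, Meet F ε sgn lev K X (delay (gridFlux F ε) (prof ε sgn K X)) p q ∧
      ((sgn p ≠ sgn q ∧ survivors F ε sgn lev K X (delay (gridFlux F ε) (prof ε sgn K X)) ⊂ K) ∨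
      (sgn p = sgn q ∧
        survivors F ε sgn lev K X (delay (gridFlux F ε) (prof ε sgn K X)) = K)) := by
  have hpos := hc.delay_pos (F := F) hε
  obtain ⟨-, p', hp', q', hq', hpq', he'⟩ := hc.delay_mem hε hne
  obtain ⟨p, q, hm, hset⟩ := hc.exists_meet hε (hb ⟨p', hp', q', hq', hpq', he'⟩) hne
  set s := delay (gridFlux F ε) (prof ε sgn K X)
  have himg : ∀ x, x ∈ (fun p => frontPos p s) '' meetingFronts (gridFlux F ε) (prof ε sgn K X) s ↔
      x = adv F ε sgn lev K X s p := by
    intro x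
    rw [hset, Set.image_pair, Set.mem_insert_iff, Set.mem_singleton_iff]
    have e : frontPos (X q, vel F ε sgn lev K X q) s = frontPos (X p, vel F ε sgn lev K X p) s :=
      hm.adv_eq.symm
    rw [e, or_self]
    rfl
  by_cases hpq : sgn p = sgn q
  · have hst := hc.step_merge hε hpos.le le_rfl hm hpq
    have he : survivors F ε sgn lev K X s = K :=
      Finset.filter_true_of_mem fun k hk _ => (hst.mem_iff k hk).1 hk
    rw [he]
    exact ⟨hst, p, q, hm, Or.inr ⟨hpq, rfl⟩⟩
  · have hst := hc.step_cancel hε hpos.le le_rfl hm hpq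
    have he : survivors F ε sgn lev K X s = K.filter fun k =>
        adv F ε sgn lev K X s k = adv F ε sgn lev K X s p → InCellJump sgn lev
          (below sgn K (adv F ε sgn lev K X s) (adv F ε sgn lev K X s k))
          (upto sgn K (adv F ε sgn lev K X s) (adv F ε sgn lev K X s k)) k :=
      Finset.filter_congr fun k _ => by rw [himg]
    rw [he]
    exact ⟨hst.1, p, q, hm, Or.inl ⟨hpq, hst.2⟩⟩

end Step

variable {F : ℝ → ℝ} {u₀ : ℝ → ℝ} {ε : ℝ} {sgn lev : ℕ → ℤ} {N : ℕ} {X₀ : ℕ → ℝ}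
  {K : ℕ → Finset ℕ} {X : ℕ → ℕ → ℝ}

/-- The wave tracing of `u₀` is described by the trajectory `K`, `X` of its cells. -/
structure Track (F : ℝ → ℝ) (ε : ℝ) (u₀ : ℝ → ℝ) (sgn lev : ℕ → ℤ) (N : ℕ) (K : ℕ → Finset ℕ)
    (X : ℕ → ℕ → ℝ) : Prop where
  cells : Cells ε u₀ sgn lev N (X 0)
  traj : Traj F ε sgn lev K X
  zero : K 0 = Finset.range N
  profile : ∀ n, (stage (gridFlux F ε) u₀ n).profile = prof ε sgn (K n) (X n)
  time : ∀ n, (stage (gridFlux F ε) u₀ n).time = tm F ε sgn K X n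
  alive : ∀ n, (tracing (gridFlux F ε) u₀ n).alive = WaveTracking.cells ε (K n)
  pos_eq : ∀ n, ∀ k ∈ K n, ∀ w ∈ cell ε k, (tracing (gridFlux F ε) u₀ n).pos w = X n k

/-- The stages of the evolution of the cells. -/
def cellStage (F : ℝ → ℝ) (ε : ℝ) (sgn lev : ℕ → ℤ) (N : ℕ) (X₀ : ℕ → ℝ) :
    ℕ → Finset ℕ × (ℕ → ℝ)
  | 0 => (Finset.range N, X₀)
  | n + 1 =>
    let S := cellStage F ε sgn lev N X₀ n
    (survivors F ε sgn lev S.1 S.2 (delay (gridFlux F ε) (prof ε sgn S.1 S.2)),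
      adv F ε sgn lev S.1 S.2 (delay (gridFlux F ε) (prof ε sgn S.1 S.2)))

theorem Cells.entSpeed_grp (C : Cells ε u₀ sgn lev N X₀) {J : Finset ℕ} {Y : ℕ → ℝ}
    (hJ : J ⊆ Finset.range N) (hc : Config sgn lev J Y) {k : ℕ} (hk : k ∈ J) {w : ℝ}
    (hw : w ∈ cell ε k) :
    entSpeed (gridFlux F ε) u₀ (WaveTracking.cells ε (grp J Y k)) w = vel F ε sgn lev J Y k :=
  C.entSpeed_eq ((Finset.filter_subset _ _).trans hJ) (hc.image_grp hk) (mem_grp_self hk)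
    (fun _ hl => (hc.run_grp hk).const _ hl _ (mem_grp_self hk)) hw

theorem Cells.speed_eq (C : Cells ε u₀ sgn lev N X₀) {J : Finset ℕ} {Y : ℕ → ℝ}
    (hJ : J ⊆ Finset.range N) (hc : Config sgn lev J Y) {S : Tracing}
    (ha : S.alive = WaveTracking.cells ε J) (hp : ∀ k ∈ J, ∀ w ∈ cell ε k, S.pos w = Y k)
    {k : ℕ} (hk : k ∈ J) {w : ℝ} (hw : w ∈ cell ε k) :
    S.speed (gridFlux F ε) u₀ w = vel F ε sgn lev J Y k := by
  rw [← C.entSpeed_grp hJ hc hk hw, Tracing.speed]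
  congr 1
  ext z
  rw [Set.mem_ofPred_eq, ha]
  constructor
  · rintro ⟨⟨l, hl, hz⟩, h⟩
    rw [hp l hl z hz, hp k hk w hw] at h
    exact ⟨l, mem_grp.2 ⟨hl, h⟩, hz⟩
  · rintro ⟨l, hl, hz⟩
    rw [mem_grp] at hl
    refine ⟨⟨l, hl.1, hz⟩, ?_⟩
    rw [hp l hl.1 z hz, hp k hk w hw, hl.2]

/-- By induction on the stages the profile is that of the cells, which determines the next
interaction, while the tracing moves each cell rigidly with its `vel` and applies the survival test
cell by cell. -/
theorem Cells.exists_track (C : Cells ε u₀ sgn lev N X₀)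
    (hb : BinaryInteractions (gridFlux F ε) u₀) :
    ∃ K X, Track F ε u₀ sgn lev N K X := by
  set K : ℕ → Finset ℕ := fun n => (cellStage F ε sgn lev N X₀ n).1 with hK
  set X : ℕ → ℕ → ℝ := fun n => (cellStage F ε sgn lev N X₀ n).2 with hX
  have hK1 : ∀ n, K (n + 1) = survivors F ε sgn lev (K n) (X n) (dl F ε sgn K X n) := fun n => rfl
  have hX1 : ∀ n, X (n + 1) = adv F ε sgn lev (K n) (X n) (dl F ε sgn K X n) := fun n => rfl
  have hε := C.pos
  have hbin : ∀ n, (stage (gridFlux F ε) u₀ n).profile = prof ε sgn (K n) (X n) →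
      (meetingFronts (gridFlux F ε) (prof ε sgn (K n) (X n)) (dl F ε sgn K X n)).Nonempty →
      (meetingFronts (gridFlux F ε) (prof ε sgn (K n) (X n)) (dl F ε sgn K X n)).ncard = 2 := by
    intro n hn
    have := hb n
    rw [interactingFronts, hn] at this
    exact this
  have hstep : ∀ n, Config sgn lev (K n) (X n) →
      (stage (gridFlux F ε) u₀ n).profile = prof ε sgn (K n) (X n) →
      Step F ε sgn lev (K n) (X n) (dl F ε sgn K X n) (K (n + 1)) := by
    intro n hc hn
    rw [hK1]
    by_cases h : (meetingTimes (gridFlux F ε) (prof ε sgn (K n) (X n))).Nonempty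
    · exact (hc.step_survivors_of_meet hε (hbin n hn) h).1
    · exact (hc.step_survivors_of_quiet hε h).1
  have key : ∀ n, Config sgn lev (K n) (X n) ∧
      (stage (gridFlux F ε) u₀ n).profile = prof ε sgn (K n) (X n) ∧ K n ⊆ Finset.range N := by
    intro n
    induction n with
    | zero => exact ⟨C.cfg, C.prof_eq, subset_rfl⟩
    | succ n ih =>
      obtain ⟨hc, hn, hs⟩ := ih
      have hst := hstep n hc hn
      refine ⟨by rw [hX1]; exact hst.cfg, ?_, hst.sub.trans hs⟩
      rw [stage, hn]
      simp only
      rw [hc.evolve_prof hε (hc.delay_pos hε).le]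
      ext x
      rw [prof, prof, hX1, hst.upto_eq]
      rfl
  have htr : ∀ n, (tracing (gridFlux F ε) u₀ n).alive = WaveTracking.cells ε (K n) ∧
      ∀ k ∈ K n, ∀ w ∈ cell ε k, (tracing (gridFlux F ε) u₀ n).pos w = X n k := by
    intro n
    induction n with
    | zero =>
      exact ⟨C.allWaves_eq, fun k hk w hw => C.initialPos_eq k (Finset.mem_range.1 hk) w hw⟩
    | succ n ih =>
      obtain ⟨ha, hp⟩ := ih
      obtain ⟨hc, hn, hs⟩ := key n
      have hy : ∀ k ∈ K n, ∀ w ∈ cell ε k, (tracing (gridFlux F ε) u₀ n).pos w +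
          (tracing (gridFlux F ε) u₀ n).speed (gridFlux F ε) u₀ w *
            delay (gridFlux F ε) (stage (gridFlux F ε) u₀ n).profile = X (n + 1) k := by
        intro k hk w hw
        rw [hp k hk w hw, C.speed_eq hs hc ha hp hk hw, hn]
        rfl
      -- The canceled cells do not contribute to the profile, which may thus be computed before
      -- their removal; `survivors` states its test in this form.
      have hv : (stage (gridFlux F ε) u₀ (n + 1)).profile = prof ε sgn (K n) (X (n + 1)) := by
        rw [stage, hn]
        simp only
        rw [hc.evolve_prof hε (hc.delay_pos hε).le]
        rfl
      refine ⟨?_, fun k hk w hw => hy k ((hstep n hc hn).sub hk) w hw⟩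
      have hsurv : ∀ k ∈ K n, ∀ w ∈ cell ε k,
          ((tracing (gridFlux F ε) u₀ n).pos w +
            (tracing (gridFlux F ε) u₀ n).speed (gridFlux F ε) u₀ w *
              delay (gridFlux F ε) (stage (gridFlux F ε) u₀ n).profile ∈
                interactionPoints (gridFlux F ε) u₀ n →
            InJump u₀ (Function.leftLim (stage (gridFlux F ε) u₀ (n + 1)).profile
              ((tracing (gridFlux F ε) u₀ n).pos w +
              (tracing (gridFlux F ε) u₀ n).speed (gridFlux F ε) u₀ w *
              delay (gridFlux F ε) (stage (gridFlux F ε) u₀ n).profile))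
              ((stage (gridFlux F ε) u₀ (n + 1)).profile
              ((tracing (gridFlux F ε) u₀ n).pos w +
              (tracing (gridFlux F ε) u₀ n).speed (gridFlux F ε) u₀ w *
              delay (gridFlux F ε) (stage (gridFlux F ε) u₀ n).profile)) w) ↔ k ∈ K (n + 1) := by
        intro k hk w hw
        rw [hy k hk w hw, hv, leftLim_prof, prof,
          C.inJump_iff (Finset.mem_range.1 (hs hk)) hw, interactionPoints, interactingFronts, hn,
          hK1, survivors, Finset.mem_filter]
        exact ⟨fun h => ⟨hk, h⟩, fun h => h.2⟩
      ext w
      rw [tracing]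
      simp only [Set.mem_ofPred_eq, ha]
      constructor
      · rintro ⟨⟨k, hk, hw⟩, h⟩
        exact ⟨k, (hsurv k hk w hw).1 h, hw⟩
      · rintro ⟨k, hk, hw⟩
        have hk' := (hstep n hc hn).sub hk
        exact ⟨⟨k, hk', hw⟩, (hsurv k hk' w hw).2 hk⟩
  refine ⟨K, X, C, ?_, rfl, fun n => (key n).2.1, ?_, fun n => (htr n).1,
    fun n => (htr n).2⟩
  · refine ⟨hε, fun n => (key n).1, hX1, fun n => hstep n (key n).1 (key n).2.1, fun n h => ?_,
      fun n h => ?_⟩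
    · exact ((key n).1.step_survivors_of_quiet hε h).2
    · exact ((key n).1.step_survivors_of_meet hε (hbin n (key n).2.1) h).2
  · intro n
    induction n with
    | zero => rw [tm_zero]; rfl
    | succ n ih => rw [stage, tm_succ, ← ih, dl, ← (key n).2.1]

namespace Track

variable (T : Track F ε u₀ sgn lev N K X)
include T

theorem sub (n : ℕ) : K n ⊆ Finset.range N := T.zero ▸ T.traj.anti (Nat.zero_le n)

theorem stageIndex_eq {t : ℝ} {n : ℕ} (h₁ : tm F ε sgn K X n ≤ t)
    (h₂ : t < tm F ε sgn K X (n + 1)) : stageIndex (gridFlux F ε) u₀ t = n := by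
  rw [stageIndex]
  refine IsGreatest.csSup_eq ⟨?_, fun m hm => ?_⟩
  · rw [Set.mem_ofPred_eq, T.time]; exact h₁
  · rw [Set.mem_ofPred_eq, T.time] at hm
    have := T.traj.tm_strictMono.lt_iff_lt.1 (hm.trans_lt h₂)
    omega

variable {t : ℝ} {n : ℕ}

theorem waves_eq (h₁ : tm F ε sgn K X n ≤ t) (h₂ : t < tm F ε sgn K X (n + 1)) :
    waves (gridFlux F ε) u₀ t = WaveTracking.cells ε (K n) := by
  rw [waves, T.stageIndex_eq h₁ h₂, T.alive]

theorem pos_adv (h₁ : tm F ε sgn K X n ≤ t) (h₂ : t < tm F ε sgn K X (n + 1)) {k : ℕ}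
    (hk : k ∈ K n) {w : ℝ} (hw : w ∈ cell ε k) : pos (gridFlux F ε) u₀ t w =
      adv F ε sgn lev (K n) (X n) (t - tm F ε sgn K X n) k := by
  rw [pos, T.stageIndex_eq h₁ h₂, T.pos_eq n k hk w hw, T.time,
    T.cells.speed_eq (T.sub n) (T.traj.cfg n) (T.alive n) (T.pos_eq n) hk hw, adv]

theorem solution_eq (h₁ : tm F ε sgn K X n ≤ t) (h₂ : t < tm F ε sgn K X (n + 1)) :
    solution (gridFlux F ε) u₀ t =
      prof ε sgn (K n) (adv F ε sgn lev (K n) (X n) (t - tm F ε sgn K X n)) := by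
  ext x
  rw [solution, T.stageIndex_eq h₁ h₂, T.profile, T.time,
    (T.traj.cfg n).evolve_prof T.traj.pos (sub_nonneg.2 h₁)]

end Track

end

/-! ### The interaction potential as a finite sum -/

section

open scoped Classical

variable {F : ℝ → ℝ} {u₀ : ℝ → ℝ} {ε : ℝ} {sgn lev : ℕ → ℤ} {N : ℕ}
  {K : ℕ → Finset ℕ} {X : ℕ → ℕ → ℝ}

theorem adv_sub_self {K : Finset ℕ} {X : ℕ → ℝ} (t : ℝ) :
    adv F ε sgn lev K X (t - t) = X := by
  ext k; simp [adv]

theorem measurableSet_cell (k : ℕ) : MeasurableSet (cell ε k) := measurableSet_Ioc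

theorem cells_inter (hε : 0 < ε) (J J' : Finset ℕ) : cells ε J ∩ cells ε J' = cells ε (J ∩ J') := by
  ext w
  constructor
  · rintro ⟨⟨k, hk, hw⟩, h⟩
    exact ⟨k, Finset.mem_inter.2 ⟨hk, (mem_cells_iff hε hw).1 h⟩, hw⟩
  · rintro ⟨k, hk, hw⟩
    rw [Finset.mem_inter] at hk
    exact ⟨⟨k, hk.1, hw⟩, ⟨k, hk.2, hw⟩⟩

theorem cells_eq_biUnion (J : Finset ℕ) : cells ε J = ⋃ k ∈ J, cell ε k := by
  ext w
  simp only [cells, Set.mem_ofPred_eq, Set.mem_iUnion, exists_prop]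

theorem pairwiseDisjoint_cell (hε : 0 < ε) (J : Finset ℕ) :
    (J : Set ℕ).PairwiseDisjoint (cell ε) := fun _ _ _ _ hkl =>
  Set.disjoint_left.2 fun _ h h' => hkl (mem_cell_unique hε h h')

theorem volume_cell (k : ℕ) : MeasureTheory.volume (cell ε k) = ENNReal.ofReal ε := by
  rw [cell, Real.volume_Ioc]
  congr 1; ring

theorem volume_cells (hε : 0 < ε) (J : Finset ℕ) :
    MeasureTheory.volume (cells ε J) = ENNReal.ofReal (ε * J.card) := by
  rw [cells_eq_biUnion, MeasureTheory.measure_biUnion_finset (pairwiseDisjoint_cell hε J)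
    fun _ _ => measurableSet_Ioc]
  rw [Finset.sum_congr rfl fun k _ => volume_cell k, Finset.sum_const, nsmul_eq_mul,
    ENNReal.ofReal_mul hε.le, ENNReal.ofReal_natCast, mul_comm]

theorem lintegral_cells (hε : 0 < ε) (J : Finset ℕ) {s : Set ℝ} (hs : MeasurableSet s)
    (f : ℝ → ℝ≥0∞) : ∫⁻ w in cells ε J ∩ s, f w = ∑ k ∈ J, ∫⁻ w in cell ε k ∩ s, f w := by
  have : cells ε J ∩ s = ⋃ k ∈ J, cell ε k ∩ s := by
    rw [cells_eq_biUnion, Set.iUnion₂_inter]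
  rw [this, MeasureTheory.lintegral_biUnion_finset]
  · exact fun k hk l hl hkl => (pairwiseDisjoint_cell hε J hk hl hkl).mono
      Set.inter_subset_left Set.inter_subset_left
  · exact fun _ _ => measurableSet_Ioc.inter hs

namespace Track

variable (T : Track F ε u₀ sgn lev N K X) {t : ℝ} {n : ℕ}
include T

theorem mem_waves_iff (h₁ : tm F ε sgn K X n ≤ t) (h₂ : t < tm F ε sgn K X (n + 1)) {k : ℕ}
    {w : ℝ} (hw : w ∈ cell ε k) : w ∈ waves (gridFlux F ε) u₀ t ↔ k ∈ K n := by
  rw [T.waves_eq h₁ h₂, mem_cells_iff T.traj.pos hw]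

theorem config_adv (h₁ : tm F ε sgn K X n ≤ t) (h₂ : t < tm F ε sgn K X (n + 1)) :
    Config sgn lev (K n) (adv F ε sgn lev (K n) (X n) (t - tm F ε sgn K X n)) := by
  rw [tm_succ] at h₂
  exact (T.traj.cfg n).config_adv T.traj.pos (sub_nonneg.2 h₁) (by rw [← dl]; linarith)

theorem wavesAt_eq (h₁ : tm F ε sgn K X n ≤ t) (h₂ : t < tm F ε sgn K X (n + 1)) {k : ℕ}
    (hk : k ∈ K n) {w : ℝ} (hw : w ∈ cell ε k) :
    wavesAt (gridFlux F ε) u₀ t (pos (gridFlux F ε) u₀ t w) =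
      WaveTracking.cells ε (grp (K n)
        (adv F ε sgn lev (K n) (X n) (t - tm F ε sgn K X n)) k) := by
  ext z
  rw [wavesAt, Set.mem_ofPred_eq, T.waves_eq h₁ h₂, T.pos_adv h₁ h₂ hk hw]
  constructor
  · rintro ⟨⟨l, hl, hz⟩, h⟩
    rw [T.pos_adv h₁ h₂ hl hz] at h
    exact ⟨l, mem_grp.2 ⟨hl, h⟩, hz⟩
  · rintro ⟨l, hl, hz⟩
    rw [mem_grp] at hl
    refine ⟨⟨l, hl.1, hz⟩, ?_⟩
    rw [T.pos_adv h₁ h₂ hl.1 hz, hl.2]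

theorem stage_le {s : ℝ} {m : ℕ} (h₁ : tm F ε sgn K X n ≤ t) (hts : t ≤ s)
    (h₂ : s < tm F ε sgn K X (m + 1)) : n ≤ m := by
  have := T.traj.tm_strictMono.lt_iff_lt.1 ((h₁.trans hts).trans_lt h₂)
  omega

variable {i j : ℕ} {w w' : ℝ}

theorem mem_interactionTimes_of_meetAt (h₂ : t < tm F ε sgn K X (n + 1)) (hw : w ∈ cell ε i)
    (hw' : w' ∈ cell ε j) {m : ℕ} (hm : MeetAt K X n i j m) :
    tm F ε sgn K X m ∈ interactionTimes (gridFlux F ε) u₀ t w w' := by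
  have hlt := T.traj.tm_strictMono (Nat.lt_succ_self m)
  refine ⟨h₂.trans_le (T.traj.tm_strictMono.monotone hm.1), ?_, ?_, ?_⟩
  · exact (T.mem_waves_iff le_rfl hlt hw).2 hm.2.1
  · exact (T.mem_waves_iff le_rfl hlt hw').2 hm.2.2.1
  · rw [T.pos_adv le_rfl hlt hm.2.1 hw, T.pos_adv le_rfl hlt hm.2.2.1 hw', adv_sub_self, hm.2.2.2]

/-- Strictly inside the time interval of a stage, two waves are together only on a common front,
hence were already together at that stage. Meetings are so traced back to stages, and `m = n` is
excluded because the waves are apart at time `t`. -/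
theorem exists_meetAt_of_mem (h₁ : tm F ε sgn K X n ≤ t) (hw : w ∈ cell ε i) (hw' : w' ∈ cell ε j)
    (hY : adv F ε sgn lev (K n) (X n) (t - tm F ε sgn K X n) i ≠
      adv F ε sgn lev (K n) (X n) (t - tm F ε sgn K X n) j) {s : ℝ}
    (hs : s ∈ interactionTimes (gridFlux F ε) u₀ t w w') :
    ∃ m, MeetAt K X n i j m ∧ tm F ε sgn K X m ≤ s := by
  obtain ⟨hts, hws, hws', hp⟩ := hs
  have h0 : 0 ≤ tm F ε sgn K X n := by
    rw [← tm_zero (F := F) (ε := ε) (sgn := sgn) (K := K) (X := X)]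
    exact T.traj.tm_strictMono.monotone (Nat.zero_le n)
  obtain ⟨m, hm₁, hm₂⟩ := T.traj.exists_stage (h0.trans (h₁.trans hts.le))
  have hnm := T.stage_le h₁ hts.le hm₂
  rw [T.mem_waves_iff hm₁ hm₂ hw] at hws
  rw [T.mem_waves_iff hm₁ hm₂ hw'] at hws'
  rw [T.pos_adv hm₁ hm₂ hws hw, T.pos_adv hm₁ hm₂ hws' hw'] at hp
  refine ⟨m, ?_, hm₁⟩
  rcases hm₁.eq_or_lt with rfl | hlt
  · rw [adv_sub_self] at hp
    refine ⟨lt_of_le_of_ne hnm fun e => ?_, hws, hws', hp⟩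
    subst e; linarith
  · rw [tm_succ] at hm₂
    rw [(T.traj.cfg m).adv_eq_iff T.traj.pos hws hws' (sub_pos.2 hlt)
      (by rw [← dl]; linarith)] at hp
    refine ⟨lt_of_le_of_ne hnm fun e => ?_, hws, hws', hp.1⟩
    subst e
    exact hY (hp.adv_eq _)

theorem interactionTimes_eq_empty_iff (h₁ : tm F ε sgn K X n ≤ t) (h₂ : t < tm F ε sgn K X (n + 1))
    (hw : w ∈ cell ε i) (hw' : w' ∈ cell ε j)
    (hY : adv F ε sgn lev (K n) (X n) (t - tm F ε sgn K X n) i ≠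
      adv F ε sgn lev (K n) (X n) (t - tm F ε sgn K X n) j) :
    interactionTimes (gridFlux F ε) u₀ t w w' = ∅ ↔ ¬ ∃ m, MeetAt K X n i j m := by
  constructor
  · rintro h ⟨m, hm⟩
    have := T.mem_interactionTimes_of_meetAt h₂ hw hw' hm
    rw [h] at this
    exact this
  · intro h
    rw [Set.eq_empty_iff_forall_notMem]
    intro s hs
    obtain ⟨m, hm, -⟩ := T.exists_meetAt_of_mem h₁ hw hw' hY hs
    exact h ⟨m, hm⟩

theorem interactionTime_eq (h₁ : tm F ε sgn K X n ≤ t) (h₂ : t < tm F ε sgn K X (n + 1))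
    (hw : w ∈ cell ε i) (hw' : w' ∈ cell ε j)
    (hY : adv F ε sgn lev (K n) (X n) (t - tm F ε sgn K X n) i ≠
      adv F ε sgn lev (K n) (X n) (t - tm F ε sgn K X n) j) (hm : ∃ m, MeetAt K X n i j m) :
    interactionTime (gridFlux F ε) u₀ t w w' = tm F ε sgn K X (firstMeet K X n i j) := by
  refine IsLeast.csInf_eq ⟨T.mem_interactionTimes_of_meetAt h₂ hw hw' (meetAt_firstMeet hm), ?_⟩
  intro s hs
  obtain ⟨m, hm', hms⟩ := T.exists_meetAt_of_mem h₁ hw hw' hY hs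
  exact (T.traj.tm_strictMono.monotone (firstMeet_le hm')).trans hms

theorem exists_sign_ne_iff (h₁ : tm F ε sgn K X n ≤ t) (h₂ : t < tm F ε sgn K X (n + 1))
    (hi : i ∈ K n) (hj : j ∈ K n) (hij : i < j) (hw : w ∈ cell ε i) (hw' : w' ∈ cell ε j) :
    (∃ z ∈ waves (gridFlux F ε) u₀ t ∩ Set.Icc w w', waveSign u₀ z ≠ waveSign u₀ w) ↔
      ∃ z ∈ K n, i ≤ z ∧ z ≤ j ∧ sgn z ≠ sgn i := by
  have hε := T.traj.pos
  have hN : ∀ k ∈ K n, k < N := fun k hk => Finset.mem_range.1 (T.sub n hk)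
  rw [T.waves_eq h₁ h₂, T.cells.waveSign_eq i (hN i hi) w hw]
  constructor
  · rintro ⟨z, ⟨⟨k, hk, hz⟩, hwz, hzw⟩, hne⟩
    rw [T.cells.waveSign_eq k (hN k hk) z hz] at hne
    refine ⟨k, hk, ?_, ?_, fun h => hne (by rw [h])⟩
    · by_contra! h
      linarith [lt_of_mem_cell_of_lt hε hz hw h]
    · by_contra! h
      linarith [lt_of_mem_cell_of_lt hε hw' hz h]
  · rintro ⟨k, hk, hik, hkj, hne⟩
    -- A wave of the cell `k` inside `[w, w']` is needed. If `k < j` any wave of the cell will do;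
    -- if `k = j` the wave `w'` itself is taken.
    have hik' : i < k := lt_of_le_of_ne hik fun h => hne (by rw [h])
    rcases hkj.eq_or_lt with rfl | hkj'
    · refine ⟨w', ⟨⟨k, hk, hw'⟩, (lt_of_mem_cell_of_lt hε hw hw' hik').le, le_rfl⟩, ?_⟩
      rw [T.cells.waveSign_eq k (hN k hk) w' hw']
      exact_mod_cast hne
    · have hz := right_mem_cell hε k
      refine ⟨_, ⟨⟨k, hk, hz⟩, (lt_of_mem_cell_of_lt hε hw hz hik').le,
        (lt_of_mem_cell_of_lt hε hz hw' hkj').le⟩, ?_⟩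
      rw [T.cells.waveSign_eq k (hN k hk) _ hz]
      exact_mod_cast hne

/-- The weights of pairs of waves are constant on pairs of cells. -/
theorem weight_eq (h₁ : tm F ε sgn K X n ≤ t) (h₂ : t < tm F ε sgn K X (n + 1))
    (hi : i ∈ K n) (hj : j ∈ K n) (hij : i < j) (hw : w ∈ cell ε i) (hw' : w' ∈ cell ε j) :
    weight F ε u₀ t w w' = stageWt (normF2 F) F ε sgn lev K X n
      (grp (K n) (adv F ε sgn lev (K n) (X n) (t - tm F ε sgn K X n))) i j := by
  have hε := T.traj.pos
  rw [weight, T.exists_sign_ne_iff h₁ h₂ hi hj hij hw hw', T.pos_adv h₁ h₂ hi hw,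
    T.pos_adv h₁ h₂ hj hw']
  have hc := T.config_adv h₁ h₂
  have hYdef : adv F ε sgn lev (K n) (X n) (t - tm F ε sgn K X n) =
    adv F ε sgn lev (K n) (X n) (t - tm F ε sgn K X n) := rfl
  by_cases hs : ∃ z ∈ K n, i ≤ z ∧ z ≤ j ∧ sgn z ≠ sgn i
  · rw [if_pos hs, stageWt_of_sgn hs]
  rw [if_neg hs]
  by_cases hY : adv F ε sgn lev (K n) (X n) (t - tm F ε sgn K X n) i =
      adv F ε sgn lev (K n) (X n) (t - tm F ε sgn K X n) j
  · rw [if_pos (Or.inl hY), stageWt_of_mem hs (mem_grp.2 ⟨hj, hY.symm⟩)]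
  by_cases hm : ∃ m, MeetAt K X n i j m
  swap
  · rw [if_pos (Or.inr ((T.interactionTimes_eq_empty_iff h₁ h₂ hw hw' hY).2 hm)),
      stageWt_of_not_meet hs hm]
  have hne : ¬ interactionTimes (gridFlux F ε) u₀ t w w' = ∅ := fun h =>
    (T.interactionTimes_eq_empty_iff h₁ h₂ hw hw' hY).1 h hm
  have hmeet := meetAt_firstMeet hm
  have hfut : futureWaves (gridFlux F ε) u₀ t w w' = WaveTracking.cells ε (meetCells K X n i j) := by
    rw [futureWaves, T.interactionTime_eq h₁ h₂ hw hw' hY hm,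
      T.wavesAt_eq le_rfl (T.traj.tm_strictMono (Nat.lt_succ_self _)) hmeet.2.1 hw, adv_sub_self,
      meetCells]
  have hji : j ∉ grp (K n) (adv F ε sgn lev (K n) (X n) (t - tm F ε sgn K X n)) i := fun h =>
    hY (mem_grp.1 h).2.symm
  have hij' : i ∉ grp (K n) (adv F ε sgn lev (K n) (X n) (t - tm F ε sgn K X n)) j := fun h =>
    hY (mem_grp.1 h).2
  obtain ⟨a, ha, ha', ha'', iL⟩ := T.traj.left_image (hc.run_grp hi) (mem_grp_self hi) hji hj hij
    hmeet (sgn_const_of_not hs) (hc.image_grp hi)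
  obtain ⟨b, hb, hb', hb'', iR⟩ := T.traj.right_image (hc.run_grp hj) (mem_grp_self hj) hij' hi hij
    hmeet (sgn_const_of_not hs) (hc.image_grp hj)
  rw [← meetCells] at iL iR
  have hiE : i ∈ meetCells K X n i j := mem_grp_self hmeet.2.1
  have hjE : j ∈ meetCells K X n i j := mem_grp.2 ⟨hmeet.2.2.1, hmeet.2.2.2.symm⟩
  rw [if_neg (by tauto), stageWt_of_meet hs hji hm, numerator, denominator, leftWaves, rightWaves,
    hfut, T.wavesAt_eq h₁ h₂ hi hw, T.wavesAt_eq h₁ h₂ hj hw', cells_inter hε, cells_inter hε,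
    T.cells.entSpeed_eq (Finset.inter_subset_left.trans ((hc.run_grp hi).subset.trans (T.sub n)))
      iL (Finset.mem_inter.2 ⟨mem_grp_self hi, hiE⟩)
      (fun l hl => (hc.run_grp hi).const l (Finset.mem_inter.1 hl).1 i (mem_grp_self hi)) hw,
    T.cells.entSpeed_eq (Finset.inter_subset_left.trans ((hc.run_grp hj).subset.trans (T.sub n)))
      iR (Finset.mem_inter.2 ⟨mem_grp_self hj, hjE⟩)
      (fun l hl => (hc.run_grp hj).const l (Finset.mem_inter.1 hl).1 j (mem_grp_self hj)) hw',
    volume_cells hε, ENNReal.ofReal_div_of_pos]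
  exact mul_pos hε (by exact_mod_cast Finset.card_pos.2 ⟨i, hiE⟩)

/-- Waves of one cell always share their position, so the pairs that the sum over cells does not see
contribute nothing. -/
theorem weight_eq_zero (h₁ : tm F ε sgn K X n ≤ t) (h₂ : t < tm F ε sgn K X (n + 1))
    (hi : i ∈ K n) (hw : w ∈ cell ε i) (hw' : w' ∈ cell ε i) : weight F ε u₀ t w w' = 0 := by
  have hN := Finset.mem_range.1 (T.sub n hi)
  rw [weight, if_neg, if_pos]
  · left
    rw [T.pos_adv h₁ h₂ hi hw, T.pos_adv h₁ h₂ hi hw']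
  · rintro ⟨z, ⟨-, h3, h4⟩, h⟩
    refine h ?_
    rw [T.cells.waveSign_eq i hN w hw, T.cells.waveSign_eq i hN z
      ⟨hw.1.trans_le h3, h4.trans hw'.2⟩]

/-- Weights are constant on the product of two distinct cells, which has measure `ε²`, and zero
inside a cell. -/
theorem potential_eq (h₁ : tm F ε sgn K X n ≤ t) (h₂ : t < tm F ε sgn K X (n + 1)) :
    potential F ε u₀ t = potSum F ε sgn lev K X n
      (grp (K n) (adv F ε sgn lev (K n) (X n) (t - tm F ε sgn K X n))) *
        ENNReal.ofReal ε * ENNReal.ofReal ε := by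
  have hε := T.traj.pos
  rw [potential, T.waves_eq h₁ h₂]
  have houter := lintegral_cells hε (K n) MeasurableSet.univ fun w =>
    ∫⁻ w' in WaveTracking.cells ε (K n) ∩ Set.Ioi w, weight F ε u₀ t w w'
  simp only [Set.inter_univ] at houter
  rw [houter, potSum, Finset.sum_mul, Finset.sum_mul]
  refine Finset.sum_congr rfl fun i hi => ?_
  rw [MeasureTheory.setLIntegral_congr_fun (g := fun _ => (∑ j ∈ K n, if i < j then
    stageWt (normF2 F) F ε sgn lev K X n
      (grp (K n) (adv F ε sgn lev (K n) (X n) (t - tm F ε sgn K X n))) i j else 0) *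
        ENNReal.ofReal ε) (measurableSet_cell i), MeasureTheory.setLIntegral_const, volume_cell]
  intro w hw
  simp only
  rw [lintegral_cells hε (K n) measurableSet_Ioi, Finset.sum_mul]
  refine Finset.sum_congr rfl fun j hj => ?_
  rcases lt_trichotomy i j with hij | rfl | hij
  · have : cell ε j ∩ Set.Ioi w = cell ε j :=
      Set.inter_eq_left.2 fun w' hw' => lt_of_mem_cell_of_lt hε hw hw' hij
    rw [if_pos hij, this, MeasureTheory.setLIntegral_congr_fun (measurableSet_cell j) fun w' hw' =>
      T.weight_eq h₁ h₂ hi hj hij hw hw', MeasureTheory.setLIntegral_const, volume_cell]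
  · rw [if_neg (lt_irrefl _), zero_mul, MeasureTheory.setLIntegral_congr_fun (g := fun _ => 0)
      ((measurableSet_cell i).inter measurableSet_Ioi) fun w' hw' =>
      T.weight_eq_zero h₁ h₂ hi hw hw'.1, MeasureTheory.lintegral_zero]
  · have : cell ε j ∩ Set.Ioi w = ∅ := by
      rw [Set.eq_empty_iff_forall_notMem]
      rintro w' ⟨hw', h⟩
      exact absurd (lt_of_mem_cell_of_lt hε hw' hw hij) (not_lt.2 (le_of_lt h))
    rw [if_neg hij.not_gt, zero_mul, this, MeasureTheory.Measure.restrict_empty,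
      MeasureTheory.lintegral_zero_measure]

/-- The interaction potential at the time of a stage. -/
theorem potential_tm (n : ℕ) : potential F ε u₀ (tm F ε sgn K X n) =
    potSum F ε sgn lev K X n (grp (K n) (X n)) * ENNReal.ofReal ε * ENNReal.ofReal ε := by
  rw [T.potential_eq le_rfl (T.traj.tm_strictMono (Nat.lt_succ_self n)), adv_sub_self]

/-- The interaction potential between two stages. -/
theorem potential_of_lt (h₁ : tm F ε sgn K X n < t) (h₂ : t < tm F ε sgn K X (n + 1)) :
    potential F ε u₀ t = potSum F ε sgn lev K X n (front F ε sgn lev (K n) (X n)) *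
      ENNReal.ofReal ε * ENNReal.ofReal ε := by
  rw [T.potential_eq h₁.le h₂]
  congr 2
  refine Finset.sum_congr rfl fun i hi => Finset.sum_congr rfl fun j hj => ?_
  -- After the stage and before the next one, cells share a position exactly when they are on one
  -- front.
  have : ∀ k ∈ K n, grp (K n) (adv F ε sgn lev (K n) (X n) (t - tm F ε sgn K X n)) k =
      front F ε sgn lev (K n) (X n) k := by
    intro k hk
    ext l
    rw [mem_grp, mem_front]
    rw [tm_succ] at h₂
    exact and_congr_right fun hl => (T.traj.cfg n).adv_eq_iff T.traj.pos hl hk (sub_pos.2 h₁)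
      (by rw [← dl]; linarith)
  rw [stageWt, stageWt, wt, wt, this i hi, this j hj]

end Track

end

/-! ### Change of speed and estimates of the potential -/

section

open scoped Classical

section Fronts

variable {F : ℝ → ℝ} {ε : ℝ} {sgn lev : ℕ → ℤ} {K : Finset ℕ} {X : ℕ → ℝ}

theorem Config.sum_below_front (hε : 0 < ε) (hc : Config sgn lev K X) {k : ℕ} (hk : k ∈ K) :
    ∑ j ∈ K.filter (fun j => ∀ g ∈ front F ε sgn lev K X k, j < g), sgn j =
      below sgn K X (X k) +
        ∑ j ∈ (K.filter (X · = X k)).filter (vel F ε sgn lev K X · < vel F ε sgn lev K X k),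
          sgn j := by
  rw [below, ← Finset.sum_union]
  · congr 1
    ext j
    simp only [Finset.mem_filter, Finset.mem_union]
    constructor
    · rintro ⟨hj, h⟩
      have hjk := h k (mem_front_self hk)
      rcases (hc.mono j hj k hk hjk.le).lt_or_eq with h' | h'
      · exact Or.inl ⟨hj, h'⟩
      · refine Or.inr ⟨⟨hj, h'⟩, lt_of_le_of_ne (hc.vel_mono hε hj hk h' hjk.le) fun he => ?_⟩
        exact lt_irrefl _ (h j (mem_front.2 ⟨hj, h', he⟩))
    · rintro (⟨hj, h⟩ | ⟨⟨hj, h⟩, h'⟩)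
      · refine ⟨hj, fun g hg => ?_⟩
        rw [mem_front] at hg
        by_contra! hlt
        have := hc.mono g hg.1 j hj hlt
        rw [hg.2.1] at this
        linarith
      · refine ⟨hj, fun g hg => ?_⟩
        rw [mem_front] at hg
        by_contra! hlt
        have := hc.vel_mono (F := F) hε hg.1 hj (hg.2.1.trans h.symm) hlt
        rw [hg.2.2] at this
        linarith
  · rw [Finset.disjoint_left]
    intro j hj hj'
    simp only [Finset.mem_filter] at hj hj'
    exact hj.2.ne hj'.1.2

/-- The states on the two sides of a wavefront. -/
theorem Config.frontLeft_frontRight (hε : 0 < ε) (hc : Config sgn lev K X) {k : ℕ} (hk : k ∈ K)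
    {a b : ℤ} (hab : (front F ε sgn lev K X k).image lev = Finset.Ico a b) :
    frontLeft (gridFlux F ε) (prof ε sgn K X) (X k, vel F ε sgn lev K X k) = sgn k * (a * ε) ∧
    frontRight (gridFlux F ε) (prof ε sgn K X) (X k, vel F ε sgn lev K X k) =
      sgn k * (b * ε) := by
  have hlt := mem_Ico_of_image hab (mem_front_self hk)
  have hs : (sgn k : ℝ) * sgn k = 1 := by exact_mod_cast hc.sgn_mul_self k
  have hsum := hc.sum_below_front (F := F) hε hk
  have hi := (hc.run_front (F := F) hε hk).image_lev hc.toPreConfig (mem_front_self hk)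
  rw [hsum, hab] at hi
  set A := below sgn K X (X k) +
    ∑ j ∈ (K.filter (X · = X k)).filter (vel F ε sgn lev K X · < vel F ε sgn lev K X k), sgn j
    with hA
  have hc0 : 0 < (front F ε sgn lev K X k).card := Finset.card_pos.2 ⟨k, mem_front_self hk⟩
  have hmem : ∀ m, (a ≤ m ∧ m < b) ↔
      (sgn k * A ≤ m ∧ m < sgn k * A + (front F ε sgn lev K X k).card) := fun m => by
    rw [← Finset.mem_Ico, hi, Finset.mem_Ico]
  have e1 : a = sgn k * A := by
    have h1 := (hmem a).1 (by omega)
    have h2 := (hmem (sgn k * A)).2 (by omega)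
    omega
  have e2 : b = sgn k * A + (front F ε sgn lev K X k).card := by
    have h1 := (hmem (b - 1)).1 (by omega)
    have h2 := (hmem (sgn k * A + (front F ε sgn lev K X k).card - 1)).2 (by omega)
    omega
  constructor
  · rw [hc.frontLeft_eq hε, ← hA, e1]
    push_cast
    linear_combination (-(A : ℝ) * ε) * hs
  · rw [hc.frontRight_eq hε, e2]
    have e3 : below sgn K X (X k) + ∑ j ∈ (K.filter (X · = X k)).filter
        (vel F ε sgn lev K X · ≤ vel F ε sgn lev K X k), sgn j =
        A + sgn k * (front F ε sgn lev K X k).card := by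
      have : (K.filter (X · = X k)).filter (vel F ε sgn lev K X · ≤ vel F ε sgn lev K X k) =
          (K.filter (X · = X k)).filter (vel F ε sgn lev K X · < vel F ε sgn lev K X k) ∪
            front F ε sgn lev K X k := by
        ext j
        simp only [Finset.mem_filter, Finset.mem_union, mem_front, Fr, le_iff_lt_or_eq]
        tauto
      rw [this, Finset.sum_union, Finset.sum_congr (s₁ := front F ε sgn lev K X k) rfl
        fun j hj => (hc.run_front hε hk).const j hj k (mem_front_self hk), Finset.sum_const,
        nsmul_eq_mul, hA]
      · ring
      · rw [Finset.disjoint_left]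
        intro j hj hj'
        rw [Finset.mem_filter] at hj
        rw [mem_front] at hj'
        exact hj.2.ne hj'.2.2
    simp only at e3 ⊢
    rw [e3]
    push_cast
    linear_combination (-(A : ℝ) * ε) * hs

end Fronts

section SpeedChange

variable {F : ℝ → ℝ} {ε : ℝ}

/-- The grid points, where the derivatives of the envelopes are not controlled, are countably many
and do not affect the integral. -/
theorem integral_of_const_on_cells (hε : 0 < ε) {a b : ℤ} (hab : a ≤ b) {g : ℝ → ℝ} {C : ℝ}
    (h : ∀ m : ℤ, a ≤ m → m < b → ∀ τ, m * ε < τ → τ < (m + 1) * ε → g τ = C) :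
    ∫ τ in (a * ε : ℝ)..(b * ε), g τ = C * ((b - a) * ε) := by
  have hab' : (a : ℝ) * ε ≤ b * ε := by
    have : (a : ℝ) ≤ b := by exact_mod_cast hab
    gcongr
  have hae : ∀ᵐ τ : ℝ, τ ∉ Set.range fun k : ℤ => (k : ℝ) * ε :=
    (Set.countable_range _).ae_notMem _
  rw [intervalIntegral.integral_congr_ae (g := fun _ => C), intervalIntegral.integral_const,
    smul_eq_mul]
  · ring
  · filter_upwards [hae] with τ hτ hτ'
    rw [Set.uIoc_of_le hab'] at hτ'
    obtain ⟨k, hk1, hk2⟩ := exists_cell hε τ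
    have hk1' : k * ε < τ := lt_of_le_of_ne hk1 fun e => hτ ⟨k, e⟩
    refine h k ?_ ?_ τ hk1' hk2
    · have : (a : ℝ) * ε < ((k + 1 : ℤ) : ℝ) * ε := by push_cast; linarith [hτ'.1]
      have : (a : ℝ) < ((k + 1 : ℤ) : ℝ) := lt_of_mul_lt_mul_right this hε.le
      have : a < k + 1 := by exact_mod_cast this
      omega
    · have : (k : ℝ) * ε < b * ε := by linarith [hτ'.2]
      have : (k : ℝ) < b := lt_of_mul_lt_mul_right this hε.le
      exact_mod_cast this

/-- The deviations from a weighted mean balance, so the two terms are equal. This doubling is the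
origin of the factor `1/2` in front of the change of speed. -/
theorem abs_sub_average {x y p q : ℝ} (hxy : y ≤ x) (hp : 0 < p) (hq : 0 < q) :
    |x - (x * p + y * q) / (p + q)| * p + |y - (x * p + y * q) / (p + q)| * q =
      2 * (p * q * (x - y) / (p + q)) := by
  have hpq : 0 < p + q := by linarith
  have e1 : x - (x * p + y * q) / (p + q) = q * (x - y) / (p + q) := by field_simp; ring
  have e2 : y - (x * p + y * q) / (p + q) = -(p * (x - y) / (p + q)) := by field_simp; ring
  rw [e1, e2, abs_neg, abs_of_nonneg, abs_of_nonneg]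
  · field_simp; ring
  · exact div_nonneg (mul_nonneg hp.le (sub_nonneg.2 hxy)) hpq.le
  · exact div_nonneg (mul_nonneg hq.le (sub_nonneg.2 hxy)) hpq.le

/-- The change of speed when two wavefronts of the same sign merge. -/
theorem speedChange_eq (hε : 0 < ε) {s : ℤ} (hs : s = 1 ∨ s = -1) {a b c : ℤ} (hab : a < b)
    (hbc : b < c) {x y : ℝ} (hxy : y ≤ x)
    (h₁ : ∀ m, a ≤ m → m < b → slope (flux F ε s) a b m = x * ε)
    (h₂ : ∀ m, b ≤ m → m < c → slope (flux F ε s) b c m = y * ε)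
    (h₃ : ∀ m, a ≤ m → m < c → slope (flux F ε s) a c m =
      (x * ε * (b - a) + y * ε * (c - b)) / (c - a)) :
    speedChange (gridFlux F ε) (s * (a * ε)) (s * (b * ε)) (s * (c * ε)) =
      2 * (((b - a) * (c - b) * ((x - y) / (ε * (c - a)))) * ε * ε) := by
  have r1 : (0 : ℝ) < b - a := by have : (a : ℝ) < b := by exact_mod_cast hab
                                  linarith
  have r2 : (0 : ℝ) < c - b := by have : (b : ℝ) < c := by exact_mod_cast hbc
                                  linarith
  have h₃' : ∀ m, a ≤ m → m < c → slope (flux F ε s) a c m / ε =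
      (x * (b - a) + y * (c - b)) / ((b - a) + (c - b)) := by
    intro m h1 h2
    have : (c : ℝ) - a ≠ 0 := by linarith
    have : (b - a : ℝ) + (c - b) ≠ 0 := by linarith
    rw [h₃ m h1 h2]
    field_simp
    ring
  have h₁' : ∀ m, a ≤ m → m < b → slope (flux F ε s) a b m / ε = x := fun m h1 h2 => by
    rw [h₁ m h1 h2, mul_div_cancel_right₀ _ hε.ne']
  have h₂' : ∀ m, b ≤ m → m < c → slope (flux F ε s) b c m / ε = y := fun m h1 h2 => by
    rw [h₂ m h1 h2, mul_div_cancel_right₀ _ hε.ne']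
  have hfin : |x - (x * (b - a) + y * (c - b)) / ((b - a) + (c - b))| * ((b - a) * ε) +
      |y - (x * (b - a) + y * (c - b)) / ((b - a) + (c - b))| * ((c - b) * ε) =
      2 * (((b - a) * (c - b) * ((x - y) / (ε * (c - a)))) * ε * ε) := by
    have := abs_sub_average hxy r1 r2
    rw [← mul_assoc, ← mul_assoc, ← add_mul, this]
    have h1 : (c : ℝ) - a ≠ 0 := by linarith
    rw [show (b - a : ℝ) + (c - b) = c - a by ring]
    field_simp
  rcases hs with rfl | rfl
  · have hlt : ((1 : ℤ) : ℝ) * (a * ε) < ((1 : ℤ) : ℝ) * (b * ε) := by push_cast; nlinarith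
    rw [speedChange, if_pos hlt]
    simp only [Int.cast_one, one_mul]
    rw [integral_of_const_on_cells hε hab.le
        (C := |x - (x * (b - a) + y * (c - b)) / ((b - a) + (c - b))|),
      integral_of_const_on_cells hε hbc.le
        (C := |y - (x * (b - a) + y * (c - b)) / ((b - a) + (c - b))|), hfin]
    · intro m hm1 hm2 τ hτ1 hτ2
      rw [deriv_convEnv hε hm1 hm2 (convex_Icc _ _) Set.Ioo_subset_Icc_self subset_rfl hτ1 hτ2,
        deriv_convEnv hε (hab.le.trans hm1) hm2 (convex_Icc _ _) Set.Ioo_subset_Icc_self subset_rfl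
          hτ1 hτ2, h₂' m hm1 hm2, h₃' m (hab.le.trans hm1) hm2]
    · intro m hm1 hm2 τ hτ1 hτ2
      rw [deriv_convEnv hε hm1 hm2 (convex_Icc _ _) Set.Ioo_subset_Icc_self subset_rfl hτ1 hτ2,
        deriv_convEnv hε hm1 (hm2.trans hbc) (convex_Icc _ _) Set.Ioo_subset_Icc_self subset_rfl
          hτ1 hτ2, h₁' m hm1 hm2, h₃' m hm1 (hm2.trans hbc)]
  · have hlt : ¬ ((-1 : ℤ) : ℝ) * (a * ε) < ((-1 : ℤ) : ℝ) * (b * ε) := by push_cast; nlinarith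
    rw [speedChange, if_neg hlt]
    have e : ∀ k : ℤ, ((-1 : ℤ) : ℝ) * (k * ε) = (-k : ℤ) * ε := fun k => by push_cast; ring
    rw [e, e, e]
    -- For negative waves the grid interval `m` of states carries the oriented level `-m - 1`.
    have i1 := integral_of_const_on_cells hε (a := -b) (b := -a) (by omega)
      (g := fun τ => |deriv (concEnv (Set.Icc ((-b : ℤ) * ε) ((-a : ℤ) * ε)) (gridFlux F ε)) τ -
        deriv (concEnv (Set.Icc ((-c : ℤ) * ε) ((-a : ℤ) * ε)) (gridFlux F ε)) τ|)
      (C := |x - (x * (b - a) + y * (c - b)) / ((b - a) + (c - b))|) (by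
        intro m hm1 hm2 τ hτ1 hτ2
        have hm1' : a ≤ -m - 1 := by omega
        have hm2' : -m - 1 < b := by omega
        have t1 : -(((-m - 1 : ℤ) : ℝ) + 1) * ε < τ := by push_cast; linarith
        have t2 : τ < -((-m - 1 : ℤ) : ℝ) * ε := by push_cast; linarith
        push_cast
        rw [deriv_concEnv hε hm1' hm2' (convex_Icc _ _) Set.Ioo_subset_Icc_self subset_rfl t1 t2,
          deriv_concEnv hε hm1' (hm2'.trans hbc) (convex_Icc _ _) Set.Ioo_subset_Icc_self
            subset_rfl t1 t2, h₁' _ hm1' hm2', h₃' _ hm1' (hm2'.trans hbc)])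
    have i2 := integral_of_const_on_cells hε (a := -c) (b := -b) (by omega)
      (g := fun τ => |deriv (concEnv (Set.Icc ((-c : ℤ) * ε) ((-b : ℤ) * ε)) (gridFlux F ε)) τ -
        deriv (concEnv (Set.Icc ((-c : ℤ) * ε) ((-a : ℤ) * ε)) (gridFlux F ε)) τ|)
      (C := |y - (x * (b - a) + y * (c - b)) / ((b - a) + (c - b))|) (by
        intro m hm1 hm2 τ hτ1 hτ2
        have hm1' : b ≤ -m - 1 := by omega
        have hm2' : -m - 1 < c := by omega
        have t1 : -(((-m - 1 : ℤ) : ℝ) + 1) * ε < τ := by push_cast; linarith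
        have t2 : τ < -((-m - 1 : ℤ) : ℝ) * ε := by push_cast; linarith
        push_cast
        rw [deriv_concEnv hε hm1' hm2' (convex_Icc _ _) Set.Ioo_subset_Icc_self subset_rfl t1 t2,
          deriv_concEnv hε (hab.le.trans hm1') hm2' (convex_Icc _ _) Set.Ioo_subset_Icc_self
            subset_rfl t1 t2, h₂' _ hm1' hm2', h₃' _ (hab.le.trans hm1') hm2'])
    rw [i1, i2, ← hfin]
    push_cast
    ring

end SpeedChange

variable {F : ℝ → ℝ} {u₀ : ℝ → ℝ} {ε : ℝ} {sgn lev : ℕ → ℤ} {N : ℕ}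
  {K : ℕ → Finset ℕ} {X : ℕ → ℕ → ℝ}

namespace Track

/-- Every weight is at most `normF2 F`, and adding the double sum over `i < j` to its transpose
counts no pair of cells twice, so twice the sum is at most `normF2 F` times `N²`. -/
theorem potential_zero_le (T : Track F ε u₀ sgn lev N K X) (hF : ContDiff ℝ 2 F)
    (htv : totalVar u₀ ≠ ⊤) : potential F ε u₀ 0 ≤ normF2 F * totalVar u₀ ^ 2 / 2 := by
  have h0 := T.potential_tm 0
  rw [tm_zero] at h0
  have hle := T.traj.potSum_le hF 0
  have e : totalVar u₀ = N * ENNReal.ofReal ε := by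
    rw [← ENNReal.ofReal_toReal htv, T.cells.total, ENNReal.ofReal_mul (Nat.cast_nonneg _),
      ENNReal.ofReal_natCast]
  rw [ENNReal.le_div_iff_mul_le (Or.inl two_ne_zero) (Or.inl ENNReal.ofNat_ne_top), h0, e]
  have hsum : (∑ i ∈ K 0, ∑ j ∈ K 0, if i < j then normF2 F else 0) * 2 ≤
      normF2 F * (N * N) := by
    rw [mul_two]
    nth_rewrite 2 [Finset.sum_comm]
    rw [← Finset.sum_add_distrib]
    simp only [← Finset.sum_add_distrib]
    refine (Finset.sum_le_sum fun i _ => Finset.sum_le_sum (g := fun _ => normF2 F)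
      fun j _ => ?_).trans (le_of_eq ?_)
    · split_ifs with h1 h2
      · exact absurd (h1.trans h2) (lt_irrefl _)
      · rw [add_zero]
      · rw [zero_add]
      · rw [add_zero]; exact zero_le
    · rw [Finset.sum_const, Finset.sum_const, T.zero, Finset.card_range, nsmul_eq_mul,
        nsmul_eq_mul]
      ring
  calc _ ≤ (∑ i ∈ K 0, ∑ j ∈ K 0, if i < j then normF2 F else 0) * ENNReal.ofReal ε *
        ENNReal.ofReal ε * 2 := by gcongr
    _ = ((∑ i ∈ K 0, ∑ j ∈ K 0, if i < j then normF2 F else 0) * 2) * ENNReal.ofReal ε *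
        ENNReal.ofReal ε := by ring
    _ ≤ (normF2 F * (N * N)) * ENNReal.ofReal ε * ENNReal.ofReal ε := by gcongr
    _ = _ := by ring

/-- Strictly between two stages the potential is constant, given by the sum over fronts. Everything
reduces to the chain: group sum at `n`, front sum at `n`, group sum at `n + 1`, in decreasing order.
-/
theorem potential_antitoneOn (T : Track F ε u₀ sgn lev N K X) (hF : ContDiff ℝ 2 F) :
    AntitoneOn (potential F ε u₀) (Set.Ici 0) := by
  intro s hs t ht hst
  obtain ⟨n, hn₁, hn₂⟩ := T.traj.exists_stage hs
  obtain ⟨m, hm₁, hm₂⟩ := T.traj.exists_stage ht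
  have hnm := T.stage_le hn₁ hst hm₂
  have up : ∀ {r : ℝ} {l : ℕ}, tm F ε sgn K X l ≤ r → r < tm F ε sgn K X (l + 1) →
      potential F ε u₀ r ≤ potSum F ε sgn lev K X l (grp (K l) (X l)) * ENNReal.ofReal ε *
        ENNReal.ofReal ε := by
    intro r l h1 h2
    rcases h1.eq_or_lt with rfl | h1
    · exact (T.potential_tm l).le
    · rw [T.potential_of_lt h1 h2]
      gcongr
      exact T.traj.potSum_front_le l
  have down : ∀ {r : ℝ} {l : ℕ}, tm F ε sgn K X l ≤ r → r < tm F ε sgn K X (l + 1) →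
      potSum F ε sgn lev K X l (front F ε sgn lev (K l) (X l)) * ENNReal.ofReal ε *
        ENNReal.ofReal ε ≤ potential F ε u₀ r := by
    intro r l h1 h2
    rcases h1.eq_or_lt with rfl | h1
    · rw [T.potential_tm l]
      gcongr
      exact T.traj.potSum_front_le l
    · exact (T.potential_of_lt h1 h2).ge
  rcases hnm.eq_or_lt with rfl | hlt
  · rcases hn₁.eq_or_lt with rfl | hn₁
    · rw [T.potential_tm]; exact up hm₁ hm₂
    · rw [T.potential_of_lt hn₁ hn₂, T.potential_of_lt (hn₁.trans_le hst) hm₂]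
  · refine (up hm₁ hm₂).trans (le_trans ?_ (down hn₁ hn₂))
    gcongr
    exact (T.traj.potSum_grp_antitone hF hlt).trans (T.traj.potSum_succ_le hF n)

/-- Only two fronts meet at a stage, so the given ones are those of `p` and `q`, told apart by their
speeds. Each front carries a jump of its own sign, so the monotonicity of `a`, `b`, `c` forces equal
signs and no cell is canceled. -/
theorem exists_mergeAt (T : Track F ε u₀ sgn lev N K X) {n : ℕ} {a b c : ℝ}
    (hI : Interaction (gridFlux F ε) u₀ n a b c) (hs : a < b ∧ b < c ∨ c < b ∧ b < a) :
    ∃ p q α β γ, MergeAt F ε sgn lev K X n p q α β γ ∧ a = sgn p * (α * ε) ∧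
      b = sgn p * (β * ε) ∧ c = sgn p * (γ * ε) := by
  have hε := T.traj.pos
  have hc := T.traj.cfg n
  obtain ⟨P, hP, Q, hQ, hv, hpos, ea, eb, eb', ec⟩ := hI
  rw [interactingFronts, T.profile] at hP hQ
  rw [T.profile] at hpos ea eb eb' ec
  obtain ⟨i, hi, rfl⟩ := (hc.mem_fronts hε P).1 hP.1
  obtain ⟨j, hj, rfl⟩ := (hc.mem_fronts hε Q).1 hQ.1
  simp only at hv
  have hF : ¬ Fr F ε sgn lev (K n) (X n) i j := fun h => hv.ne h.2.symm
  have hadv : adv F ε sgn lev (K n) (X n) (dl F ε sgn K X n) i =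
      adv F ε sgn lev (K n) (X n) (dl F ε sgn K X n) j := hpos
  have hne : (meetingTimes (gridFlux F ε) (prof ε sgn (K n) (X n))).Nonempty :=
    ⟨_, (hc.mem_meetingTimes hε _).2 ⟨T.traj.dl_pos n, i, hi, j, hj, hF, hadv⟩⟩
  obtain ⟨p, q, hm, hcase⟩ := T.traj.meet n hne
  obtain ⟨hip, hjq⟩ : Fr F ε sgn lev (K n) (X n) i p ∧ Fr F ε sgn lev (K n) (X n) j q := by
    rcases hm.only i hi j hj hF hadv with h | ⟨h1, h2⟩
    · exact h
    · have := hm.vel_lt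
      rw [← h1.2, ← h2.2] at this
      exact absurd hv this.not_gt
  rw [hip.1, hip.2] at ea eb
  rw [hjq.1, hjq.2] at eb' ec
  obtain ⟨α, β, hαβ, iL⟩ := (hc.run_front (F := F) hε hm.memL).exists_image hc.toPreConfig
    ⟨p, mem_front_self hm.memL⟩
  obtain ⟨β', γ, hβγ, iR⟩ := (hc.run_front (F := F) hε hm.memR).exists_image hc.toPreConfig
    ⟨q, mem_front_self hm.memR⟩
  obtain ⟨l1, l2⟩ := hc.frontLeft_frontRight hε hm.memL iL
  obtain ⟨r1, r2⟩ := hc.frontLeft_frontRight hε hm.memR iR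
  rw [l1] at ea
  rw [l2] at eb
  rw [r1] at eb'
  rw [r2] at ec
  have hαβ' : (α : ℝ) * ε < β * ε := by
    have : (α : ℝ) < β := by exact_mod_cast hαβ
    gcongr
  have hβγ' : (β' : ℝ) * ε < γ * ε := by
    have : (β' : ℝ) < γ := by exact_mod_cast hβγ
    gcongr
  have hpq : sgn p = sgn q := by
    rcases hc.sgn_eq p with e | e <;> rcases hc.sgn_eq q with e' | e' <;>
      rw [e] at ea eb ⊢ <;> rw [e'] at eb' ec ⊢ <;> exfalso <;> push_cast at ea eb eb' ec <;>
      rcases hs with hs | hs <;> linarith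
  have hK : K (n + 1) = K n := by
    rcases hcase with h | h
    · exact absurd hpq h.1
    · exact h.2
  obtain ⟨α', β'', γ', h⟩ := T.traj.exists_mergeAt hm hpq hK
  obtain ⟨l1', l2'⟩ := hc.frontLeft_frontRight hε hm.memL h.imL
  obtain ⟨r1', r2'⟩ := hc.frontLeft_frontRight hε hm.memR h.imR
  refine ⟨p, q, α', β'', γ', h, ?_, ?_, ?_⟩
  · rw [← ea, ← l1, l1']
  · rw [← eb, ← l2, l2']
  · rw [← ec, ← r2, r2', hpq]

/-- The potential is constant on the open time intervals adjacent to the interaction, so the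
one-sided limits are the front sums at `n` and `n + 1`. The gain of `MergeAt.potSum_succ_add_le`,
times `ε²`, is half the change of speed. -/
theorem speedChange_le (T : Track F ε u₀ sgn lev N K X) (hF : ContDiff ℝ 2 F) {n : ℕ} {a b c : ℝ}
    (hI : Interaction (gridFlux F ε) u₀ n a b c) (hs : a < b ∧ b < c ∨ c < b ∧ b < a) :
    ∃ qMinus qPlus : ℝ≥0∞,
      Filter.Tendsto (potential F ε u₀) (nhdsWithin (stage (gridFlux F ε) u₀ (n + 1)).time
        (Set.Iio (stage (gridFlux F ε) u₀ (n + 1)).time)) (nhds qMinus) ∧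
      Filter.Tendsto (potential F ε u₀) (nhdsWithin (stage (gridFlux F ε) u₀ (n + 1)).time
        (Set.Ioi (stage (gridFlux F ε) u₀ (n + 1)).time)) (nhds qPlus) ∧
      ENNReal.ofReal (speedChange (gridFlux F ε) a b c) / 2 + qPlus ≤ qMinus := by
  have hε := T.traj.pos
  obtain ⟨p, q, α, β, γ, h, rfl, rfl, rfl⟩ := T.exists_mergeAt hI hs
  rw [T.time]
  refine ⟨potSum F ε sgn lev K X n (front F ε sgn lev (K n) (X n)) * ENNReal.ofReal ε *
      ENNReal.ofReal ε,
    potSum F ε sgn lev K X (n + 1) (front F ε sgn lev (K (n + 1)) (X (n + 1))) *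
      ENNReal.ofReal ε * ENNReal.ofReal ε,
    tendsto_const_nhds.congr' ?_, tendsto_const_nhds.congr' ?_, ?_⟩
  · filter_upwards [Ioo_mem_nhdsLT (T.traj.tm_strictMono (Nat.lt_succ_self n))] with t ht
    exact (T.potential_of_lt ht.1 ht.2).symm
  · filter_upwards [Ioo_mem_nhdsGT (T.traj.tm_strictMono (Nat.lt_succ_self (n + 1)))] with t ht
    exact (T.potential_of_lt ht.1 ht.2).symm
  · have hcfg := T.traj.cfg (n + 1)
    have hIm := h.im
    rw [h.keep, T.traj.succ n] at hcfg hIm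
    obtain ⟨s1, s2, s3, -⟩ := h.meet.vel_adv hε (T.traj.cfg n) h.same hcfg h.hab h.hbc h.imL h.imR
      hIm
    rw [speedChange_eq hε ((T.traj.cfg n).sgn_eq p) h.hab h.hbc h.meet.vel_lt.le s1 s2 s3]
    set D := ((β : ℝ) - α) * (γ - β) *
      ((vel F ε sgn lev (K n) (X n) p - vel F ε sgn lev (K n) (X n) q) / (ε * (γ - α))) with hD
    have hhalf : ENNReal.ofReal (2 * (D * ε * ε)) / 2 =
        ENNReal.ofReal D * ENNReal.ofReal ε * ENNReal.ofReal ε := by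
      rw [ENNReal.ofReal_mul zero_le_two, ENNReal.ofReal_mul' hε.le, ENNReal.ofReal_mul' hε.le,
        ENNReal.ofReal_ofNat, mul_comm, mul_div_assoc, ENNReal.div_self two_ne_zero
          ENNReal.ofNat_ne_top, mul_one]
    rw [hhalf, ← add_mul, ← add_mul]
    gcongr
    rw [add_comm]
    refine le_trans ?_ (h.potSum_succ_add_le T.traj hF)
    gcongr
    exact T.traj.potSum_front_le (n + 1)

end Track

end

section

open scoped Classical

variable {F : ℝ → ℝ} {ε : ℝ} {sgn lev sgn' lev' : ℕ → ℤ}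

/-! ### Configurations with the same profile -/

section Profile

variable {K K' : Finset ℕ} {X X' : ℕ → ℝ}

theorem upto_eq_of_prof_eq (hε : 0 < ε) (h : prof ε sgn K X = prof ε sgn' K' X') (x : ℝ) :
    upto sgn K X x = upto sgn' K' X' x := by
  have := congrFun h x
  rw [prof, prof] at this
  exact_mod_cast mul_right_cancel₀ hε.ne' this

theorem below_eq_of_prof_eq (hε : 0 < ε) (h : prof ε sgn K X = prof ε sgn' K' X') (x : ℝ) :
    below sgn K X x = below sgn' K' X' x := by
  have := leftLim_prof ε sgn K X x
  rw [h, leftLim_prof] at this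
  exact_mod_cast (mul_right_cancel₀ hε.ne' this).symm

/-- The speed of a cell is determined by the profile. -/
theorem Config.vel_eq_of_prof_eq (hε : 0 < ε) (hc : Config sgn lev K X)
    (hc' : Config sgn' lev' K' X') (h : prof ε sgn K X = prof ε sgn' K' X') {k k' : ℕ} (hk : k ∈ K)
    (hk' : k' ∈ K') (hX : X k = X' k') (hs : sgn' k' = sgn k) (hl : lev' k' = lev k) :
    vel F ε sgn lev K X k = vel F ε sgn' lev' K' X' k' := by
  have h1 := hc.lev_mem hk
  have h2 := hc'.lev_mem hk'
  rw [vel_eq (hc.image_grp hk) (h1.1.trans_lt h1.2) rfl,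
    vel_eq (hc'.image_grp hk') (h2.1.trans_lt h2.2) rfl, hs, hl, ← hX, below_eq_of_prof_eq hε h,
    upto_eq_of_prof_eq hε h]

/-- The jump of the common profile at `X k` fixes the sign and the interval of levels of the cells
there. The level of `k` lies in that interval, hence is the level of some cell of `K'`. -/
theorem Config.exists_matching_cell (hε : 0 < ε) (hc : Config sgn lev K X)
    (hc' : Config sgn' lev' K' X') (h : prof ε sgn K X = prof ε sgn' K' X') {k : ℕ} (hk : k ∈ K) :
    ∃ k' ∈ K', X' k' = X k ∧ sgn' k' = sgn k ∧ lev' k' = lev k := by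
  have hlt := hc.lev_mem hk
  rw [below_eq_of_prof_eq hε h, upto_eq_of_prof_eq hε h] at hlt
  have hne : (K'.filter (X' · = X k)).Nonempty := by
    rw [Finset.nonempty_iff_ne_empty]
    intro he
    rw [upto_eq, he, Finset.sum_empty, add_zero] at hlt
    linarith [hlt.1, hlt.2]
  obtain ⟨l, hl⟩ := hne
  rw [Finset.mem_filter] at hl
  have hl2 := hc'.lev_mem hl.1
  rw [hl.2] at hl2
  have hs : sgn' l = sgn k := by
    rcases hc.sgn_eq k with e | e <;> rcases hc'.sgn_eq l with e' | e' <;>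
      rw [e] at hlt ⊢ <;> rw [e'] at hl2 ⊢ <;> exfalso <;> linarith [hlt.1, hlt.2, hl2.1, hl2.2]
  have hm : lev k ∈ (grp K' X' l).image lev' := by
    rw [hc'.image_grp hl.1, Finset.mem_Ico, hl.2, hs]
    exact hlt
  obtain ⟨j, hj, hjk⟩ := Finset.mem_image.1 hm
  have hj' := mem_grp.1 hj
  exact ⟨j, hj'.1, hj'.2.trans hl.2, (hc'.same j hj'.1 l hl.1 hj'.2).trans hs, hjk⟩

theorem Config.eq_of_lev_eq (hc : Config sgn lev K X) {k l : ℕ} (hk : k ∈ K) (hl : l ∈ K)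
    (hX : X k = X l) (h : lev k = lev l) : k = l :=
  ((hc.run_grp hl).strictMonoOn hc.toPreConfig).injOn (mem_grp.2 ⟨hk, hX⟩) (mem_grp_self hl) h

/-- An order preserving bijection between sets of cells which preserves signs and states. -/
structure Matching (sgn lev sgn' lev' : ℕ → ℤ) (A A' : Finset ℕ) (φ : ℕ → ℕ) : Prop where
  bij : Set.BijOn φ A A'
  mono : StrictMonoOn φ A
  sgn_eq : ∀ k ∈ A, sgn' (φ k) = sgn k
  lev_eq : ∀ k ∈ A, lev' (φ k) = lev k

/-- The cells in `B` and `B'` and their positions correspond to each other. -/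
def Corr (A : Finset ℕ) (φ : ℕ → ℕ) (B : Finset ℕ) (Y : ℕ → ℝ) (B' : Finset ℕ) (Y' : ℕ → ℝ) :
    Prop :=
  ∀ k ∈ A, (k ∈ B ↔ φ k ∈ B') ∧ (k ∈ B → Y k = Y' (φ k))

/-- Position and level identify a cell, and levels increase along the cells at one position. The
correspondence given cell by cell is therefore bijective and preserves the order. -/
theorem Config.exists_matching (hε : 0 < ε) (hc : Config sgn lev K X)
    (hc' : Config sgn' lev' K' X') (h : prof ε sgn K X = prof ε sgn' K' X') :
    ∃ φ, Matching sgn lev sgn' lev' K K' φ ∧ Corr K φ K X K' X' := by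
  have hex : ∀ k, ∃ k', k ∈ K → k' ∈ K' ∧ X' k' = X k ∧ sgn' k' = sgn k ∧ lev' k' = lev k := by
    intro k
    by_cases hk : k ∈ K
    · obtain ⟨k', h'⟩ := hc.exists_matching_cell hε hc' h hk
      exact ⟨k', fun _ => h'⟩
    · exact ⟨0, fun h => absurd h hk⟩
  choose φ hφ using hex
  have hmono : StrictMonoOn φ K := by
    intro k hk l hl hkl
    obtain ⟨a1, a2, -, a4⟩ := hφ k hk
    obtain ⟨b1, b2, -, b4⟩ := hφ l hl
    by_contra! hle
    have hX : X k = X l := by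
      refine le_antisymm (hc.mono k hk l hl hkl.le) ?_
      rw [← a2, ← b2]
      exact hc'.mono _ b1 _ a1 hle
    have h1 := (hc.run_grp hl).strictMonoOn hc.toPreConfig (mem_grp.2 ⟨hk, hX⟩) (mem_grp_self hl) hkl
    have h2 := ((hc'.run_grp b1).strictMonoOn hc'.toPreConfig).monotoneOn (mem_grp_self b1)
      (mem_grp.2 ⟨a1, by rw [a2, b2, hX]⟩) hle
    omega
  refine ⟨φ, ⟨⟨fun k hk => (hφ k hk).1, hmono.injOn, fun k' hk' => ?_⟩, hmono,
    fun k hk => (hφ k hk).2.2.1, fun k hk => (hφ k hk).2.2.2⟩,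
    fun k hk => ⟨iff_of_true hk (hφ k hk).1, fun _ => (hφ k hk).2.1.symm⟩⟩
  obtain ⟨k, hk, e1, -, e3⟩ := hc'.exists_matching_cell hε hc h.symm hk'
  obtain ⟨a1, a2, -, a4⟩ := hφ k hk
  exact ⟨k, hk, hc'.eq_of_lev_eq a1 hk' (a2.trans e1) (a4.trans e3)⟩

end Profile

section Matching

variable {A A' : Finset ℕ} {φ : ℕ → ℕ}

theorem Matching.mem_image (M : Matching sgn lev sgn' lev' A A' φ) {J : Finset ℕ} (hJ : J ⊆ A)
    {k : ℕ} (hk : k ∈ A) : φ k ∈ J.image φ ↔ k ∈ J := by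
  rw [Finset.mem_image]
  refine ⟨fun ⟨l, hl, h⟩ => ?_, fun h => ⟨k, h, rfl⟩⟩
  rwa [← M.bij.injOn (hJ hl) hk h]

theorem Matching.grp_image (M : Matching sgn lev sgn' lev' A A' φ) {B B' : Finset ℕ} {Y Y' : ℕ → ℝ}
    (hB : B ⊆ A) (hB' : B' ⊆ A') (h : Corr A φ B Y B' Y') {i : ℕ} (hi : i ∈ B) :
    grp B' Y' (φ i) = (grp B Y i).image φ := by
  have key : ∀ l ∈ A, φ l ∈ grp B' Y' (φ i) ↔ l ∈ grp B Y i := by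
    intro l hl
    rw [mem_grp, mem_grp, ← (h l hl).1, ← (h i (hB hi)).2 hi]
    exact and_congr_right fun hlB => by rw [(h l hl).2 hlB]
  ext l'
  constructor
  · intro hl'
    obtain ⟨l, hl, rfl⟩ := M.bij.surjOn (hB' (mem_grp.1 hl').1)
    exact Finset.mem_image_of_mem _ ((key l hl).1 hl')
  · intro hl'
    obtain ⟨l, hl, rfl⟩ := Finset.mem_image.1 hl'
    exact (key l (hB (mem_grp.1 hl).1)).2 hl

theorem Matching.grpSlope_image (M : Matching sgn lev sgn' lev' A A' φ) {J : Finset ℕ} (hJ : J ⊆ A)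
    {k : ℕ} (hk : k ∈ A) :
    grpSlope F ε sgn' lev' (J.image φ) (φ k) = grpSlope F ε sgn lev J k := by
  have : lev' '' (J.image φ : Finset ℕ) = lev '' J := by
    rw [Finset.coe_image, Set.image_image]
    exact Set.image_congr fun l hl => M.lev_eq l (hJ hl)
  rw [grpSlope, grpSlope, this, M.sgn_eq k hk, M.lev_eq k hk]

/-- A weight involves the cells only through order, sign, level, grouping and presence at the
meeting, all of which are carried over by `φ`. Meetings of pairs in one group are irrelevant, so
nothing is asked about them. -/
theorem Matching.wt_eq (M : Matching sgn lev sgn' lev' A A' φ) {C : ℝ≥0∞} {γ γ' : ℕ → Finset ℕ}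
    {E E' : Finset ℕ} {P P' : Prop} (hγ : ∀ k ∈ A, γ k ⊆ A)
    (hγ' : ∀ k ∈ A, γ' (φ k) = (γ k).image φ) {i j : ℕ} (hi : i ∈ A) (hj : j ∈ A)
    (hP : j ∉ γ i → (P ↔ P')) (hE : j ∉ γ i → P → E ⊆ A ∧ E' = E.image φ) :
    wt C F ε sgn' lev' A' γ' E' P' (φ i) (φ j) = wt C F ε sgn lev A γ E P i j := by
  have h1 : (∃ z ∈ A', φ i ≤ z ∧ z ≤ φ j ∧ sgn' z ≠ sgn' (φ i)) ↔
      ∃ z ∈ A, i ≤ z ∧ z ≤ j ∧ sgn z ≠ sgn i := by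
    constructor
    · rintro ⟨z', hz', h⟩
      obtain ⟨z, hz, rfl⟩ := M.bij.surjOn hz'
      rw [M.mono.le_iff_le hi hz, M.mono.le_iff_le hz hj, M.sgn_eq z hz, M.sgn_eq i hi] at h
      exact ⟨z, hz, h⟩
    · rintro ⟨z, hz, h⟩
      refine ⟨φ z, M.bij.mapsTo hz, ?_⟩
      rwa [M.mono.le_iff_le hi hz, M.mono.le_iff_le hz hj, M.sgn_eq z hz, M.sgn_eq i hi]
  have h2 : φ j ∈ γ' (φ i) ↔ j ∈ γ i := by rw [hγ' i hi, M.mem_image (hγ i hi) hj]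
  rw [wt, wt]
  simp only [h1, h2]
  by_cases hs : ∃ z ∈ A, i ≤ z ∧ z ≤ j ∧ sgn z ≠ sgn i
  · rw [if_pos hs, if_pos hs]
  rw [if_neg hs, if_neg hs]
  by_cases hji : j ∈ γ i
  · rw [if_pos (Or.inl hji), if_pos (Or.inl hji)]
  by_cases hp : P
  swap
  · rw [if_pos (Or.inr hp), if_pos (Or.inr fun h => hp ((hP hji).2 h))]
  have hp' := (hP hji).1 hp
  obtain ⟨hEA, rfl⟩ := hE hji hp
  have hint : ∀ k ∈ A, γ' (φ k) ∩ E.image φ = (γ k ∩ E).image φ := by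
    intro k hk
    rw [hγ' k hk, Finset.image_inter_of_injOn]
    refine M.bij.injOn.mono ?_
    rw [← Finset.coe_union, Finset.coe_subset]
    exact Finset.union_subset (hγ k hk) hEA
  rw [if_neg (by tauto), if_neg (by tauto), hint i hi, hint j hj,
    M.grpSlope_image (Finset.inter_subset_left.trans (hγ i hi)) hi,
    M.grpSlope_image (Finset.inter_subset_left.trans (hγ j hj)) hj,
    Finset.card_image_of_injOn (M.bij.injOn.mono hEA)]

end Matching

/-! ### Trajectories as functions of the time -/

variable {K K' : ℕ → Finset ℕ} {X X' : ℕ → ℕ → ℝ}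

/-- The number of the last stage not after the time `t`. -/
def stageNo (F : ℝ → ℝ) (ε : ℝ) (sgn : ℕ → ℤ) (K : ℕ → Finset ℕ) (X : ℕ → ℕ → ℝ) (t : ℝ) : ℕ :=
  sSup {n | tm F ε sgn K X n ≤ t}

/-- The cells present at the time `t`. -/
def cellsAt (F : ℝ → ℝ) (ε : ℝ) (sgn : ℕ → ℤ) (K : ℕ → Finset ℕ) (X : ℕ → ℕ → ℝ) (t : ℝ) :
    Finset ℕ :=
  K (stageNo F ε sgn K X t)

/-- The positions of the cells at the time `t`. -/
def posAt (F : ℝ → ℝ) (ε : ℝ) (sgn lev : ℕ → ℤ) (K : ℕ → Finset ℕ) (X : ℕ → ℕ → ℝ) (t : ℝ) :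
    ℕ → ℝ :=
  adv F ε sgn lev (K (stageNo F ε sgn K X t)) (X (stageNo F ε sgn K X t))
    (t - tm F ε sgn K X (stageNo F ε sgn K X t))

namespace Traj

variable (T : Traj F ε sgn lev K X)
include T

theorem stageNo_eq {n : ℕ} {t : ℝ} (h₁ : tm F ε sgn K X n ≤ t) (h₂ : t < tm F ε sgn K X (n + 1)) :
    stageNo F ε sgn K X t = n := by
  refine IsGreatest.csSup_eq ⟨h₁, fun m hm => ?_⟩
  have := T.tm_strictMono.lt_iff_lt.1 (lt_of_le_of_lt hm h₂)
  omega

theorem cellsAt_eq {n : ℕ} {t : ℝ} (h₁ : tm F ε sgn K X n ≤ t) (h₂ : t < tm F ε sgn K X (n + 1)) :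
    cellsAt F ε sgn K X t = K n := by
  rw [cellsAt, T.stageNo_eq h₁ h₂]

theorem posAt_eq {n : ℕ} {t : ℝ} (h₁ : tm F ε sgn K X n ≤ t) (h₂ : t < tm F ε sgn K X (n + 1)) :
    posAt F ε sgn lev K X t = adv F ε sgn lev (K n) (X n) (t - tm F ε sgn K X n) := by
  rw [posAt, T.stageNo_eq h₁ h₂]

theorem cellsAt_tm (n : ℕ) : cellsAt F ε sgn K X (tm F ε sgn K X n) = K n :=
  T.cellsAt_eq le_rfl (T.tm_strictMono n.lt_succ_self)

theorem posAt_tm (n : ℕ) : posAt F ε sgn lev K X (tm F ε sgn K X n) = X n := by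
  rw [T.posAt_eq le_rfl (T.tm_strictMono n.lt_succ_self), adv_sub_self]

theorem config_at {t : ℝ} (ht : 0 ≤ t) :
    Config sgn lev (cellsAt F ε sgn K X t) (posAt F ε sgn lev K X t) := by
  obtain ⟨n, h₁, h₂⟩ := T.exists_stage ht
  rw [T.cellsAt_eq h₁ h₂, T.posAt_eq h₁ h₂]
  rw [tm_succ] at h₂
  exact (T.cfg n).config_adv T.pos (sub_nonneg.2 h₁) (by rw [← dl]; linarith)

theorem tm_nonneg (n : ℕ) : 0 ≤ tm F ε sgn K X n := by
  rw [← tm_zero (F := F) (ε := ε) (sgn := sgn) (K := K) (X := X)]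
  exact T.tm_strictMono.monotone (Nat.zero_le n)

/-- Two solutions with the same future may have different stages, since the dummy restarts depend on
the past. So the motion is described from an arbitrary time `r`. The speed at `r` is the one at the
stage, because the envelope on a single front is affine with the same slope. -/
theorem posAt_of_lt {n : ℕ} {r s : ℝ} (h₁ : tm F ε sgn K X n ≤ r) (hrs : r < s)
    (h₂ : s ≤ tm F ε sgn K X (n + 1)) {k : ℕ} (hk : k ∈ cellsAt F ε sgn K X r) :
    posAt F ε sgn lev K X s k = posAt F ε sgn lev K X r k +
      vel F ε sgn lev (cellsAt F ε sgn K X r) (posAt F ε sgn lev K X r) k * (s - r) := by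
  have hr := hrs.trans_le h₂
  rw [T.cellsAt_eq h₁ hr] at hk ⊢
  rw [T.posAt_eq h₁ hr, (T.cfg n).vel_adv T.pos (sub_nonneg.2 h₁)
    (by rw [tm_succ] at hr; rw [← dl]; linarith) hk]
  rcases h₂.eq_or_lt with rfl | h₂
  · rw [T.posAt_tm, T.succ n, tm_succ, adv, adv]
    ring
  · rw [T.posAt_eq (h₁.trans hrs.le) h₂, adv, adv]
    ring

/-- Survival is read off the profile at the time `s`: the removal of canceled cells leaves the
profile unchanged, and before the next stage every cell passes the test. -/
theorem mem_cellsAt_of_lt {n : ℕ} {r s : ℝ} (h₁ : tm F ε sgn K X n ≤ r) (hrs : r < s)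
    (h₂ : s ≤ tm F ε sgn K X (n + 1)) {k : ℕ} (hk : k ∈ cellsAt F ε sgn K X r) :
    k ∈ cellsAt F ε sgn K X s ↔ InCellJump sgn lev
      (below sgn (cellsAt F ε sgn K X s) (posAt F ε sgn lev K X s) (posAt F ε sgn lev K X s k))
      (upto sgn (cellsAt F ε sgn K X s) (posAt F ε sgn lev K X s) (posAt F ε sgn lev K X s k)) k := by
  have hr := hrs.trans_le h₂
  rcases h₂.eq_or_lt with rfl | h₂
  · rw [T.cellsAt_eq h₁ hr] at hk
    have hst := T.step n
    have hp : prof ε sgn (K (n + 1)) (X (n + 1)) = prof ε sgn (K n) (X (n + 1)) := by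
      ext x
      rw [prof, prof, T.succ n, hst.upto_eq]
    rw [T.cellsAt_tm, T.posAt_tm, below_eq_of_prof_eq T.pos hp, upto_eq_of_prof_eq T.pos hp,
      T.succ n]
    exact hst.mem_iff k hk
  · rw [T.cellsAt_eq h₁ hr, ← T.cellsAt_eq (h₁.trans hrs.le) h₂] at hk
    exact iff_of_true hk ((T.config_at ((T.tm_nonneg n).trans (h₁.trans hrs.le))).inCellJump hk)

theorem cellsAt_subset {r s : ℝ} (hr : 0 ≤ r) (hrs : r ≤ s) :
    cellsAt F ε sgn K X s ⊆ cellsAt F ε sgn K X r := by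
  obtain ⟨n, h₁, h₂⟩ := T.exists_stage hr
  obtain ⟨m, h₃, h₄⟩ := T.exists_stage (hr.trans hrs)
  rw [T.cellsAt_eq h₁ h₂, T.cellsAt_eq h₃ h₄]
  have := T.tm_strictMono.lt_iff_lt.1 ((h₁.trans hrs).trans_lt h₄)
  exact T.anti (by omega)

theorem exists_meetAt {n : ℕ} {t s : ℝ} (h₁ : tm F ε sgn K X n ≤ t) (hts : t < s) {i j : ℕ}
    (hY : posAt F ε sgn lev K X t i ≠ posAt F ε sgn lev K X t j) (h₂ : t < tm F ε sgn K X (n + 1))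
    (hi : i ∈ cellsAt F ε sgn K X s) (hj : j ∈ cellsAt F ε sgn K X s)
    (hij : posAt F ε sgn lev K X s i = posAt F ε sgn lev K X s j) :
    ∃ m, MeetAt K X n i j m ∧ tm F ε sgn K X m ≤ s := by
  obtain ⟨m, hm₁, hm₂⟩ := T.exists_stage ((T.tm_nonneg n).trans (h₁.trans hts.le))
  have hnm := T.tm_strictMono.lt_iff_lt.1 ((h₁.trans hts.le).trans_lt hm₂)
  rw [T.cellsAt_eq hm₁ hm₂] at hi hj
  rw [T.posAt_eq hm₁ hm₂] at hij
  rw [T.posAt_eq h₁ h₂] at hY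
  refine ⟨m, ?_, hm₁⟩
  rcases hm₁.eq_or_lt with rfl | hlt
  · rw [adv_sub_self] at hij
    refine ⟨lt_of_le_of_ne (by omega) fun e => ?_, hi, hj, hij⟩
    subst e; linarith
  · rw [tm_succ] at hm₂
    rw [(T.cfg m).adv_eq_iff T.pos hi hj (sub_pos.2 hlt) (by rw [← dl]; linarith)] at hij
    refine ⟨lt_of_le_of_ne (by omega) fun e => ?_, hi, hj, hij.1⟩
    subst e
    exact hY (hij.adv_eq _)

end Traj

/-! ### Trajectories with the same future -/

section Future

variable {A A' : Finset ℕ} {φ : ℕ → ℕ} {t t' : ℝ}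

/-- The correspondence of the cells at the times `t + s` and `t' + s`. -/
def CorrAt (F : ℝ → ℝ) (ε : ℝ) (sgn lev sgn' lev' : ℕ → ℤ) (K K' : ℕ → Finset ℕ)
    (X X' : ℕ → ℕ → ℝ) (A : Finset ℕ) (φ : ℕ → ℕ) (t t' s : ℝ) : Prop :=
  Corr A φ (cellsAt F ε sgn K X (t + s)) (posAt F ε sgn lev K X (t + s))
    (cellsAt F ε sgn' K' X' (t' + s)) (posAt F ε sgn' lev' K' X' (t' + s))

/-- If neither trajectory has a stage strictly inside the time interval, speeds and cancellations on
it are determined by the common profile, and the correspondence passes from `r` to `s`. -/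
theorem Traj.corrAt_of_lt (T : Traj F ε sgn lev K X) (T' : Traj F ε sgn' lev' K' X')
    (M : Matching sgn lev sgn' lev' A A' φ) (ht : 0 ≤ t) (ht' : 0 ≤ t')
    (hprof : ∀ s, 0 ≤ s →
      prof ε sgn (cellsAt F ε sgn K X (t + s)) (posAt F ε sgn lev K X (t + s)) =
        prof ε sgn' (cellsAt F ε sgn' K' X' (t' + s)) (posAt F ε sgn' lev' K' X' (t' + s)))
    {r s : ℝ} (hr : 0 ≤ r) (hrs : r < s) {n n' : ℕ} (h₁ : tm F ε sgn K X n ≤ t + r)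
    (h₂ : t + s ≤ tm F ε sgn K X (n + 1)) (h₁' : tm F ε sgn' K' X' n' ≤ t' + r)
    (h₂' : t' + s ≤ tm F ε sgn' K' X' (n' + 1))
    (h : CorrAt F ε sgn lev sgn' lev' K K' X X' A φ t t' r) :
    CorrAt F ε sgn lev sgn' lev' K K' X X' A φ t t' s := by
  intro k hk
  obtain ⟨ha, hp⟩ := h k hk
  have hsub := T.cellsAt_subset (add_nonneg ht hr) (by linarith : t + r ≤ t + s)
  have hsub' := T'.cellsAt_subset (add_nonneg ht' hr) (by linarith : t' + r ≤ t' + s)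
  by_cases hkr : k ∈ cellsAt F ε sgn K X (t + r)
  swap
  · have hkr' := fun h => hkr (ha.2 h)
    exact ⟨iff_of_false (fun h => hkr (hsub h)) fun h => hkr' (hsub' h), fun h => absurd (hsub h) hkr⟩
  have hkr' := ha.1 hkr
  have hX : posAt F ε sgn lev K X (t + s) k = posAt F ε sgn' lev' K' X' (t' + s) (φ k) := by
    rw [T.posAt_of_lt h₁ (by linarith) h₂ hkr, T'.posAt_of_lt h₁' (by linarith) h₂' hkr',
      (T.config_at (add_nonneg ht hr)).vel_eq_of_prof_eq T.pos (T'.config_at (add_nonneg ht' hr))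
        (hprof r hr) hkr hkr' (hp hkr) (M.sgn_eq k hk) (M.lev_eq k hk), hp hkr]
    ring
  refine ⟨?_, fun _ => hX⟩
  rw [T.mem_cellsAt_of_lt h₁ (by linarith) h₂ hkr, T'.mem_cellsAt_of_lt h₁' (by linarith) h₂' hkr',
    hX, below_eq_of_prof_eq T.pos (hprof s (hr.trans hrs.le)),
    upto_eq_of_prof_eq T.pos (hprof s (hr.trans hrs.le)), InCellJump, InCellJump, M.sgn_eq k hk,
    M.lev_eq k hk]

/-- The stages of the two trajectories may interlace. An induction on the stages of the first one
and, between two of them, on those of the second one reaches every time through intervals without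
stages inside. -/
theorem Traj.corrAt (T : Traj F ε sgn lev K X) (T' : Traj F ε sgn' lev' K' X')
    (M : Matching sgn lev sgn' lev' A A' φ) (ht : 0 ≤ t) (ht' : 0 ≤ t')
    (hprof : ∀ s, 0 ≤ s →
      prof ε sgn (cellsAt F ε sgn K X (t + s)) (posAt F ε sgn lev K X (t + s)) =
        prof ε sgn' (cellsAt F ε sgn' K' X' (t' + s)) (posAt F ε sgn' lev' K' X' (t' + s)))
    (h : CorrAt F ε sgn lev sgn' lev' K K' X X' A φ t t' 0) {s : ℝ} (hs : 0 ≤ s) :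
    CorrAt F ε sgn lev sgn' lev' K K' X X' A φ t t' s := by
  have outer : ∀ n : ℕ, ∀ s, 0 ≤ s → t + s ≤ tm F ε sgn K X n →
      CorrAt F ε sgn lev sgn' lev' K K' X X' A φ t t' s := by
    intro n
    induction n with
    | zero =>
      intro s hs hn
      rw [tm_zero] at hn
      obtain rfl : s = 0 := by linarith
      exact h
    | succ n ih =>
      set a := max 0 (tm F ε sgn K X n - t) with ha
      have ha0 : 0 ≤ a := le_max_left _ _
      have han : tm F ε sgn K X n ≤ t + a := by linarith [le_max_right 0 (tm F ε sgn K X n - t)]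
      have hPa : CorrAt F ε sgn lev sgn' lev' K K' X X' A φ t t' a := by
        rcases max_choice 0 (tm F ε sgn K X n - t) with e | e
        · rw [ha, e]; exact h
        · exact ih a ha0 (by rw [ha, e]; linarith)
      have inner : ∀ n' : ℕ, ∀ s, a ≤ s → t + s ≤ tm F ε sgn K X (n + 1) →
          t' + s ≤ tm F ε sgn' K' X' n' →
          CorrAt F ε sgn lev sgn' lev' K K' X X' A φ t t' s := by
        intro n'
        induction n' with
        | zero =>
          intro s has _ hn'
          rw [tm_zero] at hn'
          obtain rfl : s = a := by linarith
          exact hPa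
        | succ n' ih' =>
          intro s has hn hn'
          set b := max a (tm F ε sgn' K' X' n' - t') with hb
          have hab : a ≤ b := le_max_left _ _
          have hbn : tm F ε sgn' K' X' n' ≤ t' + b := by
            linarith [le_max_right a (tm F ε sgn' K' X' n' - t')]
          rcases has.eq_or_lt with rfl | has
          · exact hPa
          rcases le_or_gt s (tm F ε sgn' K' X' n' - t') with hsb | hsb
          · exact ih' s has.le hn (by linarith)
          have hbs : b < s := max_lt has hsb
          have hPb : CorrAt F ε sgn lev sgn' lev' K K' X X' A φ t t' b := by
            rcases max_choice a (tm F ε sgn' K' X' n' - t') with e | e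
            · rw [hb, e]; exact hPa
            · exact ih' b hab (by linarith) (by rw [hb, e]; linarith)
          exact T.corrAt_of_lt T' M ht ht' hprof (ha0.trans hab) hbs (by linarith) hn hbn hn' hPb
      intro s hs hn
      rcases le_or_gt a s with has | has
      · obtain ⟨n', hn'⟩ := T'.exists_lt_tm (t' + s)
        exact inner n' s has hn hn'.le
      · refine ih s hs ?_
        rcases lt_max_iff.1 has with h0 | h0 <;> linarith
  obtain ⟨n, hn⟩ := T.exists_lt_tm (t + s)
  exact outer n s hs hn.le

/-- The numbers of the stages differ, but the meeting times counted from `t` and `t'` agree. A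
meeting in one trajectory yields one in the other that is no later, so first meetings are
simultaneous and the cells present at them correspond. -/
theorem Traj.potSum_eq_of_corrAt (T : Traj F ε sgn lev K X) (T' : Traj F ε sgn' lev' K' X')
    {n n' : ℕ} (M : Matching sgn lev sgn' lev' (K n) (K' n') φ)
    (h₁ : tm F ε sgn K X n ≤ t) (h₂ : t < tm F ε sgn K X (n + 1))
    (h₁' : tm F ε sgn' K' X' n' ≤ t') (h₂' : t' < tm F ε sgn' K' X' (n' + 1))
    (h : ∀ s, 0 ≤ s → CorrAt F ε sgn lev sgn' lev' K K' X X' (K n) φ t t' s) :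
    potSum F ε sgn lev K X n (grp (K n) (posAt F ε sgn lev K X t)) =
      potSum F ε sgn' lev' K' X' n' (grp (K' n') (posAt F ε sgn' lev' K' X' t')) := by
  have h0 : Corr (K n) φ (K n) (posAt F ε sgn lev K X t) (K' n') (posAt F ε sgn' lev' K' X' t') := by
    have := h 0 le_rfl
    rwa [CorrAt, add_zero, add_zero, T.cellsAt_eq h₁ h₂, T'.cellsAt_eq h₁' h₂'] at this
  have hst : ∀ i ∈ K n, ∀ j ∈ K n,
      posAt F ε sgn lev K X t i ≠ posAt F ε sgn lev K X t j →
      ∀ m, MeetAt K X n i j m → ∃ m', MeetAt K' X' n' (φ i) (φ j) m' ∧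
        tm F ε sgn' K' X' m' - t' ≤ tm F ε sgn K X m - t := by
    intro i hi j hj hY m hm
    have hlt : t < tm F ε sgn K X m := h₂.trans_le (T.tm_strictMono.monotone hm.1)
    have hc := h (tm F ε sgn K X m - t) (by linarith)
    rw [CorrAt, add_sub_cancel, T.cellsAt_tm, T.posAt_tm] at hc
    obtain ⟨m', hm', hle⟩ := T'.exists_meetAt h₁'
      (by linarith : t' < t' + (tm F ε sgn K X m - t)) (i := φ i) (j := φ j)
      (by rwa [← (h0 i hi).2 hi, ← (h0 j hj).2 hj]) h₂' ((hc i hi).1.1 hm.2.1)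
      ((hc j hj).1.1 hm.2.2.1)
      (by rw [← (hc i hi).2 hm.2.1, ← (hc j hj).2 hm.2.2.1, hm.2.2.2])
    exact ⟨m', hm', by linarith⟩
  have hts : ∀ i ∈ K n, ∀ j ∈ K n,
      posAt F ε sgn lev K X t i ≠ posAt F ε sgn lev K X t j →
      ∀ m', MeetAt K' X' n' (φ i) (φ j) m' → ∃ m, MeetAt K X n i j m ∧
        tm F ε sgn K X m - t ≤ tm F ε sgn' K' X' m' - t' := by
    intro i hi j hj hY m' hm
    have hlt : t' < tm F ε sgn' K' X' m' := h₂'.trans_le (T'.tm_strictMono.monotone hm.1)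
    have hc := h (tm F ε sgn' K' X' m' - t') (by linarith)
    rw [CorrAt, add_sub_cancel, T'.cellsAt_tm, T'.posAt_tm] at hc
    have hi' := (hc i hi).1.2 hm.2.1
    have hj' := (hc j hj).1.2 hm.2.2.1
    obtain ⟨m, hm', hle⟩ := T.exists_meetAt h₁
      (by linarith : t < t + (tm F ε sgn' K' X' m' - t')) hY h₂ hi' hj'
      (by rw [(hc i hi).2 hi', (hc j hj).2 hj', hm.2.2.2])
    exact ⟨m, hm', by linarith⟩
  have hwt : ∀ i ∈ K n, ∀ j ∈ K n,
      stageWt (normF2 F) F ε sgn lev K X n (grp (K n) (posAt F ε sgn lev K X t)) i j =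
        stageWt (normF2 F) F ε sgn' lev' K' X' n' (grp (K' n') (posAt F ε sgn' lev' K' X' t'))
          (φ i) (φ j) := by
    intro i hi j hj
    refine (M.wt_eq (fun k _ => Finset.filter_subset _ _)
      (fun k hk => M.grp_image subset_rfl subset_rfl h0 hk) hi hj (fun hji => ?_)
      fun hji hm => ?_).symm
    · have hY : posAt F ε sgn lev K X t i ≠ posAt F ε sgn lev K X t j := fun e =>
        hji (mem_grp.2 ⟨hj, e.symm⟩)
      exact ⟨fun ⟨m, hm⟩ => (hst i hi j hj hY m hm).imp fun _ h => h.1,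
        fun ⟨m, hm⟩ => (hts i hi j hj hY m hm).imp fun _ h => h.1⟩
    · have hY : posAt F ε sgn lev K X t i ≠ posAt F ε sgn lev K X t j := fun e =>
        hji (mem_grp.2 ⟨hj, e.symm⟩)
      have hf := meetAt_firstMeet hm
      obtain ⟨m', hm', hle⟩ := hst i hi j hj hY _ hf
      have hf' := meetAt_firstMeet ⟨m', hm'⟩
      obtain ⟨m, hm2, hle2⟩ := hts i hi j hj hY _ hf'
      have e1 := T'.tm_strictMono.monotone (firstMeet_le hm')
      have e2 := T.tm_strictMono.monotone (firstMeet_le hm2)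
      have hlt : t < tm F ε sgn K X (firstMeet K X n i j) :=
        h₂.trans_le (T.tm_strictMono.monotone hf.1)
      have hc := h (tm F ε sgn K X (firstMeet K X n i j) - t) (by linarith)
      have htime : t' + (tm F ε sgn K X (firstMeet K X n i j) - t) =
          tm F ε sgn' K' X' (firstMeet K' X' n' (φ i) (φ j)) := by linarith
      rw [CorrAt, htime, add_sub_cancel, T.cellsAt_tm, T.posAt_tm, T'.cellsAt_tm,
        T'.posAt_tm] at hc
      exact ⟨(Finset.filter_subset _ _).trans (T.anti hf.1.le),
        M.grp_image (T.anti hf.1.le) (T'.anti hf'.1.le) hc hf.2.1⟩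
  refine Finset.sum_nbij φ M.bij.mapsTo M.bij.injOn M.bij.surjOn fun i hi => ?_
  refine Finset.sum_nbij φ M.bij.mapsTo M.bij.injOn M.bij.surjOn fun j hj => ?_
  simp only [M.mono.lt_iff_lt hi hj, hwt i hi j hj]

theorem Track.potential_eq_of_solution_eq {u₀ u₀' : ℝ → ℝ} {N N' : ℕ}
    (T : Track F ε u₀ sgn lev N K X) (T' : Track F ε u₀' sgn' lev' N' K' X') (ht : 0 ≤ t)
    (ht' : 0 ≤ t') (h : ∀ s : ℝ, 0 ≤ s → ∀ x : ℝ,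
      solution (gridFlux F ε) u₀ (t + s) x = solution (gridFlux F ε) u₀' (t' + s) x) :
    potential F ε u₀ t = potential F ε u₀' t' := by
  have hsol : ∀ s, 0 ≤ s → solution (gridFlux F ε) u₀ s =
      prof ε sgn (cellsAt F ε sgn K X s) (posAt F ε sgn lev K X s) := by
    intro s hs
    obtain ⟨n, h₁, h₂⟩ := T.traj.exists_stage hs
    rw [T.solution_eq h₁ h₂, T.traj.cellsAt_eq h₁ h₂, T.traj.posAt_eq h₁ h₂]
  have hsol' : ∀ s, 0 ≤ s → solution (gridFlux F ε) u₀' s =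
      prof ε sgn' (cellsAt F ε sgn' K' X' s) (posAt F ε sgn' lev' K' X' s) := by
    intro s hs
    obtain ⟨n, h₁, h₂⟩ := T'.traj.exists_stage hs
    rw [T'.solution_eq h₁ h₂, T'.traj.cellsAt_eq h₁ h₂, T'.traj.posAt_eq h₁ h₂]
  have hprof : ∀ s, 0 ≤ s →
      prof ε sgn (cellsAt F ε sgn K X (t + s)) (posAt F ε sgn lev K X (t + s)) =
        prof ε sgn' (cellsAt F ε sgn' K' X' (t' + s)) (posAt F ε sgn' lev' K' X' (t' + s)) := by
    intro s hs
    rw [← hsol _ (by linarith), ← hsol' _ (by linarith)]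
    exact funext (h s hs)
  have hprof0 := hprof 0 le_rfl
  rw [add_zero, add_zero] at hprof0
  obtain ⟨φ, M, hM⟩ := (T.traj.config_at ht).exists_matching T.traj.pos (T'.traj.config_at ht') hprof0
  obtain ⟨n, h₁, h₂⟩ := T.traj.exists_stage ht
  obtain ⟨n', h₁', h₂'⟩ := T'.traj.exists_stage ht'
  have hcorr := fun s (hs : 0 ≤ s) => T.traj.corrAt T'.traj M ht ht' hprof
    (by rwa [CorrAt, add_zero, add_zero]) hs
  rw [T.traj.cellsAt_eq h₁ h₂] at M hcorr
  rw [T'.traj.cellsAt_eq h₁' h₂'] at M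
  rw [T.potential_eq h₁ h₂, T'.potential_eq h₁' h₂', ← T.traj.posAt_eq h₁ h₂,
    ← T'.traj.posAt_eq h₁' h₂', T.traj.potSum_eq_of_corrAt T'.traj M h₁ h₂ h₁' h₂' hcorr]

end Future

end

end WaveTracking

end

/-! ### Proof of the proposition -/

theorem proposition2p2
    (F : ℝ → ℝ) (hF : ContDiff ℝ 2 F) (ε : ℝ) (hε : 0 < ε)
    (ubar : ℝ → ℝ) (hubar : WaveTracking.totalVar ubar ≠ ⊤)
    (u₀ : ℝ → ℝ) (hu₀ : WaveTracking.IsDiscretization F ε ubar u₀) :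
    -- the value at a given time depends on the present and future profiles only
    (∀ ubar' u₀' : ℝ → ℝ, WaveTracking.totalVar ubar' ≠ ⊤ →
      WaveTracking.IsDiscretization F ε ubar' u₀' → ∀ t t' : ℝ, 0 ≤ t → 0 ≤ t' →
      (∀ s : ℝ, 0 ≤ s → ∀ x : ℝ,
        WaveTracking.solution (WaveTracking.gridFlux F ε) u₀ (t + s) x =
          WaveTracking.solution (WaveTracking.gridFlux F ε) u₀' (t' + s) x) →
      WaveTracking.potential F ε u₀ t = WaveTracking.potential F ε u₀' t') ∧
    -- bound at time zero
    WaveTracking.potential F ε u₀ 0 ≤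
      WaveTracking.normF2 F * WaveTracking.totalVar ubar ^ 2 / 2 ∧
    -- monotonicity
    AntitoneOn (WaveTracking.potential F ε u₀) (Set.Ici 0) ∧
    -- bound on the change of speed at same-sign interactions
    (∀ (n : ℕ) (a b c : ℝ),
      WaveTracking.Interaction (WaveTracking.gridFlux F ε) u₀ n a b c →
      (a < b ∧ b < c ∨ c < b ∧ b < a) →
      ∃ qMinus qPlus : ENNReal,
        Filter.Tendsto (WaveTracking.potential F ε u₀)
          (nhdsWithin (WaveTracking.stage (WaveTracking.gridFlux F ε) u₀ (n + 1)).time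
            (Set.Iio (WaveTracking.stage (WaveTracking.gridFlux F ε) u₀ (n + 1)).time))
          (nhds qMinus) ∧
        Filter.Tendsto (WaveTracking.potential F ε u₀)
          (nhdsWithin (WaveTracking.stage (WaveTracking.gridFlux F ε) u₀ (n + 1)).time
            (Set.Ioi (WaveTracking.stage (WaveTracking.gridFlux F ε) u₀ (n + 1)).time))
          (nhds qPlus) ∧
        ENNReal.ofReal (WaveTracking.speedChange (WaveTracking.gridFlux F ε) a b c) / 2 + qPlus ≤
          qMinus) := by
  obtain ⟨sgn, lev, N, X₀, C⟩ := WaveTracking.exists_Cells hε hu₀.rightCont hu₀.compactSupport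
    hu₀.grid (ne_top_of_le_ne_top hubar hu₀.totalVar_le)
  obtain ⟨K, X, T⟩ := C.exists_track hu₀.binary
  refine ⟨?_, ?_, T.potential_antitoneOn hF, fun n a b c => T.speedChange_le hF⟩
  · intro ubar' u₀' hubar' hu₀' t t' ht ht' h
    obtain ⟨sgn', lev', N', X₀', C'⟩ := WaveTracking.exists_Cells hε hu₀'.rightCont
      hu₀'.compactSupport hu₀'.grid (ne_top_of_le_ne_top hubar' hu₀'.totalVar_le)
    obtain ⟨K', X', T'⟩ := C'.exists_track hu₀'.binary
    exact T.potential_eq_of_solution_eq T' ht ht' h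
  · refine (T.potential_zero_le hF (ne_top_of_le_ne_top hubar hu₀.totalVar_le)).trans ?_
    gcongr
    exact hu₀.totalVar_le
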